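/- Let $m,\hbar,\lambda>0$, let $-4m^2<a<0$, and let $\lambda_1,\lambda_2,g_1,g_2$ be real numbers with $(\lambda_1,\lambda_2)\neq(0,0)$, $(g_1,g_2)\neq(0,0)$ and $g_2\lambda_1-\lambda_2g_1\ge 0$. For $z\in\mathbb{C}\setminus(-\infty,-4m^2)$ put $$F_a(z)=\int_{4m^2}^\infty\sqrt{1-\tfrac{4m^2}{M^2}}\Big(\frac1{M^2+a}-\frac1{M^2+z}\Big)\,dM^2,\qquad S(z)=-(\lambda_1+\lambda_2z)\,\frac{\lambda\hbar}{16\pi^2}F_a(z)-(g_1+g_2z),$$ and let $\mathcal S\subset\mathbb{C}$ be the set of zeros of $S$, where a point of the branch cut $(-\infty,-4m^2)$ is counted as a zero if one of the two boundary values of $S$ there vanishes. Let $\square=-\partial_t^2+\Delta$ on $\mathbb{R}\times\mathbb{R}^3$ and let $\tilde f(\vec p)=\int f(\vec x)e^{i\vec p\cdot\vec x}d^3\vec x$ be the spatial Fourier transform. Put $$\tilde A(\tau,\vec p)=-\int_{4m^2}^\infty\frac{1}{16\pi^2}\sqrt{1-\tfrac{4m^2}{M^2}}\;\frac{1}{M^2+a}\;\frac{\sin(\tau\sqrt{|\vec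 p|^2+M^2})}{\sqrt{|\vec p|^2+M^2}}\,dM^2,$$ $$\widetilde{\mathcal K_a\psi}(t,\vec p)=\int_0^\infty\tilde A(\tau,\vec p)\,\widetilde{((\square+a)\psi)}(t-\tau,\vec p)\,d\tau .$$ A solution with spatially compact support of $$(g_2\square-g_1)\psi=(\lambda_1-\lambda_2\square)\,\hbar\lambda\,\mathcal K_a\psi\qquad(*)$$ is a smooth $\psi:\mathbb{R}\times\mathbb{R}^3\to\mathbb{R}$ whose support has compact intersection with $[-T,T]\times\mathbb{R}^3$ for every $T$, such that for almost every $\vec p$ the integral defining $\widetilde{\mathcal K_a\psi}(t,\vec p)$ converges absolutely for all $t$, is $C^2$ in $t$, and the spatial Fourier transform of $(*)$ at $\vec p$, with $\square$ acting on $\widetilde{\mathcal K_a\psi}$ as $-\partial_t^2-|\vec p|^2$, holds for all $t$. "Solutions decay" means: for every such $\psi$ and every $\vec x\in\mathbb{R}^3$, $\psi(t,\vec x)=O(t^{-3/2})$ as $t\to+\infty$. Then: (a) If $\lambda_2=0$, $\frac{g_2}{\lambda_1}\ge0$, $-\frac{g_1}{\lambda_1}\le\frac{\lambda\hbar}{16\pi^2}F_a(0)$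 and $\frac{\lambda\hbar}{16\pi^2}F_a(-4m^2)\le-\frac{g_1}{\lambda_1}+4m^2\frac{g_2}{\lambda_1}$, then $\mathcal S$ has exactly one element; it is real and $\le0$, and it is $<0$ if $-\frac{g_1}{\lambda_1}<\frac{\lambda\hbar}{16\pi^2}F_a(0)$. Solutions decay. (b) If $\lambda_2,g_2\ne0$ and $-\frac{\lambda_1}{\lambda_2}<-\frac{g_1}{g_2}<a$ (with $a<0$), then all elements of $\mathcal S$ are real and $<0$, and $|\mathcal S|\le2$; if moreover $-4m^2\le-\frac{g_1}{g_2}$ (in particular if $-4m^2<-\frac{\lambda_1}{\lambda_2}$), then $|\mathcal S|\in\{1,2\}$. Solutions decay. (c) If $\lambda_2\ne0$, $-4m^2<-\frac{\lambda_1}{\lambda_2}<a$ (with $a<0$), $g_2>0$ and $0\le-\frac{g_1}{\lambda_1}\le\frac{\lambda\hbar}{16\pi^2}F_a(0)$, then all elements of $\mathcal S$ are real and $\le0$, and they are all $<0$ if $-\frac{g_1}{\lambda_1}<\frac{\lambda\hbar}{16\pi^2}F_a(0)$; moreover $|\mathcal S|\in\{1,2\}$. Solutions decay. -/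

import Mathlib

open Filter Topology MeasureTheory Set
open scoped ContDiff

noncomputable section

namespace SemiclassicalToy

/-- Euclidean space `ℝ³`; Minkowski spacetime is `ℝ × ℝ³`, with signature `(-,+,+,+)`. -/
abbrev Space : Type := EuclideanSpace ℝ (Fin 3)

/-! ### The function `F_a`, the function `S` and its zeros -/

/-- `F_a(z) = ∫_{4m²}^∞ √(1 - 4m²/M²) (1/(M² + a) - 1/(M² + z)) dM²`, with `μ = M²` as the variable
of integration. The integral converges absolutely for every `z` outside the open half-line
`(-∞, -4m²)`. -/
def Fa (m a : ℝ) (z : ℂ) : ℂ :=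
  ∫ μ in Ioi (4 * m ^ 2),
    (Real.sqrt (1 - 4 * m ^ 2 / μ) : ℂ) * (1 / ((μ : ℂ) + (a : ℂ)) - 1 / ((μ : ℂ) + z))

/-- The values of `F_a` on the real half-line `[-4m², ∞)`, where `F_a` is real. -/
def FaReal (m a s : ℝ) : ℝ := (Fa m a (s : ℂ)).re

/-- The coupling `λħ/(16π²)`. -/
def coupling (hbar lam : ℝ) : ℝ := lam * hbar / (16 * Real.pi ^ 2)

/-- `S(z) = -(λ₁ + λ₂ z) (λħ/16π²) F_a(z) - (g₁ + g₂ z)`. -/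
def S (m a hbar lam lam₁ lam₂ g₁ g₂ : ℝ) (z : ℂ) : ℂ :=
  -(((lam₁ : ℂ) + (lam₂ : ℂ) * z) * (coupling hbar lam : ℂ) * Fa m a z)
    - ((g₁ : ℂ) + (g₂ : ℂ) * z)

/-- The open branch cut `(-∞, -4m²)` of `F_a`. -/
def branchCut (m : ℝ) : Set ℂ := {z | z.im = 0 ∧ z.re < -(4 * m ^ 2)}

/-- The set `𝒮 ⊂ ℂ` of the zeros of `S`. Across the branch cut `S` jumps, and a point of the cut is a
zero if one of the two boundary values of `S` there (from the upper or from the lower half-plane)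
vanishes. -/
def zeroSet (m a hbar lam lam₁ lam₂ g₁ g₂ : ℝ) : Set ℂ :=
  {z | z ∉ branchCut m ∧ S m a hbar lam lam₁ lam₂ g₁ g₂ z = 0} ∪
  {z | z ∈ branchCut m ∧
    (Tendsto (S m a hbar lam lam₁ lam₂ g₁ g₂) (𝓝[{w : ℂ | 0 < w.im}] z) (𝓝 0) ∨
      Tendsto (S m a hbar lam lam₁ lam₂ g₁ g₂) (𝓝[{w : ℂ | w.im < 0}] z) (𝓝 0))}

/-! ### The linearized semiclassical equation -/

/-- The d'Alembert operator `□ = -∂ₜ² + Δ`. -/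
def dAlembert (ψ : ℝ → Space → ℝ) (t : ℝ) (x : Space) : ℝ :=
  -(iteratedDeriv 2 (fun r => ψ r x) t) + Laplacian.laplacian (ψ t) x

/-- The spatial Fourier transform `∫ f(x) e^{i p·x} d³x`. -/
def spatialFourier (f : Space → ℝ) (p : Space) : ℂ :=
  ∫ x : Space, (f x : ℂ) * Complex.exp (Complex.I * ((inner ℝ p x : ℝ) : ℂ))

/-- The spatial Fourier transform at `t > 0` of the retarded propagator of the Klein-Gordon equation
with squared mass `μ = M²`: `-sin(ω₀ t)/ω₀` with `ω₀ = √(|p|² + M²)`. It vanishes for `t < 0`. -/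
def retardedFourier (μ t : ℝ) (p : Space) : ℝ :=
  -(Real.sin (Real.sqrt (‖p‖ ^ 2 + μ) * t) / Real.sqrt (‖p‖ ^ 2 + μ))

/-- The spectral density `ϱ(M²) = (1/16π²) √(1 - 4m²/M²)`. -/
def spectralDensity (m μ : ℝ) : ℝ :=
  1 / (16 * Real.pi ^ 2) * Real.sqrt (1 - 4 * m ^ 2 / μ)

/-- The spatial Fourier transform at `t > 0` of `∫_{4m²}^∞ ϱ(M²)/(M² + a) Δ_R(·, M²) dM²`. -/
def loopKernel (m a t : ℝ) (p : Space) : ℝ :=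
  ∫ μ in Ioi (4 * m ^ 2), spectralDensity m μ / (μ + a) * retardedFourier μ t p

/-- The integrand, at the elapsed time `r > 0`, of the time convolution that gives the spatial Fourier
transform of `𝒦_a ψ` at `(t, p)`. The kernel of `𝒦_a` is the distributional derivative `□ + a` of the
kernel above; in the convolution, `□ + a` acts on the smooth function `ψ`. -/
def KaIntegrand (m a : ℝ) (ψ : ℝ → Space → ℝ) (t : ℝ) (p : Space) (r : ℝ) : ℂ :=
  (loopKernel m a r p : ℂ) *
    spatialFourier (fun x => dAlembert ψ (t - r) x + a * ψ (t - r) x) p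

/-- The spatial Fourier transform of `⟨φ²⟩^(lin) = ħ λ 𝒦_a ψ`, the linearized expectation value of the
Wick square in the Minkowski vacuum. -/
def wickFourier (m a hbar lam : ℝ) (ψ : ℝ → Space → ℝ) (t : ℝ) (p : Space) : ℂ :=
  ((hbar * lam : ℝ) : ℂ) * ∫ r in Ioi (0 : ℝ), KaIntegrand m a ψ t p r

/-- `ψ` is a smooth solution with spatially compact support of
`(g₂ □ - g₁) ψ = (λ₁ - λ₂ □) ⟨φ²⟩^(lin)`. The retarded operator `𝒦_a` integrates over the whole past;
for `ψ` to be a solution the integral has to converge. The equation is an identity between spatial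
Fourier transforms, on which `□` acts as `-∂ₜ² - |p|²`. -/
structure IsSolution (m a hbar lam lam₁ lam₂ g₁ g₂ : ℝ) (ψ : ℝ → Space → ℝ) : Prop where
  smooth : ContDiff ℝ ∞ (fun y : ℝ × Space => ψ y.1 y.2)
  spatially_compact : ∀ T : ℝ, ∃ R : ℝ, ∀ t : ℝ, |t| ≤ T → ∀ x : Space, R < ‖x‖ → ψ t x = 0
  converges : ∀ᵐ p : Space, ∀ t : ℝ, IntegrableOn (KaIntegrand m a ψ t p) (Ioi 0)
  regular : ∀ᵐ p : Space, ContDiff ℝ 2 (fun t => wickFourier m a hbar lam ψ t p)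
  equation : ∀ᵐ p : Space, ∀ t : ℝ,
    spatialFourier (fun x => g₂ * dAlembert ψ t x - g₁ * ψ t x) p =
      (lam₁ : ℂ) * wickFourier m a hbar lam ψ t p -
        (lam₂ : ℂ) * (-(iteratedDeriv 2 (fun r => wickFourier m a hbar lam ψ r p) t) -
          ((‖p‖ ^ 2 : ℝ) : ℂ) * wickFourier m a hbar lam ψ t p)

/-- Every smooth solution with spatially compact support decays, at every fixed point of space, at
least as `1 / t^{3/2}` for large times. -/
def SolutionsDecay (m a hbar lam lam₁ lam₂ g₁ g₂ : ℝ) : Prop :=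
  ∀ ψ : ℝ → Space → ℝ, IsSolution m a hbar lam lam₁ lam₂ g₁ g₂ ψ →
    ∀ x : Space, (fun t : ℝ => ψ t x) =O[atTop] fun t : ℝ => t ^ (-(3 / 2) : ℝ)

end SemiclassicalToy

end

/-!
With `c = λħ/16π²` write `S = -(λ₁ + λ₂ z) c F_a - (g₁ + g₂ z)`.

**Zeros.** The function `F_a` is a Herglotz function: up to a constant it is
`Ψ(z) = ∫₀¹ 2 (z + 4m²) / (z + 4m² - z β²) dβ` (`Fa_eq`), which maps the upper half-plane to itself
(`bubble_im_pos`), increases strictly on `[-4m², ∞)` (`bubbleReal_strictMonoOn`) and has a positive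
imaginary part on the cut. If `g₂ λ₁ - λ₂ g₁ ≥ 0`, the quotient `(g₁ + g₂ z) / (λ₁ + λ₂ z)` has the
same monotonicity, hence so has `-S / (λ₁ + λ₂ z)`. Therefore all zeros of `S` are real and lie in
`[-4m², ∞)` (`zeroSet_eq`), they are simple (`deriv_S_ne_zero`), and there is at most one of them on
each side of the pole `-λ₁/λ₂` (`encard_gapZeros_le_two`). Their existence and their sign follow from
the intermediate value theorem and the signs of `S` at `-4m²`, `-λ₁/λ₂`, `-g₁/g₂`, `a` and `0`.

**Decay.** Let `f` be the spatial Fourier transform of a solution at momentum `p`, and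
`D = ∂ₜ² + |p|²`, which is `-□` at this momentum. The equation is
`(g₁ + g₂ D) f + (λ₁ + λ₂ D) W = 0`, where `W` is the convolution over the whole past of
`(a - D) f` with a retarded kernel `A`. The Laplace transform of the equation has the symbol
`S(s² + |p|²)` (`sub_mul_laplaceKernel`, `symbolAt_eq_S`). Let `P` be a real quadratic polynomial that
vanishes at the zeros of `S`, which are simple. Then `P / S` is polynomially bounded up to the
imaginary axis `s = iω` (`RegularSymbol.norm_quadratic_le`), so, regularized by a test function, it is
the Fourier transform of a function `k`. The function `k` is retarded, because `P / S` is analytic in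
`Re s > 0` (`RegularSymbol.greenKernel_eq_zero`), and `k = O(|t|^{-3/2})`, because only the cut
contributes to its odd part and the phase `√(κ² + |p|² + 4m²)` is stationary at the threshold `κ = 0`,
where the amplitude vanishes (`RegularSymbol.norm_greenKernel_le`).

The kernel `A` also decays like `t^{-3/2}`, and not faster. For that reason the absolute convergence
of the convolution forces the source `(a - D) f` to be integrable in the past against `|t|^{-3/2}`
(`isPast_of_integrableOn`). This is what is needed for associativity of the convolutions with `k`
and `A`, and convolving the equation with `k` inverts the symbol: `P(D) (a - D) f = 0`
(`RegularSymbol.conv_eq_zero`, `RegularSymbol.linOp_eq_zero`).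

The roots of `P` may be completed to two numbers `ζ₁ ≠ ζ₂` which are nonpositive and different from
`a`. By partial fractions the solution is then a sum of three smooth fields with spatially compact
support that satisfy the Klein-Gordon equations with squared masses `-ζ₁`, `-ζ₂` and `-a`
(`SpatiallyCompact.isBigO_of_linOp`). Each of them is `O(t^{-3/2})` at every point of space: the
Fourier representation in polar coordinates reduces this to the radial oscillatory integral, in which
the volume element `κ² dκ` vanishes at the stationary point (`SpatiallyCompact.isBigO`). In the
exceptional case `S(a) = 0`, which occurs only for `λ₂ = 0`, the factor `a - D` appears in every term
of the equation, and `P / (z - a)` takes the place of `P` (`RegularSymbol.linOp_eq_zero_of_eq`).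
-/

noncomputable section

namespace SemiclassicalToy

/-! ### The vacuum bubble `Ψ` -/

/-- The denominator `z + b - z β²` of the Feynman-parameter representation of `F_a`, written as a
convex combination of `z + b` and `b`. -/
def bubbleDen (b : ℝ) (z : ℂ) (β : ℝ) : ℂ := (z + b) * (1 - (β : ℂ) ^ 2) + b * (β : ℂ) ^ 2

/-- The integrand `2 (z + b) / (z + b - z β²)` of the Feynman-parameter representation of `F_a`. -/
def bubbleKernel (b : ℝ) (z : ℂ) (β : ℝ) : ℂ := 2 * (z + b) / bubbleDen b z β

/-- `Ψ(z) = ∫_0^1 2 (z + b) / (z + b - z β²) dβ`. With `b = 4m²` one has `F_a(z) = Ψ(z) - Ψ(a)`. -/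
def bubble (b : ℝ) (z : ℂ) : ℂ := ∫ β in (0 : ℝ)..1, bubbleKernel b z β

lemma bubbleDen_eq (b : ℝ) (z : ℂ) (β : ℝ) :
    bubbleDen b z β = (((1 - β ^ 2 : ℝ) : ℂ)) * (z + b) + ((b * β ^ 2 : ℝ) : ℂ) := by
  unfold bubbleDen; push_cast; ring

lemma bubbleDen_mem_slitPlane {b : ℝ} (hb : 0 < b) {z : ℂ} (hz : z + b ∈ Complex.slitPlane)
    {β : ℝ} (h0 : 0 ≤ β) (h1 : β ≤ 1) : bubbleDen b z β ∈ Complex.slitPlane := by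
  have hβ : 0 ≤ 1 - β ^ 2 := by nlinarith
  rw [bubbleDen_eq, Complex.mem_slitPlane_iff]
  rw [Complex.mem_slitPlane_iff] at hz
  simp only [Complex.add_re, Complex.add_im, Complex.re_ofReal_mul, Complex.im_ofReal_mul,
    Complex.ofReal_re, Complex.ofReal_im] at hz ⊢
  rcases hβ.eq_or_lt with h | h
  · left; rw [← h]; nlinarith
  · rcases hz with hz | hz
    · left; have := mul_pos h hz; nlinarith [mul_nonneg hb.le (sq_nonneg β)]
    · right; simp only [add_zero] at hz ⊢; exact mul_ne_zero h.ne' hz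

lemma bubbleDen_ne_zero {b : ℝ} (hb : 0 < b) {z : ℂ} (hz : z + b ∈ Complex.slitPlane)
    {β : ℝ} (h0 : 0 ≤ β) (h1 : β ≤ 1) : bubbleDen b z β ≠ 0 :=
  Complex.slitPlane_ne_zero (bubbleDen_mem_slitPlane hb hz h0 h1)

lemma continuous_bubbleDen (b : ℝ) : Continuous fun q : ℂ × ℝ => bubbleDen b q.1 q.2 := by
  unfold bubbleDen; fun_prop

lemma continuousOn_bubbleKernel {b : ℝ} (hb : 0 < b) {z : ℂ} (hz : z + b ∈ Complex.slitPlane) :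
    ContinuousOn (bubbleKernel b z) (Icc 0 1) := by
  unfold bubbleKernel
  refine ContinuousOn.div (by fun_prop)
    ((continuous_bubbleDen b).comp (Continuous.prodMk_right z)).continuousOn fun β hβ => ?_
  exact bubbleDen_ne_zero hb hz hβ.1 hβ.2

lemma intervalIntegrable_bubbleKernel {b : ℝ} (hb : 0 < b) {z : ℂ}
    (hz : z + b ∈ Complex.slitPlane) :
    IntervalIntegrable (bubbleKernel b z) volume 0 1 := by
  apply ContinuousOn.intervalIntegrable
  rw [uIcc_of_le zero_le_one]; exact continuousOn_bubbleKernel hb hz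

@[simp] lemma bubbleKernel_threshold (b β : ℝ) : bubbleKernel b (-(b : ℂ)) β = 0 := by
  simp [bubbleKernel]

@[simp] lemma bubble_threshold (b : ℝ) : bubble b (-(b : ℂ)) = 0 := by
  simp [bubble]

lemma bubbleKernel_sub {b : ℝ} {z w : ℂ} {β : ℝ} (hz : bubbleDen b z β ≠ 0)
    (hw : bubbleDen b w β ≠ 0) :
    bubbleKernel b z β - bubbleKernel b w β =
      2 * b * (β : ℂ) ^ 2 * (z - w) / (bubbleDen b z β * bubbleDen b w β) := by
  unfold bubbleKernel
  rw [div_sub_div _ _ hz hw]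
  congr 1
  unfold bubbleDen; ring

/-- A point outside the open branch cut is either the threshold `-4m²` or lies in the cut plane. -/
lemma eq_threshold_or_mem_slitPlane {m : ℝ} {z : ℂ} (hz : z ∉ branchCut m) :
    z = -((4 * m ^ 2 : ℝ) : ℂ) ∨ z + ((4 * m ^ 2 : ℝ) : ℂ) ∈ Complex.slitPlane := by
  by_cases h : z.im = 0
  · have h2 : -(4 * m ^ 2) ≤ z.re := by
      by_contra h3
      exact hz ⟨h, not_le.1 h3⟩
    rcases h2.eq_or_lt with h3 | h3
    · left; apply Complex.ext <;> simp only [Complex.neg_re, Complex.neg_im, Complex.ofReal_re,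
        Complex.ofReal_im, h, ← h3, neg_zero]
    · right; rw [Complex.mem_slitPlane_iff]; left
      simp only [Complex.add_re, Complex.ofReal_re]; linarith
  · right; rw [Complex.mem_slitPlane_iff]; right
    simpa only [Complex.add_im, Complex.ofReal_im, add_zero] using h

lemma ofReal_add_mem_slitPlane {b s : ℝ} (h : -b < s) : (s : ℂ) + b ∈ Complex.slitPlane := by
  rw [Complex.mem_slitPlane_iff]; left; simp only [Complex.add_re, Complex.ofReal_re]; linarith

/-- The substitution `M² = 4m² / (1 - β²)` turns the dispersion integral `F_a` into an integral
over the Feynman parameter `β`. -/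
theorem Fa_eq {m a : ℝ} (hm : 0 < m) (ha : -(4 * m ^ 2) < a) {z : ℂ} (hz : z ∉ branchCut m) :
    Fa m a z = bubble (4 * m ^ 2) z - bubble (4 * m ^ 2) a := by
  set b : ℝ := 4 * m ^ 2 with hbdef
  have hb : 0 < b := by positivity
  have him : (fun β : ℝ => b / (1 - β ^ 2)) '' (Ioo 0 1) = Ioi b := by
    ext μ
    simp only [mem_image, mem_Ioo, mem_Ioi]
    constructor
    · rintro ⟨β, ⟨h0, h1⟩, rfl⟩
      rw [lt_div_iff₀ (by nlinarith)]; nlinarith [mul_pos hb (mul_pos h0 h0)]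
    · intro hμ
      have hμ0 : 0 < μ := hb.trans hμ
      have h1 : b / μ < 1 := (div_lt_one hμ0).2 hμ
      have h2 : 0 < b / μ := div_pos hb hμ0
      refine ⟨Real.sqrt (1 - b / μ), ⟨Real.sqrt_pos.2 (by linarith), ?_⟩, ?_⟩
      · rw [Real.sqrt_lt' one_pos]; linarith
      · rw [Real.sq_sqrt (by linarith), sub_sub_cancel, div_div_cancel₀ hb.ne']
  have hder : ∀ β ∈ Ioo (0 : ℝ) 1, HasDerivWithinAt (fun β : ℝ => b / (1 - β ^ 2))
      (2 * b * β / (1 - β ^ 2) ^ 2) (Ioo 0 1) β := by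
    intro β hβ
    have hne : 1 - β ^ 2 ≠ 0 := by nlinarith [hβ.1, hβ.2]
    have h1 : HasDerivAt (fun β : ℝ => 1 - β ^ 2) (-(2 * β)) β := by
      simpa using (hasDerivAt_pow 2 β).const_sub 1
    have h2 := (hasDerivAt_const β b).fun_div h1 hne
    have e : 0 * (1 - β ^ 2) - b * -(2 * β) = 2 * b * β := by ring
    rw [e] at h2
    exact h2.hasDerivWithinAt
  have hinj : InjOn (fun β : ℝ => b / (1 - β ^ 2)) (Ioo 0 1) := by
    intro x hx y hy hxy
    have hxn : 1 - x ^ 2 ≠ 0 := by nlinarith [hx.1, hx.2]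
    have hyn : 1 - y ^ 2 ≠ 0 := by nlinarith [hy.1, hy.2]
    replace hxy : b / (1 - x ^ 2) = b / (1 - y ^ 2) := hxy
    rw [div_eq_div_iff hxn hyn] at hxy
    have h := mul_left_cancel₀ hb.ne' hxy
    have : x ^ 2 = y ^ 2 := by linarith
    nlinarith [hx.1, hy.1, (sq_eq_sq₀ hx.1.le hy.1.le).1 this]
  unfold Fa
  rw [← hbdef, ← him, integral_image_eq_integral_abs_deriv_smul measurableSet_Ioo hder hinj]
  have hza := ofReal_add_mem_slitPlane ha
  have hzden : ∀ β ∈ Ioo (0 : ℝ) 1, bubbleDen b z β ≠ 0 := by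
    intro β hβ
    rcases eq_threshold_or_mem_slitPlane hz with h | h
    · have : bubbleDen b z β = b * (β : ℂ) ^ 2 := by rw [h, bubbleDen]; ring
      rw [this]
      have hβ0 := hβ.1
      have hbβ : b * β ^ 2 ≠ 0 := by positivity
      exact_mod_cast hbβ
    · exact bubbleDen_ne_zero hb h hβ.1.le hβ.2.le
  have hzint : IntervalIntegrable (bubbleKernel b z) volume 0 1 := by
    rcases eq_threshold_or_mem_slitPlane hz with h | h
    · rw [h]
      have : bubbleKernel b (-((4 * m ^ 2 : ℝ) : ℂ)) = fun _ => 0 := by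
        ext β; exact bubbleKernel_threshold b β
      rw [this]; exact intervalIntegrable_const
    · exact intervalIntegrable_bubbleKernel hb h
  unfold bubble
  rw [← intervalIntegral.integral_sub hzint (intervalIntegrable_bubbleKernel hb hza),
    intervalIntegral.integral_of_le zero_le_one, integral_Ioc_eq_integral_Ioo]
  symm
  refine setIntegral_congr_fun measurableSet_Ioo fun β hβ => ?_
  have hne : 0 < 1 - β ^ 2 := by nlinarith [hβ.1, hβ.2]
  have h1 : (1 : ℝ) - b / (b / (1 - β ^ 2)) = β ^ 2 := by field_simp; ring
  rw [h1, Real.sqrt_sq hβ.1.le, abs_of_nonneg (by have := hβ.1; positivity),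
    bubbleKernel_sub (hzden β hβ) (bubbleDen_ne_zero hb hza hβ.1.le hβ.2.le), Complex.real_smul]
  have hneC : (1 : ℂ) - (β : ℂ) ^ 2 ≠ 0 := by exact_mod_cast hne.ne'
  have key : ∀ w : ℂ, bubbleDen b w β ≠ 0 →
      1 / (((b / (1 - β ^ 2) : ℝ) : ℂ) + w) = (1 - (β : ℂ) ^ 2) / bubbleDen b w β := by
    intro w hw
    have : (((b / (1 - β ^ 2) : ℝ) : ℂ) + w) = bubbleDen b w β / (1 - (β : ℂ) ^ 2) := by
      rw [eq_div_iff hneC]; push_cast; unfold bubbleDen; field_simp; ring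
    rw [this, one_div_div]
  rw [key _ (hzden β hβ), key _ (bubbleDen_ne_zero hb hza hβ.1.le hβ.2.le)]
  have hA := bubbleDen_ne_zero hb hza hβ.1.le hβ.2.le
  have hB := hzden β hβ
  rw [div_sub_div _ _ hA hB]
  have e : (1 - (β : ℂ) ^ 2) * bubbleDen b z β - bubbleDen b a β * (1 - (β : ℂ) ^ 2) =
      (1 - (β : ℂ) ^ 2) ^ 2 * (z - a) := by unfold bubbleDen; ring
  rw [e]
  push_cast
  field_simp

/-- The derivative `Ψ'(z) = ∫_0^1 2 b β² / (z + b - z β²)² dβ`. -/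
def bubbleDeriv (b : ℝ) (z : ℂ) : ℂ :=
  ∫ β in (0 : ℝ)..1, 2 * b * (β : ℂ) ^ 2 / bubbleDen b z β ^ 2

theorem hasDerivAt_bubble {b : ℝ} (hb : 0 < b) {z : ℂ} (hz : z + b ∈ Complex.slitPlane) :
    HasDerivAt (bubble b) (bubbleDeriv b z) z := by
  have hopen : IsOpen {w : ℂ | w + b ∈ Complex.slitPlane} :=
    Complex.isOpen_slitPlane.preimage (by fun_prop)
  obtain ⟨r, hr, hball⟩ := Metric.nhds_basis_closedBall.mem_iff.1 (hopen.mem_nhds hz)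
  have hcomp : IsCompact (Metric.closedBall z r ×ˢ Icc (0 : ℝ) 1) :=
    (isCompact_closedBall z r).prod isCompact_Icc
  have hcont : ContinuousOn (fun q : ℂ × ℝ => 2 * b * (q.2 : ℂ) ^ 2 / bubbleDen b q.1 q.2 ^ 2)
      (Metric.closedBall z r ×ˢ Icc (0 : ℝ) 1) := by
    refine ContinuousOn.div (by fun_prop) ((continuous_bubbleDen b).pow 2).continuousOn ?_
    rintro ⟨w, β⟩ ⟨hw, hβ⟩
    exact pow_ne_zero 2 (bubbleDen_ne_zero hb (hball hw) hβ.1 hβ.2)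
  obtain ⟨C, hC⟩ := hcomp.exists_bound_of_continuousOn hcont
  have huIoc : ∀ β ∈ uIoc (0 : ℝ) 1, β ∈ Icc (0 : ℝ) 1 := by
    intro β hβ; rw [uIoc_of_le zero_le_one] at hβ; exact ⟨hβ.1.le, hβ.2⟩
  refine (intervalIntegral.hasDerivAt_integral_of_dominated_loc_of_deriv_le
    (F := fun w β => bubbleKernel b w β) (F' := fun w β => 2 * b * (β : ℂ) ^ 2 / bubbleDen b w β ^ 2)
    (s := Metric.ball z r) (bound := fun _ => C)
    (Metric.ball_mem_nhds z hr) ?_ (intervalIntegrable_bubbleKernel hb hz) ?_ ?_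
    intervalIntegrable_const ?_).2
  · filter_upwards [Metric.ball_mem_nhds z hr] with w hw
    rw [uIoc_of_le zero_le_one]
    exact (intervalIntegrable_bubbleKernel hb
      (hball (Metric.ball_subset_closedBall hw))).1.aestronglyMeasurable
  · have : ContinuousOn (fun β : ℝ => 2 * b * (β : ℂ) ^ 2 / bubbleDen b z β ^ 2) (Icc 0 1) :=
      ContinuousOn.div (by fun_prop)
        (((continuous_bubbleDen b).comp (Continuous.prodMk_right z)).pow 2).continuousOn
        fun β hβ => pow_ne_zero 2 (bubbleDen_ne_zero hb hz hβ.1 hβ.2)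
    rw [uIoc_of_le zero_le_one]
    exact (this.mono Ioc_subset_Icc_self).aestronglyMeasurable measurableSet_Ioc
  · exact Eventually.of_forall fun β hβ w hw =>
      hC (w, β) ⟨Metric.ball_subset_closedBall hw, huIoc β hβ⟩
  · refine Eventually.of_forall fun β hβ w hw => ?_
    have hd := bubbleDen_ne_zero hb (hball (Metric.ball_subset_closedBall hw))
      (huIoc β hβ).1 (huIoc β hβ).2
    have h1 : HasDerivAt (fun w : ℂ => 2 * (w + b)) 2 w := by
      simpa using ((hasDerivAt_id w).add_const (b : ℂ)).const_mul 2
    have h2 : HasDerivAt (fun w : ℂ => bubbleDen b w β) (1 - (β : ℂ) ^ 2) w := by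
      unfold bubbleDen
      simpa using (((hasDerivAt_id w).add_const (b : ℂ)).mul_const (1 - (β : ℂ) ^ 2)).add_const
        (b * (β : ℂ) ^ 2)
    have h3 := h1.fun_div h2 hd
    have e : 2 * bubbleDen b w β - 2 * (w + b) * (1 - (β : ℂ) ^ 2) = 2 * b * (β : ℂ) ^ 2 := by
      unfold bubbleDen; ring
    rw [e] at h3
    exact h3

/-- `Ψ` is a Herglotz function: it maps the upper half-plane to itself. -/
theorem bubble_im_pos {b : ℝ} (hb : 0 < b) {z : ℂ} (hz : 0 < z.im) : 0 < (bubble b z).im := by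
  have hs : z + b ∈ Complex.slitPlane := by
    rw [Complex.mem_slitPlane_iff]; right; simpa using hz.ne'
  have hI := intervalIntegrable_bubbleKernel hb hs
  have e : (bubble b z).im = ∫ β in (0 : ℝ)..1, (bubbleKernel b z β).im := by
    unfold bubble
    rw [intervalIntegral.integral_of_le zero_le_one, intervalIntegral.integral_of_le zero_le_one]
    exact ((Complex.imCLM.integral_comp_comm
      ((intervalIntegrable_iff_integrableOn_Ioc_of_le zero_le_one).1 hI)).symm)
  have him : ∀ β : ℝ, (bubbleKernel b z β).im =
      2 * b * β ^ 2 * z.im / Complex.normSq (bubbleDen b z β) := by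
    intro β
    unfold bubbleKernel
    rw [Complex.div_im]
    have h1 : (bubbleDen b z β).re = (1 - β ^ 2) * (z.re + b) + b * β ^ 2 := by
      rw [bubbleDen_eq]
      simp only [Complex.add_re, Complex.re_ofReal_mul, Complex.ofReal_re]
    have h2 : (bubbleDen b z β).im = (1 - β ^ 2) * z.im := by
      rw [bubbleDen_eq]
      simp only [Complex.add_im, Complex.im_ofReal_mul, Complex.ofReal_im, add_zero]
    rw [h1, h2]
    simp
    ring
  rw [e]
  have hcont : ContinuousOn (fun β => (bubbleKernel b z β).im) (Icc 0 1) :=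
    Complex.continuous_im.comp_continuousOn (continuousOn_bubbleKernel hb hs)
  refine intervalIntegral.intervalIntegral_pos_of_pos_on
    (hcont.intervalIntegrable_of_Icc zero_le_one) (fun β hβ => ?_) zero_lt_one
  rw [him]
  have := Complex.normSq_pos.2 (bubbleDen_ne_zero hb hs hβ.1.le hβ.2.le)
  have := hβ.1
  positivity

lemma bubble_conj (b : ℝ) (z : ℂ) :
    bubble b ((starRingEnd ℂ) z) = (starRingEnd ℂ) (bubble b z) := by
  unfold bubble
  rw [intervalIntegral.integral_of_le zero_le_one, intervalIntegral.integral_of_le zero_le_one,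
    ← integral_conj]
  congr 1
  ext β
  simp [bubbleKernel, bubbleDen, Complex.conj_ofNat]

lemma bubble_ofReal_im (b s : ℝ) : (bubble b (s : ℂ)).im = 0 := by
  have := bubble_conj b (s : ℂ)
  rw [Complex.conj_ofReal] at this
  exact Complex.conj_eq_iff_im.1 this.symm

/-- The real values of `Ψ` on `[-b, ∞)`. -/
def bubbleReal (b s : ℝ) : ℝ := (bubble b (s : ℂ)).re

lemma ofReal_bubbleReal (b s : ℝ) : ((bubbleReal b s : ℝ) : ℂ) = bubble b (s : ℂ) := by
  apply Complex.ext
  · simp [bubbleReal]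
  · simp [bubble_ofReal_im]

/-- The values of the Feynman-parameter integrand at real points. -/
lemma bubbleKernel_ofReal (b s β : ℝ) :
    bubbleKernel b (s : ℂ) β =
      ((2 * (s + b) / ((s + b) * (1 - β ^ 2) + b * β ^ 2) : ℝ) : ℂ) := by
  simp [bubbleKernel, bubbleDen]

lemma bubbleReal_eq (b s : ℝ) : bubbleReal b s =
    ∫ β in (0 : ℝ)..1, 2 * (s + b) / ((s + b) * (1 - β ^ 2) + b * β ^ 2) := by
  have : bubble b (s : ℂ) =
      ((∫ β in (0 : ℝ)..1, 2 * (s + b) / ((s + b) * (1 - β ^ 2) + b * β ^ 2) : ℝ) : ℂ) := by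
    rw [← intervalIntegral.integral_ofReal]
    unfold bubble
    congr 1
    ext β
    exact bubbleKernel_ofReal b s β
  rw [bubbleReal, this, Complex.ofReal_re]

@[simp] lemma bubbleReal_threshold (b : ℝ) : bubbleReal b (-b) = 0 := by
  simp [bubbleReal]

lemma bubbleRealDen_pos {b s β : ℝ} (hb : 0 < b) (hs : -b < s) (h0 : 0 ≤ β) (h1 : β ≤ 1) :
    0 < (s + b) * (1 - β ^ 2) + b * β ^ 2 := by
  rcases h0.eq_or_lt with h | h
  · rw [← h]; nlinarith
  · have : 0 ≤ 1 - β ^ 2 := by nlinarith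
    have : 0 ≤ (s + b) * (1 - β ^ 2) := mul_nonneg (by linarith) this
    positivity

lemma continuousOn_bubbleRealKernel {b s : ℝ} (hb : 0 < b) (hs : -b < s) :
    ContinuousOn (fun β : ℝ => 2 * (s + b) / ((s + b) * (1 - β ^ 2) + b * β ^ 2)) (Icc 0 1) :=
  ContinuousOn.div (by fun_prop) (by fun_prop)
    fun _ hβ => (bubbleRealDen_pos hb hs hβ.1 hβ.2).ne'

theorem bubbleReal_strictMonoOn {b : ℝ} (hb : 0 < b) :
    StrictMonoOn (bubbleReal b) (Ici (-b)) := by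
  intro s hs t ht hst
  have ht' : -b < t := lt_of_le_of_lt hs hst
  rcases (show -b ≤ s from hs).eq_or_lt with h | h
  · rw [← h, bubbleReal_threshold, bubbleReal_eq]
    refine intervalIntegral.intervalIntegral_pos_of_pos_on
      ((continuousOn_bubbleRealKernel hb ht').intervalIntegrable_of_Icc zero_le_one)
      (fun β hβ => ?_) zero_lt_one
    exact div_pos (by linarith) (bubbleRealDen_pos hb ht' hβ.1.le hβ.2.le)
  · rw [bubbleReal_eq, bubbleReal_eq]
    have hlt : ∀ β ∈ Ioc (0 : ℝ) 1, 2 * (s + b) / ((s + b) * (1 - β ^ 2) + b * β ^ 2) <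
        2 * (t + b) / ((t + b) * (1 - β ^ 2) + b * β ^ 2) := by
      intro β hβ
      rw [div_lt_div_iff₀ (bubbleRealDen_pos hb h hβ.1.le hβ.2)
        (bubbleRealDen_pos hb ht' hβ.1.le hβ.2)]
      nlinarith [mul_pos (mul_pos hb (sub_pos.2 hst)) (mul_pos hβ.1 hβ.1)]
    exact intervalIntegral.integral_lt_integral_of_continuousOn_of_le_of_exists_lt zero_lt_one
      (continuousOn_bubbleRealKernel hb h) (continuousOn_bubbleRealKernel hb ht')
      (fun β hβ => (hlt β hβ).le) ⟨1, ⟨zero_le_one, le_rfl⟩, hlt 1 ⟨zero_lt_one, le_rfl⟩⟩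

theorem bubbleReal_continuousOn {b : ℝ} (hb : 0 < b) :
    ContinuousOn (bubbleReal b) (Ici (-b)) := by
  intro s hs
  rcases (show -b ≤ s from hs).eq_or_lt with h | h
  · rw [← h]
    have hT : Tendsto (bubbleReal b) (𝓝[>] (-b)) (𝓝 0) := by
      have e : bubbleReal b = fun s => ∫ β in (0 : ℝ)..1,
          2 * (s + b) / ((s + b) * (1 - β ^ 2) + b * β ^ 2) := by ext s; exact bubbleReal_eq b s
      rw [e]
      suffices h : Tendsto (fun s => ∫ β in (0 : ℝ)..1,
          2 * (s + b) / ((s + b) * (1 - β ^ 2) + b * β ^ 2)) (𝓝[>] (-b))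
          (𝓝 (∫ β in (0 : ℝ)..1, (0 : ℝ))) by simpa using h
      have hnear : ∀ᶠ s in 𝓝[>] (-b), s ∈ Ioo (-b) 0 := Ioo_mem_nhdsGT (by linarith)
      refine intervalIntegral.tendsto_integral_filter_of_dominated_convergence (fun _ => (2 : ℝ))
        ?_ ?_ (intervalIntegrable_const (μ := volume)) ?_
      · filter_upwards [hnear] with s hs
        rw [uIoc_of_le zero_le_one]
        exact ((continuousOn_bubbleRealKernel hb hs.1).mono
          Ioc_subset_Icc_self).aestronglyMeasurable measurableSet_Ioc
      · filter_upwards [hnear] with s hs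
        refine Eventually.of_forall fun β hβ => ?_
        rw [uIoc_of_le zero_le_one] at hβ
        have hd := bubbleRealDen_pos hb hs.1 hβ.1.le hβ.2
        rw [Real.norm_of_nonneg (div_nonneg (by linarith [hs.1]) hd.le), div_le_iff₀ hd]
        nlinarith [mul_nonneg (neg_nonneg.2 hs.2.le) (sq_nonneg β)]
      · refine Eventually.of_forall fun β hβ => ?_
        rw [uIoc_of_le zero_le_one] at hβ
        have hβ0 := hβ.1
        have hc : ContinuousAt (fun s : ℝ => 2 * (s + b) / ((s + b) * (1 - β ^ 2) + b * β ^ 2))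
            (-b) := by
          refine ContinuousAt.div (by fun_prop) (by fun_prop) ?_
          simp only [neg_add_cancel, zero_mul, zero_add]; positivity
        have := hc.tendsto.mono_left (nhdsWithin_le_nhds (s := Ioi (-b)))
        simpa using this
    rw [ContinuousWithinAt, bubbleReal_threshold, ← Ioi_insert, nhdsWithin_insert, tendsto_sup]
    refine ⟨?_, hT⟩
    rw [tendsto_pure_left]
    intro U hU; rw [bubbleReal_threshold]; exact mem_of_mem_nhds hU
  · have h1 := (hasDerivAt_bubble hb (ofReal_add_mem_slitPlane h)).continuousAt
    have : ContinuousAt (bubbleReal b) s :=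
      Complex.continuous_re.continuousAt.comp
        (h1.comp Complex.continuous_ofReal.continuousAt)
    exact this.continuousWithinAt

/-- `Ψ' > 0` on the real half-line `(-b, ∞)`; in particular `Ψ'` does not vanish there. -/
theorem bubbleDeriv_ofReal {b s : ℝ} (hb : 0 < b) (hs : -b < s) :
    ∃ d : ℝ, 0 < d ∧ bubbleDeriv b (s : ℂ) = d := by
  refine ⟨∫ β in (0 : ℝ)..1, 2 * b * β ^ 2 / ((s + b) * (1 - β ^ 2) + b * β ^ 2) ^ 2, ?_, ?_⟩
  · refine intervalIntegral.intervalIntegral_pos_of_pos_on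
      (ContinuousOn.intervalIntegrable_of_Icc (μ := volume) zero_le_one ?_) (fun β hβ => ?_) zero_lt_one
    · exact ContinuousOn.div (by fun_prop) (by fun_prop)
        fun _ hβ => (pow_pos (bubbleRealDen_pos hb hs hβ.1 hβ.2) 2).ne'
    · have := bubbleRealDen_pos hb hs hβ.1.le hβ.2.le
      have := hβ.1
      positivity
  · unfold bubbleDeriv
    rw [← intervalIntegral.integral_ofReal]
    congr 1
    ext β
    simp [bubbleDen]

/-! ### Boundary behaviour of `Ψ` on the upper half-plane -/

/-- The open upper half-plane. -/
def upperHalf : Set ℂ := {z | 0 < z.im}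

lemma add_mem_slitPlane_of_mem_upperHalf {b : ℝ} {z : ℂ} (hz : z ∈ upperHalf) :
    z + b ∈ Complex.slitPlane := by
  rw [Complex.mem_slitPlane_iff]; right
  simpa using (show 0 < z.im from hz).ne'

/-- The uniformizing variable `y = √(1 + b / z)` (principal branch). -/
def velocity (b : ℝ) (z : ℂ) : ℂ := (1 + b / z) ^ (2⁻¹ : ℂ)

lemma velocity_sq (b : ℝ) (z : ℂ) : velocity b z ^ 2 = 1 + b / z :=
  Complex.cpow_ofNat_inv_pow _ 2

lemma im_one_add_div_neg {b : ℝ} (hb : 0 < b) {z : ℂ} (hz : z ∈ upperHalf) :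
    (1 + (b : ℂ) / z).im < 0 := by
  have hz' : 0 < z.im := hz
  have hz0 : z ≠ 0 := fun h => by simp [h] at hz'
  have hn := Complex.normSq_pos.2 hz0
  simp only [Complex.add_im, Complex.one_im, Complex.div_im, Complex.ofReal_im, Complex.ofReal_re]
  have : 0 < b * z.im / Complex.normSq z := by positivity
  simp only [zero_mul, zero_div]
  linarith

lemma velocity_re_pos {b : ℝ} (hb : 0 < b) {z : ℂ} (hz : z ∈ upperHalf) :
    0 < (velocity b z).re := by
  have him := im_one_add_div_neg hb hz
  unfold velocity
  rw [Complex.cpow_inv_two_re]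
  apply Real.sqrt_pos.2
  have : |(1 + (b : ℂ) / z).re| < ‖1 + (b : ℂ) / z‖ := Complex.abs_re_lt_norm.2 him.ne
  have := neg_abs_le (1 + (b : ℂ) / z).re
  linarith

lemma velocity_im_neg {b : ℝ} (hb : 0 < b) {z : ℂ} (hz : z ∈ upperHalf) :
    (velocity b z).im < 0 := by
  have h1 := velocity_re_pos hb hz
  have h2 := im_one_add_div_neg hb hz
  rw [← velocity_sq, pow_two, Complex.mul_im] at h2
  nlinarith

/-- The Möbius image `(y + β) / (y - β)` lies in the upper half-plane for `β > 0`. -/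
lemma moebius_im_pos {y : ℂ} (hy : y.im < 0) {β : ℝ} (hβ : 0 < β) :
    0 < ((y + β) / (y - β)).im := by
  have hne : y - β ≠ 0 := fun h => by
    have := congrArg Complex.im h; simp at this; exact hy.ne this
  have hn := Complex.normSq_pos.2 hne
  rw [Complex.div_im]
  simp only [Complex.add_im, Complex.ofReal_im, Complex.sub_re, Complex.ofReal_re, Complex.add_re,
    Complex.sub_im, add_zero, sub_zero]
  rw [← sub_div]
  apply div_pos _ hn
  nlinarith

/-- Closed form of `Ψ`: the integrand of `Ψ` is the derivative in `β` of
`y log ((y + β) / (y - β))`, where `y = √(1 + b / z)`. -/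
theorem bubble_eq_log {b : ℝ} (hb : 0 < b) {z : ℂ} (hz : z ∈ upperHalf) :
    bubble b z =
      velocity b z * Complex.log ((velocity b z + 1) / (velocity b z - 1)) := by
  set y := velocity b z with hy
  have hyim : y.im < 0 := velocity_im_neg hb hz
  have hz0 : z ≠ 0 := fun h => by
    have : 0 < z.im := hz
    simp [h] at this
  have hysq : z + b = z * y ^ 2 := by
    rw [hy, velocity_sq]; field_simp
  have hsub : ∀ β : ℝ, y - β ≠ 0 := fun β h => by
    have := congrArg Complex.im h; simp at this; exact hyim.ne this
  have hadd : ∀ β : ℝ, y + β ≠ 0 := fun β h => by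
    have := congrArg Complex.im h; simp at this; exact hyim.ne this
  have hderiv : ∀ β ∈ uIcc (0 : ℝ) 1,
      HasDerivAt (fun β : ℝ => y * Complex.log ((y + β) / (y - β))) (bubbleKernel b z β) β := by
    intro β hβ
    rw [uIcc_of_le zero_le_one] at hβ
    have hs : (y + β) / (y - β) ∈ Complex.slitPlane := by
      rcases hβ.1.eq_or_lt with h | h
      · rw [← h]
        have : y ≠ 0 := by simpa using hsub 0
        simp [this]
      · rw [Complex.mem_slitPlane_iff]; right; exact (moebius_im_pos hyim h).ne'
    have h1 : HasDerivAt (fun β : ℝ => y + (β : ℂ)) 1 β :=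
      (Complex.ofRealCLM.hasDerivAt (x := β)).const_add y
    have h2 : HasDerivAt (fun β : ℝ => y - (β : ℂ)) (-1) β :=
      (Complex.ofRealCLM.hasDerivAt (x := β)).const_sub y
    have h3 := ((h1.fun_div h2 (hsub β)).clog_real hs).const_mul y
    refine h3.congr_deriv ?_
    have hA := hadd β
    have hB := hsub β
    have hden : bubbleDen b z β = z * ((y + β) * (y - β)) := by
      unfold bubbleDen
      linear_combination (hysq)
    unfold bubbleKernel
    rw [hden, hysq]
    field_simp
    ring
  unfold bubble
  rw [intervalIntegral.integral_eq_sub_of_hasDerivAt hderiv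
    (intervalIntegrable_bubbleKernel hb (add_mem_slitPlane_of_mem_upperHalf hz))]
  have : y ≠ 0 := by simpa using hsub 0
  simp [this]

/-- The boundary value of `Ψ` at the point `-(b + κ²)` of the cut, from the upper half-plane. -/
def bubblePlus (b κ : ℝ) : ℂ :=
  ((κ / Real.sqrt (κ ^ 2 + b) : ℝ) : ℂ) *
    (((2 * Real.arsinh (κ / Real.sqrt b) : ℝ) : ℂ) + Real.pi * Complex.I)

lemma neg_sq_add_ne_zero {b : ℝ} (hb : 0 < b) (κ : ℝ) : (-((b + κ ^ 2 : ℝ) : ℂ)) ≠ 0 := by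
  rw [neg_ne_zero]; exact_mod_cast (by positivity : b + κ ^ 2 ≠ 0)

lemma tendsto_velocity {b : ℝ} (hb : 0 < b) {κ : ℝ} (hκ : 0 ≤ κ) :
    Tendsto (velocity b) (𝓝 (-((b + κ ^ 2 : ℝ) : ℂ)))
      (𝓝 ((κ / Real.sqrt (κ ^ 2 + b) : ℝ) : ℂ)) := by
  have hpos : 0 < κ ^ 2 + b := by positivity
  have e1 : 1 + (b : ℂ) / (-((b + κ ^ 2 : ℝ) : ℂ)) = ((κ ^ 2 / (κ ^ 2 + b) : ℝ) : ℂ) := by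
    have : ((b : ℂ) + κ ^ 2) ≠ 0 := by
      have := neg_sq_add_ne_zero hb κ; simpa using neg_ne_zero.1 this
    have h2 : ((κ : ℂ) ^ 2 + b) ≠ 0 := by rwa [add_comm]
    push_cast
    field_simp
    ring
  have hc : ContinuousAt (velocity b) (-((b + κ ^ 2 : ℝ) : ℂ)) := by
    unfold velocity
    refine ContinuousAt.comp (g := fun w : ℂ => w ^ (2⁻¹ : ℂ)) (f := fun z : ℂ => 1 + (b : ℂ) / z)
      ?_ ?_
    · apply Complex.continuousAt_cpow_const_of_re_pos
      · left; rw [e1, Complex.ofReal_re]; positivity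
      · norm_num
    · exact continuousAt_const.add (continuousAt_const.div continuousAt_id (neg_sq_add_ne_zero hb κ))
  have hv : velocity b (-((b + κ ^ 2 : ℝ) : ℂ)) = ((κ / Real.sqrt (κ ^ 2 + b) : ℝ) : ℂ) := by
    unfold velocity
    rw [e1]
    have : (2⁻¹ : ℂ) = ((2⁻¹ : ℝ) : ℂ) := by norm_num
    rw [this, ← Complex.ofReal_cpow (by positivity)]
    congr 1
    rw [show (2⁻¹ : ℝ) = 1 / 2 by norm_num, ← Real.sqrt_eq_rpow, Real.sqrt_div (by positivity),
      Real.sqrt_sq hκ]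
  rw [← hv]; exact hc

lemma log_moebius_eq_arsinh {b : ℝ} (hb : 0 < b) (κ : ℝ) :
    Real.log ((1 + κ / Real.sqrt (κ ^ 2 + b)) / (1 - κ / Real.sqrt (κ ^ 2 + b))) =
      2 * Real.arsinh (κ / Real.sqrt b) := by
  have hpos : 0 < κ ^ 2 + b := by positivity
  set r := Real.sqrt (κ ^ 2 + b) with hr
  have hr2 : r ^ 2 = κ ^ 2 + b := Real.sq_sqrt hpos.le
  have hr0 : 0 < r := Real.sqrt_pos.2 hpos
  set d := Real.sqrt b with hd
  have hd2 : d ^ 2 = b := Real.sq_sqrt hb.le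
  have hd0 : 0 < d := Real.sqrt_pos.2 hb
  have habs : |κ| < r := abs_lt_of_sq_lt_sq (by rw [hr2]; linarith) hr0.le
  have h1 := abs_lt.1 habs
  have hs : Real.sqrt (1 + (κ / d) ^ 2) = r / d := by
    rw [show 1 + (κ / d) ^ 2 = (r / d) ^ 2 by rw [div_pow, div_pow, hr2, hd2]; field_simp; ring]
    exact Real.sqrt_sq (by positivity)
  rw [Real.arsinh, hs]
  have e : (1 + κ / r) / (1 - κ / r) = (κ / d + r / d) ^ 2 := by
    have hsub : r - κ ≠ 0 := by linarith
    have h3 : 1 - κ / r ≠ 0 := by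
      rw [one_sub_div hr0.ne']; exact div_ne_zero hsub hr0.ne'
    rw [div_eq_iff h3]
    field_simp
    rw [hd2]
    linear_combination (κ + r) * (-1) * (hr2)
  rw [e, Real.log_pow]
  norm_num

lemma tendsto_moebius {b : ℝ} (hb : 0 < b) {κ : ℝ} (hκ : 0 ≤ κ) :
    Tendsto (fun z => Complex.log ((velocity b z + 1) / (velocity b z - 1)))
      (𝓝[upperHalf] (-((b + κ ^ 2 : ℝ) : ℂ)))
      (𝓝 (((2 * Real.arsinh (κ / Real.sqrt b) : ℝ) : ℂ) + Real.pi * Complex.I)) := by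
  have hpos : 0 < κ ^ 2 + b := by positivity
  set y0 : ℝ := κ / Real.sqrt (κ ^ 2 + b) with hy0
  have hy0n : 0 ≤ y0 := by positivity
  have hy0l : y0 < 1 := by
    rw [hy0, div_lt_one (Real.sqrt_pos.2 hpos), Real.lt_sqrt hκ]; linarith
  have hne : (y0 : ℂ) - 1 ≠ 0 := by
    rw [sub_ne_zero]; exact_mod_cast hy0l.ne
  have ht := (tendsto_velocity hb hκ).mono_left (nhdsWithin_le_nhds (s := upperHalf))
  have hw : Tendsto (fun z => (velocity b z + 1) / (velocity b z - 1))
      (𝓝[upperHalf] (-((b + κ ^ 2 : ℝ) : ℂ))) (𝓝 (((y0 + 1) / (y0 - 1) : ℝ) : ℂ)) := by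
    have := (ht.add_const 1).div (ht.sub_const 1) hne
    have e : (((y0 + 1) / (y0 - 1) : ℝ) : ℂ) = ((y0 : ℂ) + 1) / ((y0 : ℂ) - 1) := by push_cast; rfl
    rw [e]; exact this
  have hw' : Tendsto (fun z => (velocity b z + 1) / (velocity b z - 1))
      (𝓝[upperHalf] (-((b + κ ^ 2 : ℝ) : ℂ)))
      (𝓝[{z : ℂ | 0 ≤ z.im}] (((y0 + 1) / (y0 - 1) : ℝ) : ℂ)) := by
    refine tendsto_nhdsWithin_iff.2 ⟨hw, ?_⟩
    filter_upwards [self_mem_nhdsWithin] with z hz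
    have := moebius_im_pos (velocity_im_neg hb hz) zero_lt_one
    simpa using this.le
  have hneg : (y0 + 1) / (y0 - 1) < 0 := div_neg_of_pos_of_neg (by linarith) (by linarith)
  have := (Complex.tendsto_log_nhdsWithin_im_nonneg_of_re_neg_of_im_zero
    (z := (((y0 + 1) / (y0 - 1) : ℝ) : ℂ)) (by rwa [Complex.ofReal_re])
    (Complex.ofReal_im _)).comp hw'
  have hl : Real.log ‖(((y0 + 1) / (y0 - 1) : ℝ) : ℂ)‖ = 2 * Real.arsinh (κ / Real.sqrt b) := by
    rw [← log_moebius_eq_arsinh hb κ, Complex.norm_real, Real.norm_eq_abs, abs_of_neg hneg]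
    congr 1
    rw [← div_neg]; congr 1 <;> ring
  rw [hl] at this
  exact this

theorem tendsto_bubble_boundary {b : ℝ} (hb : 0 < b) {κ : ℝ} (hκ : 0 ≤ κ) :
    Tendsto (bubble b) (𝓝[upperHalf] (-((b + κ ^ 2 : ℝ) : ℂ))) (𝓝 (bubblePlus b κ)) := by
  have ht := (tendsto_velocity hb hκ).mono_left (nhdsWithin_le_nhds (s := upperHalf))
  refine (ht.mul (tendsto_moebius hb hκ)).congr' ?_
  filter_upwards [self_mem_nhdsWithin] with z hz
  exact (bubble_eq_log hb hz).symm

/-- At the threshold `Ψ` behaves like a square root; in particular it dominates `z + b`. -/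
theorem isLittleO_bubble_threshold {b : ℝ} (hb : 0 < b) :
    (fun z : ℂ => z + b) =o[𝓝[upperHalf] (-(b : ℂ))] bubble b := by
  have h0 : (-((b + 0 ^ 2 : ℝ) : ℂ)) = -(b : ℂ) := by norm_num
  have ht := (tendsto_velocity hb le_rfl).mono_left (nhdsWithin_le_nhds (s := upperHalf))
  have hl := tendsto_moebius hb le_rfl
  rw [h0] at ht hl
  have hlne : (((2 * Real.arsinh (0 / Real.sqrt b) : ℝ) : ℂ) + Real.pi * Complex.I) ≠ 0 := by
    simp [Real.pi_ne_zero]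
  -- `z + b = z y²` and `Ψ = y log(…)`, so the quotient is `z y / log(…) → 0`.
  have hq : Tendsto (fun z : ℂ => z * velocity b z /
      Complex.log ((velocity b z + 1) / (velocity b z - 1))) (𝓝[upperHalf] (-(b : ℂ))) (𝓝 0) := by
    have hid : Tendsto (fun z : ℂ => z) (𝓝[upperHalf] (-(b : ℂ))) (𝓝 (-(b : ℂ))) := nhdsWithin_le_nhds
    have := (hid.mul ht).div hl hlne
    rw [zero_div, Complex.ofReal_zero, mul_zero, zero_div] at this
    exact this
  rw [Asymptotics.isLittleO_iff_tendsto']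
  · refine hq.congr' ?_
    filter_upwards [self_mem_nhdsWithin] with z hz
    have hz0 : z ≠ 0 := fun h => by
      have : 0 < z.im := hz
      simp [h] at this
    have hy : velocity b z ≠ 0 := fun h => by
      have := velocity_re_pos hb hz; simp [h] at this
    rw [bubble_eq_log hb hz]
    have : z + b = z * velocity b z ^ 2 := by rw [velocity_sq]; field_simp
    rw [this, pow_two, ← mul_assoc, mul_comm (velocity b z) (Complex.log _),
      mul_div_mul_right _ _ hy]
  · filter_upwards [self_mem_nhdsWithin] with z hz h
    have := bubble_im_pos hb hz
    simp [h] at this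

lemma tendsto_velocity_cobounded (b : ℝ) :
    Tendsto (velocity b) (Bornology.cobounded ℂ) (𝓝 1) := by
  have h1 : Tendsto (fun z : ℂ => 1 + (b : ℂ) / z) (Bornology.cobounded ℂ) (𝓝 (1 + b * 0)) :=
    (tendsto_inv₀_cobounded.const_mul (b : ℂ)).const_add 1
  simp only [mul_zero, add_zero] at h1
  have h2 : ContinuousAt (fun w : ℂ => w ^ (2⁻¹ : ℂ)) 1 :=
    Complex.continuousAt_cpow_const_of_re_pos (Or.inl (by simp)) (by norm_num)
  have := h2.tendsto.comp h1
  rw [Complex.one_cpow] at this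
  exact this

/-- The logarithm in `Ψ`, rewritten as `(y + 1)² z / b`. -/
lemma moebius_velocity_eq {b : ℝ} (hb : 0 < b) {z : ℂ} (hz : z ∈ upperHalf) :
    (velocity b z + 1) / (velocity b z - 1) = (velocity b z + 1) ^ 2 / b * z := by
  have hz0 : z ≠ 0 := fun h => by
    have : 0 < z.im := hz
    simp [h] at this
  have hb' : (b : ℂ) ≠ 0 := by exact_mod_cast hb.ne'
  have hy1 : velocity b z - 1 ≠ 0 := fun h => by
    have h1 := velocity_im_neg hb hz
    rw [sub_eq_zero.1 h] at h1; simp at h1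
  rw [div_eq_iff hy1]
  have : b = z * (velocity b z ^ 2 - 1) := by rw [velocity_sq]; field_simp; ring
  field_simp
  linear_combination (velocity b z + 1) * this

lemma tendsto_norm_moebius {b : ℝ} (hb : 0 < b) :
    Tendsto (fun z => ‖(velocity b z + 1) / (velocity b z - 1)‖)
      (Bornology.cobounded ℂ ⊓ 𝓟 upperHalf) atTop := by
  have h1 : Tendsto (fun z => ‖(velocity b z + 1) ^ 2 / b‖)
      (Bornology.cobounded ℂ ⊓ 𝓟 upperHalf) (𝓝 ‖((1 : ℂ) + 1) ^ 2 / b‖) :=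
    (((((tendsto_velocity_cobounded b).add_const 1).pow 2).div_const (b : ℂ)).norm).mono_left
      inf_le_left
  have hb' : (b : ℂ) ≠ 0 := by exact_mod_cast hb.ne'
  have hpos : 0 < ‖((1 : ℂ) + 1) ^ 2 / b‖ := norm_pos_iff.2 (div_ne_zero (by norm_num) hb')
  have h2 := Tendsto.pos_mul_atTop hpos h1
    ((tendsto_norm_cobounded_atTop (E := ℂ)).mono_left inf_le_left)
  refine h2.congr' ?_
  filter_upwards [mem_inf_of_right (mem_principal_self _)] with z hz
  rw [moebius_velocity_eq hb hz, norm_mul]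

/-- `|Ψ|` grows at infinity (logarithmically). -/
theorem tendsto_norm_bubble {b : ℝ} (hb : 0 < b) :
    Tendsto (fun z => ‖bubble b z‖) (Bornology.cobounded ℂ ⊓ 𝓟 upperHalf) atTop := by
  have h1 : Tendsto (fun z => ‖velocity b z‖) (Bornology.cobounded ℂ ⊓ 𝓟 upperHalf) (𝓝 ‖(1 : ℂ)‖) :=
    ((tendsto_velocity_cobounded b).norm).mono_left inf_le_left
  have h2 : Tendsto (fun z => ‖Complex.log ((velocity b z + 1) / (velocity b z - 1))‖)
      (Bornology.cobounded ℂ ⊓ 𝓟 upperHalf) atTop := by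
    refine tendsto_atTop_mono (fun z => ?_) (Real.tendsto_log_atTop.comp (tendsto_norm_moebius hb))
    simp only [Function.comp]
    rw [← Complex.log_re]
    exact Complex.re_le_norm _
  refine (Tendsto.pos_mul_atTop (by simp) h1 h2).congr' ?_
  filter_upwards [mem_inf_of_right (mem_principal_self _)] with z hz
  rw [bubble_eq_log hb hz, norm_mul]

theorem isLittleO_bubble_cobounded {b : ℝ} (hb : 0 < b) :
    bubble b =o[Bornology.cobounded ℂ ⊓ 𝓟 upperHalf] (fun z : ℂ => z) := by
  have hM := tendsto_norm_moebius hb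
  have h1 : (fun z => velocity b z) =O[Bornology.cobounded ℂ ⊓ 𝓟 upperHalf] fun _ => (1 : ℝ) :=
    ((tendsto_velocity_cobounded b).mono_left inf_le_left).isBigO_one ℝ
  have h2 : (fun z => Complex.log ((velocity b z + 1) / (velocity b z - 1)))
      =o[Bornology.cobounded ℂ ⊓ 𝓟 upperHalf]
        fun z => ‖(velocity b z + 1) / (velocity b z - 1)‖ := by
    have hlog : (fun z => Real.log ‖(velocity b z + 1) / (velocity b z - 1)‖)
        =o[Bornology.cobounded ℂ ⊓ 𝓟 upperHalf]
          fun z => ‖(velocity b z + 1) / (velocity b z - 1)‖ :=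
      Real.isLittleO_log_id_atTop.comp_tendsto hM
    have hpi : (fun _ : ℂ => Real.pi) =o[Bornology.cobounded ℂ ⊓ 𝓟 upperHalf]
          fun z => ‖(velocity b z + 1) / (velocity b z - 1)‖ := by
      rw [Asymptotics.isLittleO_const_left]; right
      simpa [Function.comp_def] using hM
    have := hlog.norm_left.add hpi
    refine Asymptotics.IsBigO.trans_isLittleO (Asymptotics.IsBigO.of_bound 1 ?_) this
    refine Eventually.of_forall fun z => ?_
    rw [one_mul]
    refine (Complex.norm_le_abs_re_add_abs_im _).trans (le_trans ?_ (Real.le_norm_self _))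
    rw [Complex.log_re, Complex.log_im]
    exact add_le_add le_rfl (Complex.abs_arg_le_pi _)
  have h3 : (fun z => ‖(velocity b z + 1) / (velocity b z - 1)‖)
      =O[Bornology.cobounded ℂ ⊓ 𝓟 upperHalf] fun z : ℂ => z := by
    have hO : (fun z => (velocity b z + 1) ^ 2 / b)
        =O[Bornology.cobounded ℂ ⊓ 𝓟 upperHalf] fun _ => (1 : ℝ) :=
      (((((tendsto_velocity_cobounded b).add_const 1).pow 2).div_const (b : ℂ)).mono_left
        inf_le_left).isBigO_one ℝ
    have e : (fun z => ‖(velocity b z + 1) ^ 2 / b * z‖)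
        =O[Bornology.cobounded ℂ ⊓ 𝓟 upperHalf] fun z : ℂ => z := by
      have h := hO.mul (Asymptotics.isBigO_refl (fun z : ℂ => z)
        (Bornology.cobounded ℂ ⊓ 𝓟 upperHalf)).norm_right
      simp only [one_mul] at h
      exact h.norm_left.of_norm_right
    refine e.congr' ?_ EventuallyEq.rfl
    filter_upwards [mem_inf_of_right (mem_principal_self _)] with z hz
    rw [moebius_velocity_eq hb hz]
  have := h1.mul_isLittleO (h2.trans_isBigO h3).norm_right
  simp only [one_mul] at this
  refine this.of_norm_right.congr' ?_ EventuallyEq.rfl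
  filter_upwards [mem_inf_of_right (mem_principal_self _)] with z hz
  rw [bubble_eq_log hb hz]

/-! ### The symbol `S` on the cut plane and on the cut -/

section Symbol

variable {m a hbar lam lam₁ lam₂ g₁ g₂ : ℝ}

/-- The boundary value of `S` at the point `-(4m² + κ²)` of the cut, from the upper half-plane. It
is a smooth function of the real variable `κ`. -/
def SPlus (m a hbar lam lam₁ lam₂ g₁ g₂ κ : ℝ) : ℂ :=
  -((((lam₁ - lam₂ * (4 * m ^ 2 + κ ^ 2)) * coupling hbar lam : ℝ) : ℂ) *
      (bubblePlus (4 * m ^ 2) κ - (bubbleReal (4 * m ^ 2) a : ℂ)))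
    - ((g₁ - g₂ * (4 * m ^ 2 + κ ^ 2) : ℝ) : ℂ)

lemma coupling_pos (hhbar : 0 < hbar) (hlam : 0 < lam) : 0 < coupling hbar lam := by
  unfold coupling; positivity

lemma notMem_branchCut_of_slitPlane {z : ℂ} (hz : z + ((4 * m ^ 2 : ℝ) : ℂ) ∈ Complex.slitPlane) :
    z ∉ branchCut m := by
  rintro ⟨h1, h2⟩
  rw [Complex.mem_slitPlane_iff] at hz
  simp only [Complex.add_re, Complex.add_im, Complex.ofReal_re, Complex.ofReal_im, h1] at hz
  rcases hz with hz | hz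
  · linarith
  · simp at hz

lemma notMem_branchCut_of_upperHalf {z : ℂ} (hz : z ∈ upperHalf) : z ∉ branchCut m :=
  fun h => (show 0 < z.im from hz).ne' h.1

lemma ofReal_notMem_branchCut {s : ℝ} (hs : -(4 * m ^ 2) ≤ s) : (s : ℂ) ∉ branchCut m :=
  fun h => absurd h.2 (by simpa using hs)

theorem S_eq (hm : 0 < m) (ha : -(4 * m ^ 2) < a) {z : ℂ} (hz : z ∉ branchCut m) :
    S m a hbar lam lam₁ lam₂ g₁ g₂ z =
      -(((lam₁ : ℂ) + lam₂ * z) * coupling hbar lam *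
        (bubble (4 * m ^ 2) z - (bubbleReal (4 * m ^ 2) a : ℂ))) - (g₁ + g₂ * z) := by
  rw [S, Fa_eq hm ha hz, ofReal_bubbleReal]

theorem FaReal_eq (hm : 0 < m) (ha : -(4 * m ^ 2) < a) {s : ℝ} (hs : -(4 * m ^ 2) ≤ s) :
    FaReal m a s = bubbleReal (4 * m ^ 2) s - bubbleReal (4 * m ^ 2) a := by
  rw [FaReal, Fa_eq hm ha (ofReal_notMem_branchCut hs), ← ofReal_bubbleReal, ← ofReal_bubbleReal,
    ← Complex.ofReal_sub, Complex.ofReal_re]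

/-- The symbol at real points of the closed gap `[-4m², ∞)`. -/
theorem S_ofReal (hm : 0 < m) (ha : -(4 * m ^ 2) < a) {s : ℝ} (hs : -(4 * m ^ 2) ≤ s) :
    S m a hbar lam lam₁ lam₂ g₁ g₂ (s : ℂ) =
      ((-((lam₁ + lam₂ * s) * coupling hbar lam * FaReal m a s) - (g₁ + g₂ * s) : ℝ) : ℂ) := by
  rw [S_eq hm ha (ofReal_notMem_branchCut hs), FaReal_eq hm ha hs, ← ofReal_bubbleReal]
  push_cast; ring

lemma S_conj (z : ℂ) : S m a hbar lam lam₁ lam₂ g₁ g₂ ((starRingEnd ℂ) z) =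
    (starRingEnd ℂ) (S m a hbar lam lam₁ lam₂ g₁ g₂ z) := by
  have : Fa m a ((starRingEnd ℂ) z) = (starRingEnd ℂ) (Fa m a z) := by
    unfold Fa
    rw [← integral_conj]
    congr 1
    ext μ
    simp
  simp [S, this]

theorem hasDerivAt_S (hm : 0 < m) (ha : -(4 * m ^ 2) < a) {z : ℂ}
    (hz : z + ((4 * m ^ 2 : ℝ) : ℂ) ∈ Complex.slitPlane) :
    HasDerivAt (S m a hbar lam lam₁ lam₂ g₁ g₂)
      (-((lam₂ : ℂ) * coupling hbar lam * (bubble (4 * m ^ 2) z - (bubbleReal (4 * m ^ 2) a : ℂ)) +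
        (lam₁ + lam₂ * z) * coupling hbar lam * bubbleDeriv (4 * m ^ 2) z) - g₂) z := by
  have hb : 0 < 4 * m ^ 2 := by positivity
  have hopen : IsOpen {w : ℂ | w + ((4 * m ^ 2 : ℝ) : ℂ) ∈ Complex.slitPlane} :=
    Complex.isOpen_slitPlane.preimage (by fun_prop)
  have h1 : HasDerivAt (fun w : ℂ => ((lam₁ : ℂ) + lam₂ * w) * coupling hbar lam)
      (lam₂ * coupling hbar lam) z := by
    simpa using (((hasDerivAt_id z).const_mul (lam₂ : ℂ)).const_add (lam₁ : ℂ)).mul_const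
      (coupling hbar lam : ℂ)
  have h2 := (hasDerivAt_bubble hb hz).sub_const (bubbleReal (4 * m ^ 2) a : ℂ)
  have h3 : HasDerivAt (fun w : ℂ => (g₁ : ℂ) + g₂ * w) g₂ z := by
    simpa using ((hasDerivAt_id z).const_mul (g₂ : ℂ)).const_add (g₁ : ℂ)
  refine ((h1.fun_mul h2).fun_neg.fun_sub h3).congr_of_eventuallyEq ?_
  filter_upwards [hopen.mem_nhds hz] with w hw
  exact S_eq hm ha (notMem_branchCut_of_slitPlane hw)

theorem tendsto_S_boundary (hm : 0 < m) (ha : -(4 * m ^ 2) < a) {κ : ℝ} (hκ : 0 ≤ κ) :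
    Tendsto (S m a hbar lam lam₁ lam₂ g₁ g₂)
      (𝓝[upperHalf] (-((4 * m ^ 2 + κ ^ 2 : ℝ) : ℂ)))
      (𝓝 (SPlus m a hbar lam lam₁ lam₂ g₁ g₂ κ)) := by
  have hb : 0 < 4 * m ^ 2 := by positivity
  have hid : Tendsto (fun z : ℂ => z) (𝓝[upperHalf] (-((4 * m ^ 2 + κ ^ 2 : ℝ) : ℂ)))
    (𝓝 (-((4 * m ^ 2 + κ ^ 2 : ℝ) : ℂ))) := nhdsWithin_le_nhds
  have h1 := (((((hid.const_mul (lam₂ : ℂ)).const_add (lam₁ : ℂ)).mul_const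
    (coupling hbar lam : ℂ)).mul ((tendsto_bubble_boundary hb hκ).sub_const
      (bubbleReal (4 * m ^ 2) a : ℂ))).neg).sub ((hid.const_mul (g₂ : ℂ)).const_add (g₁ : ℂ))
  have e : SPlus m a hbar lam lam₁ lam₂ g₁ g₂ κ =
      -(((lam₁ : ℂ) + lam₂ * (-((4 * m ^ 2 + κ ^ 2 : ℝ) : ℂ))) * coupling hbar lam *
        (bubblePlus (4 * m ^ 2) κ - (bubbleReal (4 * m ^ 2) a : ℂ))) -
        (g₁ + g₂ * (-((4 * m ^ 2 + κ ^ 2 : ℝ) : ℂ))) := by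
    unfold SPlus; push_cast; ring
  rw [e]
  refine h1.congr' ?_
  filter_upwards [self_mem_nhdsWithin] with z hz
  exact (S_eq hm ha (notMem_branchCut_of_upperHalf hz)).symm

lemma bubblePlus_im (b κ : ℝ) : (bubblePlus b κ).im = κ / Real.sqrt (κ ^ 2 + b) * Real.pi := by
  simp [bubblePlus]

lemma SPlus_im (κ : ℝ) : (SPlus m a hbar lam lam₁ lam₂ g₁ g₂ κ).im =
    -((lam₁ - lam₂ * (4 * m ^ 2 + κ ^ 2)) * coupling hbar lam *
      (κ / Real.sqrt (κ ^ 2 + 4 * m ^ 2) * Real.pi)) := by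
  unfold SPlus
  rw [Complex.sub_im, Complex.neg_im, Complex.im_ofReal_mul, Complex.ofReal_im, Complex.sub_im,
    bubblePlus_im, Complex.ofReal_im]
  ring

/-- On the cut `S` can vanish only where both coefficients vanish. -/
theorem SPlus_ne_zero (hm : 0 < m) (hc : 0 < coupling hbar lam) {κ : ℝ} (hκ : 0 < κ)
    (h : lam₁ - lam₂ * (4 * m ^ 2 + κ ^ 2) = 0 → g₁ - g₂ * (4 * m ^ 2 + κ ^ 2) ≠ 0) :
    SPlus m a hbar lam lam₁ lam₂ g₁ g₂ κ ≠ 0 := by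
  intro h0
  have him := congrArg Complex.im h0
  rw [SPlus_im, Complex.zero_im, neg_eq_zero] at him
  have h1 : lam₁ - lam₂ * (4 * m ^ 2 + κ ^ 2) = 0 := by
    have hpos : κ / Real.sqrt (κ ^ 2 + 4 * m ^ 2) * Real.pi ≠ 0 := by positivity
    rcases mul_eq_zero.1 him with h2 | h2
    · exact (mul_eq_zero.1 h2).resolve_right hc.ne'
    · exact absurd h2 hpos
  apply h h1
  have h2 : SPlus m a hbar lam lam₁ lam₂ g₁ g₂ κ = -((g₁ - g₂ * (4 * m ^ 2 + κ ^ 2) : ℝ) : ℂ) := by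
    unfold SPlus; rw [h1]; simp
  rw [h2, neg_eq_zero] at h0
  exact_mod_cast h0

lemma SPlus_zero (hm : 0 < m) (ha : -(4 * m ^ 2) < a) : SPlus m a hbar lam lam₁ lam₂ g₁ g₂ 0 =
    S m a hbar lam lam₁ lam₂ g₁ g₂ (((-(4 * m ^ 2) : ℝ)) : ℂ) := by
  rw [S_eq hm ha (ofReal_notMem_branchCut le_rfl), Complex.ofReal_neg, bubble_threshold]
  unfold SPlus bubblePlus
  simp
  ring

/-- `S` stays away from zero at infinity: the logarithmic growth of `F_a` cannot be compensated by
the rational coefficients. -/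
theorem tendsto_norm_S_atTop (hm : 0 < m) (ha : -(4 * m ^ 2) < a) (hc : 0 < coupling hbar lam)
    (hlams : lam₁ ≠ 0 ∨ lam₂ ≠ 0) :
    Tendsto (fun z => ‖S m a hbar lam lam₁ lam₂ g₁ g₂ z‖)
      (Bornology.cobounded ℂ ⊓ 𝓟 upperHalf) atTop := by
  have hb : 0 < 4 * m ^ 2 := by positivity
  set l := Bornology.cobounded ℂ ⊓ 𝓟 upperHalf with hl
  set C : ℂ := (bubbleReal (4 * m ^ 2) a : ℂ) with hC
  have hz : Tendsto (fun z : ℂ => ‖z‖) l atTop :=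
    (tendsto_norm_cobounded_atTop (E := ℂ)).mono_left inf_le_left
  have hinv : Tendsto (fun z : ℂ => z⁻¹) l (𝓝 0) := tendsto_inv₀_cobounded.mono_left inf_le_left
  have hz0 : ∀ᶠ z in l, z ≠ 0 := by
    filter_upwards [hz.eventually_gt_atTop 0] with z h
    exact norm_pos_iff.1 h
  have hB : Tendsto (fun z => ‖bubble (4 * m ^ 2) z - C‖) l atTop := by
    refine tendsto_atTop_mono (fun z => ?_)
      (tendsto_atTop_add_const_right l (-‖C‖) (tendsto_norm_bubble hb))
    rw [← sub_eq_add_neg]; exact norm_sub_norm_le _ _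
  have hS : ∀ᶠ z in l, S m a hbar lam lam₁ lam₂ g₁ g₂ z =
      -(((lam₁ : ℂ) + lam₂ * z) * coupling hbar lam * (bubble (4 * m ^ 2) z - C)) -
        (g₁ + g₂ * z) := by
    filter_upwards [mem_inf_of_right (mem_principal_self _)] with z hz
    exact S_eq hm ha (notMem_branchCut_of_upperHalf hz)
  have hcC : (coupling hbar lam : ℂ) ≠ 0 := by exact_mod_cast hc.ne'
  by_cases h2 : lam₂ = 0
  · have h1 : (lam₁ : ℂ) ≠ 0 := by
      have := hlams.resolve_right (fun h => h h2); exact_mod_cast this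
    by_cases hg : g₂ = 0
    · have key : Tendsto (fun z => ‖(lam₁ : ℂ) * coupling hbar lam‖ *
          ‖bubble (4 * m ^ 2) z - C‖ + -‖(g₁ : ℂ)‖) l atTop :=
        tendsto_atTop_add_const_right l _
          (hB.const_mul_atTop (norm_pos_iff.2 (mul_ne_zero h1 hcC)))
      refine tendsto_atTop_mono' l ?_ key
      filter_upwards [hS] with z hz
      rw [hz, h2, hg]
      simp only [Complex.ofReal_zero, zero_mul, add_zero]
      rw [← norm_mul, ← sub_eq_add_neg, ← norm_neg ((lam₁ : ℂ) * _ * _)]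
      exact norm_sub_norm_le _ _
    · -- the linear term dominates the logarithm
      have hg' : (g₂ : ℂ) ≠ 0 := by exact_mod_cast hg
      have hr : Tendsto (fun z => bubble (4 * m ^ 2) z * z⁻¹) l (𝓝 0) := by
        simpa [div_eq_mul_inv] using (isLittleO_bubble_cobounded hb).tendsto_div_nhds_zero
      have ht : Tendsto (fun z => -((lam₁ : ℂ) * coupling hbar lam *
          (bubble (4 * m ^ 2) z * z⁻¹ - C * z⁻¹)) - (g₁ * z⁻¹ + g₂)) l
          (𝓝 (-((lam₁ : ℂ) * coupling hbar lam * (0 - C * 0)) - (g₁ * 0 + g₂))) :=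
        (((hr.sub (hinv.const_mul C)).const_mul _).neg).sub
          ((hinv.const_mul (g₁ : ℂ)).add_const (g₂ : ℂ))
      have hlim : -((lam₁ : ℂ) * coupling hbar lam * (0 - C * 0)) - (g₁ * 0 + g₂) = -g₂ := by ring
      rw [hlim] at ht
      refine (Tendsto.pos_mul_atTop (norm_pos_iff.2 (neg_ne_zero.2 hg')) ht.norm hz).congr' ?_
      filter_upwards [hS, hz0] with z hz h0
      rw [hz, ← norm_mul, h2]
      congr 1
      field_simp
      simp
      ring
  · have h2' : (lam₂ : ℂ) ≠ 0 := by exact_mod_cast h2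
    have ht : Tendsto (fun z : ℂ => ((lam₁ : ℂ) * z⁻¹ + lam₂) * coupling hbar lam) l
        (𝓝 (((lam₁ : ℂ) * 0 + lam₂) * coupling hbar lam)) :=
      ((hinv.const_mul (lam₁ : ℂ)).add_const (lam₂ : ℂ)).mul_const _
    have hgt : Tendsto (fun z : ℂ => ‖(g₁ : ℂ) * z⁻¹ + g₂‖) l (𝓝 ‖(g₁ : ℂ) * 0 + g₂‖) :=
      ((hinv.const_mul (g₁ : ℂ)).add_const (g₂ : ℂ)).norm
    have hpos : 0 < ‖((lam₁ : ℂ) * 0 + lam₂) * coupling hbar lam‖ := by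
      rw [mul_zero, zero_add]; exact norm_pos_iff.2 (mul_ne_zero h2' hcC)
    have h3 := (Tendsto.pos_mul_atTop hpos ht.norm hB).atTop_add hgt.neg
    refine tendsto_atTop_mono' l ?_ (h3.atTop_mul_atTop₀ hz)
    filter_upwards [hS, hz0] with z hz h0
    rw [hz, ← norm_mul, ← sub_eq_add_neg]
    calc _ ≤ ‖-(((lam₁ : ℂ) * z⁻¹ + lam₂) * coupling hbar lam * (bubble (4 * m ^ 2) z - C)) -
          (g₁ * z⁻¹ + g₂)‖ * ‖z‖ := by
            refine mul_le_mul_of_nonneg_right ?_ (norm_nonneg _)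
            rw [← norm_neg (_ * (bubble (4 * m ^ 2) z - C))]
            exact norm_sub_norm_le _ _
      _ = _ := by
            rw [← norm_mul]; congr 1; field_simp

/-- The real polynomial `P₀ + P₁ z + P₂ z²` at a complex point. -/
def quadratic (P₀ P₁ P₂ : ℝ) (z : ℂ) : ℂ := P₀ + P₁ * z + P₂ * z ^ 2

/-- A polynomial `P` that vanishes at all zeros of `S`, all of which are simple and real. The
fields collect what makes `P / S` polynomially bounded up to the boundary of the cut plane. -/
structure RegularSymbol (m a hbar lam lam₁ lam₂ g₁ g₂ P₀ P₁ P₂ : ℝ) : Prop where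
  m_pos : 0 < m
  a_gt : -(4 * m ^ 2) < a
  coupling_pos : 0 < coupling hbar lam
  coeff_ne_zero : lam₁ ≠ 0 ∨ lam₂ ≠ 0
  upper : ∀ z ∈ upperHalf, S m a hbar lam lam₁ lam₂ g₁ g₂ z ≠ 0
  gap : ∀ s : ℝ, -(4 * m ^ 2) < s → S m a hbar lam lam₁ lam₂ g₁ g₂ s = 0 →
    quadratic P₀ P₁ P₂ s = 0 ∧ deriv (S m a hbar lam lam₁ lam₂ g₁ g₂) s ≠ 0
  cut : ∀ κ : ℝ, 0 < κ → SPlus m a hbar lam lam₁ lam₂ g₁ g₂ κ ≠ 0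
  threshold : S m a hbar lam lam₁ lam₂ g₁ g₂ ((-(4 * m ^ 2) : ℝ) : ℂ) = 0 →
    quadratic P₀ P₁ P₂ ((-(4 * m ^ 2) : ℝ) : ℂ) = 0 ∧ lam₁ - lam₂ * (4 * m ^ 2) ≠ 0

lemma differentiable_quadratic (P₀ P₁ P₂ : ℝ) : Differentiable ℂ (quadratic P₀ P₁ P₂) := by
  unfold quadratic; fun_prop

variable {P₀ P₁ P₂ : ℝ}

lemma quadratic_isBigO_sub {z₀ : ℂ} (h : quadratic P₀ P₁ P₂ z₀ = 0) :
    quadratic P₀ P₁ P₂ =O[𝓝 z₀] fun z => z - z₀ := by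
  have := ((differentiable_quadratic P₀ P₁ P₂) z₀).isBigO_sub
  simpa [h] using this

/-- Near every point of the closed upper half-plane, `P / S` is bounded. -/
lemma quadratic_isBigO_S (H : RegularSymbol m a hbar lam lam₁ lam₂ g₁ g₂ P₀ P₁ P₂) {z₀ : ℂ}
    (hz₀ : 0 ≤ z₀.im) :
    quadratic P₀ P₁ P₂ =O[𝓝[upperHalf] z₀] S m a hbar lam lam₁ lam₂ g₁ g₂ := by
  have hb : 0 < 4 * m ^ 2 := by have := H.m_pos; positivity
  have hPb : quadratic P₀ P₁ P₂ =O[𝓝[upperHalf] z₀] fun _ => (1 : ℝ) :=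
    (((differentiable_quadratic P₀ P₁ P₂).continuous.continuousAt (x := z₀)).tendsto.mono_left
      nhdsWithin_le_nhds).isBigO_one ℝ
  -- at a point with a nonzero boundary value there is nothing to do
  have hne : ∀ c : ℂ, c ≠ 0 → Tendsto (S m a hbar lam lam₁ lam₂ g₁ g₂) (𝓝[upperHalf] z₀) (𝓝 c) →
      quadratic P₀ P₁ P₂ =O[𝓝[upperHalf] z₀] S m a hbar lam lam₁ lam₂ g₁ g₂ := by
    intro c hc ht
    refine hPb.trans ?_
    refine Asymptotics.IsBigO.of_bound (2 / ‖c‖) ?_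
    have hcpos := norm_pos_iff.2 hc
    filter_upwards [ht.norm.eventually_const_lt (u := ‖c‖ / 2) (by linarith)] with z hz
    rw [norm_one, div_mul_eq_mul_div, le_div_iff₀ hcpos]
    linarith
  by_cases hslit : z₀ + ((4 * m ^ 2 : ℝ) : ℂ) ∈ Complex.slitPlane
  · have hd := hasDerivAt_S (hbar := hbar) (lam := lam) (lam₁ := lam₁) (lam₂ := lam₂) (g₁ := g₁)
      (g₂ := g₂) H.m_pos H.a_gt hslit
    by_cases h0 : S m a hbar lam lam₁ lam₂ g₁ g₂ z₀ = 0
    · have hreal : z₀.im = 0 := by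
        by_contra him
        exact H.upper z₀ (lt_of_le_of_ne hz₀ (Ne.symm him)) h0
      have hz₀r : z₀ = (z₀.re : ℂ) := Complex.ext rfl (by simpa using hreal)
      have hre : -(4 * m ^ 2) < z₀.re := by
        rw [Complex.mem_slitPlane_iff] at hslit
        rcases hslit with h | h
        · simp only [Complex.add_re, Complex.ofReal_re] at h; linarith
        · simp only [Complex.add_im, Complex.ofReal_im, hreal, add_zero, ne_eq, not_true] at h
      rw [hz₀r] at h0
      obtain ⟨hP, hS'⟩ := H.gap _ hre h0
      rw [← hz₀r] at hP hS' h0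
      have h1 := quadratic_isBigO_sub hP
      rw [hd.deriv] at hS'
      have h2 := (hd.isTheta_sub hS').2.comp_tendsto (k := fun z => (z, z₀)) (l' := 𝓝 z₀)
        (tendsto_id.prodMk (tendsto_pure.2 (Eventually.of_forall fun _ => rfl)))
      simp only [Function.comp_def, h0, sub_zero] at h2
      exact (h1.trans h2).mono nhdsWithin_le_nhds
    · exact hne _ h0 (hd.continuousAt.tendsto.mono_left nhdsWithin_le_nhds)
  · -- now `z₀` is a point of the closed cut
    have hreal : z₀.im = 0 := by
      by_contra him
      apply hslit; rw [Complex.mem_slitPlane_iff]; right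
      rwa [Complex.add_im, Complex.ofReal_im, add_zero]
    have hre : z₀.re ≤ -(4 * m ^ 2) := by
      by_contra h
      apply hslit; rw [Complex.mem_slitPlane_iff]; left
      simp only [Complex.add_re, Complex.ofReal_re]; linarith
    set κ := Real.sqrt (-z₀.re - 4 * m ^ 2) with hκdef
    have hκ2 : κ ^ 2 = -z₀.re - 4 * m ^ 2 := Real.sq_sqrt (by linarith)
    have hz₀κ : z₀ = -((4 * m ^ 2 + κ ^ 2 : ℝ) : ℂ) := by
      rw [hκ2]
      apply Complex.ext
      · simp
      · simp only [Complex.neg_im, Complex.ofReal_im, neg_zero, hreal]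
    have ht := tendsto_S_boundary (hbar := hbar) (lam := lam) (lam₁ := lam₁) (lam₂ := lam₂)
      (g₁ := g₁) (g₂ := g₂) H.m_pos H.a_gt (Real.sqrt_nonneg (-z₀.re - 4 * m ^ 2))
    rw [← hκdef, ← hz₀κ] at ht
    rcases (Real.sqrt_nonneg (-z₀.re - 4 * m ^ 2)).eq_or_lt with h | h
    · rw [← hκdef] at h
      by_cases h0 : S m a hbar lam lam₁ lam₂ g₁ g₂ ((-(4 * m ^ 2) : ℝ) : ℂ) = 0
      · -- a zero at the threshold: `S` vanishes like a square root there
        obtain ⟨hP, hl⟩ := H.threshold h0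
        have hz₀' : z₀ = -((4 * m ^ 2 : ℝ) : ℂ) := by rw [hz₀κ, ← h]; norm_num
        have hz₀'' : z₀ = ((-(4 * m ^ 2) : ℝ) : ℂ) := by rw [hz₀', Complex.ofReal_neg]
        rw [← hz₀''] at hP h0
        refine ((quadratic_isBigO_sub hP).mono nhdsWithin_le_nhds).trans ?_
        have hlit := isLittleO_bubble_threshold hb
        rw [← hz₀'] at hlit
        have hlit' : (fun z : ℂ => z - z₀) =o[𝓝[upperHalf] z₀] bubble (4 * m ^ 2) := by
          refine hlit.congr_left fun z => ?_
          rw [hz₀', sub_neg_eq_add]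
        refine hlit'.isBigO.trans ?_
        -- `S = -(λ₁ + λ₂ z) c Ψ + O(z - z₀)`
        set q : ℂ → ℂ := fun z => ((lam₁ : ℂ) + lam₂ * z) * coupling hbar lam with hq
        have hqne : q z₀ ≠ 0 := by
          rw [hq, hz₀']
          refine mul_ne_zero ?_ (by exact_mod_cast H.coupling_pos.ne')
          have : ((lam₁ - lam₂ * (4 * m ^ 2) : ℝ) : ℂ) ≠ 0 := by exact_mod_cast hl
          convert this using 1; push_cast; ring
        set e : ℂ := (lam₂ : ℂ) * coupling hbar lam * (bubbleReal (4 * m ^ 2) a : ℂ) - g₂ with he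
        have hSe : ∀ᶠ z in 𝓝[upperHalf] z₀, S m a hbar lam lam₁ lam₂ g₁ g₂ z -
            e * (z - z₀) = -(q z) * bubble (4 * m ^ 2) z := by
          have h00 : S m a hbar lam lam₁ lam₂ g₁ g₂ z₀ = (q z₀) * (bubbleReal (4 * m ^ 2) a : ℂ) -
              (g₁ + g₂ * z₀) := by
            rw [S_eq H.m_pos H.a_gt (by rw [hz₀'']; exact ofReal_notMem_branchCut le_rfl)]
            have : bubble (4 * m ^ 2) z₀ = 0 := by rw [hz₀']; exact bubble_threshold _
            rw [this]; ring
          rw [h0] at h00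
          filter_upwards [self_mem_nhdsWithin] with z hz
          rw [S_eq H.m_pos H.a_gt (notMem_branchCut_of_upperHalf hz)]
          simp only [hq, he] at h00 ⊢
          linear_combination (-1 : ℂ) * h00
        have hqt : Tendsto (fun z => -(q z)) (𝓝[upperHalf] z₀) (𝓝 (-(q z₀))) := by
          have : Continuous fun z => -(q z) := by rw [hq]; fun_prop
          exact this.continuousAt.tendsto.mono_left nhdsWithin_le_nhds
        have hB1 : bubble (4 * m ^ 2) =O[𝓝[upperHalf] z₀]
            fun z => S m a hbar lam lam₁ lam₂ g₁ g₂ z - e * (z - z₀) := by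
          have hO : (fun _ : ℂ => (1 : ℂ)) =O[𝓝[upperHalf] z₀] fun z => -(q z) := by
            refine Asymptotics.IsBigO.of_bound (2 / ‖-(q z₀)‖) ?_
            have hcpos := norm_pos_iff.2 (neg_ne_zero.2 hqne)
            filter_upwards [hqt.norm.eventually_const_lt (u := ‖-(q z₀)‖ / 2) (by linarith)] with z hz
            rw [norm_one, div_mul_eq_mul_div, le_div_iff₀ hcpos]
            linarith
          have := hO.mul (Asymptotics.isBigO_refl (bubble (4 * m ^ 2)) (𝓝[upperHalf] z₀))
          simp only [one_mul] at this
          exact this.congr' EventuallyEq.rfl (hSe.mono fun z hz => hz.symm)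
        -- absorb the linear term
        have hsmall : (fun z => e * (z - z₀)) =o[𝓝[upperHalf] z₀]
            fun z => S m a hbar lam lam₁ lam₂ g₁ g₂ z - e * (z - z₀) :=
          (hlit'.const_mul_left e).trans_isBigO hB1
        have h4 := hsmall.right_isBigO_add
        exact hB1.trans (h4.congr_right fun z => by ring)
      · rw [← SPlus_zero H.m_pos H.a_gt, h] at h0
        exact hne _ h0 ht
    · exact hne _ (H.cut _ h) ht

/-- `P / S` is polynomially bounded in the upper half-plane. -/
theorem RegularSymbol.norm_quadratic_le
    (H : RegularSymbol m a hbar lam lam₁ lam₂ g₁ g₂ P₀ P₁ P₂) :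
    ∃ C : ℝ, 0 < C ∧ ∀ z ∈ upperHalf, ‖quadratic P₀ P₁ P₂ z‖ ≤
      C * (1 + ‖z‖) ^ 2 * ‖S m a hbar lam lam₁ lam₂ g₁ g₂ z‖ := by
  have h1 := (tendsto_norm_S_atTop (g₁ := g₁) (g₂ := g₂) H.m_pos H.a_gt H.coupling_pos
    H.coeff_ne_zero).eventually_ge_atTop 1
  rw [eventually_inf_principal] at h1
  obtain ⟨R, hR⟩ : ∃ R : ℝ, ∀ z : ℂ, R ≤ ‖z‖ → z ∈ upperHalf →
      1 ≤ ‖S m a hbar lam lam₁ lam₂ g₁ g₂ z‖ := by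
    rw [← comap_norm_atTop, eventually_comap] at h1
    obtain ⟨R, hR⟩ := eventually_atTop.1 h1
    exact ⟨R, fun z hz hU => hR ‖z‖ hz z rfl hU⟩
  have hK : IsCompact (Metric.closedBall (0 : ℂ) R ∩ {z | 0 ≤ z.im}) :=
    (isCompact_closedBall _ _).inter_right (isClosed_le continuous_const Complex.continuous_im)
  obtain ⟨C, hC⟩ : ∃ C : ℝ, ∀ z ∈ (Metric.closedBall (0 : ℂ) R ∩ {z | 0 ≤ z.im}) ∩ upperHalf,
      ‖quadratic P₀ P₁ P₂ z‖ ≤ C * ‖S m a hbar lam lam₁ lam₂ g₁ g₂ z‖ := by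
    refine hK.induction_on (p := fun s => ∃ C : ℝ, ∀ z ∈ s ∩ upperHalf,
      ‖quadratic P₀ P₁ P₂ z‖ ≤ C * ‖S m a hbar lam lam₁ lam₂ g₁ g₂ z‖) ?_ ?_ ?_ ?_
    · exact ⟨0, fun z hz => absurd hz.1 (notMem_empty z)⟩
    · rintro s t hst ⟨C, hC⟩
      exact ⟨C, fun z hz => hC z ⟨hst hz.1, hz.2⟩⟩
    · rintro s t ⟨C, hC⟩ ⟨D, hD⟩
      refine ⟨max C D, ?_⟩
      rintro z ⟨hz | hz, hU⟩
      · exact (hC z ⟨hz, hU⟩).trans (mul_le_mul_of_nonneg_right (le_max_left _ _) (norm_nonneg _))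
      · exact (hD z ⟨hz, hU⟩).trans (mul_le_mul_of_nonneg_right (le_max_right _ _) (norm_nonneg _))
    · rintro z₀ ⟨-, hz₀⟩
      obtain ⟨C, hC⟩ := (quadratic_isBigO_S H hz₀).bound
      obtain ⟨t, ht, htC⟩ := mem_nhdsWithin_iff_exists_mem_nhds_inter.1 hC
      exact ⟨t, mem_nhdsWithin_of_mem_nhds ht, C, fun z hz => htC hz⟩
  set A : ℝ := |P₀| + |P₁| + |P₂| with hA
  have hA0 : 0 ≤ A := by positivity
  refine ⟨max C A + 1, by have := hA0.trans (le_max_right C A); linarith, fun z hz => ?_⟩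
  have hone : 1 ≤ (1 + ‖z‖) ^ 2 := one_le_pow₀ (by have := norm_nonneg z; linarith)
  have hSn := norm_nonneg (S m a hbar lam lam₁ lam₂ g₁ g₂ z)
  have hmax0 : 0 ≤ max C A := hA0.trans (le_max_right C A)
  rcases le_total ‖z‖ R with h | h
  · refine (hC z ⟨⟨by simpa using h, (show 0 < z.im from hz).le⟩, hz⟩).trans ?_
    refine mul_le_mul_of_nonneg_right ?_ hSn
    calc C ≤ max C A + 1 := by linarith [le_max_left C A]
      _ ≤ (max C A + 1) * (1 + ‖z‖) ^ 2 := le_mul_of_one_le_right (by linarith) hone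
  · have h3 := hR z h hz
    have h4 : ‖quadratic P₀ P₁ P₂ z‖ ≤ A * (1 + ‖z‖) ^ 2 := by
      have hz0 := norm_nonneg z
      calc ‖quadratic P₀ P₁ P₂ z‖ ≤ ‖(P₀ : ℂ)‖ + ‖(P₁ : ℂ) * z‖ + ‖(P₂ : ℂ) * z ^ 2‖ :=
            norm_add₃_le
        _ = |P₀| * 1 + |P₁| * ‖z‖ + |P₂| * ‖z‖ ^ 2 := by simp
        _ ≤ |P₀| * (1 + ‖z‖) ^ 2 + |P₁| * (1 + ‖z‖) ^ 2 + |P₂| * (1 + ‖z‖) ^ 2 := by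
            gcongr
            · nlinarith
            · linarith
        _ = A * (1 + ‖z‖) ^ 2 := by rw [hA]; ring
    calc ‖quadratic P₀ P₁ P₂ z‖ ≤ A * (1 + ‖z‖) ^ 2 := h4
      _ ≤ (max C A + 1) * (1 + ‖z‖) ^ 2 := by gcongr; linarith [le_max_right C A]
      _ ≤ (max C A + 1) * (1 + ‖z‖) ^ 2 * ‖S m a hbar lam lam₁ lam₂ g₁ g₂ z‖ :=
          le_mul_of_one_le_right (by positivity) h3

end Symbol

/-! ### Oscillatory integrals with the phase `√(κ² + M²)` -/

/-- The dispersion relation `ω(κ) = √(κ² + M²)`. -/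
def disp (M κ : ℝ) : ℝ := Real.sqrt (κ ^ 2 + M ^ 2)

lemma disp_sq (M κ : ℝ) : disp M κ ^ 2 = κ ^ 2 + M ^ 2 := Real.sq_sqrt (by positivity)

lemma disp_pos {M : ℝ} (hM : 0 < M) (κ : ℝ) : 0 < disp M κ := Real.sqrt_pos.2 (by positivity)

lemma le_disp {M : ℝ} (κ : ℝ) : M ≤ disp M κ :=
  Real.le_sqrt_of_sq_le (by nlinarith [sq_nonneg κ])

lemma self_le_disp (M κ : ℝ) : κ ≤ disp M κ :=
  Real.le_sqrt_of_sq_le (by nlinarith [sq_nonneg M])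

lemma disp_le {M κ : ℝ} (hM : 0 < M) (hκ : 0 ≤ κ) : disp M κ ≤ M + κ := by
  unfold disp
  rw [Real.sqrt_le_left (by linarith)]
  nlinarith

lemma disp_zero {M : ℝ} (hM : 0 < M) : disp M 0 = M := by
  unfold disp; rw [zero_pow two_ne_zero, zero_add, Real.sqrt_sq hM.le]

lemma hasDerivAt_disp {M : ℝ} (hM : 0 < M) (κ : ℝ) :
    HasDerivAt (disp M) (κ / disp M κ) κ := by
  have h : HasDerivAt (fun κ : ℝ => κ ^ 2 + M ^ 2) (2 * κ) κ := by
    simpa using (hasDerivAt_pow 2 κ).add_const (M ^ 2)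
  refine (h.sqrt (by positivity)).congr_deriv ?_
  rw [disp, mul_div_mul_left _ _ two_ne_zero]

lemma continuous_disp (M : ℝ) : Continuous (disp M) := by unfold disp; fun_prop

/-- The oscillating factor `e^{i t ω(κ)}`. -/
def wave (M t κ : ℝ) : ℂ := Complex.exp (Complex.I * ((t * disp M κ : ℝ) : ℂ))

@[simp] lemma norm_wave (M t κ : ℝ) : ‖wave M t κ‖ = 1 := by
  unfold wave; rw [mul_comm]; exact Complex.norm_exp_ofReal_mul_I _

lemma continuous_wave (M t : ℝ) : Continuous (wave M t) := by
  have := continuous_disp M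
  unfold wave; fun_prop

lemma hasDerivAt_wave {M : ℝ} (hM : 0 < M) (t κ : ℝ) :
    HasDerivAt (wave M t) (wave M t κ * (Complex.I * ((t * (κ / disp M κ) : ℝ) : ℂ))) κ := by
  unfold wave
  exact ((((hasDerivAt_disp hM κ).const_mul t).ofReal_comp).const_mul Complex.I).cexp

/-- The primitive of `e^{i t ω} κ / ω` used for integrating by parts. -/
lemma hasDerivAt_wave_div {M : ℝ} (hM : 0 < M) {t : ℝ} (ht : t ≠ 0) (κ : ℝ) :
    HasDerivAt (fun κ => wave M t κ / (Complex.I * t))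
      (((κ / disp M κ : ℝ) : ℂ) * wave M t κ) κ := by
  have htC : (t : ℂ) ≠ 0 := by exact_mod_cast ht
  refine ((hasDerivAt_wave hM t κ).div_const (Complex.I * t)).congr_deriv ?_
  rw [Complex.ofReal_mul]
  field_simp

lemma norm_wave_div (M : ℝ) (t κ : ℝ) : ‖wave M t κ / (Complex.I * t)‖ = |t|⁻¹ := by
  simp

lemma integrableOn_one_add_sq {C : ℝ} :
    IntegrableOn (fun κ : ℝ => C / (1 + κ) ^ 2) (Ioi 0) := by
  have h := (integrableOn_add_rpow_Ioi_of_lt (a := (-2 : ℝ)) (c := 0) (m := 1)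
    (by norm_num) (by norm_num)).const_mul C
  refine IntegrableOn.congr_fun h (fun κ hκ => ?_) measurableSet_Ioi
  have hκ : (0 : ℝ) < κ := hκ
  rw [Real.rpow_neg (by positivity), div_eq_mul_inv, add_comm κ 1]
  norm_cast

/-- The basic estimate: an amplitude that vanishes at least like `κ ^ α` at the stationary point
`κ = 0` of the phase gives a decay `|t| ^ (-(1 + α) / 2)`. The interval `κ ≤ |t| ^ (-1/2)` is
estimated trivially; on the rest one integrates by parts once. -/
theorem norm_integral_wave_le {M : ℝ} (hM : 0 < M) {α : ℝ} (hα0 : 0 ≤ α) (hα1 : α < 1)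
    {C : ℝ} {b b' : ℝ → ℂ} (hb : ∀ κ, 0 ≤ κ → HasDerivAt b (b' κ) κ)
    (hb'c : ContinuousOn b' (Ici 0))
    (hbα : ∀ κ, 0 ≤ κ → ‖b κ‖ ≤ C * κ ^ α) (hb2 : ∀ κ, 0 ≤ κ → ‖b κ‖ ≤ C / (1 + κ) ^ 2)
    (hb'2 : ∀ κ, 0 ≤ κ → ‖b' κ‖ ≤ C / (1 + κ) ^ 2) {t : ℝ} (ht : 1 ≤ |t|) :
    ‖∫ κ in Ioi (0 : ℝ), b κ * wave M t κ‖ ≤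
      (1 + (M + 1) + (2 * M + 1) / (1 - α)) * C * |t| ^ (-(1 + α) / 2) := by
  have hC : 0 ≤ C := by simpa using (norm_nonneg _).trans (hb2 0 le_rfl)
  have ht0 : 0 < |t| := by linarith
  have htne : t ≠ 0 := abs_pos.1 ht0
  set ε : ℝ := |t| ^ (-(1 / 2) : ℝ) with hε
  have hε0 : 0 < ε := Real.rpow_pos_of_pos ht0 _
  have hε1 : ε ≤ 1 := Real.rpow_le_one_of_one_le_of_nonpos ht (by norm_num)
  have hε2 : |t|⁻¹ = ε ^ (2 : ℝ) := by
    rw [hε, ← Real.rpow_mul ht0.le, ← Real.rpow_neg_one]; norm_num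
  have hεα : |t| ^ (-(1 + α) / 2) = ε ^ (1 + α) := by
    rw [hε, ← Real.rpow_mul ht0.le]; congr 1; ring
  have hbc : ContinuousOn b (Ici 0) := fun κ hκ => (hb κ hκ).continuousAt.continuousWithinAt
  have hint : IntegrableOn (fun κ => b κ * wave M t κ) (Ioi 0) := by
    refine Integrable.mono' (integrableOn_one_add_sq (C := C))
      ((hbc.mono Ioi_subset_Ici_self).mul
        (continuous_wave M t).continuousOn |>.aestronglyMeasurable measurableSet_Ioi) ?_
    filter_upwards [ae_restrict_mem measurableSet_Ioi] with κ hκ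
    rw [norm_mul, norm_wave, mul_one]; exact hb2 κ (le_of_lt hκ)
  have hsplit : Ioi (0 : ℝ) = Ioc 0 ε ∪ Ioi ε := (Ioc_union_Ioi_eq_Ioi hε0.le).symm
  rw [hsplit, setIntegral_union (Ioc_disjoint_Ioi le_rfl) measurableSet_Ioi
    (hint.mono_set (by rw [hsplit]; exact subset_union_left))
    (hint.mono_set (by rw [hsplit]; exact subset_union_right))]
  -- the inner interval
  have h1 : ‖∫ κ in Ioc 0 ε, b κ * wave M t κ‖ ≤ C * ε ^ (1 + α) := by
    have := norm_setIntegral_le_of_norm_le_const (μ := volume) (s := Ioc 0 ε)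
      (f := fun κ => b κ * wave M t κ) (C := C * ε ^ α) (by simp) (fun κ hκ => by
        rw [norm_mul, norm_wave, mul_one]
        refine (hbα κ hκ.1.le).trans ?_
        exact mul_le_mul_of_nonneg_left (Real.rpow_le_rpow hκ.1.le hκ.2 hα0) hC)
    refine this.trans_eq ?_
    rw [Real.volume_real_Ioc_of_le hε0.le, sub_zero, mul_assoc, add_comm, Real.rpow_add hε0,
      Real.rpow_one]
  -- the outer interval
  set u : ℝ → ℂ := fun κ => b κ * ((disp M κ / κ : ℝ) : ℂ) with hu
  set u' : ℝ → ℂ := fun κ => b' κ * ((disp M κ / κ : ℝ) : ℂ) +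
    b κ * ((-(M ^ 2 / (κ ^ 2 * disp M κ)) : ℝ) : ℂ) with hu'
  have hud : ∀ κ ∈ Ioi ε, HasDerivAt u (u' κ) κ := by
    intro κ hκ
    have hκ0 : 0 < κ := hε0.trans hκ
    have hd : HasDerivAt (fun κ => disp M κ / κ) (-(M ^ 2 / (κ ^ 2 * disp M κ))) κ := by
      have h := (hasDerivAt_disp hM κ).fun_div (hasDerivAt_id κ) hκ0.ne'
      refine h.congr_deriv ?_
      have hp := disp_pos hM κ
      simp only [id]
      field_simp
      rw [disp_sq]; ring
    exact (hb κ hκ0.le).mul hd.ofReal_comp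
  have hωκ : ∀ κ, 0 < κ → disp M κ / κ ≤ (M + 1) * (1 + κ) / κ := by
    intro κ hκ
    gcongr
    have := disp_le hM hκ.le
    nlinarith
  have hκα : ∀ κ : ℝ, 0 < κ → κ ^ (1 - α) ≤ 1 + κ := by
    intro κ hκ
    rcases le_total κ 1 with h | h
    · exact (Real.rpow_le_one hκ.le h (by linarith)).trans (by linarith)
    · calc κ ^ (1 - α) ≤ κ ^ (1 : ℝ) := Real.rpow_le_rpow_of_exponent_le h (by linarith)
        _ ≤ 1 + κ := by rw [Real.rpow_one]; linarith
  have hu'b : ∀ κ ∈ Ioi ε, ‖u' κ‖ ≤ C * (2 * M + 1) * κ ^ (α - 2) := by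
    intro κ hκ
    have hκ0 : 0 < κ := hε0.trans hκ
    have hp := disp_pos hM κ
    have e1 : κ ^ (α - 2) = κ ^ α / κ ^ 2 := by
      rw [Real.rpow_sub hκ0]; norm_cast
    have hA : ‖b' κ * ((disp M κ / κ : ℝ) : ℂ)‖ ≤ C * (M + 1) * κ ^ (α - 2) := by
      rw [norm_mul, Complex.norm_real, Real.norm_of_nonneg (by positivity)]
      have hk := hκα κ hκ0
      calc ‖b' κ‖ * (disp M κ / κ) ≤ C / (1 + κ) ^ 2 * ((M + 1) * (1 + κ) / κ) :=
            mul_le_mul (hb'2 κ hκ0.le) (hωκ κ hκ0) (by positivity) (by positivity)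
        _ = C * (M + 1) * (1 / ((1 + κ) * κ)) := by field_simp
        _ ≤ C * (M + 1) * κ ^ (α - 2) := by
            refine mul_le_mul_of_nonneg_left ?_ (by positivity)
            have e2 : κ ^ (α - 2) = 1 / (κ ^ (1 - α) * κ) := by
              rw [eq_div_iff (by positivity), ← mul_assoc, ← Real.rpow_add hκ0]
              conv_lhs => rw [← Real.rpow_one κ, ← Real.rpow_mul hκ0.le, ← Real.rpow_add hκ0]
              norm_num
            rw [e2]
            exact one_div_le_one_div_of_le (by positivity)
              (mul_le_mul_of_nonneg_right hk hκ0.le)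
    have hB : ‖b κ * ((-(M ^ 2 / (κ ^ 2 * disp M κ)) : ℝ) : ℂ)‖ ≤ C * M * κ ^ (α - 2) := by
      rw [norm_mul, Complex.norm_real, norm_neg, Real.norm_of_nonneg (by positivity)]
      have : M ^ 2 / (κ ^ 2 * disp M κ) ≤ M / κ ^ 2 := by
        rw [div_le_div_iff₀ (by positivity) (by positivity)]
        have := le_disp (M := M) κ
        have h2 : 0 ≤ M * κ ^ 2 := by positivity
        nlinarith
      calc _ ≤ C * κ ^ α * (M / κ ^ 2) :=
            mul_le_mul (hbα κ hκ0.le) this (by positivity) (by positivity)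
        _ = C * M * κ ^ (α - 2) := by rw [e1]; ring
    calc ‖u' κ‖ ≤ _ := norm_add_le _ _
      _ ≤ C * (M + 1) * κ ^ (α - 2) + C * M * κ ^ (α - 2) := add_le_add hA hB
      _ = C * (2 * M + 1) * κ ^ (α - 2) := by ring
  have hpow : IntegrableOn (fun κ : ℝ => C * (2 * M + 1) * κ ^ (α - 2)) (Ioi ε) :=
    (integrableOn_Ioi_rpow_of_lt (by linarith) hε0).const_mul _
  have hu'c : ContinuousOn u' (Ioi ε) := by
    have hsub : Ioi ε ⊆ Ici 0 := fun κ hκ => (hε0.trans hκ).le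
    have hne : ∀ κ ∈ Ioi ε, κ ≠ 0 := fun κ hκ => (hε0.trans hκ).ne'
    refine ((hb'c.mono hsub).mul (Complex.continuous_ofReal.comp_continuousOn ?_)).add
      ((hbc.mono hsub).mul (Complex.continuous_ofReal.comp_continuousOn ?_))
    · exact (continuous_disp M).continuousOn.div continuousOn_id hne
    · exact (continuousOn_const.div ((continuousOn_id.pow 2).mul (continuous_disp M).continuousOn)
        fun κ hκ => mul_ne_zero (pow_ne_zero 2 (hne κ hκ)) (disp_pos hM κ).ne').neg
  have hu'v : IntegrableOn (u' * fun κ => wave M t κ / (Complex.I * t)) (Ioi ε) := by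
    refine Integrable.mono' (hpow.mul_const |t|⁻¹)
      ((hu'c.mul (by have := continuous_wave M t; fun_prop)).aestronglyMeasurable
        measurableSet_Ioi) ?_
    filter_upwards [ae_restrict_mem measurableSet_Ioi] with κ hκ
    rw [Pi.mul_apply, norm_mul, norm_wave_div]
    exact mul_le_mul_of_nonneg_right (hu'b κ hκ) (by positivity)
  have huv' : ∀ κ ∈ Ioi ε, u κ * (((κ / disp M κ : ℝ) : ℂ) * wave M t κ) = b κ * wave M t κ := by
    intro κ hκ
    have hκ0 : κ ≠ 0 := (hε0.trans hκ).ne'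
    have hp := (disp_pos hM κ).ne'
    rw [hu]
    have : ((disp M κ / κ : ℝ) : ℂ) * ((κ / disp M κ : ℝ) : ℂ) = 1 := by
      rw [← Complex.ofReal_mul]; field_simp; simp
    linear_combination b κ * wave M t κ * this
  have hub : ∀ κ, 0 < κ → ‖u κ‖ ≤ C * (M + 1) * (1 / ((1 + κ) * κ)) := by
    intro κ hκ0
    have hp := disp_pos hM κ
    rw [hu]
    simp only
    rw [norm_mul, Complex.norm_real, Real.norm_of_nonneg (by positivity)]
    calc ‖b κ‖ * (disp M κ / κ) ≤ C / (1 + κ) ^ 2 * ((M + 1) * (1 + κ) / κ) :=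
          mul_le_mul (hb2 κ hκ0.le) (hωκ κ hκ0) (by positivity) (by positivity)
      _ = C * (M + 1) * (1 / ((1 + κ) * κ)) := by field_simp
  have hparts := integral_Ioi_mul_deriv_eq_deriv_mul (a := ε)
    (u := u) (v := fun κ => wave M t κ / (Complex.I * t)) (u' := u')
    (v' := fun κ => ((κ / disp M κ : ℝ) : ℂ) * wave M t κ)
    (a' := u ε * (wave M t ε / (Complex.I * t))) (b' := 0)
    hud (fun κ _ => hasDerivAt_wave_div hM htne κ)
    ((hint.mono_set (Ioi_subset_Ioi hε0.le)).congr_fun (fun κ hκ => (huv' κ hκ).symm)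
      measurableSet_Ioi) hu'v ?_ ?_
  · rw [setIntegral_congr_fun measurableSet_Ioi huv'] at hparts
    have h2 : ‖∫ κ in Ioi ε, b κ * wave M t κ‖ ≤
        ((M + 1) + (2 * M + 1) / (1 - α)) * C * ε ^ (1 + α) := by
      rw [hparts]
      have hbd : ‖u ε * (wave M t ε / (Complex.I * t))‖ ≤ (M + 1) * C * ε ^ (1 + α) := by
        rw [norm_mul, norm_wave_div, hε2, hu]
        simp only
        have hp := disp_pos hM ε
        rw [norm_mul, Complex.norm_real, Real.norm_of_nonneg (by positivity)]
        have : disp M ε / ε ≤ (M + 1) / ε := by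
          gcongr; exact (disp_le hM hε0.le).trans (by linarith)
        calc ‖b ε‖ * (disp M ε / ε) * ε ^ (2 : ℝ) ≤ C * ε ^ α * ((M + 1) / ε) * ε ^ (2 : ℝ) := by
              gcongr; exact hbα ε hε0.le
          _ = (M + 1) * C * ε ^ (1 + α) := by
              rw [add_comm 1 α, Real.rpow_add hε0, Real.rpow_one]; norm_cast; field_simp
      have hI : ‖∫ κ in Ioi ε, u' κ * (wave M t κ / (Complex.I * t))‖ ≤
          (2 * M + 1) / (1 - α) * C * ε ^ (1 + α) := by
        refine (norm_integral_le_of_norm_le (hpow.mul_const |t|⁻¹) ?_).trans_eq ?_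
        · filter_upwards [ae_restrict_mem measurableSet_Ioi] with κ hκ
          rw [norm_mul, norm_wave_div]
          exact mul_le_mul_of_nonneg_right (hu'b κ hκ) (by positivity)
        · rw [integral_mul_const, integral_const_mul, integral_Ioi_rpow_of_lt (by linarith) hε0,
            hε2, show α - 2 + 1 = α - 1 by ring]
          have e3 : ε ^ (1 + α) = ε ^ (α - 1) * ε ^ (2 : ℝ) := by
            rw [← Real.rpow_add hε0]; congr 1; ring
          rw [e3]
          have : 1 - α ≠ 0 := by linarith
          have h' : α - 1 ≠ 0 := by linarith
          rw [show α - 1 = -(1 - α) by ring, neg_div_neg_eq]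
          ring
      calc _ ≤ ‖(0 : ℂ) - u ε * (wave M t ε / (Complex.I * t))‖ +
            ‖∫ κ in Ioi ε, u' κ * (wave M t κ / (Complex.I * t))‖ := norm_sub_le _ _
        _ ≤ (M + 1) * C * ε ^ (1 + α) + (2 * M + 1) / (1 - α) * C * ε ^ (1 + α) := by
            rw [zero_sub, norm_neg]; exact add_le_add hbd hI
        _ = _ := by ring
    calc _ ≤ _ := norm_add_le _ _
      _ ≤ C * ε ^ (1 + α) + ((M + 1) + (2 * M + 1) / (1 - α)) * C * ε ^ (1 + α) :=
          add_le_add h1 h2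
      _ = _ := by rw [hεα]; ring
  · have hc : ContinuousAt (u * fun κ => wave M t κ / (Complex.I * t)) ε := by
      refine ContinuousAt.mul ?_ (hasDerivAt_wave_div hM htne ε).continuousAt
      exact (hb ε hε0.le).continuousAt.mul (Complex.continuous_ofReal.continuousAt.comp
        ((continuous_disp M).continuousAt.div continuousAt_id hε0.ne'))
    exact hc.tendsto.mono_left nhdsWithin_le_nhds
  · rw [tendsto_zero_iff_norm_tendsto_zero]
    have hlim : Tendsto (fun κ : ℝ => C * (M + 1) * κ⁻¹ * |t|⁻¹) atTop (𝓝 0) := by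
      simpa using (tendsto_inv_atTop_zero.const_mul (C * (M + 1))).mul_const |t|⁻¹
    refine tendsto_of_tendsto_of_tendsto_of_le_of_le' tendsto_const_nhds hlim
      (Eventually.of_forall fun _ => norm_nonneg _) ?_
    filter_upwards [eventually_gt_atTop 0] with κ hκ
    rw [Pi.mul_apply, norm_mul, norm_wave_div]
    refine mul_le_mul_of_nonneg_right ((hub κ hκ).trans ?_) (by positivity)
    refine mul_le_mul_of_nonneg_left ?_ (by positivity)
    rw [← one_div]
    exact one_div_le_one_div_of_le hκ (by nlinarith)

/-- `f` is twice continuously differentiable on `[0, ∞)` with first and second derivative `f₁` and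
`f₂`, all of them bounded by `C (1 + κ) ^ e`. -/
structure C2Bound (e C : ℝ) (f f₁ f₂ : ℝ → ℂ) : Prop where
  deriv₁ : ∀ κ, 0 ≤ κ → HasDerivAt f (f₁ κ) κ
  deriv₂ : ∀ κ, 0 ≤ κ → HasDerivAt f₁ (f₂ κ) κ
  cont₂ : ContinuousOn f₂ (Ici 0)
  bound₀ : ∀ κ, 0 ≤ κ → ‖f κ‖ ≤ C * (1 + κ) ^ e
  bound₁ : ∀ κ, 0 ≤ κ → ‖f₁ κ‖ ≤ C * (1 + κ) ^ e
  bound₂ : ∀ κ, 0 ≤ κ → ‖f₂ κ‖ ≤ C * (1 + κ) ^ e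

lemma C2Bound.nonneg {e C : ℝ} {f f₁ f₂ : ℝ → ℂ} (h : C2Bound e C f f₁ f₂) : 0 ≤ C := by
  simpa using (norm_nonneg _).trans (h.bound₀ 0 le_rfl)

lemma C2Bound.cont₀ {e C : ℝ} {f f₁ f₂ : ℝ → ℂ} (h : C2Bound e C f f₁ f₂) :
    ContinuousOn f (Ici 0) := fun κ hκ => (h.deriv₁ κ hκ).continuousAt.continuousWithinAt

lemma C2Bound.cont₁ {e C : ℝ} {f f₁ f₂ : ℝ → ℂ} (h : C2Bound e C f f₁ f₂) :
    ContinuousOn f₁ (Ici 0) := fun κ hκ => (h.deriv₂ κ hκ).continuousAt.continuousWithinAt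

/-- The amplitude `(g ω)'` produced by one integration by parts. -/
def partsAmp (M : ℝ) (g g₁ : ℝ → ℂ) (κ : ℝ) : ℂ :=
  g₁ κ * (disp M κ : ℂ) + g κ * ((κ / disp M κ : ℝ) : ℂ)

/-- The derivative of `partsAmp`. -/
def partsAmp' (M : ℝ) (g g₁ g₂ : ℝ → ℂ) (κ : ℝ) : ℂ :=
  g₂ κ * (disp M κ : ℂ) + 2 * g₁ κ * ((κ / disp M κ : ℝ) : ℂ) +
    g κ * ((M ^ 2 / disp M κ ^ 3 : ℝ) : ℂ)

lemma div_disp_le_one {M : ℝ} (hM : 0 < M) (κ : ℝ) : κ / disp M κ ≤ 1 :=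
  (div_le_one (disp_pos hM κ)).2 (self_le_disp M κ)

lemma rpow_neg_three {κ : ℝ} (hκ : 0 ≤ κ) : (1 + κ) ^ (-3 : ℝ) = 1 / (1 + κ) ^ 3 := by
  rw [Real.rpow_neg (by positivity), one_div]; norm_cast

section Parts

variable {M C : ℝ} {g g₁ g₂ : ℝ → ℂ}

lemma hasDerivAt_partsAmp (hM : 0 < M) (h : C2Bound (-3) C g g₁ g₂) {κ : ℝ} (hκ : 0 ≤ κ) :
    HasDerivAt (partsAmp M g g₁) (partsAmp' M g g₁ g₂ κ) κ := by
  have hp := disp_pos hM κ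
  have hd : HasDerivAt (fun κ => κ / disp M κ) (M ^ 2 / disp M κ ^ 3) κ := by
    refine ((hasDerivAt_id κ).fun_div (hasDerivAt_disp hM κ) hp.ne').congr_deriv ?_
    simp only [id]
    field_simp
    linear_combination disp_sq M κ
  refine (((h.deriv₂ κ hκ).fun_mul (hasDerivAt_disp hM κ).ofReal_comp).fun_add
    ((h.deriv₁ κ hκ).fun_mul hd.ofReal_comp)).congr_deriv ?_
  unfold partsAmp'
  ring

lemma norm_partsAmp_le (hM : 0 < M) (h : C2Bound (-3) C g g₁ g₂) {κ : ℝ} (hκ : 0 ≤ κ) :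
    ‖partsAmp M g g₁ κ‖ ≤ (M + 3 + 1 / M) * C / (1 + κ) ^ 2 := by
  have hp := disp_pos hM κ
  have hC := h.nonneg
  have hx : 0 < 1 + κ := by linarith
  have h0 := h.bound₀ κ hκ
  have h1 := h.bound₁ κ hκ
  rw [rpow_neg_three hκ] at h0 h1
  have hd := disp_le hM hκ
  have hκd : 0 ≤ κ / disp M κ := by positivity
  calc ‖partsAmp M g g₁ κ‖ ≤ ‖g₁ κ‖ * disp M κ + ‖g κ‖ * (κ / disp M κ) := by
        unfold partsAmp
        refine (norm_add_le _ _).trans_eq ?_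
        rw [norm_mul, norm_mul, Complex.norm_real, Complex.norm_real, Real.norm_of_nonneg hp.le,
          Real.norm_of_nonneg hκd]
    _ ≤ C * (1 / (1 + κ) ^ 3) * (M + κ) + C * (1 / (1 + κ) ^ 3) * 1 := by
        gcongr; exact div_disp_le_one hM κ
    _ = C / (1 + κ) ^ 3 * (M + κ + 1) := by ring
    _ ≤ C / (1 + κ) ^ 3 * ((M + 3 + 1 / M) * (1 + κ)) := by
        refine mul_le_mul_of_nonneg_left ?_ (by positivity)
        have : 0 < 1 / M := by positivity
        nlinarith
    _ = (M + 3 + 1 / M) * C / (1 + κ) ^ 2 := by field_simp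

lemma norm_partsAmp'_le (hM : 0 < M) (h : C2Bound (-3) C g g₁ g₂) {κ : ℝ} (hκ : 0 ≤ κ) :
    ‖partsAmp' M g g₁ g₂ κ‖ ≤ (M + 3 + 1 / M) * C / (1 + κ) ^ 2 := by
  have hp := disp_pos hM κ
  have hC := h.nonneg
  have hx : 0 < 1 + κ := by linarith
  have h0 := h.bound₀ κ hκ
  have h1 := h.bound₁ κ hκ
  have h2 := h.bound₂ κ hκ
  rw [rpow_neg_three hκ] at h0 h1 h2
  have hd := disp_le hM hκ
  have hκd : 0 ≤ κ / disp M κ := by positivity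
  have h3 : M ^ 2 / disp M κ ^ 3 ≤ 1 / M := by
    rw [div_le_div_iff₀ (by positivity) hM]
    have := pow_le_pow_left₀ hM.le (le_disp (M := M) κ) 3
    nlinarith
  calc ‖partsAmp' M g g₁ g₂ κ‖ ≤ ‖g₂ κ‖ * disp M κ + 2 * ‖g₁ κ‖ * (κ / disp M κ) +
        ‖g κ‖ * (M ^ 2 / disp M κ ^ 3) := by
        unfold partsAmp'
        refine (norm_add₃_le).trans_eq ?_
        simp only [norm_mul, Complex.norm_real]
        rw [Real.norm_of_nonneg hp.le, Real.norm_of_nonneg hκd,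
          Real.norm_of_nonneg (by positivity : 0 ≤ M ^ 2 / disp M κ ^ 3)]
        norm_num
    _ ≤ C * (1 / (1 + κ) ^ 3) * (M + κ) + 2 * (C * (1 / (1 + κ) ^ 3)) * 1 +
        C * (1 / (1 + κ) ^ 3) * (1 / M) := by
        gcongr; exact div_disp_le_one hM κ
    _ = C / (1 + κ) ^ 3 * (M + κ + 2 + 1 / M) := by ring
    _ ≤ C / (1 + κ) ^ 3 * ((M + 3 + 1 / M) * (1 + κ)) := by
        refine mul_le_mul_of_nonneg_left ?_ (by positivity)
        have : 0 < 1 / M := by positivity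
        nlinarith
    _ = (M + 3 + 1 / M) * C / (1 + κ) ^ 2 := by field_simp

lemma continuousOn_partsAmp (hM : 0 < M) (h : C2Bound (-3) C g g₁ g₂) :
    ContinuousOn (partsAmp M g g₁) (Ici 0) := fun _ hκ =>
  (hasDerivAt_partsAmp hM h hκ).continuousAt.continuousWithinAt

lemma continuousOn_partsAmp' (hM : 0 < M) (h : C2Bound (-3) C g g₁ g₂) :
    ContinuousOn (partsAmp' M g g₁ g₂) (Ici 0) := by
  have hne : ∀ κ, disp M κ ≠ 0 := fun κ => (disp_pos hM κ).ne'
  have hd := continuous_disp M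
  have h1 : Continuous fun κ => ((κ / disp M κ : ℝ) : ℂ) :=
    Complex.continuous_ofReal.comp (continuous_id.div hd hne)
  have h2 : Continuous fun κ => ((M ^ 2 / disp M κ ^ 3 : ℝ) : ℂ) :=
    Complex.continuous_ofReal.comp (continuous_const.div (hd.pow 3) fun κ => pow_ne_zero 3 (hne κ))
  have h3 : Continuous fun κ => (disp M κ : ℂ) := Complex.continuous_ofReal.comp hd
  exact ((h.cont₂.mul h3.continuousOn).add
    ((continuousOn_const.mul h.cont₁).mul h1.continuousOn)).add (h.cont₀.mul h2.continuousOn)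

/-- One integration by parts: the factor `κ` in the amplitude gains a factor `1 / t`. -/
theorem integral_mul_wave_eq (hM : 0 < M) (h : C2Bound (-3) C g g₁ g₂) (hg0 : g 0 = 0) {t : ℝ}
    (ht : t ≠ 0) :
    ∫ κ in Ioi (0 : ℝ), (κ : ℂ) * g κ * wave M t κ =
      Complex.I / t * ∫ κ in Ioi (0 : ℝ), partsAmp M g g₁ κ * wave M t κ := by
  have htC : (t : ℂ) ≠ 0 := by exact_mod_cast ht
  have hC := h.nonneg
  have hωc : Continuous fun κ => (disp M κ : ℂ) :=
    Complex.continuous_ofReal.comp (continuous_disp M)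
  have hud : ∀ κ ∈ Ioi (0 : ℝ), HasDerivAt (fun κ => g κ * (disp M κ : ℂ)) (partsAmp M g g₁ κ) κ :=
    fun κ hκ => (h.deriv₁ κ (le_of_lt hκ)).fun_mul (hasDerivAt_disp hM κ).ofReal_comp
  have huv' : ∀ κ : ℝ, g κ * (disp M κ : ℂ) * (((κ / disp M κ : ℝ) : ℂ) * wave M t κ) =
      (κ : ℂ) * g κ * wave M t κ := by
    intro κ
    have hp : (disp M κ : ℂ) ≠ 0 := by exact_mod_cast (disp_pos hM κ).ne'
    rw [Complex.ofReal_div]; field_simp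
  have hI1 : IntegrableOn (fun κ : ℝ => (κ : ℂ) * g κ * wave M t κ) (Ioi 0) := by
    refine Integrable.mono' (integrableOn_one_add_sq (C := C)) ?_ ?_
    · exact (((Complex.continuous_ofReal.continuousOn.mul h.cont₀).mul
        (continuous_wave M t).continuousOn).mono Ioi_subset_Ici_self).aestronglyMeasurable
        measurableSet_Ioi
    · filter_upwards [ae_restrict_mem measurableSet_Ioi] with κ hκ
      have hκ : 0 < κ := hκ
      rw [norm_mul, norm_mul, norm_wave, mul_one, Complex.norm_real, Real.norm_of_nonneg hκ.le]
      have h0 := h.bound₀ κ hκ.le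
      rw [rpow_neg_three hκ.le] at h0
      calc κ * ‖g κ‖ ≤ (1 + κ) * (C * (1 / (1 + κ) ^ 3)) :=
            mul_le_mul (by linarith) h0 (norm_nonneg _) (by positivity)
        _ = C / (1 + κ) ^ 2 := by field_simp
  have hI2 : IntegrableOn (partsAmp M g g₁ * fun κ => wave M t κ / (Complex.I * t)) (Ioi 0) := by
    refine Integrable.mono' ((integrableOn_one_add_sq (C := (M + 3 + 1 / M) * C)).mul_const |t|⁻¹)
      ?_ ?_
    · exact (((continuousOn_partsAmp hM h).mul
        ((continuous_wave M t).div_const _).continuousOn).mono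
          Ioi_subset_Ici_self).aestronglyMeasurable measurableSet_Ioi
    · filter_upwards [ae_restrict_mem measurableSet_Ioi] with κ hκ
      rw [Pi.mul_apply, norm_mul, norm_wave_div]
      exact mul_le_mul_of_nonneg_right (norm_partsAmp_le hM h (le_of_lt hκ)) (by positivity)
  have hparts := integral_Ioi_mul_deriv_eq_deriv_mul (a := (0 : ℝ))
    (u := fun κ => g κ * (disp M κ : ℂ)) (v := fun κ => wave M t κ / (Complex.I * t))
    (u' := partsAmp M g g₁) (v' := fun κ => ((κ / disp M κ : ℝ) : ℂ) * wave M t κ)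
    (a' := 0) (b' := 0) hud (fun κ _ => hasDerivAt_wave_div hM ht κ)
    (hI1.congr_fun (fun κ _ => (huv' κ).symm) measurableSet_Ioi) hI2 ?_ ?_
  · simp only [huv', sub_zero, zero_sub] at hparts
    rw [hparts, ← integral_const_mul, ← integral_neg]
    congr 1
    ext κ
    have : Complex.I * Complex.I = -1 := Complex.I_mul_I
    field_simp
    rw [Complex.I_sq]; ring
  · have hc : ContinuousAt ((fun κ => g κ * (disp M κ : ℂ)) * fun κ => wave M t κ / (Complex.I * t))
        0 := ((h.deriv₁ 0 le_rfl).continuousAt.mul hωc.continuousAt).mul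
          (hasDerivAt_wave_div hM ht 0).continuousAt
    have := hc.tendsto.mono_left (nhdsWithin_le_nhds (s := Ioi 0))
    simpa [hg0] using this
  · rw [tendsto_zero_iff_norm_tendsto_zero]
    have hlim : Tendsto (fun κ : ℝ => C * (M + 1) * κ⁻¹ * |t|⁻¹) atTop (𝓝 0) := by
      simpa using (tendsto_inv_atTop_zero.const_mul (C * (M + 1))).mul_const |t|⁻¹
    refine tendsto_of_tendsto_of_tendsto_of_le_of_le' tendsto_const_nhds hlim
      (Eventually.of_forall fun _ => norm_nonneg _) ?_
    filter_upwards [eventually_ge_atTop 1] with κ hκ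
    have hκ0 : 0 < κ := by linarith
    rw [Pi.mul_apply, norm_mul, norm_wave_div]
    refine mul_le_mul_of_nonneg_right ?_ (by positivity)
    have h0 := h.bound₀ κ hκ0.le
    rw [rpow_neg_three hκ0.le] at h0
    rw [norm_mul, Complex.norm_real, Real.norm_of_nonneg (disp_pos hM κ).le]
    have hd := disp_le hM hκ0.le
    calc ‖g κ‖ * disp M κ ≤ C * (1 / (1 + κ) ^ 3) * ((M + 1) * (1 + κ)) :=
          mul_le_mul h0 (by nlinarith) (disp_pos hM κ).le (by positivity)
      _ = C * (M + 1) * ((1 + κ) ^ 2)⁻¹ := by field_simp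
      _ ≤ C * (M + 1) * κ⁻¹ := by
          gcongr; nlinarith

/-- **Dispersive decay.** An amplitude `κ g(κ)` with `g(0) = 0` gives the decay `|t| ^ (-3/2)`, with
a constant that depends on `g` only through its `C²` bound. -/
theorem norm_integral_mul_wave_le (hM : 0 < M) : ∃ K : ℝ, 0 ≤ K ∧
    ∀ (C : ℝ) (g g₁ g₂ : ℝ → ℂ), C2Bound (-3) C g g₁ g₂ → g 0 = 0 → ∀ t : ℝ, 1 ≤ |t| →
      ‖∫ κ in Ioi (0 : ℝ), (κ : ℂ) * g κ * wave M t κ‖ ≤ K * C * |t| ^ (-(3 / 2) : ℝ) := by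
  refine ⟨(1 + (M + 1) + (2 * M + 1) / (1 - 0)) * (M + 3 + 1 / M), by positivity, ?_⟩
  intro C g g₁ g₂ h hg0 t ht
  have ht0 : 0 < |t| := by linarith
  have hC := h.nonneg
  rw [integral_mul_wave_eq hM h hg0 (abs_pos.1 ht0), norm_mul]
  have h1 := norm_integral_wave_le hM (α := 0) le_rfl zero_lt_one (C := (M + 3 + 1 / M) * C)
    (fun κ hκ => hasDerivAt_partsAmp hM h hκ) (continuousOn_partsAmp' hM h)
    (fun κ hκ => by
      rw [Real.rpow_zero, mul_one]
      refine (norm_partsAmp_le hM h hκ).trans (div_le_self (by positivity) ?_)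
      exact one_le_pow₀ (by linarith))
    (fun κ hκ => norm_partsAmp_le hM h hκ) (fun κ hκ => norm_partsAmp'_le hM h hκ) ht
  have h2 : ‖Complex.I / (t : ℂ)‖ = |t|⁻¹ := by simp
  rw [h2]
  calc |t|⁻¹ * _ ≤ |t|⁻¹ * _ := mul_le_mul_of_nonneg_left h1 (by positivity)
    _ = _ := by
      have : |t| ^ (-(3 / 2) : ℝ) = |t|⁻¹ * |t| ^ (-(1 + 0) / 2 : ℝ) := by
        rw [← Real.rpow_neg_one, ← Real.rpow_add ht0]; norm_num
      rw [this]; ring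

end Parts

/-! ### Amplitudes with polynomially bounded derivatives -/

lemma C2Bound.mul {e e' C D : ℝ} {f f₁ f₂ g g₁ g₂ : ℝ → ℂ} (F : C2Bound e C f f₁ f₂)
    (G : C2Bound e' D g g₁ g₂) : C2Bound (e + e') (4 * (C * D)) (fun κ => f κ * g κ)
      (fun κ => f₁ κ * g κ + f κ * g₁ κ)
      (fun κ => (f₂ κ * g κ + f₁ κ * g₁ κ) + (f₁ κ * g₁ κ + f κ * g₂ κ)) := by
  have hC := F.nonneg
  have hD := G.nonneg
  have key : ∀ (κ : ℝ) (x y : ℂ), 0 ≤ κ → ‖x‖ ≤ C * (1 + κ) ^ e → ‖y‖ ≤ D * (1 + κ) ^ e' →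
      ‖x * y‖ ≤ C * D * (1 + κ) ^ (e + e') := by
    intro κ x y hκ hx hy
    rw [norm_mul, Real.rpow_add (by linarith)]
    calc ‖x‖ * ‖y‖ ≤ (C * (1 + κ) ^ e) * (D * (1 + κ) ^ e') :=
          mul_le_mul hx hy (norm_nonneg _) (by positivity)
      _ = _ := by ring
  have hpos : ∀ κ : ℝ, 0 ≤ κ → 0 ≤ C * D * (1 + κ) ^ (e + e') := fun κ hκ => by positivity
  refine ⟨fun κ hκ => (F.deriv₁ κ hκ).fun_mul (G.deriv₁ κ hκ),
    fun κ hκ => ((F.deriv₂ κ hκ).fun_mul (G.deriv₁ κ hκ)).fun_add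
      ((F.deriv₁ κ hκ).fun_mul (G.deriv₂ κ hκ)),
    ((F.cont₂.mul G.cont₀).add (F.cont₁.mul G.cont₁)).add
      ((F.cont₁.mul G.cont₁).add (F.cont₀.mul G.cont₂)), ?_, ?_, ?_⟩ <;> intro κ hκ <;>
    have h00 := key κ _ _ hκ (F.bound₀ κ hκ) (G.bound₀ κ hκ) <;>
    have h01 := key κ _ _ hκ (F.bound₀ κ hκ) (G.bound₁ κ hκ) <;>
    have h10 := key κ _ _ hκ (F.bound₁ κ hκ) (G.bound₀ κ hκ) <;>
    have h11 := key κ _ _ hκ (F.bound₁ κ hκ) (G.bound₁ κ hκ) <;>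
    have h02 := key κ _ _ hκ (F.bound₀ κ hκ) (G.bound₂ κ hκ) <;>
    have h20 := key κ _ _ hκ (F.bound₂ κ hκ) (G.bound₀ κ hκ) <;>
    have h0 := hpos κ hκ <;> rw [mul_assoc 4]
  · linarith
  · linarith [norm_add_le (f₁ κ * g κ) (f κ * g₁ κ)]
  · linarith [norm_add_le (f₂ κ * g κ + f₁ κ * g₁ κ) (f₁ κ * g₁ κ + f κ * g₂ κ),
      norm_add_le (f₂ κ * g κ) (f₁ κ * g₁ κ), norm_add_le (f₁ κ * g₁ κ) (f κ * g₂ κ)]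

lemma C2Bound.mono {e e' C : ℝ} {f f₁ f₂ : ℝ → ℂ} (H : C2Bound e C f f₁ f₂) (he : e ≤ e') :
    C2Bound e' C f f₁ f₂ := by
  have key : ∀ κ : ℝ, 0 ≤ κ → C * (1 + κ) ^ e ≤ C * (1 + κ) ^ e' := fun κ hκ =>
    mul_le_mul_of_nonneg_left (Real.rpow_le_rpow_of_exponent_le (by linarith) he) H.nonneg
  exact ⟨H.deriv₁, H.deriv₂, H.cont₂, fun κ hκ => (H.bound₀ κ hκ).trans (key κ hκ),
    fun κ hκ => (H.bound₁ κ hκ).trans (key κ hκ), fun κ hκ => (H.bound₂ κ hκ).trans (key κ hκ)⟩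

lemma C2Bound.mono_const {e C C' : ℝ} {f f₁ f₂ : ℝ → ℂ} (H : C2Bound e C f f₁ f₂) (h : C ≤ C') :
    C2Bound e C' f f₁ f₂ := by
  have key : ∀ κ : ℝ, 0 ≤ κ → C * (1 + κ) ^ e ≤ C' * (1 + κ) ^ e := fun κ hκ =>
    mul_le_mul_of_nonneg_right h (by positivity)
  exact ⟨H.deriv₁, H.deriv₂, H.cont₂, fun κ hκ => (H.bound₀ κ hκ).trans (key κ hκ),
    fun κ hκ => (H.bound₁ κ hκ).trans (key κ hκ), fun κ hκ => (H.bound₂ κ hκ).trans (key κ hκ)⟩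

lemma C2Bound.ofReal_id : C2Bound 1 1 (fun κ => (κ : ℂ)) (fun _ => 1) fun _ => 0 := by
  refine ⟨fun κ _ => Complex.ofRealCLM.hasDerivAt,
    fun κ _ => hasDerivAt_const κ 1, continuousOn_const, ?_, ?_, ?_⟩ <;> intro κ hκ <;>
    simp [abs_of_nonneg hκ] <;> linarith

/-- `f` and its first two derivatives are `O((1 + κ) ^ e)` on `[0, ∞)`. -/
def C2Growth (e : ℝ) (f : ℝ → ℂ) : Prop := ∃ C f₁ f₂, C2Bound e C f f₁ f₂

namespace C2Growth

variable {e e' : ℝ} {f g : ℝ → ℂ}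

lemma continuousOn (h : C2Growth e f) : ContinuousOn f (Ici 0) := by
  obtain ⟨C, f₁, f₂, H⟩ := h
  exact H.cont₀

lemma mono (h : C2Growth e f) (he : e ≤ e') : C2Growth e' f := by
  obtain ⟨C, f₁, f₂, H⟩ := h
  exact ⟨C, f₁, f₂, H.mono he⟩

lemma const (c : ℂ) : C2Growth 0 fun _ => c := by
  refine ⟨‖c‖, fun _ => 0, fun _ => 0, fun κ _ => hasDerivAt_const κ c,
    fun κ _ => hasDerivAt_const κ 0, continuousOn_const, ?_, ?_, ?_⟩ <;> intro κ hκ <;> simp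

lemma add (hf : C2Growth e f) (hg : C2Growth e g) : C2Growth e fun κ => f κ + g κ := by
  obtain ⟨C, f₁, f₂, F⟩ := hf
  obtain ⟨D, g₁, g₂, G⟩ := hg
  refine ⟨C + D, fun κ => f₁ κ + g₁ κ, fun κ => f₂ κ + g₂ κ,
    fun κ hκ => (F.deriv₁ κ hκ).fun_add (G.deriv₁ κ hκ),
    fun κ hκ => (F.deriv₂ κ hκ).fun_add (G.deriv₂ κ hκ), F.cont₂.add G.cont₂, ?_, ?_, ?_⟩ <;>
    intro κ hκ <;> refine (norm_add_le _ _).trans ?_ <;> rw [add_mul]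
  · exact add_le_add (F.bound₀ κ hκ) (G.bound₀ κ hκ)
  · exact add_le_add (F.bound₁ κ hκ) (G.bound₁ κ hκ)
  · exact add_le_add (F.bound₂ κ hκ) (G.bound₂ κ hκ)

lemma mul (hf : C2Growth e f) (hg : C2Growth e' g) : C2Growth (e + e') fun κ => f κ * g κ := by
  obtain ⟨C, f₁, f₂, F⟩ := hf
  obtain ⟨D, g₁, g₂, G⟩ := hg
  exact ⟨_, _, _, F.mul G⟩

lemma const_mul (c : ℂ) (hf : C2Growth e f) : C2Growth e fun κ => c * f κ := by
  simpa using (const c).mul hf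

lemma neg (hf : C2Growth e f) : C2Growth e fun κ => -f κ := by
  simpa using hf.const_mul (-1)

lemma congr (hf : C2Growth e f) (h : ∀ κ, f κ = g κ) : C2Growth e g := by
  rwa [← funext h]

lemma ofReal_id : C2Growth 1 fun κ => (κ : ℂ) := ⟨_, _, _, C2Bound.ofReal_id⟩

lemma rpow_le {b : ℝ} (hb : 0 < b) (s : ℝ) : ∃ D : ℝ, 0 ≤ D ∧ ∀ κ : ℝ, 0 ≤ κ →
    (κ ^ 2 + b) ^ s ≤ D * (1 + κ) ^ (2 * s) := by
  set c : ℝ := 1 / (2 * (1 + 1 / b)) with hc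
  have hc0 : 0 < c := by positivity
  refine ⟨max ((1 + b) ^ s) (c ^ s), le_max_of_le_left (by positivity), fun κ hκ => ?_⟩
  have hx : 0 < 1 + κ := by linarith
  have hsq : (1 + κ) ^ (2 * s) = ((1 + κ) ^ 2) ^ s := by
    rw [Real.rpow_mul hx.le]; norm_cast
  have hq : 0 < κ ^ 2 + b := by positivity
  rw [hsq]
  rcases le_total 0 s with hs | hs
  · calc (κ ^ 2 + b) ^ s ≤ ((1 + b) * (1 + κ) ^ 2) ^ s := by
          refine Real.rpow_le_rpow hq.le ?_ hs
          nlinarith [mul_nonneg hb.le hκ, mul_nonneg (mul_nonneg hb.le hκ) hκ]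
      _ = (1 + b) ^ s * ((1 + κ) ^ 2) ^ s := Real.mul_rpow (by positivity) (by positivity)
      _ ≤ _ := mul_le_mul_of_nonneg_right (le_max_left _ _) (by positivity)
  · calc (κ ^ 2 + b) ^ s ≤ (c * (1 + κ) ^ 2) ^ s := by
          refine Real.rpow_le_rpow_of_nonpos (by positivity) ?_ hs
          rw [hc, one_div_mul_eq_div, div_le_iff₀ (by positivity)]
          have : 0 ≤ κ ^ 2 / b := by positivity
          have e : (κ ^ 2 + b) * (2 * (1 + 1 / b)) = 2 * (κ ^ 2 + b) + 2 * (κ ^ 2 / b) + 2 := by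
            field_simp; ring
          rw [e]
          nlinarith [sq_nonneg (κ - 1)]
      _ = c ^ s * ((1 + κ) ^ 2) ^ s := Real.mul_rpow (by positivity) (by positivity)
      _ ≤ _ := mul_le_mul_of_nonneg_right (le_max_right _ _) (by positivity)

lemma rpow {b : ℝ} (hb : 0 < b) (s : ℝ) :
    C2Growth (2 * s) fun κ => (((κ ^ 2 + b) ^ s : ℝ) : ℂ) := by
  obtain ⟨D₀, hD₀, h₀⟩ := rpow_le hb s
  obtain ⟨D₁, hD₁, h₁⟩ := rpow_le hb (s - 1)
  obtain ⟨D₂, hD₂, h₂⟩ := rpow_le hb (s - 2)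
  have hq : ∀ κ : ℝ, 0 < κ ^ 2 + b := fun κ => by positivity
  have hd : ∀ (s κ : ℝ), HasDerivAt (fun κ : ℝ => (κ ^ 2 + b) ^ s)
      (2 * s * κ * (κ ^ 2 + b) ^ (s - 1)) κ := by
    intro s κ
    have h : HasDerivAt (fun κ : ℝ => κ ^ 2 + b) (2 * κ) κ := by
      simpa using (hasDerivAt_pow 2 κ).add_const b
    refine (h.rpow_const (p := s) (Or.inl (hq κ).ne')).congr_deriv ?_
    ring
  set f₁ : ℝ → ℝ := fun κ => 2 * s * κ * (κ ^ 2 + b) ^ (s - 1) with hf₁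
  set f₂ : ℝ → ℝ := fun κ => 2 * s * (κ ^ 2 + b) ^ (s - 1) +
    2 * s * κ * (2 * (s - 1) * κ * (κ ^ 2 + b) ^ (s - 2)) with hf₂
  have hexp : ∀ (κ : ℝ) (r : ℝ), 0 ≤ κ → r ≤ 2 * s → (1 + κ) ^ r ≤ (1 + κ) ^ (2 * s) :=
    fun κ r hκ hr => Real.rpow_le_rpow_of_exponent_le (by linarith) hr
  have hmul : ∀ (κ r : ℝ), 0 ≤ κ → κ * (1 + κ) ^ r ≤ (1 + κ) ^ (r + 1) := by
    intro κ r hκ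
    rw [Real.rpow_add (by linarith), Real.rpow_one, mul_comm]
    exact mul_le_mul_of_nonneg_left (by linarith) (by positivity)
  refine ⟨D₀ + |2 * s| * D₁ + |2 * s| * |2 * (s - 1)| * D₂, fun κ => (f₁ κ : ℂ),
    fun κ => (f₂ κ : ℂ), fun κ _ => (hd s κ).ofReal_comp, fun κ _ => ?_, ?_, ?_, ?_, ?_⟩
  · have h1 : HasDerivAt (fun κ : ℝ => 2 * s * κ) (2 * s) κ := by
      simpa using (hasDerivAt_id κ).const_mul (2 * s)
    have h2 := h1.fun_mul (hd (s - 1) κ)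
    rw [show s - 1 - 1 = s - 2 by ring] at h2
    exact h2.ofReal_comp
  · refine (Complex.continuous_ofReal.comp ?_).continuousOn
    have hc : ∀ r : ℝ, Continuous fun κ : ℝ => (κ ^ 2 + b) ^ r := fun r =>
      Continuous.rpow_const (by fun_prop) fun κ => Or.inl (hq κ).ne'
    have := hc (s - 1)
    have := hc (s - 2)
    rw [hf₂]; fun_prop
  all_goals
    intro κ hκ
    have hx : 0 < 1 + κ := by linarith
    have hX : 0 ≤ (1 + κ) ^ (2 * s) := by positivity
    rw [Complex.norm_real, Real.norm_eq_abs]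
  · rw [abs_of_nonneg (by positivity)]
    refine (h₀ κ hκ).trans (mul_le_mul_of_nonneg_right ?_ hX)
    have : 0 ≤ |2 * s| * D₁ + |2 * s| * |2 * (s - 1)| * D₂ := by positivity
    linarith
  · rw [hf₁]
    simp only
    rw [abs_mul, abs_mul, abs_of_nonneg hκ, abs_of_nonneg (by positivity : 0 ≤ (κ ^ 2 + b) ^ (s - 1))]
    calc |2 * s| * κ * (κ ^ 2 + b) ^ (s - 1) ≤ |2 * s| * κ * (D₁ * (1 + κ) ^ (2 * (s - 1))) := by
          gcongr; exact h₁ κ hκ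
      _ = |2 * s| * D₁ * (κ * (1 + κ) ^ (2 * (s - 1))) := by ring
      _ ≤ |2 * s| * D₁ * (1 + κ) ^ (2 * s) := by
          gcongr
          exact (hmul κ _ hκ).trans (hexp κ _ hκ (by linarith))
      _ ≤ _ := by
          refine mul_le_mul_of_nonneg_right ?_ hX
          have : 0 ≤ |2 * s| * |2 * (s - 1)| * D₂ := by positivity
          linarith
  · have hp1 : 0 ≤ (κ ^ 2 + b) ^ (s - 1) := by positivity
    have hp2 : 0 ≤ (κ ^ 2 + b) ^ (s - 2) := by positivity
    calc |f₂ κ| ≤ |2 * s| * (κ ^ 2 + b) ^ (s - 1) +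
          |2 * s| * κ * (|2 * (s - 1)| * κ * (κ ^ 2 + b) ^ (s - 2)) := by
          refine (abs_add_le _ _).trans_eq ?_
          simp only [abs_mul, abs_of_nonneg hκ, abs_of_nonneg hp1, abs_of_nonneg hp2]
      _ ≤ |2 * s| * (D₁ * (1 + κ) ^ (2 * (s - 1))) +
          |2 * s| * κ * (|2 * (s - 1)| * κ * (D₂ * (1 + κ) ^ (2 * (s - 2)))) := by
          gcongr
          · exact h₁ κ hκ
          · exact h₂ κ hκ
      _ = |2 * s| * D₁ * (1 + κ) ^ (2 * (s - 1)) +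
          |2 * s| * |2 * (s - 1)| * D₂ * (κ * (κ * (1 + κ) ^ (2 * (s - 2)))) := by ring
      _ ≤ |2 * s| * D₁ * (1 + κ) ^ (2 * s) +
          |2 * s| * |2 * (s - 1)| * D₂ * (1 + κ) ^ (2 * s) := by
          gcongr
          · linarith
          · linarith
          · refine (mul_le_mul_of_nonneg_left (hmul κ _ hκ) hκ).trans ?_
            exact (hmul κ _ hκ).trans (hexp κ _ hκ (by linarith))
      _ ≤ _ := by
          rw [← add_mul]
          refine mul_le_mul_of_nonneg_right ?_ hX
          linarith

lemma inv_sqrt {b : ℝ} (hb : 0 < b) :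
    C2Growth (-1) fun κ => (((Real.sqrt (κ ^ 2 + b))⁻¹ : ℝ) : ℂ) := by
  have h := rpow hb (-(1 / 2))
  norm_num at h
  refine h.congr fun κ => ?_
  rw [Real.sqrt_eq_rpow, ← Real.rpow_neg (by positivity)]

lemma inv_quadratic {b : ℝ} (hb : 0 < b) :
    C2Growth (-2) fun κ => (((κ ^ 2 + b)⁻¹ : ℝ) : ℂ) := by
  have h := rpow hb (-1)
  norm_num at h
  refine h.congr fun κ => ?_
  rw [Real.rpow_neg_one]

lemma arsinh {d : ℝ} (hd : 0 < d) : C2Growth 1 fun κ => ((Real.arsinh (κ / d) : ℝ) : ℂ) := by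
  have hb : 0 < d ^ 2 := by positivity
  obtain ⟨C, f₁, f₂, F⟩ := inv_sqrt hb
  have key : ∀ κ : ℝ, 0 ≤ κ → C * (1 + κ) ^ (-1 : ℝ) ≤ (C + d⁻¹) * (1 + κ) ^ (1 : ℝ) := by
    intro κ hκ
    have : 0 < d⁻¹ := by positivity
    refine mul_le_mul (by linarith) (Real.rpow_le_rpow_of_exponent_le (by linarith) (by norm_num))
      (by positivity) (by have := F.nonneg; linarith)
  refine ⟨C + d⁻¹, _, f₁, fun κ hκ => ?_, F.deriv₁, F.cont₁, fun κ hκ => ?_,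
    fun κ hκ => (F.bound₀ κ hκ).trans (key κ hκ), fun κ hκ => (F.bound₁ κ hκ).trans (key κ hκ)⟩
  · have h := ((Real.hasDerivAt_arsinh (κ / d)).comp κ ((hasDerivAt_id κ).div_const d)).ofReal_comp
    refine h.congr_deriv ?_
    congr 1
    have : Real.sqrt (κ ^ 2 + d ^ 2) = d * Real.sqrt (1 + (κ / d) ^ 2) := by
      rw [show κ ^ 2 + d ^ 2 = d ^ 2 * (1 + (κ / d) ^ 2) by field_simp; ring,
        Real.sqrt_mul (by positivity), Real.sqrt_sq hd.le]
    rw [this, mul_inv]; ring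
  · have h0 : 0 ≤ κ / d := by positivity
    have hle : Real.arsinh (κ / d) ≤ κ / d := by
      rw [← Real.arsinh_sinh (κ / d), Real.arsinh_le_arsinh, Real.arsinh_sinh]
      exact Real.self_le_sinh_iff.2 h0
    rw [Complex.norm_real, Real.norm_of_nonneg (Real.arsinh_nonneg_iff.2 h0), Real.rpow_one]
    have hC := F.nonneg
    have : κ / d = d⁻¹ * κ := by ring
    have hd' : 0 < d⁻¹ := by positivity
    nlinarith

/-- The reciprocal of an amplitude that is bounded below by `c (1 + κ) ^ (-j)`. -/
lemma inv {j c : ℝ} (hf : C2Growth e f) (he : 0 ≤ e) (hj : 0 ≤ j) (hc : 0 < c)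
    (hlow : ∀ κ, 0 ≤ κ → c * (1 + κ) ^ (-j) ≤ ‖f κ‖) :
    C2Growth (2 * e + 3 * j) fun κ => (f κ)⁻¹ := by
  obtain ⟨C, f₁, f₂, F⟩ := hf
  have hC := F.nonneg
  have hne : ∀ κ, 0 ≤ κ → f κ ≠ 0 := fun κ hκ => norm_pos_iff.1
    (lt_of_lt_of_le (by positivity) (hlow κ hκ))
  have hinv : ∀ κ, 0 ≤ κ → ‖(f κ)⁻¹‖ ≤ c⁻¹ * (1 + κ) ^ j := by
    intro κ hκ
    have h1 : 0 < c * (1 + κ) ^ (-j) := by positivity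
    rw [norm_inv]
    refine (inv_anti₀ h1 (hlow κ hκ)).trans_eq ?_
    rw [mul_inv, Real.rpow_neg (by positivity), inv_inv]
  have hexp : ∀ (κ r : ℝ), 0 ≤ κ → r ≤ 2 * e + 3 * j → (1 + κ) ^ r ≤ (1 + κ) ^ (2 * e + 3 * j) :=
    fun κ r hκ hr => Real.rpow_le_rpow_of_exponent_le (by linarith) hr
  refine ⟨c⁻¹ + C * c⁻¹ ^ 2 + (C * c⁻¹ ^ 2 + 2 * C ^ 2 * c⁻¹ ^ 3),
    fun κ => -(f₁ κ * (f κ)⁻¹ ^ 2),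
    fun κ => -(f₂ κ * (f κ)⁻¹ ^ 2) + 2 * f₁ κ ^ 2 * (f κ)⁻¹ ^ 3, ?_, ?_, ?_, ?_, ?_, ?_⟩
  · intro κ hκ
    refine ((F.deriv₁ κ hκ).fun_inv (hne κ hκ)).congr_deriv ?_
    rw [inv_pow, div_eq_mul_inv, neg_mul]
  · intro κ hκ
    have h1 := (F.deriv₁ κ hκ).fun_inv (hne κ hκ)
    refine ((F.deriv₂ κ hκ).fun_mul (h1.fun_pow 2)).fun_neg.congr_deriv ?_
    have := hne κ hκ
    simp only [Nat.cast_ofNat, Nat.reduceSub, pow_one]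
    field_simp
    ring
  · have hi : ContinuousOn (fun κ => (f κ)⁻¹) (Ici 0) := F.cont₀.inv₀ hne
    exact ((F.cont₂.mul (hi.pow 2)).neg).add
      ((continuousOn_const.mul (F.cont₁.pow 2)).mul (hi.pow 3))
  all_goals
    intro κ hκ
    have hx : 0 < 1 + κ := by linarith
    have hX : 0 ≤ (1 + κ) ^ (2 * e + 3 * j) := by positivity
    have hi := hinv κ hκ
    have hA : ∀ y : ℂ, ‖y‖ ≤ C * (1 + κ) ^ e → ‖y * (f κ)⁻¹ ^ 2‖ ≤
        C * c⁻¹ ^ 2 * (1 + κ) ^ (2 * e + 3 * j) := by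
      intro y hy
      rw [norm_mul, norm_pow]
      calc ‖y‖ * ‖(f κ)⁻¹‖ ^ 2 ≤ (C * (1 + κ) ^ e) * (c⁻¹ * (1 + κ) ^ j) ^ 2 := by gcongr
        _ = C * c⁻¹ ^ 2 * (1 + κ) ^ (e + j + j) := by
            rw [Real.rpow_add hx, Real.rpow_add hx]; ring
        _ ≤ _ := by exact mul_le_mul_of_nonneg_left (hexp κ _ hκ (by linarith)) (by positivity)
    have p1 : 0 ≤ c⁻¹ := by positivity
    have p2 : 0 ≤ C * c⁻¹ ^ 2 := by positivity
    have p3 : 0 ≤ 2 * C ^ 2 * c⁻¹ ^ 3 := by positivity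
  · calc ‖(f κ)⁻¹‖ ≤ c⁻¹ * (1 + κ) ^ j := hi
      _ ≤ c⁻¹ * (1 + κ) ^ (2 * e + 3 * j) := by exact mul_le_mul_of_nonneg_left (hexp κ _ hκ (by linarith)) (by positivity)
      _ ≤ _ := mul_le_mul_of_nonneg_right (by linarith) hX
  · rw [norm_neg]
    exact (hA _ (F.bound₁ κ hκ)).trans (mul_le_mul_of_nonneg_right (by linarith) hX)
  · have hB : ‖2 * f₁ κ ^ 2 * (f κ)⁻¹ ^ 3‖ ≤ 2 * C ^ 2 * c⁻¹ ^ 3 * (1 + κ) ^ (2 * e + 3 * j) := by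
      rw [norm_mul, norm_mul, norm_pow, norm_pow]
      have h1 := F.bound₁ κ hκ
      calc ‖(2 : ℂ)‖ * ‖f₁ κ‖ ^ 2 * ‖(f κ)⁻¹‖ ^ 3 ≤
            2 * (C * (1 + κ) ^ e) ^ 2 * (c⁻¹ * (1 + κ) ^ j) ^ 3 := by
            rw [Complex.norm_ofNat]; gcongr
        _ = 2 * C ^ 2 * c⁻¹ ^ 3 * (1 + κ) ^ (e + e + j + j + j) := by
            rw [Real.rpow_add hx, Real.rpow_add hx, Real.rpow_add hx, Real.rpow_add hx]; ring
        _ ≤ _ := by exact mul_le_mul_of_nonneg_left (hexp κ _ hκ (by linarith)) (by positivity)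
    refine (norm_add_le _ _).trans ?_
    rw [norm_neg]
    have := hA _ (F.bound₂ κ hκ)
    calc _ ≤ C * c⁻¹ ^ 2 * (1 + κ) ^ (2 * e + 3 * j) +
          2 * C ^ 2 * c⁻¹ ^ 3 * (1 + κ) ^ (2 * e + 3 * j) := add_le_add this hB
      _ ≤ _ := by
          rw [← add_mul]; exact mul_le_mul_of_nonneg_right (by linarith) hX

end C2Growth

/-! ### The dispersion relation as a change of variables -/

lemma disp_strictMonoOn (M : ℝ) : StrictMonoOn (disp M) (Ici 0) := by
  intro x hx y hy hxy
  have hx : 0 ≤ x := hx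
  exact Real.sqrt_lt_sqrt (by positivity) (by nlinarith)

lemma disp_image_Ioi {M : ℝ} (hM : 0 < M) : disp M '' Ioi 0 = Ioi M := by
  ext y
  constructor
  · rintro ⟨κ, hκ, rfl⟩
    have := disp_strictMonoOn M (mem_Ici.2 le_rfl) (le_of_lt hκ : (0 : ℝ) ≤ κ) hκ
    rwa [disp_zero hM] at this
  · intro hy
    have hy : M < y := hy
    have h : 0 < y ^ 2 - M ^ 2 := by nlinarith
    refine ⟨Real.sqrt (y ^ 2 - M ^ 2), Real.sqrt_pos.2 h, ?_⟩
    rw [disp, Real.sq_sqrt h.le, sub_add_cancel, Real.sqrt_sq (by linarith)]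

/-- The substitution `ω = √(κ² + M²)`. -/
lemma integral_Ioi_eq_integral_disp {M : ℝ} (hM : 0 < M) (F : ℝ → ℂ) :
    ∫ w in Ioi M, F w = ∫ κ in Ioi (0 : ℝ), ((κ / disp M κ : ℝ) : ℂ) * F (disp M κ) := by
  rw [← disp_image_Ioi hM, integral_image_eq_integral_abs_deriv_smul measurableSet_Ioi
    (fun κ _ => (hasDerivAt_disp hM κ).hasDerivWithinAt)
    ((disp_strictMonoOn M).mono Ioi_subset_Ici_self).injOn]
  refine setIntegral_congr_fun measurableSet_Ioi fun κ hκ => ?_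
  have : 0 ≤ κ / disp M κ := div_nonneg (le_of_lt hκ) (disp_pos hM κ).le
  simp only [abs_of_nonneg this, Complex.real_smul]

lemma sq_add_image_Ioi (b : ℝ) : (fun κ : ℝ => b + κ ^ 2) '' Ioi 0 = Ioi b := by
  ext y
  constructor
  · rintro ⟨κ, hκ, rfl⟩
    have hκ : 0 < κ := hκ
    simp only [mem_Ioi]
    nlinarith
  · intro hy
    have hy : b < y := hy
    refine ⟨Real.sqrt (y - b), Real.sqrt_pos.2 (by linarith), ?_⟩
    simp only [Real.sq_sqrt (by linarith : 0 ≤ y - b)]; ring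

/-- The substitution `μ = b + κ²`. -/
lemma integral_Ioi_eq_integral_sq (b : ℝ) {E : Type*} [NormedAddCommGroup E] [NormedSpace ℝ E]
    (F : ℝ → E) : ∫ μ in Ioi b, F μ = ∫ κ in Ioi (0 : ℝ), (2 * κ) • F (b + κ ^ 2) := by
  have hd : ∀ κ ∈ Ioi (0 : ℝ),
      HasDerivWithinAt (fun κ : ℝ => b + κ ^ 2) (2 * κ) (Ioi 0) κ := fun κ _ => by
    simpa using ((hasDerivAt_pow 2 κ).const_add b).hasDerivWithinAt
  have hinj : InjOn (fun κ : ℝ => b + κ ^ 2) (Ioi 0) := by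
    intro x hx y hy hxy
    have hx : 0 < x := hx
    have hy : 0 < y := hy
    simp only at hxy
    nlinarith
  rw [← sq_add_image_Ioi b, integral_image_eq_integral_abs_deriv_smul measurableSet_Ioi hd hinj]
  refine setIntegral_congr_fun measurableSet_Ioi fun κ hκ => ?_
  have hκ : 0 < κ := hκ
  simp only [abs_of_nonneg (by positivity : 0 ≤ 2 * κ)]

namespace C2Growth

variable {e : ℝ} {f : ℝ → ℂ}

lemma comp_disp {M : ℝ} (hM : 0 < M) (hf : C2Growth e f) (he : e ≤ 0) :
    C2Growth e fun κ => f (disp M κ) := by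
  obtain ⟨C, f₁, f₂, F⟩ := hf
  have hC := F.nonneg
  have hp := disp_pos hM
  have hmaps : MapsTo (disp M) (Ici 0) (Ici 0) := fun κ _ => (hp κ).le
  have hdc := continuous_disp M
  have hexp : ∀ κ : ℝ, 0 ≤ κ → (1 + disp M κ) ^ e ≤ (1 + κ) ^ e := fun κ hκ =>
    Real.rpow_le_rpow_of_nonpos (by linarith) (by linarith [self_le_disp M κ]) he
  have key : ∀ κ : ℝ, 0 ≤ κ → ∀ y : ℂ, ‖y‖ ≤ C * (1 + disp M κ) ^ e → ‖y‖ ≤ C * (1 + κ) ^ e :=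
    fun κ hκ y hy => hy.trans (mul_le_mul_of_nonneg_left (hexp κ hκ) hC)
  have hr1 : ∀ κ : ℝ, 0 ≤ κ → ‖((κ / disp M κ : ℝ) : ℂ)‖ ≤ 1 := fun κ hκ => by
    rw [Complex.norm_real, Real.norm_of_nonneg (div_nonneg hκ (hp κ).le)]
    exact div_disp_le_one hM κ
  have hr2 : ∀ κ : ℝ, 0 ≤ κ → ‖((M ^ 2 / disp M κ ^ 3 : ℝ) : ℂ)‖ ≤ 1 / M := fun κ _ => by
    have := hp κ
    rw [Complex.norm_real, Real.norm_of_nonneg (by positivity), div_le_div_iff₀ (by positivity) hM]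
    calc M ^ 2 * M = M ^ 3 := by ring
      _ ≤ disp M κ ^ 3 := pow_le_pow_left₀ hM.le (le_disp κ) 3
      _ = _ := by ring
  refine ⟨C + C * (1 / M), fun κ => f₁ (disp M κ) * ((κ / disp M κ : ℝ) : ℂ),
    fun κ => f₂ (disp M κ) * ((κ / disp M κ : ℝ) : ℂ) ^ 2 +
      f₁ (disp M κ) * ((M ^ 2 / disp M κ ^ 3 : ℝ) : ℂ), ?_, ?_, ?_, ?_, ?_, ?_⟩
  · intro κ hκ
    refine ((F.deriv₁ _ (hp κ).le).scomp κ (hasDerivAt_disp hM κ)).congr_deriv ?_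
    rw [Complex.real_smul, mul_comm]
  · intro κ hκ
    have hd : HasDerivAt (fun κ => κ / disp M κ) (M ^ 2 / disp M κ ^ 3) κ := by
      refine ((hasDerivAt_id κ).fun_div (hasDerivAt_disp hM κ) (hp κ).ne').congr_deriv ?_
      have := (hp κ).ne'
      simp only [id]
      field_simp
      linear_combination disp_sq M κ
    have h1 := (F.deriv₂ _ (hp κ).le).scomp κ (hasDerivAt_disp hM κ)
    refine (h1.fun_mul hd.ofReal_comp).congr_deriv ?_
    rw [Complex.real_smul]
    simp only [Function.comp]
    ring
  · have h1 : Continuous fun κ => ((κ / disp M κ : ℝ) : ℂ) :=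
      Complex.continuous_ofReal.comp (continuous_id.div hdc fun κ => (hp κ).ne')
    have h2 : Continuous fun κ => ((M ^ 2 / disp M κ ^ 3 : ℝ) : ℂ) :=
      Complex.continuous_ofReal.comp
        (continuous_const.div (hdc.pow 3) fun κ => pow_ne_zero 3 (hp κ).ne')
    exact ((F.cont₂.comp hdc.continuousOn hmaps).mul (h1.pow 2).continuousOn).add
      ((F.cont₁.comp hdc.continuousOn hmaps).mul h2.continuousOn)
  all_goals
    intro κ hκ
    have hX : 0 ≤ C * (1 + κ) ^ e := by positivity
    have hX' : C * (1 + κ) ^ e ≤ (C + C * (1 / M)) * (1 + κ) ^ e := by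
      refine mul_le_mul_of_nonneg_right ?_ (by positivity)
      have : 0 ≤ C * (1 / M) := by positivity
      linarith
  · exact (key κ hκ _ (F.bound₀ _ (hp κ).le)).trans hX'
  · have h1 := key κ hκ _ (F.bound₁ _ (hp κ).le)
    rw [norm_mul]
    exact ((mul_le_mul h1 (hr1 κ hκ) (norm_nonneg _) hX).trans_eq (mul_one _)).trans hX'
  · have h1 := key κ hκ _ (F.bound₁ _ (hp κ).le)
    have h2 := key κ hκ _ (F.bound₂ _ (hp κ).le)
    refine (norm_add_le _ _).trans ?_
    rw [norm_mul, norm_mul, norm_pow, add_mul]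
    refine add_le_add ?_ ?_
    · exact (mul_le_mul h2 (pow_le_one₀ (norm_nonneg _) (hr1 κ hκ)) (by positivity) hX).trans_eq
        (mul_one _)
    · calc _ ≤ C * (1 + κ) ^ e * (1 / M) := mul_le_mul h1 (hr2 κ hκ) (norm_nonneg _) hX
        _ = _ := by ring

lemma exp_neg (n : ℕ) : C2Growth (-(n : ℝ)) fun x => ((Real.exp (-x) : ℝ) : ℂ) := by
  have hd : ∀ κ : ℝ, HasDerivAt (fun x : ℝ => Real.exp (-x)) (-Real.exp (-κ)) κ := fun κ => by
    simpa using (hasDerivAt_neg κ).exp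
  have hb : ∀ κ : ℝ, 0 ≤ κ → Real.exp (-κ) ≤
      (Nat.factorial n * Real.exp 1) * (1 + κ) ^ (-(n : ℝ)) := by
    intro κ hκ
    have h1 : (1 + κ) ^ n / Nat.factorial n ≤ Real.exp (1 + κ) :=
      Real.pow_div_factorial_le_exp _ (by linarith) n
    rw [Real.rpow_neg (by linarith), Real.rpow_natCast, ← div_eq_mul_inv,
      le_div_iff₀ (by positivity)]
    rw [div_le_iff₀ (by positivity), Real.exp_add] at h1
    calc Real.exp (-κ) * (1 + κ) ^ n
        ≤ Real.exp (-κ) * (Real.exp 1 * Real.exp κ * Nat.factorial n) := by gcongr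
      _ = (Real.exp (-κ) * Real.exp κ) * (Nat.factorial n * Real.exp 1) := by ring
      _ = _ := by rw [← Real.exp_add]; simp
  refine ⟨Nat.factorial n * Real.exp 1, fun x => ((-Real.exp (-x) : ℝ) : ℂ),
    fun x => ((Real.exp (-x) : ℝ) : ℂ), fun κ _ => (hd κ).ofReal_comp,
    fun κ _ => by simpa using (hd κ).neg.ofReal_comp, by fun_prop, ?_, ?_, ?_⟩ <;>
    intro κ hκ <;> rw [Complex.norm_real] <;> simpa using hb κ hκ

lemma sqrt_add {d : ℝ} (hd : 0 < d) : C2Growth 1 fun x => ((Real.sqrt (x + d) : ℝ) : ℂ) := by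
  have h0 : ∀ κ : ℝ, 0 ≤ κ → 0 < κ + d := fun κ hκ => by linarith
  have hs : ∀ κ : ℝ, 0 ≤ κ → HasDerivAt (fun x => Real.sqrt (x + d))
      (1 / (2 * Real.sqrt (κ + d))) κ := fun κ hκ => by
    simpa using ((hasDerivAt_id κ).add_const d).sqrt (h0 κ hκ).ne'
  have hlow : ∀ κ : ℝ, 0 ≤ κ → Real.sqrt d ≤ Real.sqrt (κ + d) := fun κ hκ =>
    Real.sqrt_le_sqrt (by linarith)
  have hd' : 0 < Real.sqrt d := Real.sqrt_pos.2 hd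
  have hc1 : 0 ≤ 1 / (2 * Real.sqrt d) := by positivity
  have hc2 : 0 ≤ 1 / (4 * Real.sqrt d ^ 3) := by positivity
  refine ⟨(1 + d) + 1 / (2 * Real.sqrt d) + 1 / (4 * Real.sqrt d ^ 3),
    fun x => ((1 / (2 * Real.sqrt (x + d)) : ℝ) : ℂ),
    fun x => ((-(1 / (4 * Real.sqrt (x + d) ^ 3)) : ℝ) : ℂ), fun κ hκ => (hs κ hκ).ofReal_comp,
    ?_, ?_, ?_, ?_, ?_⟩
  · intro κ hκ
    have hp : 0 < Real.sqrt (κ + d) := Real.sqrt_pos.2 (h0 κ hκ)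
    have h := ((hs κ hκ).const_mul 2).fun_inv (by positivity)
    simp only [one_div]
    refine (h.congr_deriv ?_).ofReal_comp
    field_simp
    ring
  · refine (Complex.continuous_ofReal.comp_continuousOn ?_)
    refine (ContinuousOn.div continuousOn_const (by fun_prop) fun κ hκ => ?_).neg
    have : 0 < Real.sqrt (κ + d) := Real.sqrt_pos.2 (h0 κ hκ)
    positivity
  all_goals
    intro κ hκ
    have hp : 0 < Real.sqrt (κ + d) := Real.sqrt_pos.2 (h0 κ hκ)
    rw [Complex.norm_real, Real.rpow_one]
  · rw [Real.norm_of_nonneg hp.le]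
    have : Real.sqrt (κ + d) ≤ 1 + (κ + d) := by
      rw [Real.sqrt_le_left (by linarith [h0 κ hκ])]; nlinarith [h0 κ hκ]
    nlinarith
  · rw [Real.norm_of_nonneg (by positivity)]
    have : 1 / (2 * Real.sqrt (κ + d)) ≤ 1 / (2 * Real.sqrt d) :=
      one_div_le_one_div_of_le (by positivity) (by linarith [hlow κ hκ])
    nlinarith
  · rw [norm_neg, Real.norm_of_nonneg (by positivity)]
    have : 1 / (4 * Real.sqrt (κ + d) ^ 3) ≤ 1 / (4 * Real.sqrt d ^ 3) :=
      one_div_le_one_div_of_le (by positivity)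
        (by linarith [pow_le_pow_left₀ hd'.le (hlow κ hκ) 3])
    nlinarith

end C2Growth

/-! ### Lower bound for an oscillatory integral -/

/-- The amplitude `e^{M-ω} √(ω + M) / ω`, for which the oscillatory integral is a Gamma integral. -/
def modelAmp (M κ : ℝ) : ℂ :=
  ((Real.exp M : ℝ) : ℂ) * (((Real.exp (-disp M κ) : ℝ) : ℂ) *
    ((Real.sqrt (disp M κ + M) : ℝ) : ℂ)) * (((disp M κ)⁻¹ : ℝ) : ℂ)

lemma c2Growth_modelAmp {M : ℝ} (hM : 0 < M) : C2Growth (-3) (modelAmp M) := by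
  have h1 : C2Growth (-2) fun κ => (fun x : ℝ => ((Real.exp (-x) : ℝ) : ℂ) *
      ((Real.sqrt (x + M) : ℝ) : ℂ)) (disp M κ) := by
    have h := ((C2Growth.exp_neg 3).mul (C2Growth.sqrt_add hM)).mono (e' := -2) (by norm_num)
    exact h.comp_disp hM (by norm_num)
  have h2 := (h1.const_mul ((Real.exp M : ℝ) : ℂ)).mul (C2Growth.inv_sqrt (b := M ^ 2) (by positivity))
  exact h2.mono (by norm_num)

lemma modelAmp_zero {M : ℝ} (hM : 0 < M) : modelAmp M 0 ≠ 0 := by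
  have h1 := Real.exp_ne_zero M
  have h2 := Real.exp_ne_zero (-M)
  have h3 : Real.sqrt (M + M) ≠ 0 := (Real.sqrt_pos.2 (by linarith)).ne'
  rw [modelAmp, disp_zero hM]
  simp only [ne_eq, mul_eq_zero, Complex.ofReal_eq_zero, inv_eq_zero, not_or]
  exact ⟨⟨h1, h2, h3⟩, hM.ne'⟩

/-- The model integral, evaluated by the substitution `ω = M + y²`. The factor `√t` is absorbed into
the Gaussian variable. -/
lemma integral_modelAmp_mul_wave {M : ℝ} (hM : 0 < M) {t : ℝ} (ht : 0 < t) :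
    (Real.sqrt t : ℂ) * ∫ κ in Ioi (0 : ℝ), modelAmp M κ * wave M t κ =
      Complex.exp (Complex.I * ((t * M : ℝ) : ℂ)) *
        (Real.pi / (((t⁻¹ : ℝ) : ℂ) - Complex.I)) ^ (1 / 2 : ℂ) := by
  have ht' : (t : ℂ) ≠ 0 := by exact_mod_cast ht.ne'
  have hG := integral_gaussian_complex_Ioi (b := ((t⁻¹ : ℝ) : ℂ) - Complex.I)
    (by simpa using inv_pos.2 ht)
  have hscale := integral_comp_mul_left_Ioi (fun x : ℝ => Complex.exp
    (-(((t⁻¹ : ℝ) : ℂ) - Complex.I) * (x : ℂ) ^ 2)) 0 (Real.sqrt_pos.2 ht)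
  rw [mul_zero, hG, Complex.real_smul] at hscale
  have hs : (Real.sqrt t : ℂ) ≠ 0 := by exact_mod_cast (Real.sqrt_pos.2 ht).ne'
  have hkey : ∫ κ in Ioi (0 : ℝ), modelAmp M κ * wave M t κ =
      Complex.exp (Complex.I * ((t * M : ℝ) : ℂ)) * (2 * ∫ x in Ioi (0 : ℝ), Complex.exp
        (-(((t⁻¹ : ℝ) : ℂ) - Complex.I) * ((Real.sqrt t * x : ℝ) : ℂ) ^ 2)) := by
    have h2 := integral_Ioi_eq_integral_sq M fun w : ℝ => (((Real.sqrt (w - M))⁻¹ : ℝ) : ℂ) *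
      Complex.exp (-(1 - Complex.I * t) * ((w - M : ℝ) : ℂ))
    rw [integral_Ioi_eq_integral_disp hM] at h2
    have h3 : ∫ κ in Ioi (0 : ℝ), modelAmp M κ * wave M t κ =
        Complex.exp (Complex.I * ((t * M : ℝ) : ℂ)) * ∫ κ in Ioi (0 : ℝ),
          ((κ / disp M κ : ℝ) : ℂ) * ((((Real.sqrt (disp M κ - M))⁻¹ : ℝ) : ℂ) *
            Complex.exp (-(1 - Complex.I * t) * ((disp M κ - M : ℝ) : ℂ))) := by
      rw [← integral_const_mul]
      refine setIntegral_congr_fun measurableSet_Ioi fun κ hκ => ?_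
      have hκ : 0 < κ := hκ
      have hlt : M < disp M κ := by
        have := disp_strictMonoOn M (mem_Ici.2 le_rfl) (mem_Ici.2 hκ.le) hκ
        rwa [disp_zero hM] at this
      have hroot : Real.sqrt (disp M κ + M) = κ * (Real.sqrt (disp M κ - M))⁻¹ := by
        have h0 : 0 < Real.sqrt (disp M κ - M) := Real.sqrt_pos.2 (by linarith)
        rw [eq_mul_inv_iff_mul_eq₀ h0.ne', ← Real.sqrt_mul (by linarith),
          Real.sqrt_eq_iff_mul_self_eq (by nlinarith) hκ.le]
        linear_combination disp_sq M κ
      have hexp : wave M t κ * ((Real.exp M : ℝ) : ℂ) * ((Real.exp (-disp M κ) : ℝ) : ℂ) =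
          Complex.exp (Complex.I * ((t * M : ℝ) : ℂ)) *
            Complex.exp (-(1 - Complex.I * t) * ((disp M κ - M : ℝ) : ℂ)) := by
        rw [wave, Complex.ofReal_exp, Complex.ofReal_exp, ← Complex.exp_add, ← Complex.exp_add,
          ← Complex.exp_add]
        congr 1; push_cast; ring
      simp only [modelAmp, hroot]
      rw [mul_left_comm (Complex.exp _) (((κ / disp M κ : ℝ)) : ℂ),
        mul_left_comm (Complex.exp _) (((Real.sqrt (disp M κ - M))⁻¹ : ℝ) : ℂ), ← hexp]
      push_cast; ring
    rw [h3, h2]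
    congr 1
    rw [← integral_const_mul]
    refine setIntegral_congr_fun measurableSet_Ioi fun y hy => ?_
    have hy : 0 < y := hy
    have hy' : (y : ℂ) ≠ 0 := by exact_mod_cast hy.ne'
    have hsq : ((Real.sqrt t * y : ℝ) : ℂ) ^ 2 = (t : ℂ) * (y : ℂ) ^ 2 := by
      norm_cast; rw [mul_pow, Real.sq_sqrt ht.le]
    simp only [add_sub_cancel_left, Real.sqrt_sq hy.le, Complex.real_smul, hsq]
    rw [show -(((t⁻¹ : ℝ) : ℂ) - Complex.I) * ((t : ℂ) * (y : ℂ) ^ 2) =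
      -(1 - Complex.I * t) * ((y ^ 2 : ℝ) : ℂ) by push_cast; field_simp]
    push_cast
    field_simp
  rw [hkey, hscale]
  push_cast
  field_simp

/-- Leading asymptotics of the oscillatory integral with amplitude `κ g(κ)`. After one integration by
parts the amplitude at the stationary point is `g'(0) M`; it is matched by a multiple of the model
amplitude, and the remainder vanishes at the stationary point and is of lower order. -/
theorem tendsto_integral_mul_wave {M : ℝ} (hM : 0 < M) {C : ℝ} {g g₁ g₂ : ℝ → ℂ}
    (h : C2Bound (-3) C g g₁ g₂) (hg0 : g 0 = 0) :
    Tendsto (fun t : ℝ => ((t ^ (3 / 2 : ℝ) : ℝ) : ℂ) *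
        (Complex.exp (-(Complex.I * ((t * M : ℝ) : ℂ))) *
          ∫ κ in Ioi (0 : ℝ), (κ : ℂ) * g κ * wave M t κ)) atTop
      (𝓝 (Complex.I * (g₁ 0 * M / modelAmp M 0 * (Real.pi / (-Complex.I)) ^ (1 / 2 : ℂ)))) := by
  obtain ⟨D, m₁, m₂, hD⟩ := c2Growth_modelAmp hM
  have hD0 := hD.nonneg
  have hC0 := h.nonneg
  set β : ℂ := g₁ 0 * M / modelAmp M 0 with hβ
  set b : ℝ → ℂ := fun κ => partsAmp M g g₁ κ - β * modelAmp M κ with hb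
  set b' : ℝ → ℂ := fun κ => partsAmp' M g g₁ g₂ κ - β * m₁ κ with hb'
  set B : ℝ := (M + 3 + 1 / M) * C + ‖β‖ * D with hB
  have hB0 : 0 ≤ B := by positivity
  have hbd : ∀ κ, 0 ≤ κ → HasDerivAt b (b' κ) κ := fun κ hκ =>
    (hasDerivAt_partsAmp hM h hκ).fun_sub ((hD.deriv₁ κ hκ).const_mul β)
  have hb'c : ContinuousOn b' (Ici 0) :=
    (continuousOn_partsAmp' hM h).sub (continuousOn_const.mul hD.cont₁)
  have hmod : ∀ κ : ℝ, 0 ≤ κ → ∀ y : ℂ, ‖y‖ ≤ D * (1 + κ) ^ (-3 : ℝ) →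
      ‖β * y‖ ≤ ‖β‖ * D / (1 + κ) ^ 2 := by
    intro κ hκ y hy
    rw [rpow_neg_three hκ] at hy
    rw [norm_mul, mul_div_assoc]
    refine mul_le_mul_of_nonneg_left (hy.trans ?_) (norm_nonneg _)
    rw [mul_one_div]
    exact div_le_div_of_nonneg_left hD0 (by positivity)
      (pow_le_pow_right₀ (by linarith) (by norm_num))
  have hb2 : ∀ κ, 0 ≤ κ → ‖b κ‖ ≤ B / (1 + κ) ^ 2 := fun κ hκ => by
    rw [hB, add_div]
    exact (norm_sub_le _ _).trans
      (add_le_add (norm_partsAmp_le hM h hκ) (hmod κ hκ _ (hD.bound₀ κ hκ)))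
  have hb'2 : ∀ κ, 0 ≤ κ → ‖b' κ‖ ≤ B / (1 + κ) ^ 2 := fun κ hκ => by
    rw [hB, add_div]
    exact (norm_sub_le _ _).trans
      (add_le_add (norm_partsAmp'_le hM h hκ) (hmod κ hκ _ (hD.bound₁ κ hκ)))
  have hle : ∀ κ : ℝ, 0 ≤ κ → B / (1 + κ) ^ 2 ≤ B := fun κ hκ =>
    div_le_self hB0 (one_le_pow₀ (by linarith))
  have hbzero : b 0 = 0 := by
    have h1 := modelAmp_zero hM
    simp only [hb, hβ, partsAmp, disp_zero hM, hg0]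
    field_simp
    simp
  have hbα : ∀ κ, 0 ≤ κ → ‖b κ‖ ≤ B * κ ^ (1 / 2 : ℝ) := by
    intro κ hκ
    rcases le_total κ 1 with h1 | h1
    · have hmv := (convex_Icc (0 : ℝ) κ).norm_image_sub_le_of_norm_hasDerivWithin_le (f := b)
        (f' := b') (C := B) (fun x hx => (hbd x hx.1).hasDerivWithinAt)
        (fun x hx => (hb'2 x hx.1).trans (hle x hx.1)) (left_mem_Icc.2 hκ) (right_mem_Icc.2 hκ)
      rw [hbzero, sub_zero, sub_zero, Real.norm_of_nonneg hκ] at hmv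
      refine hmv.trans (mul_le_mul_of_nonneg_left ?_ hB0)
      have := Real.rpow_le_rpow_of_exponent_ge' hκ h1 (by norm_num : (0 : ℝ) ≤ 1 / 2)
        (by norm_num : (1 / 2 : ℝ) ≤ 1)
      simpa using this
    · exact ((hb2 κ hκ).trans (hle κ hκ)).trans
        (le_mul_of_one_le_right hB0 (Real.one_le_rpow h1 (by norm_num)))
  have hR : ∀ t : ℝ, 1 ≤ |t| → _ := fun t ht =>
    norm_integral_wave_le hM (α := 1 / 2) (by norm_num) (by norm_num) hbd hb'c hbα hb2 hb'2 ht
  set K : ℝ := (1 + (M + 1) + (2 * M + 1) / (1 - 1 / 2)) * B with hK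
  have hint : ∀ (t : ℝ) (f : ℝ → ℂ) (E : ℝ), ContinuousOn f (Ici 0) →
      (∀ κ, 0 ≤ κ → ‖f κ‖ ≤ E / (1 + κ) ^ 2) →
      IntegrableOn (fun κ => f κ * wave M t κ) (Ioi 0) := by
    intro t f E hf hfE
    refine Integrable.mono' (integrableOn_one_add_sq (C := E)) ?_ ?_
    · exact ((hf.mul (continuous_wave M t).continuousOn).mono
        Ioi_subset_Ici_self).aestronglyMeasurable measurableSet_Ioi
    · filter_upwards [ae_restrict_mem measurableSet_Ioi] with κ hκ
      rw [norm_mul, norm_wave, mul_one]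
      exact hfE κ (le_of_lt hκ)
  have hbc : ContinuousOn b (Ici 0) := fun κ hκ => (hbd κ hκ).continuousAt.continuousWithinAt
  have hsplit : ∀ t : ℝ, 1 ≤ t → ((t ^ (3 / 2 : ℝ) : ℝ) : ℂ) *
        (Complex.exp (-(Complex.I * ((t * M : ℝ) : ℂ))) *
          ∫ κ in Ioi (0 : ℝ), (κ : ℂ) * g κ * wave M t κ) =
      Complex.I * (β * (Real.pi / (((t⁻¹ : ℝ) : ℂ) - Complex.I)) ^ (1 / 2 : ℂ)) +
        Complex.I * (((Real.sqrt t : ℝ) : ℂ) * (Complex.exp (-(Complex.I * ((t * M : ℝ) : ℂ))) *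
          ∫ κ in Ioi (0 : ℝ), b κ * wave M t κ)) := by
    intro t ht
    have ht0 : 0 < t := by linarith
    have htC : (t : ℂ) ≠ 0 := by exact_mod_cast ht0.ne'
    have hpow : ((t ^ (3 / 2 : ℝ) : ℝ) : ℂ) = t * (Real.sqrt t : ℝ) := by
      rw [← Complex.ofReal_mul, Real.sqrt_eq_rpow, show (3 / 2 : ℝ) = 1 + 1 / 2 by norm_num,
        Real.rpow_add ht0, Real.rpow_one]
    have hmI : Integrable (fun κ => β * (modelAmp M κ * wave M t κ)) (volume.restrict (Ioi 0)) := by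
      simpa only [mul_assoc, IntegrableOn] using hint t (fun κ => β * modelAmp M κ) (‖β‖ * D)
        (continuousOn_const.mul hD.cont₀) fun κ hκ => hmod κ hκ _ (hD.bound₀ κ hκ)
    have hsum : ∫ κ in Ioi (0 : ℝ), partsAmp M g g₁ κ * wave M t κ =
        β * (∫ κ in Ioi (0 : ℝ), modelAmp M κ * wave M t κ) +
          ∫ κ in Ioi (0 : ℝ), b κ * wave M t κ := by
      rw [← integral_const_mul, ← integral_add hmI
        (hint t b B hbc hb2)]
      congr 1
      ext κ
      simp only [hb]; ring
    have hmodel := integral_modelAmp_mul_wave hM ht0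
    have hcancel : Complex.exp (-(Complex.I * ((t * M : ℝ) : ℂ))) *
        Complex.exp (Complex.I * ((t * M : ℝ) : ℂ)) = 1 := by
      rw [← Complex.exp_add]; simp
    rw [integral_mul_wave_eq hM h hg0 ht0.ne', hsum, hpow]
    set J := ∫ κ in Ioi (0 : ℝ), modelAmp M κ * wave M t κ
    set R := ∫ κ in Ioi (0 : ℝ), b κ * wave M t κ
    set G := ((Real.pi : ℂ) / (((t⁻¹ : ℝ) : ℂ) - Complex.I)) ^ (1 / 2 : ℂ)
    set e := Complex.exp (-(Complex.I * ((t * M : ℝ) : ℂ)))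
    set e' := Complex.exp (Complex.I * ((t * M : ℝ) : ℂ))
    have : (t : ℂ) * ((Real.sqrt t : ℝ) : ℂ) * (e * (Complex.I / t * (β * J + R))) =
        Complex.I * (β * (e * (((Real.sqrt t : ℝ) : ℂ) * J))) +
          Complex.I * (((Real.sqrt t : ℝ) : ℂ) * (e * R)) := by
      field_simp
    rw [this, hmodel, ← mul_assoc e e' G, hcancel, one_mul]
  have hlim1 : Tendsto (fun t : ℝ =>
      Complex.I * (β * (Real.pi / (((t⁻¹ : ℝ) : ℂ) - Complex.I)) ^ (1 / 2 : ℂ))) atTop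
      (𝓝 (Complex.I * (β * (Real.pi / (-Complex.I)) ^ (1 / 2 : ℂ)))) := by
    refine ((Tendsto.cpow ?_ tendsto_const_nhds ?_).const_mul β).const_mul Complex.I
    · refine tendsto_const_nhds.div ?_ (by simp)
      have : Tendsto (fun t : ℝ => ((t⁻¹ : ℝ) : ℂ)) atTop (𝓝 ((0 : ℝ) : ℂ)) :=
        (Complex.continuous_ofReal.tendsto 0).comp tendsto_inv_atTop_zero
      simpa using this.sub_const Complex.I
    · right
      rw [div_neg, Complex.div_I, neg_neg]
      simp [Real.pi_ne_zero]
  have hlim2 : Tendsto (fun t : ℝ => Complex.I * (((Real.sqrt t : ℝ) : ℂ) *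
      (Complex.exp (-(Complex.I * ((t * M : ℝ) : ℂ))) *
        ∫ κ in Ioi (0 : ℝ), b κ * wave M t κ))) atTop (𝓝 0) := by
    rw [tendsto_zero_iff_norm_tendsto_zero]
    have h0 : Tendsto (fun t : ℝ => K * t ^ (-(1 / 4) : ℝ)) atTop (𝓝 0) := by
      simpa using (tendsto_rpow_neg_atTop (by norm_num : (0 : ℝ) < 1 / 4)).const_mul K
    refine tendsto_of_tendsto_of_tendsto_of_le_of_le' tendsto_const_nhds h0
      (Eventually.of_forall fun _ => norm_nonneg _) ?_
    filter_upwards [eventually_ge_atTop 1] with t ht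
    have ht0 : 0 < t := by linarith
    have hR := hR t (by rwa [abs_of_pos ht0])
    have he : ‖Complex.exp (-(Complex.I * ((t * M : ℝ) : ℂ)))‖ = 1 := by
      rw [show -(Complex.I * ((t * M : ℝ) : ℂ)) = ((-(t * M) : ℝ) : ℂ) * Complex.I by
        push_cast; ring]
      exact Complex.norm_exp_ofReal_mul_I _
    rw [abs_of_pos ht0] at hR
    rw [norm_mul, norm_mul, norm_mul, he, Complex.norm_I, one_mul, one_mul, Complex.norm_real,
      Real.norm_of_nonneg (Real.sqrt_nonneg t)]
    refine (mul_le_mul_of_nonneg_left hR (Real.sqrt_nonneg t)).trans_eq ?_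
    rw [Real.sqrt_eq_rpow, show (-(1 / 4) : ℝ) = 1 / 2 + -(1 + 1 / 2) / 2 by norm_num,
      Real.rpow_add ht0]
    ring
  have := hlim1.add hlim2
  rw [add_zero] at this
  refine this.congr' ?_
  filter_upwards [eventually_ge_atTop 1] with t ht
  exact (hsplit t ht).symm

/-! ### The kernel of the loop operator -/

/-- The weight `(1 + |r|) ^ (-3/2)`, the size of the kernels that occur. -/
def decayWeight (r : ℝ) : ℝ := (1 + |r|) ^ (-(3 / 2) : ℝ)

lemma decayWeight_pos (r : ℝ) : 0 < decayWeight r := Real.rpow_pos_of_pos (by positivity) _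

lemma continuous_decayWeight : Continuous decayWeight :=
  Continuous.rpow_const (by fun_prop) fun r => Or.inl (by positivity)

lemma decayWeight_neg (r : ℝ) : decayWeight (-r) = decayWeight r := by simp [decayWeight]

lemma decayWeight_le_of_abs_le {r s : ℝ} (h : |r| ≤ |s|) : decayWeight s ≤ decayWeight r :=
  Real.rpow_le_rpow_of_nonpos (by positivity) (by linarith) (by norm_num)

lemma rpow_le_decayWeight {t : ℝ} (ht : 1 ≤ |t|) :
    |t| ^ (-(3 / 2) : ℝ) ≤ 2 ^ (3 / 2 : ℝ) * decayWeight t := by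
  have h0 : 0 < |t| := by linarith
  rw [decayWeight, Real.rpow_neg (by positivity), Real.rpow_neg (by positivity),
    ← div_eq_mul_inv, inv_eq_one_div, div_le_div_iff₀ (by positivity) (by positivity), one_mul,
    ← Real.mul_rpow (by norm_num) h0.le]
  exact Real.rpow_le_rpow (by positivity) (by linarith) (by norm_num)

lemma integrable_decayWeight : Integrable decayWeight := by
  have := integrable_one_add_norm (E := ℝ) (μ := volume) (r := 3 / 2) (by simp; norm_num)
  simp only [Real.norm_eq_abs] at this
  exact this

section Oscillatory

variable {M C : ℝ} {g g₁ g₂ : ℝ → ℂ}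

lemma norm_mul_amp_le (h : C2Bound (-3) C g g₁ g₂) {κ : ℝ} (hκ : 0 ≤ κ) :
    ‖(κ : ℂ) * g κ‖ ≤ C / (1 + κ) ^ 2 := by
  have hC := h.nonneg
  have h0 := h.bound₀ κ hκ
  rw [rpow_neg_three hκ] at h0
  rw [norm_mul, Complex.norm_real, Real.norm_of_nonneg hκ]
  calc κ * ‖g κ‖ ≤ (1 + κ) * (C * (1 / (1 + κ) ^ 3)) :=
        mul_le_mul (by linarith) h0 (norm_nonneg _) (by positivity)
    _ = C / (1 + κ) ^ 2 := by field_simp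

lemma aestronglyMeasurable_mul_amp (h : C2Bound (-3) C g g₁ g₂) (t : ℝ) :
    AEStronglyMeasurable (fun κ : ℝ => (κ : ℂ) * g κ * wave M t κ) (volume.restrict (Ioi 0)) :=
  (((Complex.continuous_ofReal.continuousOn.mul h.cont₀).mul
    (continuous_wave M t).continuousOn).mono Ioi_subset_Ici_self).aestronglyMeasurable
      measurableSet_Ioi

lemma integrableOn_mul_amp (h : C2Bound (-3) C g g₁ g₂) (t : ℝ) :
    IntegrableOn (fun κ : ℝ => (κ : ℂ) * g κ * wave M t κ) (Ioi 0) := by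
  refine Integrable.mono' (integrableOn_one_add_sq (C := C)) (aestronglyMeasurable_mul_amp h t) ?_
  filter_upwards [ae_restrict_mem measurableSet_Ioi] with κ hκ
  rw [norm_mul, norm_wave, mul_one]
  exact norm_mul_amp_le h (le_of_lt hκ)

lemma continuous_integral_mul_wave (h : C2Bound (-3) C g g₁ g₂) :
    Continuous fun t => ∫ κ in Ioi (0 : ℝ), (κ : ℂ) * g κ * wave M t κ := by
  refine continuous_of_dominated (aestronglyMeasurable_mul_amp h) (fun t => ?_)
    (integrableOn_one_add_sq (C := C)) ?_
  · filter_upwards [ae_restrict_mem measurableSet_Ioi] with κ hκ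
    rw [norm_mul, norm_wave, mul_one]
    exact norm_mul_amp_le h (le_of_lt hκ)
  · refine Eventually.of_forall fun κ => ?_
    unfold wave
    fun_prop

lemma norm_integral_mul_wave_le_decayWeight (hM : 0 < M) (h : C2Growth (-3) g) (hg0 : g 0 = 0) :
    ∃ K : ℝ, 0 ≤ K ∧ ∀ t : ℝ,
      ‖∫ κ in Ioi (0 : ℝ), (κ : ℂ) * g κ * wave M t κ‖ ≤ K * decayWeight t := by
  obtain ⟨C, g₁, g₂, H⟩ := h
  obtain ⟨K, hK, hle⟩ := norm_integral_mul_wave_le hM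
  have hC := H.nonneg
  set B : ℝ := ∫ κ in Ioi (0 : ℝ), C / (1 + κ) ^ 2
  have hB : ∀ t, ‖∫ κ in Ioi (0 : ℝ), (κ : ℂ) * g κ * wave M t κ‖ ≤ B := fun t => by
    refine norm_integral_le_of_norm_le (integrableOn_one_add_sq (C := C)) ?_
    filter_upwards [ae_restrict_mem measurableSet_Ioi] with κ hκ
    rw [norm_mul, norm_wave, mul_one]
    exact norm_mul_amp_le H (le_of_lt hκ)
  have hB0 : 0 ≤ B := (norm_nonneg _).trans (hB 0)
  refine ⟨2 ^ (3 / 2 : ℝ) * (K * C) + B / decayWeight 1,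
    add_nonneg (by positivity) (div_nonneg hB0 (decayWeight_pos 1).le), fun t => ?_⟩
  have hw := decayWeight_pos t
  rw [add_mul]
  rcases le_total 1 |t| with ht | ht
  · have h1 := (hle C g g₁ g₂ H hg0 t ht).trans
      (mul_le_mul_of_nonneg_left (rpow_le_decayWeight ht) (by positivity))
    have : 0 ≤ B / decayWeight 1 * decayWeight t :=
      mul_nonneg (div_nonneg hB0 (decayWeight_pos 1).le) hw.le
    linarith
  · have h1 : B ≤ B / decayWeight 1 * decayWeight t := by
      rw [div_mul_eq_mul_div, le_div_iff₀ (decayWeight_pos 1)]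
      exact mul_le_mul_of_nonneg_left (decayWeight_le_of_abs_le (by simpa using ht)) hB0
    have : 0 ≤ 2 ^ (3 / 2 : ℝ) * (K * C) * decayWeight t := by positivity
    linarith [hB t]

/-- The imaginary part of the oscillatory integral oscillates like `cos (M t + φ)`, so it cannot be
small both at `t` and a quarter of a period later. -/
lemma decayWeight_le_abs_im_add (hM : 0 < M) (h : C2Bound (-3) C g g₁ g₂) (hg0 : g 0 = 0)
    (hg1 : g₁ 0 ≠ 0) : ∃ c R τ : ℝ, 0 < c ∧ 0 < R ∧ 0 < τ ∧ ∀ t, R ≤ t → c * decayWeight t ≤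
      |(∫ κ in Ioi (0 : ℝ), (κ : ℂ) * g κ * wave M t κ).im| +
      |(∫ κ in Ioi (0 : ℝ), (κ : ℂ) * g κ * wave M (t + τ) κ).im| := by
  set X : ℝ → ℂ := fun t => ∫ κ in Ioi (0 : ℝ), (κ : ℂ) * g κ * wave M t κ with hX
  set L : ℂ := Complex.I * (g₁ 0 * M / modelAmp M 0 * (Real.pi / (-Complex.I)) ^ (1 / 2 : ℂ))
    with hL
  have hL0 : L ≠ 0 := by
    have h1 : (Real.pi : ℂ) / (-Complex.I) ≠ 0 := by simp [Real.pi_ne_zero]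
    have h2 := modelAmp_zero hM
    have h3 : (M : ℂ) ≠ 0 := by exact_mod_cast hM.ne'
    have h4 : ((Real.pi : ℂ) / (-Complex.I)) ^ (1 / 2 : ℂ) ≠ 0 := by
      rw [Ne, Complex.cpow_eq_zero_iff]; tauto
    rw [hL]
    exact mul_ne_zero Complex.I_ne_zero (mul_ne_zero (div_ne_zero (mul_ne_zero hg1 h3) h2) h4)
  have hLpos : 0 < ‖L‖ := norm_pos_iff.2 hL0
  have hlim := tendsto_integral_mul_wave hM h hg0
  set Y : ℝ → ℂ := fun t => ((t ^ (3 / 2 : ℝ) : ℝ) : ℂ) *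
    (Complex.exp (-(Complex.I * ((t * M : ℝ) : ℂ))) * X t) with hY
  have hev : ∀ᶠ t in atTop, ‖Y t - L‖ < ‖L‖ / 8 := by
    have := (Metric.tendsto_nhds.1 hlim) (‖L‖ / 8) (by positivity)
    simpa only [dist_eq_norm] using this
  obtain ⟨R, hR⟩ := eventually_atTop.1 hev
  set τ : ℝ := Real.pi / (2 * M) with hτ
  have hτ0 : 0 < τ := by positivity
  have hXY : ∀ t, 0 < t → ((t ^ (3 / 2 : ℝ) : ℝ) : ℂ) * X t =
      Complex.exp (Complex.I * ((t * M : ℝ) : ℂ)) * Y t := by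
    intro t _
    have hcancel : Complex.exp (Complex.I * ((t * M : ℝ) : ℂ)) *
        Complex.exp (-(Complex.I * ((t * M : ℝ) : ℂ))) = 1 := by
      rw [← Complex.exp_add]; simp
    calc ((t ^ (3 / 2 : ℝ) : ℝ) : ℂ) * X t = (Complex.exp (Complex.I * ((t * M : ℝ) : ℂ)) *
          Complex.exp (-(Complex.I * ((t * M : ℝ) : ℂ)))) * (((t ^ (3 / 2 : ℝ) : ℝ) : ℂ) * X t) := by
          rw [hcancel, one_mul]
      _ = _ := by simp only [hY]; ring
  have hnorm1 : ∀ t : ℝ, ‖Complex.exp (Complex.I * ((t * M : ℝ) : ℂ))‖ = 1 := fun t => by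
    rw [mul_comm]; exact Complex.norm_exp_ofReal_mul_I _
  have hshift : ∀ t : ℝ, Complex.exp (Complex.I * (((t + τ) * M : ℝ) : ℂ)) =
      Complex.I * Complex.exp (Complex.I * ((t * M : ℝ) : ℂ)) := by
    intro t
    have : (t + τ) * M = t * M + Real.pi / 2 := by rw [hτ]; field_simp
    rw [this, Complex.ofReal_add, mul_add, Complex.exp_add, mul_comm]
    congr 1
    rw [mul_comm]; push_cast; exact Complex.exp_pi_div_two_mul_I
  refine ⟨‖L‖ / 2 * (1 + τ) ^ (-(3 / 2) : ℝ), max R 1, τ, by positivity, by positivity, hτ0, fun t ht => ?_⟩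
  have hRt : R ≤ t := (le_max_left _ _).trans ht
  have ht1 : 1 ≤ t := (le_max_right _ _).trans ht
  have ht0 : 0 < t := by linarith
  have hT0 : 0 < t + τ := by linarith
  set v : ℂ := Complex.exp (Complex.I * ((t * M : ℝ) : ℂ)) * L with hv
  have hv1 : ‖v‖ = ‖L‖ := by rw [hv, norm_mul, hnorm1, one_mul]
  have hp : 0 < t ^ (3 / 2 : ℝ) := by positivity
  have hp' : 0 < (t + τ) ^ (3 / 2 : ℝ) := by positivity
  have e1 : |v.im| - ‖L‖ / 8 ≤ t ^ (3 / 2 : ℝ) * |(X t).im| := by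
    have h1 : t ^ (3 / 2 : ℝ) * (X t).im = (v + Complex.exp (Complex.I * ((t * M : ℝ) : ℂ)) *
        (Y t - L)).im := by
      rw [← Complex.im_ofReal_mul, hXY t ht0, hv]; congr 1; ring
    have h2 : |(Complex.exp (Complex.I * ((t * M : ℝ) : ℂ)) * (Y t - L)).im| ≤ ‖L‖ / 8 := by
      refine (Complex.abs_im_le_norm _).trans ?_
      rw [norm_mul, hnorm1, one_mul]
      exact (hR t hRt).le
    rw [← abs_of_pos hp, ← abs_mul, h1, Complex.add_im]
    have := abs_sub_abs_le_abs_sub v.im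
      (-(Complex.exp (Complex.I * ((t * M : ℝ) : ℂ)) * (Y t - L)).im)
    rw [sub_neg_eq_add, abs_neg] at this
    linarith
  have e2 : |v.re| - ‖L‖ / 8 ≤ (t + τ) ^ (3 / 2 : ℝ) * |(X (t + τ)).im| := by
    have h1 : (t + τ) ^ (3 / 2 : ℝ) * (X (t + τ)).im =
        (v + Complex.exp (Complex.I * ((t * M : ℝ) : ℂ)) * (Y (t + τ) - L)).re := by
      rw [← Complex.im_ofReal_mul, hXY _ hT0, hshift, hv, mul_assoc, Complex.I_mul_im]
      congr 1; ring
    have h2 : |(Complex.exp (Complex.I * ((t * M : ℝ) : ℂ)) * (Y (t + τ) - L)).re| ≤ ‖L‖ / 8 := by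
      refine (Complex.abs_re_le_norm _).trans ?_
      rw [norm_mul, hnorm1, one_mul]
      exact (hR (t + τ) (by linarith)).le
    rw [← abs_of_pos hp', ← abs_mul, h1, Complex.add_re]
    have := abs_sub_abs_le_abs_sub v.re
      (-(Complex.exp (Complex.I * ((t * M : ℝ) : ℂ)) * (Y (t + τ) - L)).re)
    rw [sub_neg_eq_add, abs_neg] at this
    linarith
  have e3 := Complex.norm_le_abs_re_add_abs_im v
  rw [hv1] at e3
  have hpp : t ^ (3 / 2 : ℝ) ≤ (t + τ) ^ (3 / 2 : ℝ) :=
    Real.rpow_le_rpow ht0.le (by linarith) (by norm_num)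
  have e4 : ‖L‖ / 2 ≤ (t + τ) ^ (3 / 2 : ℝ) * (|(X t).im| + |(X (t + τ)).im|) := by
    have := mul_le_mul_of_nonneg_right hpp (abs_nonneg (X t).im)
    linarith
  have e5 : (t + τ) ^ (3 / 2 : ℝ) * ((1 + τ) ^ (-(3 / 2) : ℝ) * decayWeight t) ≤ 1 := by
    rw [decayWeight, abs_of_pos ht0, ← Real.mul_rpow (by positivity) (by positivity),
      Real.rpow_neg (by positivity), ← div_eq_mul_inv]
    refine div_le_one_of_le₀ (Real.rpow_le_rpow hT0.le ?_ (by norm_num)) (by positivity)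
    nlinarith [mul_pos hτ0 ht0]
  have hw := decayWeight_pos t
  calc ‖L‖ / 2 * (1 + τ) ^ (-(3 / 2) : ℝ) * decayWeight t
      ≤ (t + τ) ^ (3 / 2 : ℝ) * (|(X t).im| + |(X (t + τ)).im|) * (1 + τ) ^ (-(3 / 2) : ℝ) *
          decayWeight t := by gcongr
    _ = (t + τ) ^ (3 / 2 : ℝ) * ((1 + τ) ^ (-(3 / 2) : ℝ) * decayWeight t) *
          (|(X t).im| + |(X (t + τ)).im|) := by ring
    _ ≤ 1 * (|(X t).im| + |(X (t + τ)).im|) := by gcongr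
    _ = _ := one_mul _

end Oscillatory

section LoopKernel

variable {m a : ℝ}

/-- The mass `√(|p|² + 4m²)` of the two-particle threshold at momentum `p`. -/
def thresholdMass (m : ℝ) (p : Space) : ℝ := Real.sqrt (‖p‖ ^ 2 + 4 * m ^ 2)

lemma thresholdMass_pos (hm : 0 < m) (p : Space) : 0 < thresholdMass m p :=
  Real.sqrt_pos.2 (by positivity)

lemma thresholdMass_sq (m : ℝ) (p : Space) : thresholdMass m p ^ 2 = ‖p‖ ^ 2 + 4 * m ^ 2 :=
  Real.sq_sqrt (by positivity)

/-- The amplitude of `loopKernel`, without the explicit factor `κ`, in the variable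
`κ = √(M² - 4m²)`. -/
def loopAmp (m a : ℝ) (p : Space) (κ : ℝ) : ℂ :=
  (κ : ℂ) * (((-(1 / (8 * Real.pi ^ 2)) : ℝ) : ℂ) *
    ((((Real.sqrt (κ ^ 2 + 4 * m ^ 2))⁻¹ : ℝ) : ℂ) * (((κ ^ 2 + (4 * m ^ 2 + a))⁻¹ : ℝ) : ℂ) *
      (((Real.sqrt (κ ^ 2 + thresholdMass m p ^ 2))⁻¹ : ℝ) : ℂ)))

lemma c2Bound_loopAmp (hm : 0 < m) (ha : -(4 * m ^ 2) < a) (p : Space) :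
    ∃ C g₁ g₂, C2Bound (-3) C (loopAmp m a p) g₁ g₂ ∧ g₁ 0 ≠ 0 := by
  have hM := thresholdMass_pos hm p
  have h0 : C2Growth (-4) _ := (((C2Growth.inv_sqrt (b := 4 * m ^ 2) (by positivity)).mul
    (C2Growth.inv_quadratic (b := 4 * m ^ 2 + a) (by linarith))).mul
    (C2Growth.inv_sqrt (b := thresholdMass m p ^ 2) (by positivity))).const_mul
      ((-(1 / (8 * Real.pi ^ 2)) : ℝ) : ℂ) |>.mono (by norm_num)
  obtain ⟨C, g₁, g₂, H⟩ := (C2Growth.ofReal_id.mul h0).mono (e' := -3) (by norm_num)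
  refine ⟨C, g₁, g₂, H, ?_⟩
  obtain ⟨D, q₁, q₂, Q⟩ := h0
  have hd := (Complex.ofRealCLM.hasDerivAt (x := (0 : ℝ))).fun_mul (Q.deriv₁ 0 le_rfl)
  have := (H.deriv₁ 0 le_rfl).unique hd
  rw [this]
  have hb : 4 * m ^ 2 + a ≠ 0 := by linarith
  have h1 : Real.sqrt (4 * m ^ 2) ≠ 0 := (Real.sqrt_pos.2 (by positivity)).ne'
  have h2 : Real.sqrt (thresholdMass m p ^ 2) ≠ 0 := (Real.sqrt_pos.2 (by positivity)).ne'
  have hπ := Real.pi_ne_zero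
  simp only [Complex.ofRealCLM_apply, Complex.ofReal_zero, zero_mul, add_zero, one_mul, ne_eq,
    OfNat.ofNat_ne_zero, not_false_eq_true, zero_pow, zero_add, Complex.ofReal_one,
    mul_eq_zero, Complex.ofReal_eq_zero, inv_eq_zero, neg_eq_zero, not_or]
  refine ⟨?_, ⟨h1, hb⟩, h2⟩
  positivity

lemma loopAmp_zero (p : Space) : loopAmp m a p 0 = 0 := by simp [loopAmp]

/-- The kernel in the variable `κ = √(M² - 4m²)`: the measure `dM² = 2 κ dκ` and the square
root in the spectral density contribute one factor `κ` each. -/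
lemma loopKernel_eq (hm : 0 < m) (ha : -(4 * m ^ 2) < a) (t : ℝ) (p : Space) :
    loopKernel m a t p =
      (∫ κ in Ioi (0 : ℝ), (κ : ℂ) * loopAmp m a p κ * wave (thresholdMass m p) t κ).im := by
  obtain ⟨C, g₁, g₂, H, -⟩ := c2Bound_loopAmp hm ha p
  rw [loopKernel, integral_Ioi_eq_integral_sq]
  have him := integral_im (𝕜 := ℂ) (integrableOn_mul_amp (M := thresholdMass m p) H t)
  simp only [RCLike.im_to_complex] at him
  rw [← him]
  refine setIntegral_congr_fun measurableSet_Ioi fun κ hκ => ?_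
  have hκ : 0 < κ := hκ
  have h1 : 0 < κ ^ 2 + 4 * m ^ 2 := by positivity
  have hdisp : disp (thresholdMass m p) κ = Real.sqrt (‖p‖ ^ 2 + (4 * m ^ 2 + κ ^ 2)) := by
    rw [disp, thresholdMass_sq]; congr 1; ring
  have hs : Real.sqrt (1 - 4 * m ^ 2 / (4 * m ^ 2 + κ ^ 2)) =
      κ * (Real.sqrt (κ ^ 2 + 4 * m ^ 2))⁻¹ := by
    rw [show 1 - 4 * m ^ 2 / (4 * m ^ 2 + κ ^ 2) = κ ^ 2 / (κ ^ 2 + 4 * m ^ 2) by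
      field_simp; ring, Real.sqrt_div (by positivity), Real.sqrt_sq hκ.le, div_eq_mul_inv]
  have hw : (wave (thresholdMass m p) t κ).im = Real.sin (t * disp (thresholdMass m p) κ) := by
    rw [wave, mul_comm, Complex.exp_ofReal_mul_I_im]
  have hL : (κ : ℂ) * loopAmp m a p κ = ((κ * (κ * (-(1 / (8 * Real.pi ^ 2)) *
      ((Real.sqrt (κ ^ 2 + 4 * m ^ 2))⁻¹ * (κ ^ 2 + (4 * m ^ 2 + a))⁻¹ *
        (disp (thresholdMass m p) κ)⁻¹))) : ℝ) : ℂ) := by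
    simp only [loopAmp, disp]; push_cast; ring
  rw [hL, Complex.im_ofReal_mul, hw, retardedFourier, spectralDensity, hs, ← hdisp, smul_eq_mul,
    mul_comm t]
  have h2 : (4 * m ^ 2 + κ ^ 2 + a) ≠ 0 := by nlinarith
  have h3 : κ ^ 2 + (4 * m ^ 2 + a) ≠ 0 := by nlinarith
  have h4 : disp (thresholdMass m p) κ ≠ 0 := (disp_pos (thresholdMass_pos hm p) κ).ne'
  have h5 := Real.pi_ne_zero
  have h6 : Real.sqrt (κ ^ 2 + 4 * m ^ 2) ≠ 0 := (Real.sqrt_pos.2 h1).ne'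
  field_simp
  ring

lemma continuous_loopKernel (hm : 0 < m) (ha : -(4 * m ^ 2) < a) (p : Space) :
    Continuous fun t => loopKernel m a t p := by
  obtain ⟨C, g₁, g₂, H, -⟩ := c2Bound_loopAmp hm ha p
  simp only [loopKernel_eq hm ha]
  exact Complex.continuous_im.comp (continuous_integral_mul_wave H)

lemma abs_loopKernel_le (hm : 0 < m) (ha : -(4 * m ^ 2) < a) (p : Space) :
    ∃ K : ℝ, 0 ≤ K ∧ ∀ t, |loopKernel m a t p| ≤ K * decayWeight t := by
  obtain ⟨C, g₁, g₂, H, -⟩ := c2Bound_loopAmp hm ha p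
  obtain ⟨K, hK, h⟩ := norm_integral_mul_wave_le_decayWeight (thresholdMass_pos hm p)
    ⟨C, g₁, g₂, H⟩ (loopAmp_zero p)
  refine ⟨K, hK, fun t => ?_⟩
  rw [loopKernel_eq hm ha]
  exact (Complex.abs_im_le_norm _).trans (h t)

/-- The kernel decays not faster than `t^{-3/2}`: it cannot be small both at `t` and a quarter of the
threshold period later. -/
lemma decayWeight_le_abs_loopKernel_add (hm : 0 < m) (ha : -(4 * m ^ 2) < a) (p : Space) :
    ∃ c R τ : ℝ, 0 < c ∧ 0 < R ∧ 0 < τ ∧ ∀ t, R ≤ t →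
      c * decayWeight t ≤ |loopKernel m a t p| + |loopKernel m a (t + τ) p| := by
  obtain ⟨C, g₁, g₂, H, hne⟩ := c2Bound_loopAmp hm ha p
  simp only [loopKernel_eq hm ha]
  exact decayWeight_le_abs_im_add (thresholdMass_pos hm p) H (loopAmp_zero p) hne

end LoopKernel

/-! ### The Laplace transform of the kernel and the symbol of the equation -/

section Laplace

variable {m a : ℝ}

lemma loopAmp_eq_ofReal (p : Space) (κ : ℝ) : loopAmp m a p κ = ((loopAmp m a p κ).re : ℂ) := by
  have h : loopAmp m a p κ = ((κ * (-(1 / (8 * Real.pi ^ 2)) * ((Real.sqrt (κ ^ 2 + 4 * m ^ 2))⁻¹ *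
      (κ ^ 2 + (4 * m ^ 2 + a))⁻¹ * (Real.sqrt (κ ^ 2 + thresholdMass m p ^ 2))⁻¹)) : ℝ) : ℂ) := by
    unfold loopAmp; push_cast; ring
  rw [h, Complex.ofReal_re]

lemma ofReal_loopKernel (hm : 0 < m) (ha : -(4 * m ^ 2) < a) (t : ℝ) (p : Space) :
    (loopKernel m a t p : ℂ) = ∫ κ in Ioi (0 : ℝ), (κ : ℂ) * loopAmp m a p κ *
      ((Real.sin (t * disp (thresholdMass m p) κ) : ℝ) : ℂ) := by
  obtain ⟨C, g₁, g₂, H, -⟩ := c2Bound_loopAmp hm ha p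
  have him := integral_im (𝕜 := ℂ) (integrableOn_mul_amp (M := thresholdMass m p) H t)
  simp only [RCLike.im_to_complex] at him
  rw [loopKernel_eq hm ha, ← him, ← integral_complex_ofReal]
  refine setIntegral_congr_fun measurableSet_Ioi fun κ _ => ?_
  rw [loopAmp_eq_ofReal, ← Complex.ofReal_mul, Complex.im_ofReal_mul, wave, mul_comm Complex.I,
    Complex.exp_ofReal_mul_I_im, ← Complex.ofReal_mul]

lemma continuous_loopAmp (hm : 0 < m) (ha : -(4 * m ^ 2) < a) (p : Space) :
    Continuous (loopAmp m a p) := by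
  have hM := thresholdMass_pos hm p
  unfold loopAmp
  refine Complex.continuous_ofReal.mul (continuous_const.mul (((Complex.continuous_ofReal.comp
    (Continuous.inv₀ (by fun_prop) fun κ => ?_)).mul (Complex.continuous_ofReal.comp
    (Continuous.inv₀ (by fun_prop) fun κ => ?_))).mul (Complex.continuous_ofReal.comp
    (Continuous.inv₀ (by fun_prop) fun κ => ?_))))
  · have : 0 < κ ^ 2 + 4 * m ^ 2 := by positivity
    exact (Real.sqrt_pos.2 this).ne'
  · nlinarith
  · have : 0 < κ ^ 2 + thresholdMass m p ^ 2 := by positivity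
    exact (Real.sqrt_pos.2 this).ne'

/-- The Laplace transform of the kernel `t ↦ loopKernel m a t p`. -/
def laplaceKernel (m a : ℝ) (p : Space) (s : ℂ) : ℂ :=
  ∫ t in Ioi (0 : ℝ), (loopKernel m a t p : ℂ) * Complex.exp (-s * t)

lemma norm_exp_neg_mul_le {s : ℂ} (hs : 0 ≤ s.re) {t : ℝ} (ht : 0 ≤ t) :
    ‖Complex.exp (-s * t)‖ ≤ 1 := by
  rw [Complex.norm_exp]
  have : (-s * (t : ℂ)).re = -(s.re * t) := by simp
  rw [this]
  exact Real.exp_le_one_iff.2 (by have := mul_nonneg hs ht; linarith)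

lemma continuousOn_laplaceKernel (hm : 0 < m) (ha : -(4 * m ^ 2) < a) (p : Space) :
    ContinuousOn (laplaceKernel m a p) {s | 0 ≤ s.re} := by
  obtain ⟨K, hK, hle⟩ := abs_loopKernel_le hm ha p
  have hc := continuous_loopKernel hm ha p
  intro s₀ hs₀
  refine continuousWithinAt_of_dominated (bound := fun t => K * decayWeight t) ?_ ?_
    (integrable_decayWeight.const_mul K).integrableOn ?_
  · refine Eventually.of_forall fun s => Continuous.aestronglyMeasurable ?_
    fun_prop
  · filter_upwards [self_mem_nhdsWithin] with s hs
    filter_upwards [ae_restrict_mem measurableSet_Ioi] with t ht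
    rw [norm_mul, Complex.norm_real]
    exact (mul_le_of_le_one_right (norm_nonneg _) (norm_exp_neg_mul_le hs (le_of_lt ht))).trans
      (hle t)
  · refine Eventually.of_forall fun t => ?_
    exact (Continuous.continuousWithinAt (by fun_prop))

lemma integral_sin_mul_exp {s : ℂ} (hs : 0 < s.re) {w : ℝ} :
    ∫ t in Ioi (0 : ℝ), ((Real.sin (t * w) : ℝ) : ℂ) * Complex.exp (-s * t) =
      w / (s ^ 2 + w ^ 2) := by
  have h1 : (Complex.I * w - s).re < 0 := by simpa using hs
  have h2 : (-(Complex.I * w) - s).re < 0 := by simpa using hs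
  have n1 : Complex.I * w - s ≠ 0 := fun h => by rw [h] at h1; simp at h1
  have n2 : -(Complex.I * w) - s ≠ 0 := fun h => by rw [h] at h2; simp at h2
  have n3 : s ^ 2 + (w : ℂ) ^ 2 ≠ 0 := by
    have : s ^ 2 + (w : ℂ) ^ 2 = (Complex.I * w - s) * (-(Complex.I * w) - s) := by
      linear_combination ((w : ℂ) ^ 2) * Complex.I_sq
    rw [this]; exact mul_ne_zero n1 n2
  have e : ∀ t : ℝ, ((Real.sin (t * w) : ℝ) : ℂ) * Complex.exp (-s * t) =
      (Complex.exp ((-(Complex.I * w) - s) * t) - Complex.exp ((Complex.I * w - s) * t)) *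
        (Complex.I / 2) := by
    intro t
    have e1 : Complex.exp ((-(Complex.I * w) - s) * t) =
        Complex.exp (-((t * w : ℝ) : ℂ) * Complex.I) * Complex.exp (-s * t) := by
      rw [← Complex.exp_add]; congr 1; push_cast; ring
    have e2 : Complex.exp ((Complex.I * w - s) * t) =
        Complex.exp (((t * w : ℝ) : ℂ) * Complex.I) * Complex.exp (-s * t) := by
      rw [← Complex.exp_add]; congr 1; push_cast; ring
    rw [Complex.ofReal_sin, Complex.sin, e1, e2]
    ring
  simp only [e]
  rw [integral_mul_const, integral_sub (integrableOn_exp_mul_complex_Ioi h2 0)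
    (integrableOn_exp_mul_complex_Ioi h1 0), integral_exp_mul_complex_Ioi h2,
    integral_exp_mul_complex_Ioi h1]
  simp only [Complex.ofReal_zero, mul_zero, Complex.exp_zero]
  field_simp
  linear_combination (-2 * (w : ℂ) * s ^ 2) * Complex.I_sq

/-- The value of `-□`, that is of `∂ₜ² + |p|²`, on `e^{st}` at momentum `p`. -/
def boxSymbol (p : Space) (s : ℂ) : ℂ := s ^ 2 + ((‖p‖ ^ 2 : ℝ) : ℂ)

lemma continuous_boxSymbol (p : Space) : Continuous (boxSymbol p) := by
  unfold boxSymbol; fun_prop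

/-- In the right half-plane, the Laplace transform of the kernel is `F_a` up to an elementary
factor. -/
theorem sub_mul_laplaceKernel (hm : 0 < m) (ha : -(4 * m ^ 2) < a) (p : Space) {s : ℂ}
    (hs : 0 < s.re) : ((a : ℂ) - boxSymbol p s) * laplaceKernel m a p s =
      ((1 / (16 * Real.pi ^ 2) : ℝ) : ℂ) * Fa m a (boxSymbol p s) := by
  obtain ⟨C, g₁, g₂, H, -⟩ := c2Bound_loopAmp hm ha p
  have hM := thresholdMass_pos hm p
  set M := thresholdMass m p with hMdef
  have hswap : laplaceKernel m a p s = ∫ κ in Ioi (0 : ℝ), (κ : ℂ) * loopAmp m a p κ *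
      ((disp M κ : ℂ) / (s ^ 2 + (disp M κ : ℂ) ^ 2)) := by
    unfold laplaceKernel
    simp only [ofReal_loopKernel hm ha, ← integral_mul_const]
    rw [integral_integral_swap]
    · refine setIntegral_congr_fun measurableSet_Ioi fun κ _ => ?_
      simp only [mul_assoc]
      rw [integral_const_mul, integral_const_mul, ← integral_sin_mul_exp hs]
    · have hE : IntegrableOn (fun t : ℝ => Real.exp (-s.re * t)) (Ioi 0) :=
        integrableOn_exp_mul_Ioi (by linarith) 0
      have hdom := hE.mul_prod (integrableOn_one_add_sq (C := C))
      refine Integrable.mono' hdom ?_ ?_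
      · have := continuous_loopAmp hm ha p
        have := continuous_disp M
        refine Continuous.aestronglyMeasurable ?_
        unfold Function.uncurry
        fun_prop
      · rw [Measure.prod_restrict]
        filter_upwards [ae_restrict_mem (measurableSet_Ioi.prod measurableSet_Ioi)] with x hx
        have hx2 : 0 < x.2 := hx.2
        simp only [Function.uncurry]
        rw [norm_mul, norm_mul, Complex.norm_real, mul_comm]
        refine mul_le_mul ?_ ?_ (by positivity) (Real.exp_pos _).le
        · rw [Complex.norm_exp]
          simp
        · exact (mul_le_of_le_one_right (norm_nonneg _) (Real.abs_sin_le_one _)).trans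
            (norm_mul_amp_le H hx2.le)
  have hFa : Fa m a (boxSymbol p s) = ∫ κ in Ioi (0 : ℝ), (2 * κ) •
      ((Real.sqrt (1 - 4 * m ^ 2 / (4 * m ^ 2 + κ ^ 2)) : ℂ) *
        (1 / (((4 * m ^ 2 + κ ^ 2 : ℝ) : ℂ) + (a : ℂ)) -
          1 / (((4 * m ^ 2 + κ ^ 2 : ℝ) : ℂ) + boxSymbol p s))) := by
    unfold Fa
    exact integral_Ioi_eq_integral_sq (4 * m ^ 2) _
  rw [hswap, hFa, ← integral_const_mul, ← integral_const_mul]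
  refine setIntegral_congr_fun measurableSet_Ioi fun κ hκ => ?_
  have hκ : 0 < κ := hκ
  have h1 : 0 < κ ^ 2 + 4 * m ^ 2 := by positivity
  have hsq : Real.sqrt (1 - 4 * m ^ 2 / (4 * m ^ 2 + κ ^ 2)) =
      κ * (Real.sqrt (κ ^ 2 + 4 * m ^ 2))⁻¹ := by
    rw [show 1 - 4 * m ^ 2 / (4 * m ^ 2 + κ ^ 2) = κ ^ 2 / (κ ^ 2 + 4 * m ^ 2) by
      field_simp; ring, Real.sqrt_div (by positivity), Real.sqrt_sq hκ.le, div_eq_mul_inv]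
  have hd : (disp M κ : ℂ) ^ 2 = (κ : ℂ) ^ 2 + ((‖p‖ ^ 2 : ℝ) : ℂ) + 4 * (m : ℂ) ^ 2 := by
    have := disp_sq M κ
    rw [hMdef, thresholdMass_sq] at this
    rw [← Complex.ofReal_pow, this]; push_cast; ring
  have hden : s ^ 2 + (disp M κ : ℂ) ^ 2 ≠ 0 := by
    have h1 : (Complex.I * disp M κ - s) ≠ 0 := fun h => by
      have := congrArg Complex.re h; simp at this; linarith
    have h2 : (-(Complex.I * disp M κ) - s) ≠ 0 := fun h => by
      have := congrArg Complex.re h; simp at this; linarith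
    have : s ^ 2 + (disp M κ : ℂ) ^ 2 =
        (Complex.I * disp M κ - s) * (-(Complex.I * disp M κ) - s) := by
      linear_combination ((disp M κ : ℂ) ^ 2) * Complex.I_sq
    rw [this]; exact mul_ne_zero h1 h2
  have hden' : ((4 * m ^ 2 + κ ^ 2 : ℝ) : ℂ) + boxSymbol p s = s ^ 2 + (disp M κ : ℂ) ^ 2 := by
    rw [hd, boxSymbol]; push_cast; ring
  have hz : (a : ℂ) - boxSymbol p s =
      (((4 * m ^ 2 + κ ^ 2 : ℝ) : ℂ) + a) - (s ^ 2 + (disp M κ : ℂ) ^ 2) := by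
    rw [← hden']; ring
  have ha' : (((4 * m ^ 2 + κ ^ 2 : ℝ) : ℂ) + a) ≠ 0 := by
    have : (4 * m ^ 2 + κ ^ 2 + a : ℝ) ≠ 0 := by nlinarith
    exact_mod_cast this
  have hL : loopAmp m a p κ = (κ : ℂ) * (((-(1 / (8 * Real.pi ^ 2)) : ℝ) : ℂ) *
      ((((Real.sqrt (κ ^ 2 + 4 * m ^ 2))⁻¹ : ℝ) : ℂ) * (((4 * m ^ 2 + κ ^ 2 : ℝ) : ℂ) + a)⁻¹ *
        (disp M κ : ℂ)⁻¹)) := by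
    simp only [loopAmp, ← hMdef, disp, Complex.ofReal_inv]
    congr 6
    push_cast; ring
  have hM0 : (disp M κ : ℂ) ≠ 0 := by exact_mod_cast (disp_pos hM κ).ne'
  have hpi : (Real.pi : ℂ) ≠ 0 := by exact_mod_cast Real.pi_ne_zero
  simp only [Complex.real_smul, hsq, hden', hL, hz]
  set X : ℂ := ((4 * m ^ 2 + κ ^ 2 : ℝ) : ℂ) + a
  set Z : ℂ := s ^ 2 + (disp M κ : ℂ) ^ 2
  set q : ℝ := (Real.sqrt (κ ^ 2 + 4 * m ^ 2))⁻¹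
  push_cast
  field_simp
  ring

/-- The symbol of the linearized semiclassical equation at momentum `p`, on the closed right
half-plane of the Laplace variable `s`. -/
def symbolAt (m a hbar lam lam₁ lam₂ g₁ g₂ : ℝ) (p : Space) (s : ℂ) : ℂ :=
  -((lam₁ + lam₂ * boxSymbol p s) * ((hbar * lam : ℝ) : ℂ) *
      (((a : ℂ) - boxSymbol p s) * laplaceKernel m a p s)) - (g₁ + g₂ * boxSymbol p s)

variable {hbar lam lam₁ lam₂ g₁ g₂ : ℝ}

lemma continuousOn_symbolAt (hm : 0 < m) (ha : -(4 * m ^ 2) < a) (p : Space) :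
    ContinuousOn (symbolAt m a hbar lam lam₁ lam₂ g₁ g₂ p) {s | 0 ≤ s.re} := by
  have h1 := continuousOn_laplaceKernel hm ha p
  have h2 := (continuous_boxSymbol p).continuousOn (s := {s : ℂ | 0 ≤ s.re})
  unfold symbolAt
  fun_prop

lemma symbolAt_eq_S (hm : 0 < m) (ha : -(4 * m ^ 2) < a) (p : Space) {s : ℂ} (hs : 0 < s.re) :
    symbolAt m a hbar lam lam₁ lam₂ g₁ g₂ p s =
      S m a hbar lam lam₁ lam₂ g₁ g₂ (boxSymbol p s) := by
  rw [symbolAt, sub_mul_laplaceKernel hm ha p hs, S, coupling]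
  push_cast
  ring

lemma laplaceKernel_conj (p : Space) (s : ℂ) :
    laplaceKernel m a p ((starRingEnd ℂ) s) = (starRingEnd ℂ) (laplaceKernel m a p s) := by
  unfold laplaceKernel
  rw [← integral_conj]
  congr 1
  ext t
  rw [map_mul, Complex.conj_ofReal, ← Complex.exp_conj, map_mul, map_neg, Complex.conj_ofReal]

lemma boxSymbol_conj (p : Space) (s : ℂ) :
    boxSymbol p ((starRingEnd ℂ) s) = (starRingEnd ℂ) (boxSymbol p s) := by
  simp [boxSymbol]

lemma symbolAt_conj (p : Space) (s : ℂ) : symbolAt m a hbar lam lam₁ lam₂ g₁ g₂ p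
    ((starRingEnd ℂ) s) = (starRingEnd ℂ) (symbolAt m a hbar lam lam₁ lam₂ g₁ g₂ p s) := by
  simp only [symbolAt, laplaceKernel_conj, boxSymbol_conj, map_sub, map_neg, map_mul, map_add,
    Complex.conj_ofReal]

lemma boxSymbol_ofReal_mul_I (p : Space) (w : ℝ) :
    boxSymbol p (w * Complex.I) = ((‖p‖ ^ 2 - w ^ 2 : ℝ) : ℂ) := by
  rw [boxSymbol, mul_pow, Complex.I_sq]; push_cast; ring

lemma tendsto_add_mul_I (w : ℝ) :
    Tendsto (fun ε : ℝ => (ε : ℂ) + w * Complex.I) (𝓝[>] 0) (𝓝[{s | 0 ≤ s.re}] (w * Complex.I)) := by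
  refine tendsto_nhdsWithin_iff.2 ⟨?_, ?_⟩
  · have : Continuous fun ε : ℝ => (ε : ℂ) + w * Complex.I := by fun_prop
    simpa using (this.tendsto 0).mono_left nhdsWithin_le_nhds
  · filter_upwards [self_mem_nhdsWithin] with ε hε
    have : 0 < ε := hε
    simpa using this.le

lemma boxSymbol_add_mul_I_im (p : Space) (ε w : ℝ) :
    (boxSymbol p ((ε : ℂ) + w * Complex.I)).im = 2 * ε * w := by
  simp [boxSymbol, sq]; ring

/-- On the imaginary axis beyond the threshold, the symbol is the boundary value of `S` on the cut. -/
theorem symbolAt_mul_I (hm : 0 < m) (ha : -(4 * m ^ 2) < a) (p : Space) {κ : ℝ} (hκ : 0 ≤ κ) :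
    symbolAt m a hbar lam lam₁ lam₂ g₁ g₂ p (disp (thresholdMass m p) κ * Complex.I) =
      SPlus m a hbar lam lam₁ lam₂ g₁ g₂ κ := by
  have hM := thresholdMass_pos hm p
  set w := disp (thresholdMass m p) κ with hw
  have hw0 : 0 < w := disp_pos hM κ
  have h1 : Tendsto (fun ε : ℝ => symbolAt m a hbar lam lam₁ lam₂ g₁ g₂ p ((ε : ℂ) + w * Complex.I))
      (𝓝[>] 0) (𝓝 (symbolAt m a hbar lam lam₁ lam₂ g₁ g₂ p (w * Complex.I))) :=
    ((continuousOn_symbolAt hm ha p) (w * Complex.I) (by simp)).tendsto.comp (tendsto_add_mul_I w)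
  have hz : boxSymbol p (w * Complex.I) = -((4 * m ^ 2 + κ ^ 2 : ℝ) : ℂ) := by
    rw [boxSymbol_ofReal_mul_I, hw, disp_sq, thresholdMass_sq, ← Complex.ofReal_neg]
    congr 1; ring
  have h2 : Tendsto (fun ε : ℝ => boxSymbol p ((ε : ℂ) + w * Complex.I)) (𝓝[>] 0)
      (𝓝[upperHalf] (-((4 * m ^ 2 + κ ^ 2 : ℝ) : ℂ))) := by
    refine tendsto_nhdsWithin_iff.2 ⟨?_, ?_⟩
    · rw [← hz]
      exact ((continuous_boxSymbol p).tendsto _).comp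
        ((tendsto_add_mul_I w).mono_right nhdsWithin_le_nhds)
    · filter_upwards [self_mem_nhdsWithin] with ε hε
      have hε : 0 < ε := hε
      simp only [upperHalf, mem_ofPred_eq, boxSymbol_add_mul_I_im]
      positivity
  have h3 := (tendsto_S_boundary (hbar := hbar) (lam := lam) (lam₁ := lam₁) (lam₂ := lam₂)
    (g₁ := g₁) (g₂ := g₂) hm ha hκ).comp h2
  refine tendsto_nhds_unique h1 (h3.congr' ?_)
  filter_upwards [self_mem_nhdsWithin] with ε hε
  have hε : 0 < ε := hε
  exact (symbolAt_eq_S hm ha p (by simpa using hε)).symm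

/-- On the imaginary axis below the threshold, the symbol is the value of `S` on the real line. -/
theorem symbolAt_mul_I_of_lt (hm : 0 < m) (ha : -(4 * m ^ 2) < a) (p : Space) {w : ℝ}
    (hw : |w| < thresholdMass m p) :
    symbolAt m a hbar lam lam₁ lam₂ g₁ g₂ p (w * Complex.I) =
      S m a hbar lam lam₁ lam₂ g₁ g₂ ((‖p‖ ^ 2 - w ^ 2 : ℝ) : ℂ) := by
  have h1 : Tendsto (fun ε : ℝ => symbolAt m a hbar lam lam₁ lam₂ g₁ g₂ p ((ε : ℂ) + w * Complex.I))
      (𝓝[>] 0) (𝓝 (symbolAt m a hbar lam lam₁ lam₂ g₁ g₂ p (w * Complex.I))) :=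
    ((continuousOn_symbolAt hm ha p) (w * Complex.I) (by simp)).tendsto.comp (tendsto_add_mul_I w)
  have hlt : -(4 * m ^ 2) < ‖p‖ ^ 2 - w ^ 2 := by
    have := sq_lt_sq' (by linarith [abs_nonneg w, thresholdMass_pos hm p]) hw
    rw [sq_abs, thresholdMass_sq] at this
    linarith
  have h2 : Tendsto (fun ε : ℝ => boxSymbol p ((ε : ℂ) + w * Complex.I)) (𝓝[>] 0)
      (𝓝 ((‖p‖ ^ 2 - w ^ 2 : ℝ) : ℂ)) := by
    rw [← boxSymbol_ofReal_mul_I]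
    exact ((continuous_boxSymbol p).tendsto _).comp
      ((tendsto_add_mul_I w).mono_right nhdsWithin_le_nhds)
  have hmem := ofReal_add_mem_slitPlane hlt
  have h3 := ((hasDerivAt_S (hbar := hbar) (lam := lam) (lam₁ := lam₁) (lam₂ := lam₂)
    (g₁ := g₁) (g₂ := g₂) hm ha hmem).continuousAt.tendsto).comp h2
  refine tendsto_nhds_unique h1 (h3.congr' ?_)
  filter_upwards [self_mem_nhdsWithin] with ε hε
  have hε : 0 < ε := hε
  exact (symbolAt_eq_S hm ha p (by simpa using hε)).symm

end Laplace

/-! ### Causality from analyticity in the right half-plane -/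

lemma tendsto_add_mul_I_cont {H : ℂ → ℂ} (hd : DifferentiableOn ℂ H {s | 0 < s.re}) {ε : ℝ}
    (hε : 0 < ε) : Continuous fun w : ℝ => H ((ε : ℂ) + w * Complex.I) := by
  refine continuous_iff_continuousAt.2 fun w => ?_
  have hopen : IsOpen {s : ℂ | 0 < s.re} := isOpen_lt continuous_const Complex.continuous_re
  have h1 : ContinuousAt H ((ε : ℂ) + w * Complex.I) :=
    (hd.differentiableAt (hopen.mem_nhds (by simpa using hε))).continuousAt
  exact ContinuousAt.comp (f := fun w : ℝ => (ε : ℂ) + w * Complex.I) h1 (by fun_prop)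

/-- A function that is analytic in the right half-plane and decays exponentially to the right has
vanishing integral over the imaginary axis. -/
theorem integral_imaginary_axis_eq_zero {H : ℂ → ℂ} {C γ : ℝ} (hγ : 0 < γ)
    (hd : DifferentiableOn ℂ H {s | 0 < s.re})
    (hb : ∀ s : ℂ, 0 ≤ s.re → ‖H s‖ ≤ C * Real.exp (-γ * s.re) * (1 + s.im ^ 2)⁻¹)
    (hlim : ∀ᵐ w : ℝ, Tendsto (fun ε : ℝ => H ((ε : ℂ) + w * Complex.I)) (𝓝[>] 0)
      (𝓝 (H (w * Complex.I)))) :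
    ∫ w : ℝ, H (w * Complex.I) = 0 := by
  have hC : 0 ≤ C := by simpa using (norm_nonneg _).trans (hb 0 (by simp))
  have hb' : ∀ ε w : ℝ, 0 ≤ ε → ‖H ((ε : ℂ) + w * Complex.I)‖ ≤
      C * Real.exp (-γ * ε) * (1 + w ^ 2)⁻¹ := fun ε w hε => by
    simpa using hb ((ε : ℂ) + w * Complex.I) (by simpa using hε)
  have hcont := fun ε (hε : 0 < ε) => tendsto_add_mul_I_cont hd hε
  have hint : ∀ ε : ℝ, 0 < ε → Integrable fun w : ℝ => H ((ε : ℂ) + w * Complex.I) := fun ε hε =>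
    (integrable_inv_one_add_sq.const_mul (C * Real.exp (-γ * ε))).mono'
      (hcont ε hε).aestronglyMeasurable (Eventually.of_forall fun w => hb' ε w hε.le)
  set V : ℝ → ℂ := fun ε => ∫ w : ℝ, H ((ε : ℂ) + w * Complex.I) with hV
  -- Moving the line of integration does not change the integral.
  have hmove : ∀ ε L : ℝ, 0 < ε → ε ≤ L → V ε = V L := by
    intro ε L hε hL
    have hL0 : 0 < L := hε.trans_le hL
    have hrect : ∀ R : ℝ, 0 ≤ R →
        ‖(∫ y in (-R)..R, H ((L : ℂ) + y * Complex.I)) -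
          ∫ y in (-R)..R, H ((ε : ℂ) + y * Complex.I)‖ ≤ 2 * (C * (L - ε)) * (1 + R ^ 2)⁻¹ := by
      intro R hR
      have h := Complex.integral_boundary_rect_eq_zero_of_differentiableOn H
        ((ε : ℂ) + ((-R : ℝ) : ℂ) * Complex.I) ((L : ℂ) + (R : ℂ) * Complex.I)
        (hd.mono fun s hs => by
          have h1 := (Complex.mem_reProdIm.1 hs).1
          simp only [Complex.add_re, Complex.ofReal_re, Complex.mul_re, Complex.I_re, mul_zero,
            Complex.ofReal_im, Complex.I_im, mul_one, sub_self, add_zero, uIcc_of_le hL] at h1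
          exact hε.trans_le h1.1)
      simp only [Complex.add_re, Complex.ofReal_re, Complex.mul_re, Complex.I_re, mul_zero,
        Complex.ofReal_im, Complex.I_im, mul_one, sub_self, add_zero, Complex.add_im,
        Complex.mul_im, zero_add] at h
      have hhor : ∀ y : ℝ, |y| = R → ‖∫ x in ε..L, H ((x : ℂ) + (y : ℂ) * Complex.I)‖ ≤
          C * (L - ε) * (1 + R ^ 2)⁻¹ := by
        intro y hy
        have := intervalIntegral.norm_integral_le_of_norm_le_const (a := ε) (b := L)
          (f := fun x : ℝ => H ((x : ℂ) + (y : ℂ) * Complex.I)) (C := C * (1 + R ^ 2)⁻¹)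
          (fun x hx => by
            rw [uIoc_of_le hL] at hx
            have hx0 : 0 ≤ x := (hε.trans hx.1).le
            refine (hb' x y hx0).trans ?_
            rw [← hy, sq_abs]
            refine mul_le_mul_of_nonneg_right (mul_le_of_le_one_right hC ?_) (by positivity)
            exact Real.exp_le_one_iff.2 (by nlinarith))
        rw [abs_of_nonneg (by linarith)] at this
        linarith
      have h1 := hhor (-R) (by rw [abs_neg, abs_of_nonneg hR])
      have h2 := hhor R (abs_of_nonneg hR)
      set A := ∫ x in ε..L, H ((x : ℂ) + ((-R : ℝ) : ℂ) * Complex.I)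
      set B := ∫ x in ε..L, H ((x : ℂ) + (R : ℂ) * Complex.I)
      set X := ∫ y in (-R)..R, H ((L : ℂ) + y * Complex.I)
      set Y := ∫ y in (-R)..R, H ((ε : ℂ) + y * Complex.I)
      simp only [smul_eq_mul] at h
      have hXY : X - Y = Complex.I * (A - B) := by
        linear_combination (-Complex.I) * h + (X - Y) * Complex.I_sq
      rw [hXY, norm_mul, Complex.norm_I, one_mul]
      linarith [norm_sub_le A B]
    have t1 := intervalIntegral_tendsto_integral (hint L hL0) tendsto_neg_atTop_atBot tendsto_id
    have t2 := intervalIntegral_tendsto_integral (hint ε hε) tendsto_neg_atTop_atBot tendsto_id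
    have t3 : Tendsto (fun R : ℝ => 2 * (C * (L - ε)) * (1 + R ^ 2)⁻¹) atTop (𝓝 0) := by
      have : Tendsto (fun R : ℝ => (1 + R ^ 2)⁻¹) atTop (𝓝 0) :=
        tendsto_inv_atTop_zero.comp (tendsto_atTop_add_const_left _ _
          (tendsto_pow_atTop (by norm_num)))
      simpa using this.const_mul (2 * (C * (L - ε)))
    have t4 : ‖V L - V ε‖ ≤ 0 := by
      refine le_of_tendsto_of_tendsto (t1.sub t2).norm t3 ?_
      filter_upwards [eventually_ge_atTop 0] with R hR
      exact hrect R hR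
    exact (sub_eq_zero.1 (norm_le_zero_iff.1 t4)).symm
  have hVle : ∀ ε, 0 < ε → ‖V ε‖ ≤ C * Real.exp (-γ * ε) * Real.pi := by
    intro ε hε
    have := norm_integral_le_of_norm_le (integrable_inv_one_add_sq.const_mul
      (C * Real.exp (-γ * ε))) (Eventually.of_forall fun w => hb' ε w hε.le)
    rwa [integral_const_mul, integral_univ_inv_one_add_sq] at this
  have hV0 : ∀ ε, 0 < ε → V ε = 0 := by
    intro ε hε
    have ht : Tendsto (fun L : ℝ => C * Real.exp (-γ * L) * Real.pi) atTop (𝓝 0) := by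
      have h1 : Tendsto (fun L : ℝ => -γ * L) atTop atBot :=
        tendsto_id.const_mul_atTop_of_neg (by linarith)
      simpa using ((Real.tendsto_exp_atBot.comp h1).const_mul C).mul_const Real.pi
    refine norm_le_zero_iff.1 (ge_of_tendsto ht ?_)
    filter_upwards [eventually_ge_atTop ε] with L hL
    rw [hmove ε L hε hL]
    exact hVle L (hε.trans_le hL)
  have hdct : Tendsto V (𝓝[>] 0) (𝓝 (∫ w : ℝ, H (w * Complex.I))) := by
    refine tendsto_integral_filter_of_dominated_convergence (fun w => C * (1 + w ^ 2)⁻¹) ?_ ?_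
      (integrable_inv_one_add_sq.const_mul C) hlim
    · filter_upwards [self_mem_nhdsWithin] with ε hε
      exact (hcont ε hε).aestronglyMeasurable
    · filter_upwards [self_mem_nhdsWithin] with ε hε
      have hε : 0 < ε := hε
      refine Eventually.of_forall fun w => (hb' ε w hε.le).trans ?_
      refine mul_le_mul_of_nonneg_right (mul_le_of_le_one_right hC ?_) (by positivity)
      exact Real.exp_le_one_iff.2 (by nlinarith)
  refine tendsto_nhds_unique hdct ?_
  refine tendsto_const_nhds.congr' ?_
  filter_upwards [self_mem_nhdsWithin] with ε hε
  exact (hV0 ε hε).symm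

/-! ### Laplace transforms of test functions -/

/-- `η` is a smooth function supported in `[-δ, δ]`. -/
structure IsTest (δ : ℝ) (η : ℝ → ℂ) : Prop where
  smooth : ContDiff ℝ ∞ η
  eq_zero : ∀ t, δ < |t| → η t = 0

/-- The two-sided Laplace transform. -/
def testTransform (η : ℝ → ℂ) (s : ℂ) : ℂ := ∫ t : ℝ, η t * Complex.exp (-s * t)

namespace IsTest

variable {δ : ℝ} {η : ℝ → ℂ}

lemma hasCompactSupport (h : IsTest δ η) : HasCompactSupport η := by
  refine HasCompactSupport.intro (isCompact_Icc (a := -δ) (b := δ)) fun t ht => h.eq_zero t ?_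
  by_contra hle
  exact ht (abs_le.1 (not_lt.1 hle))

lemma continuous (h : IsTest δ η) : Continuous η := h.smooth.continuous

lemma integrable (h : IsTest δ η) : Integrable η :=
  h.continuous.integrable_of_hasCompactSupport h.hasCompactSupport

lemma integrable_mul (h : IsTest δ η) {f : ℝ → ℂ} (hf : Continuous f) :
    Integrable fun t => η t * f t :=
  (h.continuous.mul hf).integrable_of_hasCompactSupport h.hasCompactSupport.mul_right

lemma deriv (h : IsTest δ η) : IsTest δ (deriv η) := by
  refine ⟨(contDiff_infty_iff_deriv.1 h.smooth).2, fun t ht => ?_⟩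
  have : η =ᶠ[𝓝 t] fun _ => 0 := by
    have hopen : IsOpen {t : ℝ | δ < |t|} := isOpen_lt continuous_const continuous_abs
    filter_upwards [hopen.mem_nhds ht] with u hu using h.eq_zero u hu
  rw [this.deriv_eq]; simp

lemma id_mul (h : IsTest δ η) : IsTest δ fun t => (t : ℂ) * η t :=
  ⟨Complex.ofRealCLM.contDiff.mul h.smooth, fun t ht => by simp [h.eq_zero t ht]⟩

lemma const_mul (h : IsTest δ η) (c : ℂ) : IsTest δ fun t => c * η t :=
  ⟨contDiff_const.mul h.smooth, fun t ht => by simp [h.eq_zero t ht]⟩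

lemma add {η' : ℝ → ℂ} (h : IsTest δ η) (h' : IsTest δ η') : IsTest δ fun t => η t + η' t :=
  ⟨h.smooth.add h'.smooth, fun t ht => by simp [h.eq_zero t ht, h'.eq_zero t ht]⟩

lemma testTransform_deriv (h : IsTest δ η) (s : ℂ) :
    testTransform (_root_.deriv η) s = s * testTransform η s := by
  have he : Continuous fun t : ℝ => Complex.exp (-s * t) := by fun_prop
  have hde : ∀ t : ℝ, HasDerivAt (fun t : ℝ => Complex.exp (-s * t))
      (-s * Complex.exp (-s * t)) t := fun t => by
    have := ((Complex.ofRealCLM.hasDerivAt (x := t)).const_mul (-s)).cexp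
    simpa [mul_comm] using this
  have hdη : ∀ t, HasDerivAt η (_root_.deriv η t) t := fun t =>
    (h.smooth.differentiable (by simp) t).hasDerivAt
  have := integral_mul_deriv_eq_deriv_mul_of_integrable (u := η)
    (v := fun t : ℝ => Complex.exp (-s * t)) (u' := _root_.deriv η)
    (v' := fun t : ℝ => -s * Complex.exp (-s * t)) (fun t _ => hdη t) (fun t _ => hde t)
    (h.integrable_mul (f := fun t : ℝ => -s * Complex.exp (-s * t)) (by fun_prop))
    (h.deriv.integrable_mul he) (h.integrable_mul he)
  unfold testTransform
  rw [← neg_eq_iff_eq_neg.2 this, ← integral_const_mul, ← integral_neg]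
  congr 1; ext t; ring

lemma norm_testTransform_le_of_nonneg (h : IsTest δ η) {s : ℂ} (hs : 0 ≤ s.re) :
    ‖testTransform η s‖ ≤ (∫ t, ‖η t‖) * Real.exp (δ * s.re) := by
  unfold testTransform
  rw [← integral_mul_const]
  refine norm_integral_le_of_norm_le (h.integrable.norm.mul_const _)
    (Eventually.of_forall fun t => ?_)
  rw [norm_mul]
  by_cases ht : δ < |t|
  · simp [h.eq_zero t ht]
  · refine mul_le_mul_of_nonneg_left ?_ (norm_nonneg _)
    rw [Complex.norm_exp, Real.exp_le_exp]
    have h1 : -t ≤ δ := (neg_le_abs t).trans (not_lt.1 ht)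
    have : (-s * (t : ℂ)).re = -t * s.re := by simp; ring
    rw [this]
    exact mul_le_mul_of_nonneg_right h1 hs

/-- The Laplace transform of a test function decays faster than any power in the right half-plane,
up to the exponential factor that accounts for the support. -/
lemma norm_testTransform_le (h : IsTest δ η) (n : ℕ) : ∃ C : ℝ, 0 ≤ C ∧ ∀ s : ℂ, 0 ≤ s.re →
    ‖testTransform η s‖ * (1 + ‖s‖) ^ n ≤ C * Real.exp (δ * s.re) := by
  induction n generalizing η with
  | zero =>
    refine ⟨∫ t, ‖η t‖, integral_nonneg fun t => norm_nonneg _, fun s hs => ?_⟩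
    simpa using h.norm_testTransform_le_of_nonneg hs
  | succ n ih =>
    obtain ⟨C, hC, h1⟩ := ih h
    obtain ⟨D, hD, h2⟩ := ih h.deriv
    refine ⟨C + D, by positivity, fun s hs => ?_⟩
    have h3 := h2 s hs
    rw [h.testTransform_deriv, norm_mul] at h3
    calc ‖testTransform η s‖ * (1 + ‖s‖) ^ (n + 1) =
          ‖testTransform η s‖ * (1 + ‖s‖) ^ n + ‖s‖ * ‖testTransform η s‖ * (1 + ‖s‖) ^ n := by ring
      _ ≤ _ := by rw [add_mul]; exact add_le_add (h1 s hs) h3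

lemma hasDerivAt_testTransform (h : IsTest δ η) (s : ℂ) :
    HasDerivAt (testTransform η) (-testTransform (fun t => (t : ℂ) * η t) s) s := by
  have hF' : ∀ s : ℂ, Continuous fun t : ℝ => η t * (-(t : ℂ) * Complex.exp (-s * t)) := fun s => by
    have := h.continuous
    fun_prop
  have hb : Integrable fun t : ℝ => ‖η t‖ * (|t| * Real.exp ((‖s‖ + 1) * |t|)) := by
    refine (Continuous.mul h.continuous.norm (by fun_prop)).integrable_of_hasCompactSupport ?_
    exact h.hasCompactSupport.norm.mul_right
  have key := hasDerivAt_integral_of_dominated_loc_of_deriv_le (μ := volume)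
    (F := fun (s : ℂ) (t : ℝ) => η t * Complex.exp (-s * t))
    (F' := fun (s : ℂ) (t : ℝ) => η t * (-(t : ℂ) * Complex.exp (-s * t)))
    (x₀ := s) (s := Metric.ball s 1) (bound := fun t => ‖η t‖ * (|t| * Real.exp ((‖s‖ + 1) * |t|)))
    (Metric.ball_mem_nhds s one_pos)
    (Eventually.of_forall fun u => (h.continuous.mul (by fun_prop)).aestronglyMeasurable)
    (h.integrable_mul (by fun_prop)) (hF' s).aestronglyMeasurable
    (Eventually.of_forall fun t u hu => ?_) hb (Eventually.of_forall fun t u _ => ?_)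
  · refine key.2.congr_deriv ?_
    unfold testTransform
    rw [← integral_neg]
    congr 1; ext t; ring
  · rw [norm_mul, norm_mul, norm_neg, Complex.norm_real, Real.norm_eq_abs]
    refine mul_le_mul_of_nonneg_left (mul_le_mul_of_nonneg_left ?_ (abs_nonneg _)) (norm_nonneg _)
    refine (Complex.norm_exp_le_exp_norm _).trans (Real.exp_le_exp.2 ?_)
    rw [norm_mul, norm_neg, Complex.norm_real, Real.norm_eq_abs]
    refine mul_le_mul_of_nonneg_right ?_ (abs_nonneg _)
    have := norm_sub_norm_le u s
    have h2 : ‖u - s‖ < 1 := by simpa [dist_eq_norm] using hu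
    linarith
  · refine HasDerivAt.const_mul _ ?_
    have := (((hasDerivAt_id u).neg).mul_const (t : ℂ)).cexp
    simpa [mul_comm] using this

lemma hasDerivAt_testTransform_mul_I (h : IsTest δ η) (w : ℝ) :
    HasDerivAt (fun w : ℝ => testTransform η (w * Complex.I))
      (testTransform (fun t => -Complex.I * ((t : ℂ) * η t)) (w * Complex.I)) w := by
  have h1 : HasDerivAt (fun w : ℝ => (w : ℂ) * Complex.I) Complex.I w := by
    simpa using (Complex.ofRealCLM.hasDerivAt (x := w)).mul_const Complex.I
  refine ((h.hasDerivAt_testTransform _).comp w h1).congr_deriv ?_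
  unfold testTransform
  rw [← integral_neg, ← integral_mul_const]
  congr 1; ext t; ring

lemma c2Growth_testTransform (h : IsTest δ η) (n : ℕ) :
    C2Growth (-(n : ℝ)) fun w => testTransform η (w * Complex.I) := by
  have h1 := h.id_mul.const_mul (-Complex.I)
  have h2 := h1.id_mul.const_mul (-Complex.I)
  obtain ⟨C₀, hC₀, b₀⟩ := h.norm_testTransform_le n
  obtain ⟨C₁, hC₁, b₁⟩ := h1.norm_testTransform_le n
  obtain ⟨C₂, hC₂, b₂⟩ := h2.norm_testTransform_le n
  have key : ∀ (θ : ℝ → ℂ) (B : ℝ), (∀ s : ℂ, 0 ≤ s.re →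
      ‖testTransform θ s‖ * (1 + ‖s‖) ^ n ≤ B * Real.exp (δ * s.re)) → ∀ κ : ℝ, 0 ≤ κ →
      ‖testTransform θ (κ * Complex.I)‖ ≤ B * (1 + κ) ^ (-(n : ℝ)) := by
    intro θ B hB κ hκ
    have := hB (κ * Complex.I) (by simp)
    rw [norm_mul, Complex.norm_I, Complex.norm_real, Real.norm_of_nonneg hκ] at this
    rw [Real.rpow_neg (by linarith), Real.rpow_natCast, ← div_eq_mul_inv,
      le_div_iff₀ (by positivity)]
    simpa using this
  have hX : ∀ κ : ℝ, 0 ≤ κ → 0 ≤ (1 + κ) ^ (-(n : ℝ)) := fun κ hκ => by positivity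
  refine ⟨C₀ + C₁ + C₂, _, _, fun κ _ => h.hasDerivAt_testTransform_mul_I κ,
    fun κ _ => h1.hasDerivAt_testTransform_mul_I κ, fun κ _ =>
    (h2.hasDerivAt_testTransform_mul_I κ).continuousAt.continuousWithinAt, ?_, ?_, ?_⟩ <;>
    intro κ hκ
  · exact (key _ _ b₀ κ hκ).trans (mul_le_mul_of_nonneg_right (by linarith) (hX κ hκ))
  · exact (key _ _ b₁ κ hκ).trans (mul_le_mul_of_nonneg_right (by linarith) (hX κ hκ))
  · exact (key _ _ b₂ κ hκ).trans (mul_le_mul_of_nonneg_right (by linarith) (hX κ hκ))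

lemma testTransform_conj (hr : ∀ t, (starRingEnd ℂ) (η t) = η t) (s : ℂ) :
    testTransform η ((starRingEnd ℂ) s) = (starRingEnd ℂ) (testTransform η s) := by
  unfold testTransform
  rw [← integral_conj]
  congr 1; ext t
  rw [map_mul, hr, ← Complex.exp_conj, map_mul, map_neg, Complex.conj_ofReal]

lemma testTransform_neg (he : ∀ t, η (-t) = η t) (s : ℂ) :
    testTransform η (-s) = testTransform η s := by
  unfold testTransform
  rw [← integral_neg_eq_self]
  congr 1; ext t
  rw [he]; push_cast; congr 2; ring

/-- On the imaginary axis, the transform of an even real function is real. -/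
lemma testTransform_mul_I_im (hr : ∀ t, (starRingEnd ℂ) (η t) = η t) (he : ∀ t, η (-t) = η t)
    (w : ℝ) : (testTransform η (w * Complex.I)).im = 0 := by
  rw [← Complex.conj_eq_iff_im, ← testTransform_conj hr, ← testTransform_neg he]
  congr 1; simp

end IsTest

/-! ### The regularized Green function -/

section Green

variable {m a hbar lam lam₁ lam₂ g₁ g₂ P₀ P₁ P₂ : ℝ}

lemma quadratic_conj (z : ℂ) :
    quadratic P₀ P₁ P₂ ((starRingEnd ℂ) z) = (starRingEnd ℂ) (quadratic P₀ P₁ P₂ z) := by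
  simp [quadratic]

lemma continuous_quadratic : Continuous (quadratic P₀ P₁ P₂) :=
  (differentiable_quadratic P₀ P₁ P₂).continuous

/-- The lower bound for `S` relative to the polynomial that has its zeros, on the closed right
half-plane of the Laplace variable. -/
theorem RegularSymbol.norm_quadratic_boxSymbol_le
    (H : RegularSymbol m a hbar lam lam₁ lam₂ g₁ g₂ P₀ P₁ P₂) (p : Space) :
    ∃ C : ℝ, 0 < C ∧ ∀ s : ℂ, 0 ≤ s.re → ‖quadratic P₀ P₁ P₂ (boxSymbol p s)‖ ≤
      C * (1 + ‖boxSymbol p s‖) ^ 2 * ‖symbolAt m a hbar lam lam₁ lam₂ g₁ g₂ p s‖ := by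
  obtain ⟨C, hC, hle⟩ := H.norm_quadratic_le
  refine ⟨C, hC, ?_⟩
  have him : ∀ s : ℂ, (boxSymbol p s).im = 2 * s.re * s.im := fun s => by
    simp [boxSymbol, sq]; ring
  have hpos : ∀ s : ℂ, 0 < s.re → 0 < s.im → ‖quadratic P₀ P₁ P₂ (boxSymbol p s)‖ ≤
      C * (1 + ‖boxSymbol p s‖) ^ 2 * ‖symbolAt m a hbar lam lam₁ lam₂ g₁ g₂ p s‖ := by
    intro s hs hi
    rw [symbolAt_eq_S H.m_pos H.a_gt p hs]
    refine hle _ ?_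
    simp only [upperHalf, mem_ofPred_eq, him]
    positivity
  have hclosed : ∀ s : ℂ, 0 ≤ s.re → 0 ≤ s.im → ‖quadratic P₀ P₁ P₂ (boxSymbol p s)‖ ≤
      C * (1 + ‖boxSymbol p s‖) ^ 2 * ‖symbolAt m a hbar lam lam₁ lam₂ g₁ g₂ p s‖ := by
    intro s hs hi
    have hpath : Tendsto (fun ε : ℝ => s + ε * (1 + Complex.I)) (𝓝[>] 0) (𝓝[{s | 0 ≤ s.re}] s) := by
      refine tendsto_nhdsWithin_iff.2 ⟨?_, ?_⟩
      · have : Continuous fun ε : ℝ => s + ε * (1 + Complex.I) := by fun_prop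
        simpa using (this.tendsto 0).mono_left nhdsWithin_le_nhds
      · filter_upwards [self_mem_nhdsWithin] with ε hε
        have : 0 < ε := hε
        simp only [Complex.add_re, Complex.mul_re, Complex.ofReal_re,
          Complex.one_re, Complex.I_re, Complex.ofReal_im]
        linarith
    have hσ := ((continuousOn_symbolAt (hbar := hbar) (lam := lam) (lam₁ := lam₁) (lam₂ := lam₂)
      (g₁ := g₁) (g₂ := g₂) H.m_pos H.a_gt p) s hs).tendsto.comp hpath
    have hz := ((continuous_boxSymbol p).tendsto s).comp (hpath.mono_right nhdsWithin_le_nhds)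
    have hq := ((continuous_quadratic (P₀ := P₀) (P₁ := P₁) (P₂ := P₂)).tendsto _).comp hz
    refine le_of_tendsto_of_tendsto hq.norm
      ((((hz.norm.const_add 1).pow 2).const_mul C).mul hσ.norm) ?_
    filter_upwards [self_mem_nhdsWithin] with ε hε
    have hε : 0 < ε := hε
    refine hpos _ ?_ ?_
    · simp only [Complex.add_re, Complex.mul_re, Complex.ofReal_re,
        Complex.one_re, Complex.I_re, Complex.ofReal_im]
      linarith
    · simp only [Complex.add_im, Complex.mul_im, Complex.ofReal_re,
        Complex.one_im, Complex.I_im, Complex.ofReal_im]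
      linarith
  intro s hs
  rcases le_total 0 s.im with hi | hi
  · exact hclosed s hs hi
  · have := hclosed ((starRingEnd ℂ) s) (by simpa using hs) (by simpa using hi)
    simpa only [symbolAt_conj, boxSymbol_conj, quadratic_conj, Complex.norm_conj] using this

/-- The Fourier-Laplace transform of the Green function, multiplied by the polynomial that removes
the poles. At the zeros of the symbol on the imaginary axis it takes the value zero. -/
def green (m a hbar lam lam₁ lam₂ g₁ g₂ P₀ P₁ P₂ : ℝ) (p : Space) (s : ℂ) : ℂ :=
  quadratic P₀ P₁ P₂ (boxSymbol p s) / symbolAt m a hbar lam lam₁ lam₂ g₁ g₂ p s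

lemma green_conj (p : Space) (s : ℂ) :
    green m a hbar lam lam₁ lam₂ g₁ g₂ P₀ P₁ P₂ p ((starRingEnd ℂ) s) =
      (starRingEnd ℂ) (green m a hbar lam lam₁ lam₂ g₁ g₂ P₀ P₁ P₂ p s) := by
  simp only [green, symbolAt_conj, boxSymbol_conj, quadratic_conj, map_div₀]

theorem RegularSymbol.norm_green_le
    (H : RegularSymbol m a hbar lam lam₁ lam₂ g₁ g₂ P₀ P₁ P₂) (p : Space) :
    ∃ C : ℝ, 0 < C ∧ ∀ s : ℂ, 0 ≤ s.re →
      ‖green m a hbar lam lam₁ lam₂ g₁ g₂ P₀ P₁ P₂ p s‖ ≤ C * (1 + ‖s‖) ^ 4 := by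
  obtain ⟨C, hC, hle⟩ := H.norm_quadratic_boxSymbol_le p
  refine ⟨C * (1 + ‖p‖ ^ 2) ^ 2, by positivity, fun s hs => ?_⟩
  have hz : 1 + ‖boxSymbol p s‖ ≤ (1 + ‖p‖ ^ 2) * (1 + ‖s‖) ^ 2 := by
    have : ‖boxSymbol p s‖ ≤ ‖s‖ ^ 2 + ‖p‖ ^ 2 := by
      refine (norm_add_le _ _).trans_eq ?_
      rw [norm_pow, Complex.norm_real, Real.norm_of_nonneg (by positivity)]
    have h0 := norm_nonneg s
    nlinarith [mul_nonneg (sq_nonneg ‖p‖) h0, mul_nonneg (sq_nonneg ‖p‖) (sq_nonneg ‖s‖)]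
  have h1 : ‖green m a hbar lam lam₁ lam₂ g₁ g₂ P₀ P₁ P₂ p s‖ ≤ C * (1 + ‖boxSymbol p s‖) ^ 2 := by
    rw [green, norm_div]
    rcases eq_or_ne (symbolAt m a hbar lam lam₁ lam₂ g₁ g₂ p s) 0 with h | h
    · rw [h]; simp; positivity
    · rw [div_le_iff₀ (norm_pos_iff.2 h)]; exact hle s hs
  calc _ ≤ C * (1 + ‖boxSymbol p s‖) ^ 2 := h1
    _ ≤ C * ((1 + ‖p‖ ^ 2) * (1 + ‖s‖) ^ 2) ^ 2 := by gcongr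
    _ = _ := by ring

lemma boxSymbol_add_mem_slitPlane (hm : 0 < m) (p : Space) {s : ℂ} (hs : 0 < s.re) :
    boxSymbol p s + ((4 * m ^ 2 : ℝ) : ℂ) ∈ Complex.slitPlane := by
  have him : (boxSymbol p s + ((4 * m ^ 2 : ℝ) : ℂ)).im = 2 * s.re * s.im := by
    rw [Complex.add_im, Complex.ofReal_im]; simp [boxSymbol, sq]; ring
  have hre : (boxSymbol p s + ((4 * m ^ 2 : ℝ) : ℂ)).re =
      s.re ^ 2 - s.im ^ 2 + ‖p‖ ^ 2 + 4 * m ^ 2 := by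
    rw [Complex.add_re, Complex.ofReal_re, boxSymbol, Complex.add_re, Complex.ofReal_re, sq,
      Complex.mul_re]; ring
  rw [Complex.mem_slitPlane_iff, him, hre]
  rcases eq_or_ne s.im 0 with h | h
  · left
    have h1 : 0 < s.re ^ 2 := by positivity
    have h2 : 0 < ‖p‖ ^ 2 + 4 * m ^ 2 := by positivity
    rw [h]; linarith
  · right; exact mul_ne_zero (by positivity) h

lemma RegularSymbol.symbolAt_ne_zero
    (H : RegularSymbol m a hbar lam lam₁ lam₂ g₁ g₂ P₀ P₁ P₂)
    (hpos : ∀ x : ℝ, 0 < x → S m a hbar lam lam₁ lam₂ g₁ g₂ x ≠ 0) (p : Space) {s : ℂ}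
    (hs : 0 < s.re) : symbolAt m a hbar lam lam₁ lam₂ g₁ g₂ p s ≠ 0 := by
  rw [symbolAt_eq_S H.m_pos H.a_gt p hs]
  have him : (boxSymbol p s).im = 2 * s.re * s.im := by simp [boxSymbol, sq]; ring
  rcases lt_trichotomy s.im 0 with h | h | h
  · intro h0
    refine H.upper ((starRingEnd ℂ) (boxSymbol p s)) ?_ (by rw [S_conj, h0, map_zero])
    simp only [upperHalf, mem_ofPred_eq, Complex.conj_im, him]
    nlinarith [mul_pos hs (neg_pos.2 h)]
  · have hz : boxSymbol p s = ((s.re ^ 2 + ‖p‖ ^ 2 : ℝ) : ℂ) := by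
      have : s = (s.re : ℂ) := Complex.ext rfl (by simpa using h)
      rw [boxSymbol, this]; push_cast; simp
    rw [hz]
    exact hpos _ (by positivity)
  · refine H.upper _ ?_
    simp only [upperHalf, mem_ofPred_eq, him]
    positivity

lemma RegularSymbol.differentiableOn_green
    (H : RegularSymbol m a hbar lam lam₁ lam₂ g₁ g₂ P₀ P₁ P₂)
    (hpos : ∀ x : ℝ, 0 < x → S m a hbar lam lam₁ lam₂ g₁ g₂ x ≠ 0) (p : Space) :
    DifferentiableOn ℂ (green m a hbar lam lam₁ lam₂ g₁ g₂ P₀ P₁ P₂ p) {s | 0 < s.re} := by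
  have hbox : Differentiable ℂ (boxSymbol p) := by unfold boxSymbol; fun_prop
  have h1 : DifferentiableOn ℂ (symbolAt m a hbar lam lam₁ lam₂ g₁ g₂ p) {s | 0 < s.re} := by
    refine DifferentiableOn.congr (f := fun s => S m a hbar lam lam₁ lam₂ g₁ g₂ (boxSymbol p s))
      (fun s hs => ?_) fun s hs => symbolAt_eq_S H.m_pos H.a_gt p hs
    have := (hasDerivAt_S (hbar := hbar) (lam := lam) (lam₁ := lam₁) (lam₂ := lam₂) (g₁ := g₁)
      (g₂ := g₂) H.m_pos H.a_gt (boxSymbol_add_mem_slitPlane H.m_pos p hs)).differentiableAt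
    exact (this.comp s (hbox s)).differentiableWithinAt
  exact (((differentiable_quadratic P₀ P₁ P₂).comp hbox).differentiableOn).div h1
    fun s hs => H.symbolAt_ne_zero hpos p hs

lemma volume_quadratic_zero (hP : P₀ ≠ 0 ∨ P₁ ≠ 0 ∨ P₂ ≠ 0) (c : ℝ) :
    ∀ᵐ w : ℝ, quadratic P₀ P₁ P₂ ((c - w ^ 2 : ℝ) : ℂ) ≠ 0 := by
  classical
  set q : Polynomial ℝ := Polynomial.C P₀ + Polynomial.C P₁ * Polynomial.X +
    Polynomial.C P₂ * Polynomial.X ^ 2 with hq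
  have hq0 : q ≠ 0 := by
    intro h
    have h0 := congrArg (fun r => Polynomial.coeff r 0) h
    have h1 := congrArg (fun r => Polynomial.coeff r 1) h
    have h2 := congrArg (fun r => Polynomial.coeff r 2) h
    simp [hq, Polynomial.coeff_X, Polynomial.coeff_C] at h0 h1 h2
    tauto
  have hfin : {x : ℝ | q.IsRoot x}.Finite := Polynomial.finite_setOfPred_isRoot hq0
  have hfin' : {w : ℝ | q.IsRoot (c - w ^ 2)}.Finite := by
    refine Set.Finite.preimage' (f := fun w : ℝ => c - w ^ 2) hfin fun b _ => ?_
    refine ((Set.finite_singleton (Real.sqrt (c - b))).union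
      (Set.finite_singleton (-Real.sqrt (c - b)))).subset fun w hw => ?_
    have hw : c - w ^ 2 = b := hw
    have : Real.sqrt (c - b) = |w| := by rw [← Real.sqrt_sq_eq_abs]; congr 1; linarith
    rw [this]
    rcases abs_choice w with h | h <;> rw [h] <;> simp
  refine (measure_mono_null (fun w hw => ?_) (hfin'.measure_zero volume))
  have hw : ¬ quadratic P₀ P₁ P₂ ((c - w ^ 2 : ℝ) : ℂ) ≠ 0 := hw
  rw [not_not] at hw
  have : ((q.eval (c - w ^ 2) : ℝ) : ℂ) = 0 := by
    rw [← hw, hq, quadratic]; simp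
  exact_mod_cast this

/-- On the imaginary axis the symbol vanishes at most at the finitely many points that the polynomial
sends to zero. -/
lemma RegularSymbol.ae_symbolAt_ne_zero
    (H : RegularSymbol m a hbar lam lam₁ lam₂ g₁ g₂ P₀ P₁ P₂)
    (hP : P₀ ≠ 0 ∨ P₁ ≠ 0 ∨ P₂ ≠ 0) (p : Space) :
    ∀ᵐ w : ℝ, symbolAt m a hbar lam lam₁ lam₂ g₁ g₂ p (w * Complex.I) ≠ 0 := by
  obtain ⟨C, hC, hle⟩ := H.norm_quadratic_boxSymbol_le p
  filter_upwards [volume_quadratic_zero hP (‖p‖ ^ 2)] with w hw h0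
  have := hle (w * Complex.I) (by simp)
  rw [h0, norm_zero, mul_zero, boxSymbol_ofReal_mul_I] at this
  exact hw (norm_le_zero_iff.1 this)

lemma measurable_green (hm : 0 < m) (ha : -(4 * m ^ 2) < a) (p : Space) :
    Measurable fun w : ℝ => green m a hbar lam lam₁ lam₂ g₁ g₂ P₀ P₁ P₂ p (w * Complex.I) := by
  have h1 : Continuous fun w : ℝ => symbolAt m a hbar lam lam₁ lam₂ g₁ g₂ p (w * Complex.I) :=
    (continuousOn_symbolAt hm ha p).comp_continuous (by fun_prop) fun w => by simp
  have h2 : Continuous fun w : ℝ => quadratic P₀ P₁ P₂ (boxSymbol p (w * Complex.I)) :=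
    continuous_quadratic.comp ((continuous_boxSymbol p).comp (by fun_prop))
  exact h2.measurable.div h1.measurable

/-- The transform of the Green function, regularized by the test function `η`, on the imaginary
axis. -/
def greenAxis (m a hbar lam lam₁ lam₂ g₁ g₂ P₀ P₁ P₂ : ℝ) (p : Space) (η : ℝ → ℂ) (w : ℝ) : ℂ :=
  green m a hbar lam lam₁ lam₂ g₁ g₂ P₀ P₁ P₂ p (w * Complex.I) *
    testTransform η (w * Complex.I)

/-- The regularized Green function, up to a factor `2π`. -/
def greenKernel (m a hbar lam lam₁ lam₂ g₁ g₂ P₀ P₁ P₂ : ℝ) (p : Space) (η : ℝ → ℂ) (t : ℝ) : ℂ :=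
  ∫ w : ℝ, greenAxis m a hbar lam lam₁ lam₂ g₁ g₂ P₀ P₁ P₂ p η w * Complex.exp (w * Complex.I * t)

variable {δ : ℝ} {η : ℝ → ℂ}

lemma RegularSymbol.norm_green_mul_testTransform_le
    (H : RegularSymbol m a hbar lam lam₁ lam₂ g₁ g₂ P₀ P₁ P₂) (p : Space) (hη : IsTest δ η) :
    ∃ C : ℝ, 0 < C ∧ ∀ s : ℂ, 0 ≤ s.re →
      ‖green m a hbar lam lam₁ lam₂ g₁ g₂ P₀ P₁ P₂ p s * testTransform η s‖ ≤
        C * Real.exp (δ * s.re) * (1 + s.im ^ 2)⁻¹ := by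
  obtain ⟨C, hC, hG⟩ := H.norm_green_le p
  obtain ⟨D, hD, hE⟩ := hη.norm_testTransform_le 6
  refine ⟨C * (D + 1), by positivity, fun s hs => ?_⟩
  have hx : 0 < 1 + ‖s‖ := by positivity
  have him : 1 + s.im ^ 2 ≤ (1 + ‖s‖) ^ 2 := by
    have := Complex.abs_im_le_norm s
    nlinarith [sq_abs s.im, abs_nonneg s.im]
  rw [← div_eq_mul_inv, le_div_iff₀ (by positivity), norm_mul]
  calc ‖green m a hbar lam lam₁ lam₂ g₁ g₂ P₀ P₁ P₂ p s‖ * ‖testTransform η s‖ * (1 + s.im ^ 2)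
      ≤ (C * (1 + ‖s‖) ^ 4) * ‖testTransform η s‖ * (1 + ‖s‖) ^ 2 := by gcongr; exact hG s hs
    _ = C * (‖testTransform η s‖ * (1 + ‖s‖) ^ 6) := by ring
    _ ≤ C * (D * Real.exp (δ * s.re)) := mul_le_mul_of_nonneg_left (hE s hs) hC.le
    _ ≤ C * ((D + 1) * Real.exp (δ * s.re)) := by gcongr; linarith
    _ = _ := by ring

lemma norm_exp_mul_I_mul (w t : ℝ) : ‖Complex.exp (w * Complex.I * t)‖ = 1 := by
  rw [show (w : ℂ) * Complex.I * t = ((w * t : ℝ) : ℂ) * Complex.I by push_cast; ring]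
  exact Complex.norm_exp_ofReal_mul_I _

lemma RegularSymbol.norm_greenAxis_le
    (H : RegularSymbol m a hbar lam lam₁ lam₂ g₁ g₂ P₀ P₁ P₂) (p : Space) (hη : IsTest δ η) :
    ∃ C : ℝ, 0 < C ∧ ∀ w : ℝ, ‖greenAxis m a hbar lam lam₁ lam₂ g₁ g₂ P₀ P₁ P₂ p η w‖ ≤
        C * (1 + w ^ 2)⁻¹ := by
  obtain ⟨C, hC, hle⟩ := H.norm_green_mul_testTransform_le p hη
  refine ⟨C, hC, fun w => ?_⟩
  simpa [greenAxis] using hle (w * Complex.I) (by simp)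

lemma measurable_greenAxis (hm : 0 < m) (ha : -(4 * m ^ 2) < a) (p : Space) (hη : IsTest δ η) :
    Measurable (greenAxis m a hbar lam lam₁ lam₂ g₁ g₂ P₀ P₁ P₂ p η) := by
  refine (measurable_green hm ha p).mul (Continuous.measurable ?_)
  exact continuous_iff_continuousAt.2 fun w => (hη.hasDerivAt_testTransform_mul_I w).continuousAt

lemma RegularSymbol.integrable_greenAxis
    (H : RegularSymbol m a hbar lam lam₁ lam₂ g₁ g₂ P₀ P₁ P₂) (p : Space) (hη : IsTest δ η) :
    Integrable (greenAxis m a hbar lam lam₁ lam₂ g₁ g₂ P₀ P₁ P₂ p η) := by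
  obtain ⟨C, hC, hle⟩ := H.norm_greenAxis_le p hη
  exact (integrable_inv_one_add_sq.const_mul C).mono'
    (measurable_greenAxis H.m_pos H.a_gt p hη).aestronglyMeasurable (Eventually.of_forall hle)

lemma RegularSymbol.integrable_greenAxis_mul_exp
    (H : RegularSymbol m a hbar lam lam₁ lam₂ g₁ g₂ P₀ P₁ P₂) (p : Space) (hη : IsTest δ η)
    (t : ℝ) : Integrable fun w : ℝ => greenAxis m a hbar lam lam₁ lam₂ g₁ g₂ P₀ P₁ P₂ p η w *
      Complex.exp (w * Complex.I * t) := by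
  refine (H.integrable_greenAxis p hη).mono ?_ (Eventually.of_forall fun w => ?_)
  · exact (H.integrable_greenAxis p hη).aestronglyMeasurable.mul
      (Continuous.aestronglyMeasurable (by fun_prop))
  · rw [norm_mul, norm_exp_mul_I_mul, mul_one]

/-- The Green function is retarded. -/
theorem RegularSymbol.greenKernel_eq_zero
    (H : RegularSymbol m a hbar lam lam₁ lam₂ g₁ g₂ P₀ P₁ P₂)
    (hpos : ∀ x : ℝ, 0 < x → S m a hbar lam lam₁ lam₂ g₁ g₂ x ≠ 0)
    (hP : P₀ ≠ 0 ∨ P₁ ≠ 0 ∨ P₂ ≠ 0) (p : Space) (hη : IsTest δ η) {t : ℝ} (ht : t < -δ) :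
    greenKernel m a hbar lam lam₁ lam₂ g₁ g₂ P₀ P₁ P₂ p η t = 0 := by
  obtain ⟨C, hC, hle⟩ := H.norm_green_mul_testTransform_le p hη
  have hE : Differentiable ℂ (testTransform η) := fun s =>
    (hη.hasDerivAt_testTransform s).differentiableAt
  refine integral_imaginary_axis_eq_zero (H := fun s =>
    green m a hbar lam lam₁ lam₂ g₁ g₂ P₀ P₁ P₂ p s * testTransform η s * Complex.exp (s * t))
    (C := C) (γ := -(t + δ)) (by linarith) ?_ (fun s hs => ?_) ?_
  · exact ((H.differentiableOn_green hpos p).mul hE.differentiableOn).mul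
      (Differentiable.differentiableOn (by fun_prop))
  · rw [norm_mul, Complex.norm_exp]
    have : (s * (t : ℂ)).re = t * s.re := by simp [mul_comm]
    rw [this]
    calc _ ≤ C * Real.exp (δ * s.re) * (1 + s.im ^ 2)⁻¹ * Real.exp (t * s.re) :=
          mul_le_mul_of_nonneg_right (hle s hs) (Real.exp_pos _).le
      _ = C * (Real.exp (δ * s.re) * Real.exp (t * s.re)) * (1 + s.im ^ 2)⁻¹ := by ring
      _ = _ := by rw [← Real.exp_add]; congr 3; ring
  · filter_upwards [H.ae_symbolAt_ne_zero hP p] with w hw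
    have hσ := ((continuousOn_symbolAt (hbar := hbar) (lam := lam) (lam₁ := lam₁) (lam₂ := lam₂)
      (g₁ := g₁) (g₂ := g₂) H.m_pos H.a_gt p) (w * Complex.I) (by simp)).tendsto.comp
      (tendsto_add_mul_I w)
    have hid := (tendsto_add_mul_I w).mono_right (nhdsWithin_le_nhds)
    have hq := (((continuous_quadratic (P₀ := P₀) (P₁ := P₁) (P₂ := P₂)).comp
      (continuous_boxSymbol p)).tendsto (w * Complex.I)).comp hid
    have hexp := ((show Continuous fun s : ℂ => Complex.exp (s * t) by fun_prop).tendsto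
      (w * Complex.I)).comp hid
    exact ((hq.div hσ hw).mul ((hE.continuous.tendsto _).comp hid)).mul hexp

end Green

/-! ### Decay of the regularized Green function -/

lemma exists_lower_bound {f : ℝ → ℂ} (hf : ContinuousOn f (Ici 0)) (hne : ∀ κ, 0 ≤ κ → f κ ≠ 0)
    {c R : ℝ} (hc : 0 < c) (hlow : ∀ κ, R ≤ κ → c * (1 + κ) ^ (-1 : ℝ) ≤ ‖f κ‖) :
    ∃ c' : ℝ, 0 < c' ∧ ∀ κ, 0 ≤ κ → c' * (1 + κ) ^ (-1 : ℝ) ≤ ‖f κ‖ := by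
  have hcomp : IsCompact (Icc (0 : ℝ) (max R 0)) := isCompact_Icc
  obtain ⟨x, hx, hmin⟩ := hcomp.exists_isMinOn ⟨0, left_mem_Icc.2 (le_max_right _ _)⟩
    (hf.norm.mono Icc_subset_Ici_self)
  have hx0 : 0 < ‖f x‖ := norm_pos_iff.2 (hne x hx.1)
  refine ⟨min c ‖f x‖, lt_min hc hx0, fun κ hκ => ?_⟩
  have hp : 0 ≤ (1 + κ) ^ (-1 : ℝ) := by positivity
  rcases le_total κ (max R 0) with h | h
  · have h1 : (1 + κ) ^ (-1 : ℝ) ≤ 1 :=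
      Real.rpow_le_one_of_one_le_of_nonpos (by linarith) (by norm_num)
    have h2 : ‖f x‖ ≤ ‖f κ‖ := hmin ⟨hκ, h⟩
    calc _ ≤ ‖f x‖ * 1 := mul_le_mul (min_le_right _ _) h1 hp hx0.le
      _ ≤ _ := by rwa [mul_one]
  · exact (mul_le_mul_of_nonneg_right (min_le_left _ _) hp).trans
      (hlow κ ((le_max_left _ _).trans h))

lemma C2Growth.im {e : ℝ} {f : ℝ → ℂ} (h : C2Growth e f) :
    C2Growth e fun κ => ((f κ).im : ℂ) := by
  obtain ⟨C, f₁, f₂, F⟩ := h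
  have key : ∀ z : ℂ, ‖((z.im : ℝ) : ℂ)‖ ≤ ‖z‖ := fun z => by
    rw [Complex.norm_real]; exact Complex.abs_im_le_norm z
  refine ⟨C, fun κ => ((f₁ κ).im : ℂ), fun κ => ((f₂ κ).im : ℂ), fun κ hκ => ?_, fun κ hκ => ?_,
    Complex.continuous_ofReal.comp_continuousOn (Complex.continuous_im.comp_continuousOn F.cont₂),
    fun κ hκ => (key _).trans (F.bound₀ κ hκ), fun κ hκ => (key _).trans (F.bound₁ κ hκ),
    fun κ hκ => (key _).trans (F.bound₂ κ hκ)⟩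
  · exact (Complex.imCLM.hasFDerivAt.comp_hasDerivAt κ (F.deriv₁ κ hκ)).ofReal_comp
  · exact (Complex.imCLM.hasFDerivAt.comp_hasDerivAt κ (F.deriv₂ κ hκ)).ofReal_comp

section Axis

variable {m a hbar lam lam₁ lam₂ g₁ g₂ P₀ P₁ P₂ : ℝ}

/-- The quotient of `bubblePlus` by `κ`. -/
def bubbleSlope (b κ : ℝ) : ℂ :=
  (((Real.sqrt (κ ^ 2 + b))⁻¹ : ℝ) : ℂ) *
    (2 * ((Real.arsinh (κ / Real.sqrt b) : ℝ) : ℂ) + Real.pi * Complex.I)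

lemma bubblePlus_eq (b κ : ℝ) : bubblePlus b κ = κ * bubbleSlope b κ := by
  unfold bubblePlus bubbleSlope; push_cast; ring

lemma c2Growth_bubbleSlope {b : ℝ} (hb : 0 < b) : C2Growth 0 (bubbleSlope b) := by
  have h1 := (C2Growth.arsinh (Real.sqrt_pos.2 hb)).const_mul 2
  have h2 := h1.add ((C2Growth.const (Real.pi * Complex.I)).mono (e' := 1) (by norm_num))
  exact ((C2Growth.inv_sqrt hb).mul h2).mono (by norm_num)

lemma c2Growth_ofReal_quadratic (c d : ℝ) :
    C2Growth 2 fun κ => ((c + d * κ ^ 2 : ℝ) : ℂ) := by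
  have h := ((C2Growth.const (c : ℂ)).mono (e' := 2) (by norm_num)).add
    (((C2Growth.ofReal_id.mul C2Growth.ofReal_id).mono (e' := 2) (by norm_num)).const_mul (d : ℂ))
  exact h.congr fun κ => by push_cast; ring

/-- `λ₁ - λ₂ μ` is bounded below for large `μ`. -/
lemma exists_le_abs_coeff (hcoeff : lam₁ ≠ 0 ∨ lam₂ ≠ 0) (b : ℝ) :
    ∃ c R : ℝ, 0 < c ∧ 1 ≤ R ∧ ∀ κ, R ≤ κ → c ≤ |lam₁ - lam₂ * (b + κ ^ 2)| := by
  rcases eq_or_ne lam₂ 0 with h | h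
  · subst h
    exact ⟨|lam₁|, 1, abs_pos.2 (by tauto), le_rfl, fun κ _ => by simp⟩
  · have h2 : 0 < |lam₂| := abs_pos.2 h
    refine ⟨1, max 1 ((1 + |lam₁| + |lam₂| * |b|) / |lam₂|), one_pos, le_max_left _ _,
      fun κ hκ => ?_⟩
    have h1 : 1 ≤ κ := (le_max_left _ _).trans hκ
    have h3 : (1 + |lam₁| + |lam₂| * |b|) / |lam₂| ≤ κ := (le_max_right _ _).trans hκ
    rw [div_le_iff₀ h2] at h3
    have h4 : |lam₂| * κ ^ 2 ≤ |lam₁ - lam₂ * (b + κ ^ 2)| + |lam₁| + |lam₂| * |b| := by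
      have e : lam₂ * κ ^ 2 = -(lam₁ - lam₂ * (b + κ ^ 2)) + lam₁ - lam₂ * b := by ring
      calc |lam₂| * κ ^ 2 = |lam₂ * κ ^ 2| := by rw [abs_mul, abs_of_nonneg (sq_nonneg κ)]
        _ ≤ |-(lam₁ - lam₂ * (b + κ ^ 2)) + lam₁| + |lam₂ * b| := by
            rw [e]; exact abs_sub _ _
        _ ≤ _ := by
            rw [abs_mul]
            have := abs_add_le (-(lam₁ - lam₂ * (b + κ ^ 2))) lam₁
            rw [abs_neg] at this
            linarith
    have h5 : κ ≤ κ ^ 2 := by nlinarith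
    have h6 := mul_le_mul_of_nonneg_left h5 h2.le
    linarith

lemma div_sqrt_lower {b : ℝ} (hb : 0 < b) {κ : ℝ} (hκ : 0 ≤ κ) :
    (1 + Real.sqrt b)⁻¹ * (1 + κ) ^ (-1 : ℝ) ≤ (Real.sqrt (κ ^ 2 + b))⁻¹ := by
  have h1 : 0 < Real.sqrt b := Real.sqrt_pos.2 hb
  have h2 : Real.sqrt (κ ^ 2 + b) ≤ (1 + Real.sqrt b) * (1 + κ) := by
    rw [Real.sqrt_le_left (by positivity)]
    nlinarith [Real.sq_sqrt hb.le, mul_nonneg h1.le hκ, mul_nonneg hκ hκ,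
      mul_nonneg (mul_nonneg h1.le hκ) hκ, mul_nonneg (mul_nonneg h1.le h1.le) hκ]
  rw [Real.rpow_neg_one, ← mul_inv]
  exact inv_anti₀ (Real.sqrt_pos.2 (by positivity)) h2

/-- On the imaginary axis beyond the threshold, the Green function is a `C²` amplitude in `κ`, real
at the threshold. If the symbol vanishes at the threshold, it vanishes to first order in `κ` and the
polynomial to second order. -/
theorem RegularSymbol.exists_axis_amplitude
    (H : RegularSymbol m a hbar lam lam₁ lam₂ g₁ g₂ P₀ P₁ P₂) (p : Space) :
    ∃ (e : ℝ) (Y : ℝ → ℂ), C2Growth e Y ∧ (Y 0).im = 0 ∧ ∀ κ, 0 < κ →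
      green m a hbar lam lam₁ lam₂ g₁ g₂ P₀ P₁ P₂ p (disp (thresholdMass m p) κ * Complex.I) =
        Y κ := by
  have hb : 0 < 4 * m ^ 2 := by have := H.m_pos; positivity
  set b := 4 * m ^ 2 with hbdef
  set c := coupling hbar lam with hc
  set Ψ := bubbleReal b a with hΨ
  have hc0 : 0 < c := H.coupling_pos
  have hgreen : ∀ κ, 0 ≤ κ → green m a hbar lam lam₁ lam₂ g₁ g₂ P₀ P₁ P₂ p
      (disp (thresholdMass m p) κ * Complex.I) =
      quadratic P₀ P₁ P₂ (-(b + κ ^ 2 : ℝ) : ℝ) * (SPlus m a hbar lam lam₁ lam₂ g₁ g₂ κ)⁻¹ := by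
    intro κ hκ
    rw [green, symbolAt_mul_I H.m_pos H.a_gt p hκ, boxSymbol_ofReal_mul_I, disp_sq,
      thresholdMass_sq, div_eq_mul_inv]
    congr 3
    rw [hbdef]; ring
  obtain ⟨d, R, hd, hR, hcoef⟩ := exists_le_abs_coeff H.coeff_ne_zero b
  have hquad : ∀ κ : ℝ, quadratic P₀ P₁ P₂ (-(b + κ ^ 2 : ℝ) : ℝ) =
      ((P₀ - P₁ * b + P₂ * b ^ 2 : ℝ) : ℂ) +
        ((-P₁ + 2 * P₂ * b + P₂ * κ ^ 2 : ℝ) : ℂ) * ((0 + 1 * κ ^ 2 : ℝ) : ℂ) := by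
    intro κ; unfold quadratic; push_cast; ring
  have hslope := c2Growth_bubbleSlope hb
  have hl : C2Growth 2 fun κ => ((lam₁ - lam₂ * b + -lam₂ * κ ^ 2 : ℝ) : ℂ) :=
    c2Growth_ofReal_quadratic _ _
  have hr : C2Growth 2 fun κ => ((Ψ * c * (lam₁ - lam₂ * b) - (g₁ - g₂ * b) +
      (g₂ - Ψ * c * lam₂) * κ ^ 2 : ℝ) : ℂ) := c2Growth_ofReal_quadratic _ _
  have hsplit : ∀ κ : ℝ, SPlus m a hbar lam lam₁ lam₂ g₁ g₂ κ =
      -(((lam₁ - lam₂ * b + -lam₂ * κ ^ 2 : ℝ) : ℂ) * (c : ℂ) * ((κ : ℂ) * bubbleSlope b κ)) +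
        ((Ψ * c * (lam₁ - lam₂ * b) - (g₁ - g₂ * b) +
          (g₂ - Ψ * c * lam₂) * κ ^ 2 : ℝ) : ℂ) := by
    intro κ
    rw [SPlus, ← bubblePlus_eq, ← hbdef, ← hc, ← hΨ]; push_cast; ring
  by_cases h0 : SPlus m a hbar lam lam₁ lam₂ g₁ g₂ 0 = 0
  · have hS0 : S m a hbar lam lam₁ lam₂ g₁ g₂ ((-(4 * m ^ 2) : ℝ) : ℂ) = 0 := by
      rw [← SPlus_zero H.m_pos H.a_gt, h0]
    obtain ⟨hq, hlb⟩ := H.threshold hS0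
    have hr0 : Ψ * c * (lam₁ - lam₂ * b) - (g₁ - g₂ * b) = 0 := by
      have := hsplit 0
      rw [h0] at this
      simp only [Complex.ofReal_zero, zero_mul, mul_zero, neg_zero, zero_add, ne_eq,
        OfNat.ofNat_ne_zero, not_false_eq_true, zero_pow, add_zero] at this
      exact_mod_cast this.symm
    have hP0 : P₀ - P₁ * b + P₂ * b ^ 2 = 0 := by
      have : ((P₀ - P₁ * b + P₂ * b ^ 2 : ℝ) : ℂ) = 0 := by
        rw [← hq, quadratic, ← hbdef]; push_cast; ring
      exact_mod_cast this
    set S₁ : ℝ → ℂ := fun κ => -(((lam₁ - lam₂ * b + -lam₂ * κ ^ 2 : ℝ) : ℂ) *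
      ((c : ℂ) * bubbleSlope b κ)) + ((g₂ - Ψ * c * lam₂ : ℝ) : ℂ) * (κ : ℂ) with hS₁
    have hS₁g : C2Growth 2 S₁ :=
      ((hl.mul (hslope.const_mul (c : ℂ))).neg.mono (by norm_num)).add
        ((C2Growth.ofReal_id.const_mul _).mono (by norm_num))
    have hfac : ∀ κ : ℝ, SPlus m a hbar lam lam₁ lam₂ g₁ g₂ κ = κ * S₁ κ := by
      intro κ
      rw [hsplit, hr0, hS₁]; push_cast; ring
    have him : ∀ κ : ℝ, (S₁ κ).im = -((lam₁ - lam₂ * (b + κ ^ 2)) *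
        (c * ((Real.sqrt (κ ^ 2 + b))⁻¹ * Real.pi))) := by
      intro κ
      have e : S₁ κ = ((-((lam₁ - lam₂ * (b + κ ^ 2)) * (c * ((Real.sqrt (κ ^ 2 + b))⁻¹ *
          (2 * Real.arsinh (κ / Real.sqrt b))))) + (g₂ - Ψ * c * lam₂) * κ : ℝ) : ℂ) +
          ((-((lam₁ - lam₂ * (b + κ ^ 2)) * (c * ((Real.sqrt (κ ^ 2 + b))⁻¹ * Real.pi))) : ℝ) : ℂ) *
            Complex.I := by
        simp only [hS₁, bubbleSlope]; push_cast; ring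
      rw [e]; simp only [Complex.add_im, Complex.ofReal_im, Complex.im_ofReal_mul, Complex.I_im, mul_one, zero_add]
    have hne : ∀ κ, 0 ≤ κ → S₁ κ ≠ 0 := by
      intro κ hκ h
      rcases hκ.eq_or_lt with rfl | hκ
      · have h1 := him 0
        rw [h, Complex.zero_im, eq_comm, neg_eq_zero] at h1
        have h2 : 0 < c * ((Real.sqrt (0 ^ 2 + b))⁻¹ * Real.pi) := by
          have : 0 < Real.sqrt (0 ^ 2 + b) := Real.sqrt_pos.2 (by positivity)
          have := Real.pi_pos
          positivity
        have h3 := (mul_eq_zero.1 h1).resolve_right h2.ne'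
        apply hlb
        rw [← h3]; ring
      · exact H.cut κ hκ (by rw [hfac, h, mul_zero])
    have hlow : ∀ κ, R ≤ κ → d * c * (1 + Real.sqrt b)⁻¹ * (1 + κ) ^ (-1 : ℝ) ≤ ‖S₁ κ‖ := by
      intro κ hκ
      have hκ0 : 0 ≤ κ := by linarith
      refine le_trans ?_ (Complex.abs_im_le_norm _)
      have hs : 0 < Real.sqrt (κ ^ 2 + b) := Real.sqrt_pos.2 (by positivity)
      have hπ : 1 ≤ Real.pi := by linarith [Real.pi_gt_three]
      rw [him, abs_neg, abs_mul, abs_of_nonneg (by positivity :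
        0 ≤ c * ((Real.sqrt (κ ^ 2 + b))⁻¹ * Real.pi))]
      calc d * c * (1 + Real.sqrt b)⁻¹ * (1 + κ) ^ (-1 : ℝ)
          = d * (c * ((1 + Real.sqrt b)⁻¹ * (1 + κ) ^ (-1 : ℝ) * 1)) := by ring
        _ ≤ _ := by
          gcongr
          · exact hcoef κ hκ
          · exact div_sqrt_lower hb hκ0
    obtain ⟨c', hc', hlow'⟩ := exists_lower_bound hS₁g.continuousOn hne (by positivity) hlow
    have hinv := hS₁g.inv (by norm_num) zero_le_one hc' hlow'
    refine ⟨_, fun κ => (κ : ℂ) * (((-P₁ + 2 * P₂ * b + P₂ * κ ^ 2 : ℝ) : ℂ) * (S₁ κ)⁻¹),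
      C2Growth.ofReal_id.mul ((c2Growth_ofReal_quadratic _ _).mul hinv), by simp, fun κ hκ => ?_⟩
    have hκ' : (κ : ℂ) ≠ 0 := by exact_mod_cast hκ.ne'
    have hn := hne κ hκ.le
    rw [hgreen κ hκ.le, hquad, hP0, hfac]
    push_cast
    field_simp
    ring
  · have hSg : C2Growth 3 (SPlus m a hbar lam lam₁ lam₂ g₁ g₂) := by
      have h1 := ((hl.mul (C2Growth.const (c : ℂ))).mul (C2Growth.ofReal_id.mul hslope)).neg
      exact ((h1.mono (e' := 3) (by norm_num)).add (hr.mono (by norm_num))).congr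
        fun κ => (hsplit κ).symm
    have hne : ∀ κ, 0 ≤ κ → SPlus m a hbar lam lam₁ lam₂ g₁ g₂ κ ≠ 0 := by
      intro κ hκ
      rcases hκ.eq_or_lt with rfl | hκ
      · exact h0
      · exact H.cut κ hκ
    have hlow : ∀ κ, R ≤ κ → d * c * (1 + Real.sqrt b)⁻¹ * (1 + κ) ^ (-1 : ℝ) ≤
        ‖SPlus m a hbar lam lam₁ lam₂ g₁ g₂ κ‖ := by
      intro κ hκ
      have hκ1 : 1 ≤ κ := by linarith
      have hκ0 : 0 ≤ κ := by linarith
      refine le_trans ?_ (Complex.abs_im_le_norm _)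
      have hs : 0 < Real.sqrt (κ ^ 2 + b) := Real.sqrt_pos.2 (by positivity)
      have hπ : 1 ≤ Real.pi := by linarith [Real.pi_gt_three]
      rw [SPlus_im, abs_neg, abs_mul, abs_mul, ← hbdef, ← hc, abs_of_pos hc0,
        abs_of_nonneg (by positivity : 0 ≤ κ / Real.sqrt (κ ^ 2 + b) * Real.pi)]
      calc d * c * (1 + Real.sqrt b)⁻¹ * (1 + κ) ^ (-1 : ℝ)
          = d * c * (1 * ((1 + Real.sqrt b)⁻¹ * (1 + κ) ^ (-1 : ℝ)) * 1) := by ring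
        _ ≤ |lam₁ - lam₂ * (b + κ ^ 2)| * c * (κ * (Real.sqrt (κ ^ 2 + b))⁻¹ * Real.pi) := by
          gcongr
          · exact hcoef κ hκ
          · exact div_sqrt_lower hb hκ0
        _ = _ := by rw [div_eq_mul_inv]
    obtain ⟨c', hc', hlow'⟩ := exists_lower_bound hSg.continuousOn hne (by positivity) hlow
    have hinv := hSg.inv (by norm_num) zero_le_one hc' hlow'
    have hPg : C2Growth 4 fun κ : ℝ => quadratic P₀ P₁ P₂ (-(b + κ ^ 2 : ℝ) : ℝ) :=
      (((C2Growth.const ((P₀ - P₁ * b + P₂ * b ^ 2 : ℝ) : ℂ)).mono (e' := 4) (by norm_num)).add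
        (((c2Growth_ofReal_quadratic _ _).mul (c2Growth_ofReal_quadratic 0 1)).mono
          (by norm_num))).congr fun κ => (hquad κ).symm
    refine ⟨_, fun κ => quadratic P₀ P₁ P₂ (-(b + κ ^ 2 : ℝ) : ℝ) *
      (SPlus m a hbar lam lam₁ lam₂ g₁ g₂ κ)⁻¹, hPg.mul hinv, ?_, fun κ hκ => hgreen κ hκ.le⟩
    have e : quadratic P₀ P₁ P₂ (-(b + (0 : ℝ) ^ 2 : ℝ) : ℝ) *
        (SPlus m a hbar lam lam₁ lam₂ g₁ g₂ 0)⁻¹ =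
        (((P₀ - P₁ * b + P₂ * b ^ 2) *
          (Ψ * c * (lam₁ - lam₂ * b) - (g₁ - g₂ * b))⁻¹ : ℝ) : ℂ) := by
      rw [hquad, hsplit]; push_cast; simp
    exact (congrArg Complex.im e).trans (Complex.ofReal_im _)

lemma integral_eq_integral_Ioi_add_neg {f : ℝ → ℂ} (hf : Integrable f) :
    ∫ w, f w = ∫ w in Ioi (0 : ℝ), (f w + f (-w)) := by
  have h1 : IntegrableOn (fun w => f (-w)) (Ioi 0) := hf.comp_neg.integrableOn
  rw [integral_add hf.integrableOn h1, integral_comp_neg_Ioi, neg_zero, add_comm,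
    intervalIntegral.integral_Iic_add_Ioi hf.integrableOn hf.integrableOn]

variable {δ : ℝ} {η : ℝ → ℂ}

/-- The imaginary part of the transform of the Green function vanishes below the threshold. -/
lemma greenAxis_im_eq_zero (hm : 0 < m) (ha : -(4 * m ^ 2) < a) (p : Space)
    (hr : ∀ t, (starRingEnd ℂ) (η t) = η t) (he : ∀ t, η (-t) = η t) {w : ℝ}
    (hw : |w| < thresholdMass m p) :
    (greenAxis m a hbar lam lam₁ lam₂ g₁ g₂ P₀ P₁ P₂ p η w).im = 0 := by
  have h1 : (green m a hbar lam lam₁ lam₂ g₁ g₂ P₀ P₁ P₂ p (w * Complex.I)).im = 0 := by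
    rw [green, symbolAt_mul_I_of_lt hm ha p hw, boxSymbol_ofReal_mul_I, ← Complex.conj_eq_iff_im,
      map_div₀, ← S_conj, ← quadratic_conj, Complex.conj_ofReal]
  rw [greenAxis, Complex.mul_im, h1, IsTest.testTransform_mul_I_im hr he, mul_zero, zero_mul,
    add_zero]

lemma greenAxis_neg (p : Space) (hr : ∀ t, (starRingEnd ℂ) (η t) = η t) (w : ℝ) :
    greenAxis m a hbar lam lam₁ lam₂ g₁ g₂ P₀ P₁ P₂ p η (-w) =
      (starRingEnd ℂ) (greenAxis m a hbar lam lam₁ lam₂ g₁ g₂ P₀ P₁ P₂ p η w) := by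
  have : ((-w : ℝ) : ℂ) * Complex.I = (starRingEnd ℂ) ((w : ℂ) * Complex.I) := by simp
  rw [greenAxis, greenAxis, this, green_conj, IsTest.testTransform_conj hr, map_mul]

/-- The Green function decays like `|t| ^ (-3/2)`: because it vanishes for large negative times, it
equals its odd part up to a factor, and only the cut contributes to the latter. -/
theorem RegularSymbol.norm_greenKernel_le
    (H : RegularSymbol m a hbar lam lam₁ lam₂ g₁ g₂ P₀ P₁ P₂)
    (hpos : ∀ x : ℝ, 0 < x → S m a hbar lam lam₁ lam₂ g₁ g₂ x ≠ 0)
    (hP : P₀ ≠ 0 ∨ P₁ ≠ 0 ∨ P₂ ≠ 0) (p : Space) (hη : IsTest δ η) (hδ : 0 < δ)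
    (hr : ∀ t, (starRingEnd ℂ) (η t) = η t) (he : ∀ t, η (-t) = η t) :
    ∃ K : ℝ, 0 ≤ K ∧ ∀ t, ‖greenKernel m a hbar lam lam₁ lam₂ g₁ g₂ P₀ P₁ P₂ p η t‖ ≤
      K * decayWeight t := by
  have hM := thresholdMass_pos H.m_pos p
  set M := thresholdMass m p with hMdef
  set F := greenAxis m a hbar lam lam₁ lam₂ g₁ g₂ P₀ P₁ P₂ p η with hF
  set k := greenKernel m a hbar lam lam₁ lam₂ g₁ g₂ P₀ P₁ P₂ p η with hk
  have hFi := H.integrable_greenAxis p hη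
  have hFe := H.integrable_greenAxis_mul_exp p hη
  rw [← hF] at hFi hFe
  -- The amplitude on the cut.
  obtain ⟨e, Y, hY, hY0, hYeq⟩ := H.exists_axis_amplitude p
  obtain ⟨n, hn⟩ := exists_nat_ge (e + 2)
  set g : ℝ → ℂ := fun κ => (((Real.sqrt (κ ^ 2 + M ^ 2))⁻¹ : ℝ) : ℂ) *
    (((Y κ).im : ℂ) * testTransform η (disp M κ * Complex.I)) with hg
  have hgG : C2Growth (-3) g := by
    have h1 := (hη.c2Growth_testTransform n).comp_disp hM (by simp)
    exact ((C2Growth.inv_sqrt (b := M ^ 2) (by positivity)).mul (hY.im.mul h1)).mono (by linarith)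
  have hg0 : g 0 = 0 := by simp [hg, hY0]
  obtain ⟨K, hK, hKle⟩ := norm_integral_mul_wave_le_decayWeight hM hgG hg0
  obtain ⟨C, g', g'', hgB⟩ := hgG
  have hint := fun t => integrableOn_mul_amp (M := M) hgB t
  have hodd : ∀ t : ℝ, k t - k (-t) = 2 * Complex.I *
      ((∫ κ in Ioi (0 : ℝ), (κ : ℂ) * g κ * wave M t κ) -
        ∫ κ in Ioi (0 : ℝ), (κ : ℂ) * g κ * wave M (-t) κ) := by
    intro t
    have hneg : k (-t) = ∫ w : ℝ, (starRingEnd ℂ) (F w) * Complex.exp (w * Complex.I * t) := by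
      rw [hk, greenKernel, ← integral_neg_eq_self]
      congr 1; ext w
      rw [greenAxis_neg p hr]
      congr 2
      push_cast; ring
    have hconj : Integrable fun w : ℝ => (starRingEnd ℂ) (F w) *
        Complex.exp (w * Complex.I * t) := by
      have h := (hFe (-t)).comp_neg
      refine h.congr (Eventually.of_forall fun w => ?_)
      simp only [hF, greenAxis_neg p hr]
      congr 2
      push_cast; ring
    have h1 : k t - k (-t) = ∫ w : ℝ, 2 * Complex.I * (((F w).im : ℂ) *
        Complex.exp (w * Complex.I * t)) := by
      rw [hneg, hk, greenKernel, ← integral_sub (hFe t) hconj]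
      congr 1; ext w
      rw [← sub_mul, Complex.sub_conj]
      push_cast; ring
    have h2i : Integrable fun w : ℝ => ((F w).im : ℂ) * Complex.exp (w * Complex.I * t) := by
      refine (((hFe t).sub hconj).const_mul (2 * Complex.I)⁻¹).congr
        (Eventually.of_forall fun w => ?_)
      simp only [Pi.sub_apply]
      rw [← sub_mul, Complex.sub_conj]
      have := Complex.I_ne_zero
      push_cast
      field_simp
    have h3 : ∫ w in Ioi (0 : ℝ), (((F w).im : ℂ) * Complex.exp (w * Complex.I * t) +
        ((F (-w)).im : ℂ) * Complex.exp (((-w : ℝ) : ℂ) * Complex.I * t)) =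
        ∫ w in Ioi M, (((F w).im : ℂ) * Complex.exp (w * Complex.I * t) -
          ((F w).im : ℂ) * Complex.exp (w * Complex.I * ((-t : ℝ) : ℂ))) := by
      have hpt : ∀ w : ℝ, ((F w).im : ℂ) * Complex.exp (w * Complex.I * t) +
          ((F (-w)).im : ℂ) * Complex.exp (((-w : ℝ) : ℂ) * Complex.I * t) =
          ((F w).im : ℂ) * Complex.exp (w * Complex.I * t) -
          ((F w).im : ℂ) * Complex.exp (w * Complex.I * ((-t : ℝ) : ℂ)) := by
        intro w
        rw [hF, greenAxis_neg p hr, Complex.conj_im, sub_eq_add_neg, ← neg_mul,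
          ← Complex.ofReal_neg]
        congr 3
        push_cast; ring
      simp only [hpt]
      refine setIntegral_eq_of_subset_of_ae_sdiff_eq_zero measurableSet_Ioi.nullMeasurableSet
        (Ioi_subset_Ioi hM.le) ?_
      have hne : ∀ᵐ w : ℝ, w ≠ M := by simp [ae_iff, measure_singleton]
      filter_upwards [hne] with w hw hmem
      have h0 : 0 < w := hmem.1
      have hle : w ≤ M := not_lt.1 hmem.2
      have hlt : |w| < M := by rw [abs_of_pos h0]; exact lt_of_le_of_ne hle hw
      rw [hF, greenAxis_im_eq_zero H.m_pos H.a_gt p hr he hlt]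
      simp
    have h4 : ∀ κ ∈ Ioi (0 : ℝ), ((κ / disp M κ : ℝ) : ℂ) *
        (((F (disp M κ)).im : ℂ) * Complex.exp (disp M κ * Complex.I * t) -
          ((F (disp M κ)).im : ℂ) * Complex.exp (disp M κ * Complex.I * ((-t : ℝ) : ℂ))) =
        (κ : ℂ) * g κ * wave M t κ - (κ : ℂ) * g κ * wave M (-t) κ := by
      intro κ hκ
      have hFim : ((F (disp M κ)).im : ℂ) =
          ((Y κ).im : ℂ) * testTransform η (disp M κ * Complex.I) := by
        have hE : testTransform η (disp M κ * Complex.I) =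
            ((testTransform η (disp M κ * Complex.I)).re : ℂ) :=
          Complex.ext rfl (by simpa using IsTest.testTransform_mul_I_im hr he (disp M κ))
        rw [hF, greenAxis, hYeq κ hκ, hE, Complex.im_mul_ofReal, Complex.ofReal_mul]
      have hw : ∀ t : ℝ, Complex.exp (disp M κ * Complex.I * (t : ℂ)) = wave M t κ := by
        intro t; rw [wave]; congr 1; push_cast; ring
      have hdi : ((κ / disp M κ : ℝ) : ℂ) =
          (κ : ℂ) * (((Real.sqrt (κ ^ 2 + M ^ 2))⁻¹ : ℝ) : ℂ) := by
        rw [← Complex.ofReal_mul, div_eq_mul_inv]; rfl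
      rw [hFim, hw, hw, hdi, hg]
      ring
    rw [h1, integral_const_mul, integral_eq_integral_Ioi_add_neg h2i, h3,
      integral_Ioi_eq_integral_disp hM, setIntegral_congr_fun measurableSet_Ioi h4,
      integral_sub (hint t) (hint (-t))]
  set B : ℝ := ∫ w, ‖F w‖
  have hB0 : 0 ≤ B := integral_nonneg fun w => norm_nonneg _
  have hB : ∀ t, ‖k t‖ ≤ B := fun t => by
    refine (norm_integral_le_integral_norm _).trans_eq ?_
    congr 1; ext w
    rw [norm_mul, norm_exp_mul_I_mul, mul_one]
  have hwδ := decayWeight_pos δ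
  refine ⟨4 * K + B / decayWeight δ, by positivity, fun t => ?_⟩
  have hw := decayWeight_pos t
  have hsum1 : 0 ≤ B / decayWeight δ * decayWeight t := by positivity
  rw [add_mul]
  rcases lt_or_ge t (-δ) with h | h
  · rw [hk, H.greenKernel_eq_zero hpos hP p hη h, norm_zero]
    positivity
  · rcases le_or_gt t δ with h' | h'
    · have hle : B ≤ B / decayWeight δ * decayWeight t := by
        rw [div_mul_eq_mul_div, le_div_iff₀ hwδ]
        refine mul_le_mul_of_nonneg_left (decayWeight_le_of_abs_le ?_) hB0
        rw [abs_of_pos hδ]; exact abs_le.2 ⟨h, h'⟩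
      have : 0 ≤ 4 * K * decayWeight t := by positivity
      linarith [hB t]
    · have h0 : k (-t) = 0 := H.greenKernel_eq_zero hpos hP p hη (by linarith)
      have h1 := hodd t
      rw [h0, sub_zero] at h1
      have h2 := hKle t
      have h3 := hKle (-t)
      rw [decayWeight_neg] at h3
      rw [h1, norm_mul, norm_mul, Complex.norm_I, Complex.norm_ofNat, mul_one]
      have h4 := norm_sub_le (∫ κ in Ioi (0 : ℝ), (κ : ℂ) * g κ * wave M t κ)
        (∫ κ in Ioi (0 : ℝ), (κ : ℂ) * g κ * wave M (-t) κ)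
      linarith

end Axis

/-! ### Retarded convolutions -/

/-- The convolution `∫ K(s) h(x - s) ds`. -/
def conv (K h : ℝ → ℂ) (x : ℝ) : ℂ := ∫ s : ℝ, K s * h (x - s)

/-- A kernel that vanishes for large negative times and decays like `|t| ^ (-3/2)`. -/
structure IsRetarded (K : ℝ → ℂ) : Prop where
  meas : AEStronglyMeasurable K
  bound : ∃ C : ℝ, 0 ≤ C ∧ ∀ t, ‖K t‖ ≤ C * decayWeight t
  zero : ∃ δ : ℝ, ∀ t, t < -δ → K t = 0

/-- A continuous function with the past integrability that makes convolutions with retarded kernels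
converge. -/
structure IsPast (h : ℝ → ℂ) : Prop where
  cont : Continuous h
  integrable : ∀ T : ℝ, IntegrableOn (fun r => decayWeight r * ‖h r‖) (Iic T)

lemma decayWeight_mul_le (s y : ℝ) : decayWeight s * decayWeight (y - s) ≤
    2 ^ (3 / 2 : ℝ) * decayWeight y * (decayWeight s + decayWeight (y - s)) := by
  have key : ∀ r : ℝ, |y| ≤ 1 + 2 * |r| → decayWeight r ≤ 2 ^ (3 / 2 : ℝ) * decayWeight y := by
    intro r hr
    rw [decayWeight, decayWeight, Real.rpow_neg (by positivity), Real.rpow_neg (by positivity),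
      ← div_eq_mul_inv, inv_eq_one_div, div_le_div_iff₀ (by positivity) (by positivity), one_mul,
      ← Real.mul_rpow (by norm_num) (by positivity)]
    exact Real.rpow_le_rpow (by positivity) (by linarith) (by norm_num)
  have h1 := decayWeight_pos s
  have h2 := decayWeight_pos (y - s)
  have h3 : 0 ≤ 2 ^ (3 / 2 : ℝ) * decayWeight y :=
    mul_nonneg (by positivity) (decayWeight_pos y).le
  have htri : |y| ≤ |s| + |y - s| := by
    calc |y| = |s + (y - s)| := by ring_nf
      _ ≤ _ := abs_add_le _ _
  rcases le_total |s| |y - s| with h | h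
  · have := mul_le_mul_of_nonneg_left (key (y - s) (by linarith)) h1.le
    nlinarith [mul_nonneg h3 h2.le]
  · have := mul_le_mul_of_nonneg_right (key s (by linarith)) h2.le
    nlinarith [mul_nonneg h3 h1.le]

lemma decayWeight_le_mul_sub (x r : ℝ) :
    decayWeight r ≤ (1 + |x|) ^ (3 / 2 : ℝ) * decayWeight (x - r) := by
  rw [decayWeight, decayWeight, Real.rpow_neg (by positivity), Real.rpow_neg (by positivity),
    ← div_eq_mul_inv, inv_eq_one_div, div_le_div_iff₀ (by positivity) (by positivity), one_mul,
    ← Real.mul_rpow (by positivity) (by positivity)]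
  refine Real.rpow_le_rpow (by positivity) ?_ (by norm_num)
  nlinarith [abs_sub x r, mul_nonneg (abs_nonneg x) (abs_nonneg r)]

lemma IsRetarded.integrable {K : ℝ → ℂ} (hK : IsRetarded K) : Integrable K := by
  obtain ⟨C, -, hC⟩ := hK.bound
  exact (integrable_decayWeight.const_mul C).mono' hK.meas (Eventually.of_forall hC)

lemma IsTest.isRetarded {δ : ℝ} {η : ℝ → ℂ} (h : IsTest δ η) : IsRetarded η := by
  obtain ⟨B, hB⟩ := h.continuous.bounded_above_of_compact_support h.hasCompactSupport
  have hB0 : 0 ≤ B := (norm_nonneg _).trans (hB 0)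
  have hw := decayWeight_pos δ
  refine ⟨h.continuous.aestronglyMeasurable, ⟨B / decayWeight δ, by positivity, fun t => ?_⟩,
    ⟨δ, fun t ht => h.eq_zero t ?_⟩⟩
  · by_cases ht : δ < |t|
    · rw [h.eq_zero t ht, norm_zero]
      have := decayWeight_pos t
      positivity
    · rw [div_mul_eq_mul_div, le_div_iff₀ hw]
      exact mul_le_mul (hB t) (decayWeight_le_of_abs_le ((not_lt.1 ht).trans (le_abs_self δ)))
        hw.le hB0
  · rw [lt_abs]; right; linarith

/-- The integrand of a double convolution is integrable. -/
lemma IsRetarded.integrable_prod {K L h : ℝ → ℂ} (hK : IsRetarded K) (hL : IsRetarded L)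
    (hh : IsPast h) (x : ℝ) : Integrable (fun q : ℝ × ℝ => K q.1 * (L (q.2 - q.1) * h (x - q.2)))
      (volume.prod volume) := by
  obtain ⟨C, hC, hKC⟩ := hK.bound
  obtain ⟨D, hD, hLD⟩ := hL.bound
  obtain ⟨δ, hδ⟩ := hK.zero
  obtain ⟨ε, hε⟩ := hL.zero
  set G : ℝ → ℝ := (Ici (-(δ + ε))).indicator fun y => decayWeight y * ‖h (x - y)‖ with hG
  have hGint : Integrable G := by
    rw [hG, integrable_indicator_iff measurableSet_Ici]
    have h1 := (hh.integrable (x + (δ + ε))).integrable_indicator measurableSet_Iic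
    have h2 := (h1.comp_sub_left x).const_mul ((1 + |x|) ^ (3 / 2 : ℝ))
    have hc := hh.cont
    have hcw := continuous_decayWeight
    refine Integrable.mono' h2.integrableOn
      (Continuous.aestronglyMeasurable (by fun_prop)) ?_
    filter_upwards [ae_restrict_mem measurableSet_Ici] with y hy
    have hy : -(δ + ε) ≤ y := hy
    have hmem : x - y ∈ Iic (x + (δ + ε)) := by simp only [mem_Iic]; linarith
    rw [indicator_of_mem hmem, norm_mul, norm_norm, Real.norm_of_nonneg (decayWeight_pos y).le,
      ← mul_assoc]
    exact mul_le_mul_of_nonneg_right (decayWeight_le_mul_sub x y) (norm_nonneg _)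
  have hG0 : ∀ y, 0 ≤ G y := fun y =>
    indicator_nonneg (fun y _ => mul_nonneg (decayWeight_pos y).le (norm_nonneg _)) y
  have hdom1 : Integrable (fun q : ℝ × ℝ => decayWeight q.1 * G q.2) (volume.prod volume) :=
    integrable_decayWeight.mul_prod hGint
  have hdom2 : Integrable (fun q : ℝ × ℝ => G q.2 * decayWeight (q.1 - q.2))
      (volume.prod volume) :=
    hGint.convolution_integrand (ContinuousLinearMap.mul ℝ ℝ) integrable_decayWeight
  refine ((hdom1.add hdom2).const_mul (C * D * 2 ^ (3 / 2 : ℝ))).mono' ?_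
    (Eventually.of_forall fun q => ?_)
  · have m1 : AEStronglyMeasurable (fun q : ℝ × ℝ => K q.1) (volume.prod volume) :=
      hK.meas.comp_fst
    have m2 : AEStronglyMeasurable (fun q : ℝ × ℝ => L (q.2 - q.1)) (volume.prod volume) :=
      hL.meas.comp_quasiMeasurePreserving
        ((quasiMeasurePreserving_sub_of_right_invariant volume volume).comp
          Measure.measurePreserving_swap.quasiMeasurePreserving)
    have hc := hh.cont
    exact m1.mul (m2.mul (Continuous.aestronglyMeasurable (by fun_prop)))
  · obtain ⟨s, y⟩ := q
    simp only [Pi.add_apply]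
    by_cases hy : y ∈ Ici (-(δ + ε))
    · rw [norm_mul, norm_mul, hG, indicator_of_mem hy]
      have h1 := decayWeight_mul_le s y
      have hsym : decayWeight (s - y) = decayWeight (y - s) := by
        rw [← decayWeight_neg, neg_sub]
      rw [hsym]
      calc ‖K s‖ * (‖L (y - s)‖ * ‖h (x - y)‖)
          ≤ (C * decayWeight s) * ((D * decayWeight (y - s)) * ‖h (x - y)‖) := by
            gcongr
            · exact mul_nonneg hC (decayWeight_pos s).le
            · exact hKC s
            · exact hLD (y - s)
        _ = C * D * (decayWeight s * decayWeight (y - s)) * ‖h (x - y)‖ := by ring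
        _ ≤ C * D * (2 ^ (3 / 2 : ℝ) * decayWeight y * (decayWeight s + decayWeight (y - s))) *
              ‖h (x - y)‖ := by gcongr
        _ = _ := by ring
    · have hy' : y < -(δ + ε) := not_le.1 hy
      have hz : K s * (L (y - s) * h (x - y)) = 0 := by
        rcases lt_or_ge s (-δ) with h1 | h1
        · rw [hδ s h1, zero_mul]
        · rw [hε (y - s) (by linarith), zero_mul, mul_zero]
      rw [hz, norm_zero]
      have := decayWeight_pos s
      have := decayWeight_pos (s - y)
      have := hG0 y
      positivity

/-- Associativity of retarded convolutions. -/
theorem IsRetarded.conv_conv {K L h : ℝ → ℂ} (hK : IsRetarded K) (hL : IsRetarded L)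
    (hh : IsPast h) (x : ℝ) : conv K (conv L h) x = conv (conv K L) h x := by
  have hswap := integral_integral_swap (f := fun s y => K s * (L (y - s) * h (x - y)))
    (hK.integrable_prod hL hh x)
  have h1 : ∀ s : ℝ, ∫ y : ℝ, K s * (L (y - s) * h (x - y)) = K s * conv L h (x - s) := by
    intro s
    rw [integral_const_mul, conv, ← integral_sub_right_eq_self (μ := volume)
      (fun r : ℝ => L r * h (x - s - r)) s]
    congr 2; ext y
    congr 2; ring
  have h2 : ∀ y : ℝ, ∫ s : ℝ, K s * (L (y - s) * h (x - y)) = conv K L y * h (x - y) := by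
    intro y
    rw [conv, ← integral_mul_const]
    congr 1; ext s; ring
  simp only [h1, h2] at hswap
  exact hswap

lemma IsRetarded.conv {K L : ℝ → ℂ} (hK : IsRetarded K) (hL : IsRetarded L) :
    IsRetarded (conv K L) := by
  obtain ⟨C, hC, hKC⟩ := hK.bound
  obtain ⟨D, hD, hLD⟩ := hL.bound
  obtain ⟨δ, hδ⟩ := hK.zero
  obtain ⟨ε, hε⟩ := hL.zero
  set I : ℝ := ∫ r, decayWeight r
  have hI : 0 ≤ I := integral_nonneg fun r => (decayWeight_pos r).le
  refine ⟨?_, ⟨C * D * (2 ^ (3 / 2 : ℝ) * (2 * I)), by positivity, fun y => ?_⟩,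
    ⟨δ + ε, fun y hy => ?_⟩⟩
  · exact (hK.integrable.integrable_convolution (ContinuousLinearMap.mul ℝ ℂ)
      hL.integrable).aestronglyMeasurable
  · have hI2 : Integrable fun s => decayWeight (y - s) := integrable_decayWeight.comp_sub_left y
    have hle : ‖SemiclassicalToy.conv K L y‖ ≤ ∫ s, C * D * (2 ^ (3 / 2 : ℝ) * decayWeight y *
        (decayWeight s + decayWeight (y - s))) := by
      refine norm_integral_le_of_norm_le
        (((integrable_decayWeight.add hI2).const_mul _).const_mul _)
        (Eventually.of_forall fun s => ?_)
      rw [norm_mul]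
      calc ‖K s‖ * ‖L (y - s)‖ ≤ (C * decayWeight s) * (D * decayWeight (y - s)) :=
            mul_le_mul (hKC s) (hLD _) (norm_nonneg _) (mul_nonneg hC (decayWeight_pos s).le)
        _ = C * D * (decayWeight s * decayWeight (y - s)) := by ring
        _ ≤ _ := mul_le_mul_of_nonneg_left (decayWeight_mul_le s y) (by positivity)
    refine hle.trans_eq ?_
    rw [integral_const_mul, integral_const_mul, integral_add integrable_decayWeight hI2,
      integral_sub_left_eq_self (fun r => decayWeight r) volume y]
    ring
  · rw [SemiclassicalToy.conv]
    refine integral_eq_zero_of_ae (Eventually.of_forall fun s => ?_)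
    simp only [Pi.zero_apply]
    rcases lt_or_ge s (-δ) with h1 | h1
    · rw [hδ s h1, zero_mul]
    · rw [hε (y - s) (by linarith), mul_zero]

lemma IsRetarded.add {K L : ℝ → ℂ} (hK : IsRetarded K) (hL : IsRetarded L) :
    IsRetarded fun t => K t + L t := by
  obtain ⟨C, hC, hKC⟩ := hK.bound
  obtain ⟨D, hD, hLD⟩ := hL.bound
  obtain ⟨δ, hδ⟩ := hK.zero
  obtain ⟨ε, hε⟩ := hL.zero
  refine ⟨hK.meas.add hL.meas, ⟨C + D, by positivity, fun t => ?_⟩, ⟨max δ ε, fun t ht => ?_⟩⟩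
  · rw [add_mul]; exact (norm_add_le _ _).trans (add_le_add (hKC t) (hLD t))
  · rw [hδ t (by linarith [le_max_left δ ε]), hε t (by linarith [le_max_right δ ε]), add_zero]

lemma IsRetarded.integrable_mul {K h : ℝ → ℂ} (hK : IsRetarded K) (hh : IsPast h) (x : ℝ) :
    Integrable fun s => K s * h (x - s) := by
  obtain ⟨C, hC, hKC⟩ := hK.bound
  obtain ⟨δ, hδ⟩ := hK.zero
  have h1 := (hh.integrable (x + δ)).integrable_indicator measurableSet_Iic
  have hc := hh.cont
  refine ((h1.comp_sub_left x).const_mul (C * (1 + |x|) ^ (3 / 2 : ℝ))).mono'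
    (hK.meas.mul (Continuous.aestronglyMeasurable (by fun_prop))) (Eventually.of_forall fun s => ?_)
  rcases lt_or_ge s (-δ) with hs | hs
  · rw [hδ s hs, zero_mul, norm_zero]
    refine mul_nonneg (by positivity) (indicator_nonneg (fun y _ =>
      mul_nonneg (decayWeight_pos y).le (norm_nonneg _)) _)
  · have hmem : x - s ∈ Iic (x + δ) := by simp only [mem_Iic]; linarith
    rw [indicator_of_mem hmem, norm_mul]
    calc ‖K s‖ * ‖h (x - s)‖ ≤ (C * ((1 + |x|) ^ (3 / 2 : ℝ) * decayWeight (x - s))) *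
          ‖h (x - s)‖ := by
          refine mul_le_mul_of_nonneg_right ((hKC s).trans ?_) (norm_nonneg _)
          exact mul_le_mul_of_nonneg_left (decayWeight_le_mul_sub x s) hC
      _ = _ := by ring

/-- Fubini for the inverse Fourier transform of an integrable function. -/
lemma conv_inverse_transform {F L : ℝ → ℂ} (hF : Integrable F) (hL : Integrable L) (x : ℝ) :
    conv (fun t => ∫ w : ℝ, F w * Complex.exp (w * Complex.I * t)) L x =
      ∫ w : ℝ, F w * Complex.exp (w * Complex.I * x) * testTransform L (w * Complex.I) := by
  have hint : Integrable (fun q : ℝ × ℝ => F q.2 * Complex.exp (q.2 * Complex.I * q.1) *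
      L (x - q.1)) (volume.prod volume) := by
    have h1 := (hL.comp_sub_left x).mul_prod hF
    refine h1.mono ?_ (Eventually.of_forall fun q => ?_)
    · exact (hF.aestronglyMeasurable.comp_snd.mul (Continuous.aestronglyMeasurable
        (by fun_prop))).mul (hL.comp_sub_left x).aestronglyMeasurable.comp_fst
    · rw [norm_mul, norm_mul, norm_exp_mul_I_mul, norm_mul, mul_one, mul_comm]
  have hswap := integral_integral_swap (f := fun s w : ℝ => F w * Complex.exp (w * Complex.I * s) *
      L (x - s)) hint
  unfold conv
  simp only [← integral_mul_const]
  rw [hswap]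
  congr 1; ext w
  unfold testTransform
  rw [← integral_const_mul, ← integral_sub_left_eq_self (μ := volume)
    (fun t : ℝ => F w * Complex.exp (w * Complex.I * x) *
      (L t * Complex.exp (-((w : ℂ) * Complex.I) * t))) x]
  congr 1; ext s
  have : Complex.exp (w * Complex.I * s) = Complex.exp (w * Complex.I * x) *
      Complex.exp (-((w : ℂ) * Complex.I) * ((x - s : ℝ) : ℂ)) := by
    rw [← Complex.exp_add]; congr 1; push_cast; ring
  rw [this]; ring

lemma testTransform_conv {K L : ℝ → ℂ} (hK : Integrable K) (hL : Integrable L) (w : ℝ) :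
    testTransform (conv K L) (w * Complex.I) =
      testTransform K (w * Complex.I) * testTransform L (w * Complex.I) := by
  have hnorm : ∀ t : ℝ, ‖Complex.exp (-((w : ℂ) * Complex.I) * t)‖ = 1 := fun t => by
    have := norm_exp_mul_I_mul (-w) t
    rwa [Complex.ofReal_neg, neg_mul] at this
  have hint := (hK.convolution_integrand (ContinuousLinearMap.mul ℝ ℂ) hL)
  have hint' : Integrable (fun q : ℝ × ℝ => K q.2 * L (q.1 - q.2) *
      Complex.exp (-((w : ℂ) * Complex.I) * q.1)) (volume.prod volume) := by
    refine hint.mono (hint.aestronglyMeasurable.mul (Continuous.aestronglyMeasurable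
      (by fun_prop))) (Eventually.of_forall fun q => ?_)
    rw [norm_mul, hnorm, mul_one]; rfl
  have hswap := integral_integral_swap (f := fun t s : ℝ => K s * L (t - s) *
      Complex.exp (-((w : ℂ) * Complex.I) * t)) hint'
  have e1 : testTransform (conv K L) (w * Complex.I) = ∫ t : ℝ, ∫ s : ℝ, K s * L (t - s) *
      Complex.exp (-((w : ℂ) * Complex.I) * t) := by
    unfold testTransform conv
    simp only [← integral_mul_const]
  rw [e1, hswap, testTransform, ← integral_mul_const]
  congr 1; ext s
  unfold testTransform
  rw [← integral_const_mul, ← integral_sub_right_eq_self (μ := volume)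
    (fun t : ℝ => K s * Complex.exp (-((w : ℂ) * Complex.I) * s) *
      (L t * Complex.exp (-((w : ℂ) * Complex.I) * t))) s]
  congr 1; ext t
  have : Complex.exp (-((w : ℂ) * Complex.I) * t) =
      Complex.exp (-((w : ℂ) * Complex.I) * s) *
      Complex.exp (-((w : ℂ) * Complex.I) * ((t - s : ℝ) : ℂ)) := by
    rw [← Complex.exp_add]; congr 1; push_cast; ring
  rw [this]; ring

/-! ### Elimination of the Green function -/

/-- A continuous function is determined by its convolutions with even real test functions. -/
lemma eq_zero_of_conv_eq_zero {y : ℝ → ℂ} (hy : Continuous y) {v : ℝ}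
    (h : ∀ (δ : ℝ) (η : ℝ → ℂ), 0 < δ → IsTest δ η → (∀ t, (starRingEnd ℂ) (η t) = η t) →
      (∀ t, η (-t) = η t) → conv η y v = 0) : y v = 0 := by
  set φ : ℕ → ContDiffBump (0 : ℝ) := fun n =>
    ⟨(1 : ℝ) / (n + 1) / 2, 1 / (n + 1), by positivity, half_lt_self (by positivity)⟩ with hφ
  have hlim := ContDiffBump.convolution_tendsto_right_of_continuous (μ := volume) (φ := φ)
    (l := atTop) tendsto_one_div_add_atTop_nhds_zero_nat hy v
  have hz : ∀ n, MeasureTheory.convolution ((φ n).normed volume) y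
      (ContinuousLinearMap.lsmul ℝ ℝ) volume v = 0 := by
    intro n
    rw [← h (φ n).rOut (fun t => (((φ n).normed volume t : ℝ) : ℂ)) (φ n).rOut_pos
      ⟨Complex.ofRealCLM.contDiff.comp (φ n).contDiff_normed, fun t ht => ?_⟩
      (fun t => Complex.conj_ofReal _) (fun t => by rw [ContDiffBump.normed_neg])]
    · unfold conv MeasureTheory.convolution
      congr 1
    · have : t ∉ Function.support ((φ n).normed volume) := by
        rw [(φ n).support_normed_eq]
        simpa using ht.le
      rw [Function.notMem_support.1 this, Complex.ofReal_zero]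
  simp only [hz] at hlim
  exact (tendsto_nhds_unique hlim tendsto_const_nhds)

namespace IsTest

variable {δ : ℝ} {η : ℝ → ℂ}

lemma continuous_testTransform_mul_I (h : IsTest δ η) :
    Continuous fun w : ℝ => testTransform η (w * Complex.I) :=
  continuous_iff_continuousAt.2 fun w => (h.hasDerivAt_testTransform_mul_I w).continuousAt

lemma integrable_testTransform_mul_I (h : IsTest δ η) :
    Integrable fun w : ℝ => testTransform η (w * Complex.I) := by
  obtain ⟨C, hC, hle⟩ := h.norm_testTransform_le 2
  refine (integrable_inv_one_add_sq.const_mul C).mono'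
    h.continuous_testTransform_mul_I.aestronglyMeasurable (Eventually.of_forall fun w => ?_)
  have h1 := hle (w * Complex.I) (by simp)
  have h2 : (1 + w ^ 2) ≤ (1 + ‖(w : ℂ) * Complex.I‖) ^ 2 := by
    rw [norm_mul, Complex.norm_I, Complex.norm_real, Real.norm_eq_abs]
    nlinarith [sq_abs w, abs_nonneg w]
  simp only [Complex.mul_re, Complex.ofReal_re, Complex.I_re, mul_zero, Complex.ofReal_im,
    Complex.I_im, mul_one, sub_self, Real.exp_zero] at h1
  rw [← div_eq_mul_inv, le_div_iff₀ (by positivity)]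
  exact (mul_le_mul_of_nonneg_left h2 (norm_nonneg _)).trans h1

lemma integral_testTransform_mul_exp (h : IsTest δ η) (t : ℝ) :
    ∫ w : ℝ, testTransform η (w * Complex.I) * Complex.exp (w * Complex.I * t) =
      2 * Real.pi * η t := by
  have hF : ∀ ξ : ℝ, FourierTransform.fourier η ξ =
      testTransform η (((2 * Real.pi * ξ : ℝ) : ℂ) * Complex.I) := by
    intro ξ
    rw [Real.fourier_eq']
    unfold testTransform
    congr 1; ext x
    rw [smul_eq_mul, mul_comm]
    congr 2
    simp only [RCLike.inner_apply, conj_trivial]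
    push_cast; ring
  have hFi : Integrable (FourierTransform.fourier η) := by
    have := h.integrable_testTransform_mul_I.comp_mul_left' (R := 2 * Real.pi)
      (by have := Real.pi_pos; positivity)
    refine this.congr (Eventually.of_forall fun ξ => ?_)
    rw [hF]
  have hinv := congrFun (h.continuous.fourierInv_fourier_eq h.integrable hFi) t
  rw [Real.fourierInv_eq'] at hinv
  have hsc := Measure.integral_comp_mul_left (fun w : ℝ => testTransform η (w * Complex.I) *
    Complex.exp (w * Complex.I * t)) (2 * Real.pi)
  have hpi := Real.pi_pos
  rw [abs_of_pos (by positivity), Complex.real_smul] at hsc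
  have e : ∫ ξ : ℝ, Complex.exp (((2 * Real.pi * inner ℝ ξ t : ℝ) : ℂ) * Complex.I) •
      FourierTransform.fourier η ξ = ∫ ξ : ℝ, testTransform η
        (((2 * Real.pi * ξ : ℝ) : ℂ) * Complex.I) *
          Complex.exp (((2 * Real.pi * ξ : ℝ) : ℂ) * Complex.I * t) := by
    congr 1; ext ξ
    rw [hF, smul_eq_mul, mul_comm]
    congr 2
    simp only [RCLike.inner_apply, conj_trivial]
    push_cast; ring
  rw [e, hsc] at hinv
  have hpi' : (Real.pi : ℂ) ≠ 0 := by exact_mod_cast hpi.ne'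
  rw [← hinv, ← mul_assoc, Complex.ofReal_inv, Complex.ofReal_mul, Complex.ofReal_ofNat,
    mul_inv_cancel₀ (mul_ne_zero two_ne_zero hpi'), one_mul]

end IsTest

section Elimination

variable {m a hbar lam lam₁ lam₂ g₁ g₂ P₀ P₁ P₂ : ℝ}

/-- The retarded kernel of the loop operator. -/
def retardedLoop (m a : ℝ) (p : Space) (t : ℝ) : ℂ :=
  (Ioi (0 : ℝ)).indicator (fun t => (loopKernel m a t p : ℂ)) t

lemma isRetarded_retardedLoop (hm : 0 < m) (ha : -(4 * m ^ 2) < a) (p : Space) :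
    IsRetarded (retardedLoop m a p) := by
  obtain ⟨K, hK, hle⟩ := abs_loopKernel_le hm ha p
  refine ⟨?_, ⟨K, hK, fun t => ?_⟩, ⟨0, fun t ht => ?_⟩⟩
  · exact (Complex.continuous_ofReal.comp
      (continuous_loopKernel hm ha p)).aestronglyMeasurable.indicator measurableSet_Ioi
  · refine (norm_indicator_le_norm_self _ _).trans ?_
    rw [Complex.norm_real]; exact hle t
  · rw [neg_zero] at ht
    exact indicator_of_notMem (by simpa using ht.le) _

lemma conv_retardedLoop (p : Space) (h : ℝ → ℂ) (x : ℝ) : conv (retardedLoop m a p) h x =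
    ∫ r in Ioi (0 : ℝ), (loopKernel m a r p : ℂ) * h (x - r) := by
  rw [conv, ← integral_indicator measurableSet_Ioi]
  congr 1; ext r
  rw [retardedLoop, indicator_mul_left]

lemma testTransform_retardedLoop (p : Space) (s : ℂ) :
    testTransform (retardedLoop m a p) s = laplaceKernel m a p s := by
  rw [testTransform, laplaceKernel, ← integral_indicator measurableSet_Ioi]
  congr 1; ext r
  rw [retardedLoop, indicator_mul_left]

/-- Convolution with the Green function turns the equation `φ_ℓ * h + φ_q * (A * h) = 0` for the
source `h` into `φ_Q * h = 0`, if the symbols match almost everywhere. -/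
theorem RegularSymbol.conv_eq_zero
    (H : RegularSymbol m a hbar lam lam₁ lam₂ g₁ g₂ P₀ P₁ P₂)
    (hpos : ∀ x : ℝ, 0 < x → S m a hbar lam lam₁ lam₂ g₁ g₂ x ≠ 0)
    (hP : P₀ ≠ 0 ∨ P₁ ≠ 0 ∨ P₂ ≠ 0) (p : Space) {h : ℝ → ℂ} (hh : IsPast h) {δ : ℝ}
    {φl φq φQ : ℝ → ℂ} (hl : IsTest δ φl) (hq : IsTest δ φq) (hQ : IsTest δ φQ)
    (heq : ∀ v, conv φl h v + conv φq (conv (retardedLoop m a p) h) v = 0)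
    (hsym : ∀ᵐ w : ℝ, green m a hbar lam lam₁ lam₂ g₁ g₂ P₀ P₁ P₂ p (w * Complex.I) *
      (testTransform φl (w * Complex.I) + testTransform φq (w * Complex.I) *
        laplaceKernel m a p (w * Complex.I)) = testTransform φQ (w * Complex.I)) (v : ℝ) :
    conv φQ h v = 0 := by
  have hA := isRetarded_retardedLoop H.m_pos H.a_gt p
  have hcont : Continuous (conv φQ h) := by
    have hsupp := hQ.hasCompactSupport
    exact (HasCompactSupport.continuous_convolution_left (ContinuousLinearMap.mul ℝ ℂ)
      hsupp hQ.continuous hh.cont.locallyIntegrable)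
  refine eq_zero_of_conv_eq_zero hcont fun ε η hε hη hr he => ?_
  set B : ℝ → ℂ := fun t => φl t + conv φq (retardedLoop m a p) t with hB
  have hqA := hq.isRetarded.conv hA
  have hBr : IsRetarded B := hl.isRetarded.add hqA
  have hBh : ∀ x, conv B h x = 0 := by
    intro x
    rw [← heq x, hq.isRetarded.conv_conv hA hh, conv, conv, conv,
      ← integral_add (hl.isRetarded.integrable_mul hh x) (hqA.integrable_mul hh x)]
    congr 1; ext s
    simp only [hB]; ring
  set k := greenKernel m a hbar lam lam₁ lam₂ g₁ g₂ P₀ P₁ P₂ p η with hk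
  have hFi := H.integrable_greenAxis p hη
  have hkr : IsRetarded k := by
    obtain ⟨K, hK, hle⟩ := H.norm_greenKernel_le hpos hP p hη hε hr he
    refine ⟨Continuous.aestronglyMeasurable ?_, ⟨K, hK, hle⟩,
      ⟨ε, fun t ht => H.greenKernel_eq_zero hpos hP p hη ht⟩⟩
    refine continuous_of_dominated (fun t => (H.integrable_greenAxis_mul_exp p hη
      t).aestronglyMeasurable) (fun t => Eventually.of_forall fun w => ?_) hFi.norm
      (Eventually.of_forall fun w => by fun_prop)
    rw [norm_mul, norm_exp_mul_I_mul, mul_one]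
  -- The Fourier inversion formula identifies `k * B` with `2π η * φ_Q`.
  have hkB : conv k B = fun t => 2 * Real.pi * conv η φQ t := by
    ext t
    have h1 := conv_inverse_transform hFi hBr.integrable t
    have h2 := conv_inverse_transform hη.integrable_testTransform_mul_I hQ.integrable t
    have h3 : conv (fun t : ℝ => ∫ w : ℝ, testTransform η (w * Complex.I) *
        Complex.exp (w * Complex.I * t)) φQ t = 2 * Real.pi * conv η φQ t := by
      unfold conv
      rw [← integral_const_mul]
      congr 1; ext s
      simp only [hη.integral_testTransform_mul_exp]
      ring
    rw [← h3, h2]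
    refine h1.trans (integral_congr_ae ?_)
    filter_upwards [hsym] with w hw
    have hBt : testTransform B (w * Complex.I) = testTransform φl (w * Complex.I) +
        testTransform φq (w * Complex.I) * laplaceKernel m a p (w * Complex.I) := by
      rw [← testTransform_retardedLoop, ← testTransform_conv hq.integrable hA.integrable]
      have hi : ∀ K : ℝ → ℂ, Integrable K →
          Integrable fun t : ℝ => K t * Complex.exp (-((w : ℂ) * Complex.I) * t) := by
        intro K hK
        refine hK.mono (hK.aestronglyMeasurable.mul (Continuous.aestronglyMeasurable
          (by fun_prop))) (Eventually.of_forall fun t => ?_)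
        have := norm_exp_mul_I_mul (-w) t
        rw [Complex.ofReal_neg, neg_mul] at this
        rw [norm_mul, this, mul_one]
      unfold testTransform
      rw [← integral_add (hi _ hl.integrable) (hi _ hqA.integrable)]
      congr 1; ext t
      simp only [hB]; ring
    rw [hBt, ← hw, greenAxis]
    ring
  have hfin : conv k (conv B h) v = 2 * Real.pi * conv η (conv φQ h) v := by
    rw [hkr.conv_conv hBr hh, hη.isRetarded.conv_conv hQ.isRetarded hh, hkB, conv, conv,
      ← integral_const_mul]
    congr 1; ext s; ring
  have hz : conv k (conv B h) v = 0 := by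
    rw [show conv B h = fun _ => 0 from funext hBh, conv]; simp
  rw [hz] at hfin
  have hpi : (2 * (Real.pi : ℂ)) ≠ 0 := by simp
  exact (mul_eq_zero.1 hfin.symm).resolve_left hpi

end Elimination

/-! ### The operator `∂ₜ² + |p|²` -/

/-- The operator `∂ₜ² + c`. -/
def boxOp (c : ℝ) (f : ℝ → ℂ) (t : ℝ) : ℂ := deriv (deriv f) t + c * f t

section BoxOp

variable {δ : ℝ} {η : ℝ → ℂ} {c : ℝ}

lemma IsTest.boxOp (h : IsTest δ η) : IsTest δ (boxOp c η) :=
  h.deriv.deriv.add (h.const_mul c)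

lemma testTransform_add {η η' : ℝ → ℂ} {δ : ℝ} (h : IsTest δ η) (h' : IsTest δ η') (s : ℂ) :
    testTransform (fun t => η t + η' t) s = testTransform η s + testTransform η' s := by
  unfold testTransform
  have he : Continuous fun t : ℝ => Complex.exp (-s * t) := by fun_prop
  rw [← integral_add (h.integrable_mul he) (h'.integrable_mul he)]
  congr 1; ext t; ring

lemma testTransform_const_mul (c : ℂ) (η : ℝ → ℂ) (s : ℂ) :
    testTransform (fun t => c * η t) s = c * testTransform η s := by
  unfold testTransform
  rw [← integral_const_mul]
  congr 1; ext t; ring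

lemma IsTest.testTransform_boxOp (h : IsTest δ η) (p : Space) (s : ℂ) :
    testTransform (SemiclassicalToy.boxOp (‖p‖ ^ 2) η) s = boxSymbol p s * testTransform η s := by
  unfold SemiclassicalToy.boxOp
  rw [testTransform_add h.deriv.deriv (h.const_mul _), testTransform_const_mul,
    h.deriv.testTransform_deriv, h.testTransform_deriv, boxSymbol]
  ring

lemma contDiff_boxOp {f : ℝ → ℂ} (hf : ContDiff ℝ ∞ f) : ContDiff ℝ ∞ (boxOp c f) :=
  (contDiff_infty_iff_deriv.1 (contDiff_infty_iff_deriv.1 hf).2).2.add (contDiff_const.mul hf)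

lemma IsTest.conv_deriv (h : IsTest δ η) {f : ℝ → ℂ} (hf : ContDiff ℝ 1 f) (v : ℝ) :
    conv (_root_.deriv η) f v = conv η (_root_.deriv f) v := by
  have hfd : ∀ s : ℝ, HasDerivAt (fun s => f (v - s)) (-_root_.deriv f (v - s)) s := fun s => by
    have h1 := ((hf.differentiable (by norm_num)) (v - s)).hasDerivAt
    exact h1.comp_const_sub v s
  have hηd : ∀ s, HasDerivAt η (_root_.deriv η s) s := fun t =>
    (h.smooth.differentiable (by simp) t).hasDerivAt
  have hc : Continuous fun s => f (v - s) := hf.continuous.comp (by fun_prop)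
  have hc' : Continuous fun s => -_root_.deriv f (v - s) :=
    ((hf.continuous_deriv le_rfl).comp (by fun_prop)).neg
  have := integral_mul_deriv_eq_deriv_mul_of_integrable (u := η) (v := fun s => f (v - s))
    (u' := _root_.deriv η) (v' := fun s => -_root_.deriv f (v - s)) (fun s _ => hηd s)
    (fun s _ => hfd s) (h.integrable_mul hc') (h.deriv.integrable_mul hc) (h.integrable_mul hc)
  unfold conv
  simp only [mul_neg, integral_neg, neg_inj] at this
  exact this.symm

lemma IsTest.conv_boxOp (h : IsTest δ η) {f : ℝ → ℂ} (hf : ContDiff ℝ 2 f) (v : ℝ) :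
    conv (SemiclassicalToy.boxOp c η) f v = conv η (SemiclassicalToy.boxOp c f) v := by
  have hf' : ContDiff ℝ 1 (_root_.deriv f) := (contDiff_succ_iff_deriv.1 hf).2.2
  have e1 : conv (_root_.deriv (_root_.deriv η)) f v =
      conv η (_root_.deriv (_root_.deriv f)) v := by
    rw [h.deriv.conv_deriv (hf.of_le (by norm_num)), h.conv_deriv hf']
  have hfc : Continuous fun s => f (v - s) := hf.continuous.comp (by fun_prop)
  have hf2 : Continuous fun s => _root_.deriv (_root_.deriv f) (v - s) :=
    (hf'.continuous_deriv le_rfl).comp (by fun_prop)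
  have e2 : conv (SemiclassicalToy.boxOp c η) f v =
      conv (_root_.deriv (_root_.deriv η)) f v + c * conv η f v := by
    unfold conv SemiclassicalToy.boxOp
    rw [← integral_const_mul, ← integral_add (h.deriv.deriv.integrable_mul hfc)
      ((h.integrable_mul hfc).const_mul _)]
    congr 1; ext s; ring
  have e3 : conv η (SemiclassicalToy.boxOp c f) v =
      conv η (_root_.deriv (_root_.deriv f)) v + c * conv η f v := by
    unfold conv SemiclassicalToy.boxOp
    rw [← integral_const_mul, ← integral_add (h.integrable_mul hf2)
      ((h.integrable_mul hfc).const_mul _)]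
    congr 1; ext s; ring
  rw [e2, e3, e1]

end BoxOp

/-! ### The equation of one Fourier mode -/

/-- The operator `α + β (∂ₜ² + c)`. -/
def linOp (α β c : ℝ) (f : ℝ → ℂ) (t : ℝ) : ℂ := α * f t + β * boxOp c f t

section LinOp

variable {δ c α β : ℝ} {η f : ℝ → ℂ}

lemma contDiff_linOp (hf : ContDiff ℝ ∞ f) : ContDiff ℝ ∞ (linOp α β c f) :=
  (contDiff_const.mul hf).add (contDiff_const.mul (contDiff_boxOp hf))

lemma IsTest.linOp (h : IsTest δ η) : IsTest δ (linOp α β c η) :=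
  (h.const_mul α).add (h.boxOp.const_mul β)

lemma IsTest.testTransform_linOp (h : IsTest δ η) (p : Space) (s : ℂ) :
    testTransform (SemiclassicalToy.linOp α β (‖p‖ ^ 2) η) s =
      (α + β * boxSymbol p s) * testTransform η s := by
  unfold SemiclassicalToy.linOp
  rw [testTransform_add (h.const_mul _) (h.boxOp.const_mul _), testTransform_const_mul,
    testTransform_const_mul, h.testTransform_boxOp]
  ring

lemma IsTest.conv_add_right (h : IsTest δ η) {f g : ℝ → ℂ} (hf : Continuous f)
    (hg : Continuous g) (v : ℝ) :
    conv η (fun t => f t + g t) v = conv η f v + conv η g v := by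
  have hf' : Continuous fun s => f (v - s) := hf.comp (by fun_prop)
  have hg' : Continuous fun s => g (v - s) := hg.comp (by fun_prop)
  unfold conv
  rw [← integral_add (h.integrable_mul hf') (h.integrable_mul hg')]
  congr 1; ext s; ring

lemma IsTest.conv_add_left {η' : ℝ → ℂ} (h : IsTest δ η) (h' : IsTest δ η') (hf : Continuous f)
    (v : ℝ) : conv (fun t => η t + η' t) f v = conv η f v + conv η' f v := by
  have hf' : Continuous fun s => f (v - s) := hf.comp (by fun_prop)
  unfold conv
  rw [← integral_add (h.integrable_mul hf') (h'.integrable_mul hf')]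
  congr 1; ext s; ring

lemma conv_const_mul_left (c : ℂ) (η f : ℝ → ℂ) (v : ℝ) :
    conv (fun t => c * η t) f v = c * conv η f v := by
  unfold conv
  rw [← integral_const_mul]
  congr 1; ext s; ring

lemma conv_const_mul_right (c : ℂ) (η f : ℝ → ℂ) (v : ℝ) :
    conv η (fun t => c * f t) v = c * conv η f v := by
  unfold conv
  rw [← integral_const_mul]
  congr 1; ext s; ring

lemma continuous_boxOp (hf : ContDiff ℝ 2 f) : Continuous (boxOp c f) := by
  have h1 : ContDiff ℝ 1 (deriv f) := (contDiff_succ_iff_deriv.1 hf).2.2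
  exact (h1.continuous_deriv le_rfl).add (continuous_const.mul hf.continuous)

lemma continuous_linOp (hf : ContDiff ℝ 2 f) : Continuous (linOp α β c f) :=
  (continuous_const.mul hf.continuous).add (continuous_const.mul (continuous_boxOp hf))

/-- The operator `α + β (∂ₜ² + c)` is formally self-adjoint. -/
lemma IsTest.conv_linOp (h : IsTest δ η) (hf : ContDiff ℝ 2 f) (v : ℝ) :
    conv (SemiclassicalToy.linOp α β c η) f v = conv η (SemiclassicalToy.linOp α β c f) v := by
  unfold SemiclassicalToy.linOp
  rw [(h.const_mul _).conv_add_left (h.boxOp.const_mul _) hf.continuous,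
    h.conv_add_right (f := fun t => (α : ℂ) * f t) (g := fun t => (β : ℂ) *
      SemiclassicalToy.boxOp c f t) (continuous_const.mul hf.continuous)
      (continuous_const.mul (continuous_boxOp hf)), conv_const_mul_left, conv_const_mul_left,
    conv_const_mul_right, conv_const_mul_right, h.conv_boxOp hf]

lemma linOp_add {f g : ℝ → ℂ} (hf : ContDiff ℝ ∞ f) (hg : ContDiff ℝ ∞ g) :
    linOp α β c (fun t => f t + g t) = fun t => linOp α β c f t + linOp α β c g t := by
  have hd : ∀ {k : ℝ → ℂ}, ContDiff ℝ ∞ k → ∀ t, DifferentiableAt ℝ k t := fun hk t =>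
    hk.differentiable (by simp) t
  have hd' : ∀ {k : ℝ → ℂ}, ContDiff ℝ ∞ k → ContDiff ℝ ∞ (deriv k) := fun hk =>
    (contDiff_infty_iff_deriv.1 hk).2
  have e : deriv (fun t => f t + g t) = fun t => deriv f t + deriv g t := by
    ext t; exact deriv_fun_add (hd hf t) (hd hg t)
  ext t
  simp only [linOp, boxOp]
  rw [e, deriv_fun_add (hd (hd' hf) t) (hd (hd' hg) t)]
  ring

lemma linOp_const_mul {f : ℝ → ℂ} (hf : ContDiff ℝ ∞ f) (k : ℂ) :
    linOp α β c (fun t => k * f t) = fun t => k * linOp α β c f t := by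
  have hd : ∀ {k : ℝ → ℂ}, ContDiff ℝ ∞ k → ∀ t, DifferentiableAt ℝ k t := fun hk t =>
    hk.differentiable (by simp) t
  have hd' : ContDiff ℝ ∞ (deriv f) := (contDiff_infty_iff_deriv.1 hf).2
  have e : deriv (fun t => k * f t) = fun t => k * deriv f t := by
    ext t; exact deriv_const_mul k (hd hf t)
  ext t
  simp only [linOp, boxOp]
  rw [e, deriv_const_mul k (hd hd' t)]
  ring

lemma linOp_linOp {α' β' : ℝ} (hf : ContDiff ℝ ∞ f) : linOp α β c (linOp α' β' c f) =
    fun t => α' * linOp α β c f t + β' * linOp α β c (boxOp c f) t := by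
  have hB := contDiff_boxOp (c := c) hf
  have h1 := linOp_add (α := α) (β := β) (c := c) (f := fun t => (α' : ℂ) * f t)
    (g := fun t => (β' : ℂ) * boxOp c f t) (contDiff_const.mul hf) (contDiff_const.mul hB)
  rw [linOp_const_mul hf, linOp_const_mul hB] at h1
  exact h1

lemma linOp_comm {α' β' : ℝ} (hf : ContDiff ℝ ∞ f) :
    linOp α β c (linOp α' β' c f) = linOp α' β' c (linOp α β c f) := by
  rw [linOp_linOp hf, linOp_linOp hf]
  ext t
  simp only [linOp]
  ring

end LinOp

section Past

variable {m a : ℝ}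

/-- Since the loop kernel decays exactly like `t^{-3/2}`, convergence of the convolution with it at
all times makes the source integrable against `decayWeight` in the past. -/
lemma isPast_of_integrableOn (hm : 0 < m) (ha : -(4 * m ^ 2) < a) (p : Space) {h : ℝ → ℂ}
    (hc : Continuous h)
    (hi : ∀ t, IntegrableOn (fun r => (loopKernel m a r p : ℂ) * h (t - r)) (Ioi 0)) :
    IsPast h := by
  refine ⟨hc, fun T => ?_⟩
  obtain ⟨c, R, τ, hcp, hR, hτ, hle⟩ := decayWeight_le_abs_loopKernel_add hm ha p
  have hw := continuous_decayWeight
  -- The two convolutions at the times `T` and `T + τ` bound the tail.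
  have h1 : IntegrableOn (fun r => |loopKernel m a r p| * ‖h (T - r)‖) (Ioi R) := by
    refine ((hi T).mono_set (Ioi_subset_Ioi hR.le)).norm.congr (Eventually.of_forall fun r => ?_)
    simp only [norm_mul, Complex.norm_real, Real.norm_eq_abs]
  have h2 : IntegrableOn (fun r => |loopKernel m a (r + τ) p| * ‖h (T - r)‖) (Ioi R) := by
    have h3 := ((hi (T + τ)).mono_set (Ioi_subset_Ioi (show (0 : ℝ) ≤ R + τ by positivity))).norm
    have h3' := ((measurePreserving_add_right volume τ).integrableOn_comp_preimage
      (measurableEmbedding_addRight τ)).2 h3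
    rw [preimage_add_const_Ioi, add_sub_cancel_right] at h3'
    refine Integrable.congr h3' (Eventually.of_forall fun r => ?_)
    simp only [Function.comp_apply, norm_mul, Complex.norm_real, Real.norm_eq_abs]
    rw [show T + τ - (r + τ) = T - r by ring]
  have h3 : IntegrableOn (fun r => decayWeight r * ‖h (T - r)‖) (Ioi R) := by
    refine ((h1.add h2).const_mul c⁻¹).mono' (Continuous.aestronglyMeasurable (by fun_prop)) ?_
    filter_upwards [ae_restrict_mem measurableSet_Ioi] with r hr
    have hk := hle r (le_of_lt hr)
    have hwp := decayWeight_pos r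
    rw [Real.norm_of_nonneg (by positivity)]
    simp only [Pi.add_apply]
    rw [← add_mul, ← mul_assoc]
    refine mul_le_mul_of_nonneg_right ?_ (norm_nonneg _)
    rw [inv_mul_eq_div, le_div_iff₀ hcp, mul_comm]
    exact hk
  have h4 : IntegrableOn (fun r => decayWeight r * ‖h (T - r)‖) (Ici 0) := by
    rw [← Icc_union_Ioi_eq_Ici hR.le]
    exact (Continuous.continuousOn (by fun_prop)).integrableOn_Icc.union h3
  have h5 : IntegrableOn (fun r => decayWeight (T - r) * ‖h r‖) (Iic T) := by
    have h6 := ((Measure.measurePreserving_sub_left volume T).integrableOn_comp_preimage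
      (Homeomorph.subLeft T).measurableEmbedding).2 h4
    have e : (fun x => T - x) ⁻¹' Ici 0 = Iic T := by ext x; simp
    rw [e] at h6
    refine h6.congr (Eventually.of_forall fun r => ?_)
    simp
  refine (h5.const_mul ((1 + |T|) ^ (3 / 2 : ℝ))).mono'
    (Continuous.aestronglyMeasurable (by fun_prop)) (Eventually.of_forall fun r => ?_)
  have hwp := decayWeight_pos r
  rw [Real.norm_of_nonneg (by positivity), ← mul_assoc]
  exact mul_le_mul_of_nonneg_right (decayWeight_le_mul_sub T r) (norm_nonneg _)

end Past

section Mode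

variable {m a hbar lam lam₁ lam₂ g₁ g₂ ζ₁ ζ₂ : ℝ}

/-- The equation of one Fourier mode `f` forces `P(D) (a - D) f = 0` for `D = ∂ₜ² + |p|²` and every
polynomial `P(z) = (z - ζ₁) (z - ζ₂)` that cancels the zeros of the symbol. -/
theorem RegularSymbol.linOp_eq_zero
    (H : RegularSymbol m a hbar lam lam₁ lam₂ g₁ g₂ (ζ₁ * ζ₂) (-(ζ₁ + ζ₂)) 1)
    (hpos : ∀ x : ℝ, 0 < x → S m a hbar lam lam₁ lam₂ g₁ g₂ x ≠ 0) (p : Space) {f : ℝ → ℂ}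
    (hf : ContDiff ℝ ∞ f) (hh : IsPast (linOp a (-1) (‖p‖ ^ 2) f)) {W : ℝ → ℂ}
    (hW : ∀ t, W t = ((hbar * lam : ℝ) : ℂ) *
      conv (retardedLoop m a p) (linOp a (-1) (‖p‖ ^ 2) f) t) (hW2 : ContDiff ℝ 2 W)
    (heq : ∀ t, linOp g₁ g₂ (‖p‖ ^ 2) f t + linOp lam₁ lam₂ (‖p‖ ^ 2) W t = 0) (t : ℝ) :
    linOp (-ζ₁) 1 (‖p‖ ^ 2) (linOp (-ζ₂) 1 (‖p‖ ^ 2) (linOp a (-1) (‖p‖ ^ 2) f)) t = 0 := by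
  set c := ‖p‖ ^ 2 with hcdef
  set h := linOp a (-1) c f with hhdef
  have hhs : ContDiff ℝ ∞ h := contDiff_linOp hf
  have hP : ζ₁ * ζ₂ ≠ 0 ∨ -(ζ₁ + ζ₂) ≠ 0 ∨ (1 : ℝ) ≠ 0 := Or.inr (Or.inr one_ne_zero)
  refine eq_zero_of_conv_eq_zero (contDiff_linOp (contDiff_linOp hhs)).continuous
    fun δ φ hδ hφ hr he => ?_
  set φ' := linOp a (-1) c φ with hφ'
  have hφ't : IsTest δ φ' := hφ.linOp
  set K : ℂ := ((hbar * lam : ℝ) : ℂ) with hK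
  have two : ∀ {k : ℝ → ℂ}, ContDiff ℝ ∞ k → ContDiff ℝ 2 k := fun hk => contDiff_infty.1 hk 2
  have key := H.conv_eq_zero hpos hP p hh (φl := linOp g₁ g₂ c φ)
    (φq := fun t => K * linOp lam₁ lam₂ c φ' t)
    (φQ := fun t => -1 * linOp (-ζ₂) 1 c (linOp (-ζ₁) 1 c φ) t) hφ.linOp (hφ't.linOp.const_mul K)
    (hφ.linOp.linOp.const_mul (-1)) ?_ ?_ t
  · rw [conv_const_mul_left, hφ.linOp.conv_linOp (two hhs),
      hφ.conv_linOp (two (contDiff_linOp hhs))] at key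
    simpa using key
  · intro v
    have hKW : conv (fun t => K * linOp lam₁ lam₂ c φ' t) (conv (retardedLoop m a p) h) v =
        conv (linOp lam₁ lam₂ c φ') W v := by
      rw [conv_const_mul_left, ← conv_const_mul_right, show W = _ from funext hW]
    have h2 : Continuous (linOp lam₁ lam₂ c W) := continuous_linOp hW2
    have h1 : Continuous (linOp g₁ g₂ c f) := continuous_linOp (two hf)
    rw [hKW, hφ't.conv_linOp hW2, hφ.conv_linOp (two hhs), hhdef, linOp_comm hf,
      ← hφ.conv_linOp (two (contDiff_linOp hf)), ← hφ't.conv_add_right h1 h2]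
    simp only [heq]
    simp [conv]
  · filter_upwards [H.ae_symbolAt_ne_zero hP p] with w hw
    rw [hφ.testTransform_linOp, testTransform_const_mul, hφ't.testTransform_linOp,
      hφ.testTransform_linOp, testTransform_const_mul, hφ.linOp.testTransform_linOp,
      hφ.testTransform_linOp, green, div_mul_eq_mul_div, div_eq_iff hw]
    rw [symbolAt, quadratic, hK]
    push_cast
    ring

/-- The variant for a symbol that vanishes at `a`: then `g₁ = -g₂ a` and `λ₂ = 0`, and the factor
`a - D` of the symbol is already contained in the source. -/
theorem RegularSymbol.linOp_eq_zero_of_eq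
    (H : RegularSymbol m a hbar lam lam₁ 0 (-(g₂ * a)) g₂ (a * ζ₂) (-(a + ζ₂)) 1)
    (hpos : ∀ x : ℝ, 0 < x → S m a hbar lam lam₁ 0 (-(g₂ * a)) g₂ x ≠ 0) (p : Space)
    {f : ℝ → ℂ}
    (hf : ContDiff ℝ ∞ f) (hh : IsPast (linOp a (-1) (‖p‖ ^ 2) f)) {W : ℝ → ℂ}
    (hW : ∀ t, W t = ((hbar * lam : ℝ) : ℂ) *
      conv (retardedLoop m a p) (linOp a (-1) (‖p‖ ^ 2) f) t)
    (heq : ∀ t, linOp (-(g₂ * a)) g₂ (‖p‖ ^ 2) f t + lam₁ * W t = 0) (t : ℝ) :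
    linOp (-ζ₂) 1 (‖p‖ ^ 2) (linOp a (-1) (‖p‖ ^ 2) f) t = 0 := by
  set c := ‖p‖ ^ 2 with hcdef
  set h := linOp a (-1) c f with hhdef
  have hhs : ContDiff ℝ ∞ h := contDiff_linOp hf
  have hP : a * ζ₂ ≠ 0 ∨ -(a + ζ₂) ≠ 0 ∨ (1 : ℝ) ≠ 0 := Or.inr (Or.inr one_ne_zero)
  refine eq_zero_of_conv_eq_zero (contDiff_linOp hhs).continuous fun δ φ hδ hφ hr he => ?_
  set K : ℂ := ((hbar * lam : ℝ) : ℂ) with hK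
  have two : ∀ {k : ℝ → ℂ}, ContDiff ℝ ∞ k → ContDiff ℝ 2 k := fun hk =>
    contDiff_infty.1 hk 2
  have key := H.conv_eq_zero hpos hP p hh (φl := fun t => -(g₂ : ℂ) * φ t)
    (φq := fun t => (K * lam₁) * φ t) (φQ := linOp (-ζ₂) 1 c φ) (hφ.const_mul _)
    (hφ.const_mul _) hφ.linOp ?_ ?_ t
  · rwa [hφ.conv_linOp (two hhs)] at key
  · intro v
    have hW' : Continuous fun t => (lam₁ : ℂ) * W t := by
      have : (fun t => (lam₁ : ℂ) * W t) = fun t => -linOp (-(g₂ * a)) g₂ c f t := by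
        ext t; linear_combination heq t
      rw [this]; exact (contDiff_linOp hf).continuous.neg
    have e1 : (fun t => -(g₂ : ℂ) * h t) = linOp (-(g₂ * a)) g₂ c f := by
      ext t; simp only [hhdef, linOp]; push_cast; ring
    have e2 : conv (fun t => (K * lam₁) * φ t) (conv (retardedLoop m a p) h) v =
        conv φ (fun t => (lam₁ : ℂ) * W t) v := by
      rw [conv_const_mul_left, ← conv_const_mul_right]
      congr 1; ext t; rw [hW]; ring
    rw [e2, conv_const_mul_left, ← conv_const_mul_right, e1,
      ← hφ.conv_add_right (contDiff_linOp hf).continuous hW']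
    simp only [heq]
    simp [conv]
  · filter_upwards [H.ae_symbolAt_ne_zero hP p] with w hw
    rw [testTransform_const_mul, testTransform_const_mul, hφ.testTransform_linOp, green,
      div_mul_eq_mul_div, div_eq_iff hw]
    rw [symbolAt, quadratic, hK]
    push_cast
    ring

end Mode

/-! ### Spatially compact functions and their spatial Fourier transform -/

/-- Smooth functions on spacetime with spatially compact support. -/
structure SpatiallyCompact (ψ : ℝ → Space → ℝ) : Prop where
  smooth : ContDiff ℝ ∞ (fun y : ℝ × Space => ψ y.1 y.2)
  support : ∀ T : ℝ, ∃ R : ℝ, ∀ t : ℝ, |t| ≤ T → ∀ x : Space, R < ‖x‖ → ψ t x = 0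

namespace SpatiallyCompact

variable {ψ χ : ℝ → Space → ℝ}

lemma slice (h : SpatiallyCompact ψ) (t : ℝ) : ContDiff ℝ ∞ (ψ t) :=
  h.smooth.comp (contDiff_const.prodMk contDiff_id)

lemma hasCompactSupport (h : SpatiallyCompact ψ) (t : ℝ) : HasCompactSupport (ψ t) := by
  obtain ⟨R, hR⟩ := h.support |t|
  refine HasCompactSupport.of_support_subset_isCompact (isCompact_closedBall (0 : Space) R)
    fun x hx => ?_
  by_contra hn
  exact hx (hR t le_rfl x (by simpa using hn))

lemma add (h : SpatiallyCompact ψ) (h' : SpatiallyCompact χ) :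
    SpatiallyCompact fun t x => ψ t x + χ t x := by
  refine ⟨h.smooth.add h'.smooth, fun T => ?_⟩
  obtain ⟨R, hR⟩ := h.support T
  obtain ⟨R', hR'⟩ := h'.support T
  refine ⟨max R R', fun t ht x hx => ?_⟩
  rw [hR t ht x ((le_max_left _ _).trans_lt hx), hR' t ht x ((le_max_right _ _).trans_lt hx),
    add_zero]

lemma const_mul (h : SpatiallyCompact ψ) (c : ℝ) : SpatiallyCompact fun t x => c * ψ t x := by
  refine ⟨contDiff_const.mul h.smooth, fun T => ?_⟩
  obtain ⟨R, hR⟩ := h.support T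
  exact ⟨R, fun t ht x hx => by rw [hR t ht x hx, mul_zero]⟩

lemma sum {ι : Type*} (s : Finset ι) {ψ : ι → ℝ → Space → ℝ}
    (h : ∀ i, SpatiallyCompact (ψ i)) : SpatiallyCompact fun t x => ∑ i ∈ s, ψ i t x := by
  refine ⟨ContDiff.sum fun i _ => (h i).smooth, fun T => ?_⟩
  choose R hR using fun i => (h i).support T
  refine ⟨∑ i ∈ s, |R i|, fun t ht x hx => Finset.sum_eq_zero fun i hi => hR i t ht x ?_⟩
  exact ((le_abs_self _).trans (Finset.single_le_sum (f := fun i => |R i|)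
    (fun _ _ => abs_nonneg _) hi)).trans_lt hx

lemma translate (h : SpatiallyCompact ψ) (y : Space) : SpatiallyCompact fun t x => ψ t (y + x) := by
  refine ⟨h.smooth.comp (contDiff_fst.prodMk (contDiff_const.add contDiff_snd)), fun T => ?_⟩
  obtain ⟨R, hR⟩ := h.support T
  refine ⟨R + ‖y‖, fun t ht x hx => hR t ht _ ?_⟩
  have := norm_sub_le (y + x) y
  rw [add_sub_cancel_left] at this
  linarith

lemma hasDerivAt_time (h : SpatiallyCompact ψ) (t : ℝ) (x : Space) : HasDerivAt (fun r => ψ r x)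
    (fderiv ℝ (fun y : ℝ × Space => ψ y.1 y.2) (t, x) (1, 0)) t := by
  have h1 := (h.smooth.differentiable (by simp) (t, x)).hasFDerivAt
  have h2 : HasDerivAt (fun r : ℝ => (r, x)) ((1 : ℝ), (0 : Space)) t :=
    (hasDerivAt_id t).prodMk (hasDerivAt_const t x)
  exact h1.comp_hasDerivAt t h2

lemma fderiv_slice (h : SpatiallyCompact ψ) (t : ℝ) (x v : Space) : fderiv ℝ (ψ t) x v =
    fderiv ℝ (fun y : ℝ × Space => ψ y.1 y.2) (t, x) (0, v) := by
  have h1 := (h.smooth.differentiable (by simp) (t, x)).hasFDerivAt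
  have h2 : HasFDerivAt (fun z : Space => (t, z)) (ContinuousLinearMap.inr ℝ ℝ Space) x :=
    hasFDerivAt_prodMk_right t x
  have h3 : HasFDerivAt (ψ t) _ x := h1.comp x h2
  rw [h3.fderiv]
  rfl

lemma timeDeriv (h : SpatiallyCompact ψ) :
    SpatiallyCompact fun t x => deriv (fun r => ψ r x) t := by
  refine ⟨?_, fun T => ?_⟩
  · simp only [fun t x => (h.hasDerivAt_time t x).deriv]
    exact ((h.smooth.fderiv_right (m := ∞) (by simp)).clm_apply contDiff_const)
  · obtain ⟨R, hR⟩ := h.support (T + 1)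
    refine ⟨R, fun t ht x hx => ?_⟩
    have hev : (fun r => ψ r x) =ᶠ[𝓝 t] fun _ => 0 := by
      filter_upwards [Metric.ball_mem_nhds t one_pos] with r hr
      refine hR r ?_ x hx
      rw [Metric.mem_ball, Real.dist_eq] at hr
      have := abs_sub_abs_le_abs_sub r t
      linarith
    rw [hev.deriv_eq, deriv_const]

lemma spaceDeriv (h : SpatiallyCompact ψ) (v : Space) :
    SpatiallyCompact fun t x => fderiv ℝ (ψ t) x v := by
  refine ⟨?_, fun T => ?_⟩
  · simp only [h.fderiv_slice]
    exact ((h.smooth.fderiv_right (m := ∞) (by simp)).clm_apply contDiff_const)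
  · obtain ⟨R, hR⟩ := h.support T
    refine ⟨R, fun t ht x hx => ?_⟩
    have hev : ψ t =ᶠ[𝓝 x] fun _ => 0 := by
      filter_upwards [(isOpen_lt continuous_const continuous_norm).mem_nhds hx] with y hy
      exact hR t ht y hy
    rw [hev.fderiv_eq]; simp

lemma iteratedDeriv_two (ψ : ℝ → Space → ℝ) (t : ℝ) (x : Space) :
    iteratedDeriv 2 (fun r => ψ r x) t = deriv (fun s => deriv (fun r => ψ r x) s) t := by
  rw [iteratedDeriv_succ, iteratedDeriv_one]

lemma laplacian_eq (h : SpatiallyCompact ψ) (t : ℝ) (x : Space) :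
    Laplacian.laplacian (ψ t) x = ∑ i, fderiv ℝ (fun y => fderiv ℝ (ψ t) y
      (EuclideanSpace.basisFun (Fin 3) ℝ i)) x (EuclideanSpace.basisFun (Fin 3) ℝ i) := by
  rw [InnerProductSpace.laplacian_eq_iteratedFDeriv_orthonormalBasis (ψ t)
    (EuclideanSpace.basisFun (Fin 3) ℝ)]
  refine Finset.sum_congr rfl fun i _ => ?_
  have hd : DifferentiableAt ℝ (fderiv ℝ (ψ t)) x :=
    ((h.slice t).fderiv_right (m := ∞) (by simp)).differentiable (by simp) x
  rw [iteratedFDeriv_two_apply, fderiv_clm_apply hd (differentiableAt_const _)]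
  simp

lemma dAlembert (h : SpatiallyCompact ψ) : SpatiallyCompact (dAlembert ψ) := by
  have e : SemiclassicalToy.dAlembert ψ = fun t x =>
      (-1) * deriv (fun s => deriv (fun r => ψ r x) s) t +
      ∑ i, fderiv ℝ (fun y => fderiv ℝ (ψ t) y
      (EuclideanSpace.basisFun (Fin 3) ℝ i)) x (EuclideanSpace.basisFun (Fin 3) ℝ i) := by
    ext t x
    rw [SemiclassicalToy.dAlembert, h.laplacian_eq, iteratedDeriv_two, neg_one_mul]
  rw [e]
  exact (h.timeDeriv.timeDeriv.const_mul (-1)).add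
    (SpatiallyCompact.sum _ fun i => (h.spaceDeriv _).spaceDeriv _)

lemma continuous_character (p : Space) : Continuous fun x : Space =>
    Complex.exp (Complex.I * ((inner ℝ p x : ℝ) : ℂ)) := by fun_prop

lemma norm_character (p x : Space) :
    ‖Complex.exp (Complex.I * ((inner ℝ p x : ℝ) : ℂ))‖ = 1 := by
  rw [mul_comm]; exact Complex.norm_exp_ofReal_mul_I _

lemma integrable_mul_character (h : SpatiallyCompact ψ) (t : ℝ) (p : Space) :
    Integrable fun x => (ψ t x : ℂ) * Complex.exp (Complex.I * ((inner ℝ p x : ℝ) : ℂ)) := by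
  refine Continuous.integrable_of_hasCompactSupport
    ((Complex.continuous_ofReal.comp (h.slice t).continuous).mul (continuous_character p)) ?_
  refine HasCompactSupport.mul_right ?_
  exact (h.hasCompactSupport t).comp_left Complex.ofReal_zero

lemma spatialFourier_add (h : SpatiallyCompact ψ) (h' : SpatiallyCompact χ) (t : ℝ) (p : Space) :
    spatialFourier (fun x => ψ t x + χ t x) p = spatialFourier (ψ t) p + spatialFourier (χ t) p := by
  unfold spatialFourier
  rw [← integral_add (h.integrable_mul_character t p) (h'.integrable_mul_character t p)]
  congr 1; ext x; push_cast; ring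

lemma spatialFourier_const_mul (c : ℝ) (f : Space → ℝ) (p : Space) :
    spatialFourier (fun x => c * f x) p = c * spatialFourier f p := by
  unfold spatialFourier
  rw [← integral_const_mul]
  congr 1; ext x; push_cast; ring

lemma spatialFourier_sum {ι : Type*} (s : Finset ι) {ψ : ι → ℝ → Space → ℝ}
    (h : ∀ i, SpatiallyCompact (ψ i)) (t : ℝ) (p : Space) :
    spatialFourier (fun x => ∑ i ∈ s, ψ i t x) p = ∑ i ∈ s, spatialFourier (ψ i t) p := by
  unfold spatialFourier
  rw [← integral_finsetSum s fun i _ => (h i).integrable_mul_character t p]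
  congr 1; ext x; push_cast; rw [Finset.sum_mul]

lemma hasDerivAt_spatialFourier (h : SpatiallyCompact ψ) (t : ℝ) (p : Space) :
    HasDerivAt (fun t => spatialFourier (ψ t) p)
      (spatialFourier (fun x => deriv (fun r => ψ r x) t) p) t := by
  have h' := h.timeDeriv
  obtain ⟨R, hR⟩ := h'.support (|t| + 1)
  have hK : IsCompact (Icc (t - 1) (t + 1) ×ˢ Metric.closedBall (0 : Space) R) :=
    isCompact_Icc.prod (isCompact_closedBall _ _)
  obtain ⟨C, hC⟩ := hK.exists_bound_of_continuousOn h'.smooth.continuous.continuousOn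
  have hnhds : Icc (t - 1) (t + 1) ∈ 𝓝 t := Icc_mem_nhds (by linarith) (by linarith)
  refine (hasDerivAt_integral_of_dominated_loc_of_deriv_le (μ := volume) (x₀ := t)
    (s := Icc (t - 1) (t + 1))
    (F := fun s x => (ψ s x : ℂ) * Complex.exp (Complex.I * ((inner ℝ p x : ℝ) : ℂ)))
    (F' := fun s x => ((deriv (fun r => ψ r x) s : ℝ) : ℂ) *
      Complex.exp (Complex.I * ((inner ℝ p x : ℝ) : ℂ)))
    (bound := (Metric.closedBall (0 : Space) R).indicator fun _ => C)
    hnhds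
    (Eventually.of_forall fun s => (h.integrable_mul_character s p).aestronglyMeasurable)
    (h.integrable_mul_character t p) (h'.integrable_mul_character t p).aestronglyMeasurable
    (Eventually.of_forall fun x s hs => ?_) ?_ (Eventually.of_forall fun x s hs => ?_)).2
  · rw [norm_mul, norm_character, mul_one, Complex.norm_real]
    by_cases hx : x ∈ Metric.closedBall (0 : Space) R
    · rw [indicator_of_mem hx]
      exact hC (s, x) ⟨hs, hx⟩
    · rw [indicator_of_notMem hx, hR s ?_ x (by simpa using hx), norm_zero]
      rw [abs_le]
      constructor <;> linarith [hs.1, hs.2, neg_abs_le t, le_abs_self t]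
  · rw [integrable_indicator_iff Metric.isClosed_closedBall.measurableSet]
    exact integrableOn_const (isCompact_closedBall _ _).measure_lt_top.ne
  · have h1 := (h.hasDerivAt_time s x).ofReal_comp
    rw [← (h.hasDerivAt_time s x).deriv] at h1
    exact h1.mul_const _

lemma contDiff_spatialFourier (h : SpatiallyCompact ψ) (p : Space) :
    ContDiff ℝ ∞ fun t => spatialFourier (ψ t) p := by
  rw [contDiff_infty]
  intro n
  induction n generalizing ψ with
  | zero =>
    rw [Nat.cast_zero, contDiff_zero]
    exact continuous_iff_continuousAt.2 fun t => (h.hasDerivAt_spatialFourier t p).continuousAt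
  | succ n ih =>
    rw [Nat.cast_succ, contDiff_succ_iff_deriv]
    refine ⟨fun t => (h.hasDerivAt_spatialFourier t p).differentiableAt, by simp, ?_⟩
    rw [show deriv (fun t => spatialFourier (ψ t) p) = fun t => spatialFourier (fun x =>
      deriv (fun r => ψ r x) t) p from funext fun t => (h.hasDerivAt_spatialFourier t p).deriv]
    exact ih h.timeDeriv

lemma spatialFourier_spaceDeriv (h : SpatiallyCompact ψ) (v : Space) (t : ℝ) (p : Space) :
    spatialFourier (fun x => fderiv ℝ (ψ t) x v) p =
      -(Complex.I * ((inner ℝ p v : ℝ) : ℂ)) * spatialFourier (ψ t) p := by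
  have hf : ∀ x, HasFDerivAt (fun x => (ψ t x : ℂ)) (Complex.ofRealCLM.comp (fderiv ℝ (ψ t) x)) x :=
    fun x => Complex.ofRealCLM.hasFDerivAt.comp x
      ((h.slice t).differentiable (by simp) x).hasFDerivAt
  have hg : ∀ x, HasFDerivAt (fun x : Space => Complex.exp (Complex.I * ((inner ℝ p x : ℝ) : ℂ)))
      (Complex.exp (Complex.I * ((inner ℝ p x : ℝ) : ℂ)) • (Complex.I •
        Complex.ofRealCLM.comp (innerSL ℝ p))) x := fun x => by
    have h1 : HasFDerivAt (fun x : Space => ((inner ℝ p x : ℝ) : ℂ))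
        (Complex.ofRealCLM.comp (innerSL ℝ p)) x :=
      Complex.ofRealCLM.hasFDerivAt.comp x (innerSL ℝ p).hasFDerivAt
    exact (h1.const_mul Complex.I).cexp
  have hv := h.spaceDeriv v
  have key := integral_bilinear_hasFDerivAt_right_eq_neg_left_of_integrable (μ := volume) (v := v)
    (B := ContinuousLinearMap.mul ℝ ℂ) (f := fun x => (ψ t x : ℂ))
    (g := fun x : Space => Complex.exp (Complex.I * ((inner ℝ p x : ℝ) : ℂ)))
    (f' := fun x => Complex.ofRealCLM.comp (fderiv ℝ (ψ t) x))
    (g' := fun x => Complex.exp (Complex.I * ((inner ℝ p x : ℝ) : ℂ)) • (Complex.I •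
        Complex.ofRealCLM.comp (innerSL ℝ p)))
    (hv.integrable_mul_character t p) ?_ (h.integrable_mul_character t p) (fun x _ => hf x)
    (fun x _ => hg x)
  · have e : ∫ x, (ContinuousLinearMap.mul ℝ ℂ) (ψ t x : ℂ)
        ((Complex.exp (Complex.I * ((inner ℝ p x : ℝ) : ℂ)) • (Complex.I •
        Complex.ofRealCLM.comp (innerSL ℝ p))) v) =
        Complex.I * ((inner ℝ p v : ℝ) : ℂ) * spatialFourier (ψ t) p := by
      unfold spatialFourier
      rw [← integral_const_mul]
      congr 1; ext x
      simp
      ring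
    rw [e] at key
    rw [neg_mul, key, neg_neg]
    rfl
  · refine ((h.integrable_mul_character t p).mul_const
      (Complex.I * ((inner ℝ p v : ℝ) : ℂ))).congr (Eventually.of_forall fun x => ?_)
    simp
    ring

lemma spatialFourier_dAlembert (h : SpatiallyCompact ψ) (t : ℝ) (p : Space) :
    spatialFourier (SemiclassicalToy.dAlembert ψ t) p =
      -boxOp (‖p‖ ^ 2) (fun t => spatialFourier (ψ t) p) t := by
  have e : SemiclassicalToy.dAlembert ψ t = fun x =>
      (-1) * deriv (fun s => deriv (fun r => ψ r x) s) t +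
      ∑ i, fderiv ℝ (fun y => fderiv ℝ (ψ t) y
      (EuclideanSpace.basisFun (Fin 3) ℝ i)) x (EuclideanSpace.basisFun (Fin 3) ℝ i) := by
    ext x
    rw [SemiclassicalToy.dAlembert, h.laplacian_eq, iteratedDeriv_two, neg_one_mul]
  have hs := fun i => (h.spaceDeriv (EuclideanSpace.basisFun (Fin 3) ℝ i)).spaceDeriv
    (EuclideanSpace.basisFun (Fin 3) ℝ i)
  rw [e, (h.timeDeriv.timeDeriv.const_mul (-1)).spatialFourier_add
    (SpatiallyCompact.sum _ hs), spatialFourier_const_mul, spatialFourier_sum _ hs,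
    Finset.sum_congr rfl fun i _ => by
      rw [(h.spaceDeriv _).spatialFourier_spaceDeriv, h.spatialFourier_spaceDeriv], boxOp,
    ← (h.timeDeriv.hasDerivAt_spatialFourier t p).deriv,
    show deriv (fun t => spatialFourier (ψ t) p) = fun t => spatialFourier (fun x =>
      deriv (fun r => ψ r x) t) p from funext fun t => (h.hasDerivAt_spatialFourier t p).deriv]
  have hn : (‖p‖ : ℝ) ^ 2 = ∑ i, (inner ℝ p (EuclideanSpace.basisFun (Fin 3) ℝ i)) ^ 2 := by
    rw [EuclideanSpace.norm_sq_eq]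
    simp [EuclideanSpace.inner_single_right]
  rw [hn]
  push_cast
  rw [Finset.sum_mul, neg_add, ← Finset.sum_neg_distrib, neg_one_mul]
  congr 1
  refine Finset.sum_congr rfl fun i _ => ?_
  linear_combination (inner ℝ p (EuclideanSpace.basisFun (Fin 3) ℝ i) : ℂ) ^ 2 *
    spatialFourier (ψ t) p * Complex.I_sq

end SpatiallyCompact

/-! ### Radial oscillatory integrals -/

section Radial

variable {M C : ℝ} {b b₁ b₂ : ℝ → ℂ}

lemma integral_one_add_sq : ∫ κ in Ioi (0 : ℝ), C / (1 + κ) ^ 2 = C := by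
  have hd : ∀ x ∈ Ici (0 : ℝ), HasDerivAt (fun κ : ℝ => -C / (1 + κ)) (C / (1 + x) ^ 2) x := by
    intro x hx
    have hx : (0 : ℝ) ≤ x := hx
    have h1 : HasDerivAt (fun κ : ℝ => 1 + κ) 1 x := (hasDerivAt_id x).const_add 1
    refine ((hasDerivAt_const x (-C)).fun_div h1 (by positivity)).congr_deriv ?_
    ring
  have hl : Tendsto (fun κ : ℝ => -C / (1 + κ)) atTop (𝓝 0) :=
    tendsto_const_nhds.div_atTop (tendsto_atTop_add_const_left _ _ tendsto_id)
  rw [integral_Ioi_of_hasDerivAt_of_tendsto' hd integrableOn_one_add_sq hl]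
  simp

lemma wave_zero_mass (t : ℝ) {κ : ℝ} (hκ : 0 ≤ κ) :
    wave 0 t κ = Complex.exp (Complex.I * ((t * κ : ℝ) : ℂ)) := by
  rw [wave, disp, zero_pow two_ne_zero, add_zero, Real.sqrt_sq hκ]

lemma hasDerivAt_wave_zero_mass {t : ℝ} (ht : t ≠ 0) {κ : ℝ} (hκ : 0 < κ) :
    HasDerivAt (fun κ => wave 0 t κ / (Complex.I * t)) (wave 0 t κ) κ := by
  have htC : (t : ℂ) ≠ 0 := by exact_mod_cast ht
  have h1 : HasDerivAt (fun κ : ℝ => Complex.I * ((t * κ : ℝ) : ℂ)) (Complex.I * t) κ := by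
    have h2 : HasDerivAt (fun κ : ℝ => t * κ) t κ := by
      simpa using (hasDerivAt_id κ).const_mul t
    exact h2.ofReal_comp.const_mul Complex.I
  have h3 : HasDerivAt (fun κ : ℝ => Complex.exp (Complex.I * ((t * κ : ℝ) : ℂ)) / (Complex.I * t))
      (wave 0 t κ) κ := by
    refine (h1.cexp.div_const (Complex.I * t)).congr_deriv ?_
    rw [wave_zero_mass t hκ.le, mul_div_assoc, div_self (by simp [htC]), mul_one]
  refine h3.congr_of_eventuallyEq ?_
  filter_upwards [lt_mem_nhds hκ] with x hx
  rw [wave_zero_mass t (le_of_lt hx)]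

lemma integrableOn_mul_wave (hc : ContinuousOn b (Ioi 0))
    (hb : ∀ κ, 0 < κ → ‖b κ‖ ≤ C / (1 + κ) ^ 2) (t : ℝ) :
    IntegrableOn (fun κ => b κ * wave M t κ) (Ioi 0) := by
  refine Integrable.mono' (integrableOn_one_add_sq (C := C))
    ((hc.mul (continuous_wave M t).continuousOn).aestronglyMeasurable measurableSet_Ioi) ?_
  filter_upwards [ae_restrict_mem measurableSet_Ioi] with κ hκ
  rw [norm_mul, norm_wave, mul_one]
  exact hb κ hκ

lemma integral_mul_wave_zero_mass (hb : ∀ κ, 0 ≤ κ → HasDerivAt b (b₁ κ) κ)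
    (hc : ContinuousOn b₁ (Ici 0)) (h0 : ∀ κ, 0 ≤ κ → ‖b κ‖ ≤ C / (1 + κ) ^ 2)
    (h1 : ∀ κ, 0 ≤ κ → ‖b₁ κ‖ ≤ C / (1 + κ) ^ 2) {t : ℝ} (ht : t ≠ 0) :
    ∫ κ in Ioi (0 : ℝ), b κ * wave 0 t κ =
      Complex.I / t * (b 0 + ∫ κ in Ioi (0 : ℝ), b₁ κ * wave 0 t κ) := by
  have htC : (t : ℂ) ≠ 0 := by exact_mod_cast ht
  have hbc : ContinuousOn b (Ici 0) := fun κ hκ => (hb κ hκ).continuousAt.continuousWithinAt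
  have hI1 := integrableOn_mul_wave (M := 0) (hbc.mono Ioi_subset_Ici_self)
    (fun κ hκ => h0 κ hκ.le) t
  have hI2 := integrableOn_mul_wave (M := 0) (hc.mono Ioi_subset_Ici_self)
    (fun κ hκ => h1 κ hκ.le) t
  have hparts := integral_Ioi_mul_deriv_eq_deriv_mul (a := (0 : ℝ)) (u := b)
    (v := fun κ => wave 0 t κ / (Complex.I * t)) (u' := b₁) (v' := wave 0 t)
    (a' := b 0 / (Complex.I * t)) (b' := 0) (fun κ hκ => hb κ (le_of_lt hκ))
    (fun κ hκ => hasDerivAt_wave_zero_mass ht hκ) hI1 ?_ ?_ ?_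
  · rw [hparts]
    simp only [← mul_div_assoc]
    rw [integral_div]
    field_simp
    rw [Complex.I_sq]
    ring
  · refine (hI2.div_const (Complex.I * t)).congr (Eventually.of_forall fun κ => ?_)
    simp only [Pi.mul_apply, mul_div_assoc]
  · have hw := ((continuous_wave 0 t).div_const (Complex.I * t)).continuousAt (x := 0)
    have := ((hb 0 le_rfl).continuousAt.mul hw).tendsto.mono_left
      (nhdsWithin_le_nhds (s := Ioi 0))
    have hw0 : wave 0 t 0 = 1 := by simp [wave_zero_mass t le_rfl]
    simp only [Pi.mul_apply, hw0, mul_one_div] at this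
    exact this
  · rw [tendsto_zero_iff_norm_tendsto_zero]
    have hl : Tendsto (fun κ : ℝ => C / (1 + κ) ^ 2 * |t|⁻¹) atTop (𝓝 0) := by
      have : Tendsto (fun κ : ℝ => (1 + κ) ^ 2) atTop atTop :=
        (tendsto_pow_atTop two_ne_zero).comp (tendsto_atTop_add_const_left _ _ tendsto_id)
      simpa using (tendsto_const_nhds.div_atTop this).mul_const |t|⁻¹
    refine tendsto_of_tendsto_of_tendsto_of_le_of_le' tendsto_const_nhds hl
      (Eventually.of_forall fun _ => norm_nonneg _) ?_
    filter_upwards [eventually_ge_atTop 0] with κ hκ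
    rw [Pi.mul_apply, norm_mul, norm_wave_div]
    exact mul_le_mul_of_nonneg_right (h0 κ hκ) (by positivity)

lemma C2Bound.le_div_sq {f f₁ f₂ : ℝ → ℂ} (h : C2Bound (-3) C f f₁ f₂) {κ : ℝ} (hκ : 0 ≤ κ)
    {z : ℂ} (hz : ‖z‖ ≤ C * (1 + κ) ^ (-3 : ℝ)) : ‖z‖ ≤ C / (1 + κ) ^ 2 := by
  have hC := h.nonneg
  refine hz.trans ?_
  rw [rpow_neg_three hκ, mul_one_div]
  gcongr <;> linarith

/-- Without a mass, two integrations by parts give the decay `1 / t²`. -/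
lemma norm_integral_mul_wave_zero_mass_le (h : C2Bound (-3) C b b₁ b₂) (h0 : b 0 = 0) {t : ℝ}
    (ht : 1 ≤ |t|) :
    ‖∫ κ in Ioi (0 : ℝ), b κ * wave 0 t κ‖ ≤ 2 * C * |t| ^ (-(3 / 2) : ℝ) := by
  have ht0 : t ≠ 0 := abs_pos.1 (by linarith)
  have hC := h.nonneg
  rw [integral_mul_wave_zero_mass h.deriv₁ h.cont₁ (fun κ hκ => h.le_div_sq hκ (h.bound₀ κ hκ))
    (fun κ hκ => h.le_div_sq hκ (h.bound₁ κ hκ)) ht0, h0, zero_add,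
    integral_mul_wave_zero_mass h.deriv₂ h.cont₂ (fun κ hκ => h.le_div_sq hκ (h.bound₁ κ hκ))
    (fun κ hκ => h.le_div_sq hκ (h.bound₂ κ hκ)) ht0]
  have e1 : ‖∫ κ in Ioi (0 : ℝ), b₂ κ * wave 0 t κ‖ ≤ C := by
    refine (norm_integral_le_of_norm_le (integrableOn_one_add_sq (C := C)) ?_).trans_eq
      integral_one_add_sq
    filter_upwards [ae_restrict_mem measurableSet_Ioi] with κ hκ
    rw [norm_mul, norm_wave, mul_one]
    exact h.le_div_sq (le_of_lt hκ) (h.bound₂ κ (le_of_lt hκ))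
  have e2 : ‖b₁ 0‖ ≤ C := by simpa using h.bound₁ 0 le_rfl
  have e3 : ‖Complex.I / (t : ℂ)‖ = |t|⁻¹ := by simp
  rw [norm_mul, norm_mul, e3]
  have e4 : |t|⁻¹ * |t|⁻¹ ≤ |t| ^ (-(3 / 2) : ℝ) := by
    rw [← Real.rpow_neg_one, ← Real.rpow_add (by linarith)]
    exact Real.rpow_le_rpow_of_exponent_le ht (by norm_num)
  calc |t|⁻¹ * (|t|⁻¹ * ‖b₁ 0 + ∫ κ in Ioi (0 : ℝ), b₂ κ * wave 0 t κ‖)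
      ≤ |t|⁻¹ * (|t|⁻¹ * (2 * C)) := by
        gcongr
        exact (norm_add_le _ _).trans (by linarith)
    _ = 2 * C * (|t|⁻¹ * |t|⁻¹) := by ring
    _ ≤ _ := by gcongr

lemma c2Bound_ofReal_mul (h : C2Bound (-5) C b b₁ b₂) :
    ∃ g₁ g₂, C2Bound (-4) (4 * C) (fun κ => (κ : ℂ) * b κ) g₁ g₂ := by
  have := C2Bound.ofReal_id.mul h
  norm_num at this
  exact ⟨_, _, this⟩

lemma c2Bound_sq_mul (h : C2Bound (-5) C b b₁ b₂) :
    ∃ g₁ g₂, C2Bound (-3) (16 * C) (fun κ => (κ : ℂ) ^ 2 * b κ) g₁ g₂ := by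
  obtain ⟨g₁, g₂, H⟩ := c2Bound_ofReal_mul h
  have := C2Bound.ofReal_id.mul H
  norm_num at this
  have e : (fun κ : ℝ => (κ : ℂ) ^ 2 * b κ) = fun κ : ℝ => (κ : ℂ) * (κ * b κ) := by
    ext κ; ring
  rw [e, show 16 * C = 4 * (4 * C) by ring]
  exact ⟨_, _, this⟩

/-- An amplitude with the factor `κ²` of the volume element in three space dimensions gives the decay
`|t| ^ (-3/2)` for every mass `M ≥ 0`, also with the factor `1 / ω`. -/
lemma exists_norm_integral_sq_mul_wave_le (hM : 0 ≤ M) : ∃ K : ℝ, 0 ≤ K ∧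
    ∀ (C : ℝ) (b b₁ b₂ : ℝ → ℂ), C2Bound (-5) C b b₁ b₂ → ∀ t : ℝ, 1 ≤ |t| →
      ‖∫ κ in Ioi (0 : ℝ), ((κ : ℂ) ^ 2 * b κ) * wave M t κ‖ ≤
        K * C * |t| ^ (-(3 / 2) : ℝ) ∧
      ‖∫ κ in Ioi (0 : ℝ), ((κ : ℂ) ^ 2 / (disp M κ : ℂ) * b κ) * wave M t κ‖ ≤
        K * C * |t| ^ (-(3 / 2) : ℝ) := by
  rcases hM.eq_or_lt with rfl | hM
  · refine ⟨32, by norm_num, fun C b b₁ b₂ h t ht => ⟨?_, ?_⟩⟩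
    · obtain ⟨g₁, g₂, H⟩ := c2Bound_sq_mul h
      refine (norm_integral_mul_wave_zero_mass_le H (by simp) ht).trans_eq ?_
      ring
    · obtain ⟨g₁, g₂, H⟩ := c2Bound_ofReal_mul h
      have e : ∫ κ in Ioi (0 : ℝ), ((κ : ℂ) ^ 2 / (disp 0 κ : ℂ) * b κ) * wave 0 t κ =
          ∫ κ in Ioi (0 : ℝ), (κ : ℂ) * b κ * wave 0 t κ := by
        refine setIntegral_congr_fun measurableSet_Ioi fun κ hκ => ?_
        have hκ : 0 < κ := hκ
        have hκC : (κ : ℂ) ≠ 0 := by exact_mod_cast hκ.ne'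
        simp only [disp, zero_pow two_ne_zero, add_zero, Real.sqrt_sq hκ.le]
        field_simp
      rw [e]
      have hC := h.nonneg
      refine (norm_integral_mul_wave_zero_mass_le (H.mono (by norm_num)) (by simp) ht).trans ?_
      have : 0 ≤ |t| ^ (-(3 / 2) : ℝ) := by positivity
      nlinarith [mul_nonneg hC this]
  · obtain ⟨K, hK, hle⟩ := norm_integral_mul_wave_le hM
    obtain ⟨D, d₁, d₂, hD⟩ := C2Growth.inv_sqrt (b := M ^ 2) (by positivity)
    have hD0 := hD.nonneg
    refine ⟨4 * K + 16 * K * D, by positivity, fun C b b₁ b₂ h t ht => ?_⟩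
    have hC := h.nonneg
    have ht' : 0 ≤ |t| ^ (-(3 / 2) : ℝ) := by positivity
    obtain ⟨g₁, g₂, H⟩ := c2Bound_ofReal_mul h
    constructor
    · have e : ∀ κ : ℝ, ((κ : ℂ) ^ 2 * b κ) * wave M t κ = κ * (κ * b κ) * wave M t κ :=
        fun κ => by ring
      simp only [e]
      refine (hle _ _ g₁ g₂ (H.mono (by norm_num)) (by simp) t ht).trans ?_
      have : 0 ≤ K * D * C := by positivity
      nlinarith [mul_nonneg this ht']
    · have e : ∀ κ : ℝ, ((κ : ℂ) ^ 2 / (disp M κ : ℂ) * b κ) * wave M t κ =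
          κ * (((((Real.sqrt (κ ^ 2 + M ^ 2))⁻¹ : ℝ) : ℂ)) * (κ * b κ)) * wave M t κ :=
        fun κ => by rw [disp, Complex.ofReal_inv]; ring
      simp only [e]
      refine (hle _ _ _ _ ((hD.mul H).mono (by norm_num)) (by simp) t ht).trans ?_
      have : 0 ≤ K * C := by positivity
      nlinarith [mul_nonneg this ht']

lemma cos_eq_wave (M s κ : ℝ) :
    ((Real.cos (s * disp M κ) : ℝ) : ℂ) = (wave M s κ + wave M (-s) κ) / 2 := by
  rw [Complex.ofReal_cos, Complex.cos, wave, wave]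
  push_cast
  ring_nf

lemma sin_eq_wave (M s κ : ℝ) : ((Real.sin (s * disp M κ) : ℝ) : ℂ) =
    (wave M s κ - wave M (-s) κ) / (2 * Complex.I) := by
  rw [Complex.ofReal_sin, Complex.sin, wave, wave]
  push_cast
  have h1 : Complex.exp (-(s * disp M κ : ℂ) * Complex.I) =
      Complex.exp (Complex.I * (-s * disp M κ)) := by ring_nf
  have h2 : Complex.exp ((s * disp M κ : ℂ) * Complex.I) =
      Complex.exp (Complex.I * (s * disp M κ)) := by ring_nf
  rw [h1, h2]
  field_simp
  rw [Complex.I_sq]; ring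

/-- The radial integral of a Klein-Gordon mode along one direction. -/
lemma exists_norm_integral_mode_le (hM : 0 ≤ M) : ∃ K : ℝ, 0 ≤ K ∧
    ∀ (C : ℝ) (b b₁ b₂ c c₁ c₂ : ℝ → ℂ), C2Bound (-5) C b b₁ b₂ → C2Bound (-5) C c c₁ c₂ →
      ∀ s : ℝ, 1 ≤ |s| → ‖∫ κ in Ioi (0 : ℝ), (κ : ℂ) ^ 2 * (b κ * (Real.cos (s * disp M κ) : ℂ) +
        c κ * ((Real.sin (s * disp M κ) / disp M κ : ℝ) : ℂ))‖ ≤ K * C * |s| ^ (-(3 / 2) : ℝ) := by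
  obtain ⟨K, hK, hle⟩ := exists_norm_integral_sq_mul_wave_le hM
  refine ⟨2 * K, by positivity, fun C b b₁ b₂ c c₁ c₂ hb hc s hs => ?_⟩
  have hC := hb.nonneg
  have hs' : 1 ≤ |-s| := by rwa [abs_neg]
  obtain ⟨g₁, g₂, G⟩ := c2Bound_sq_mul hb
  obtain ⟨k₁, k₂, G'⟩ := c2Bound_ofReal_mul hc
  have hi1 : ∀ t, IntegrableOn (fun κ : ℝ => ((κ : ℂ) ^ 2 * b κ) * wave M t κ) (Ioi 0) := fun t =>
    integrableOn_mul_wave (G.cont₀.mono Ioi_subset_Ici_self)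
      (fun κ hκ => G.le_div_sq hκ.le (G.bound₀ κ hκ.le)) t
  have hdisp : ∀ κ : ℝ, 0 < κ → 0 < disp M κ := fun κ hκ => hκ.trans_le (self_le_disp M κ)
  have hi2 : ∀ t, IntegrableOn (fun κ : ℝ => ((κ : ℂ) ^ 2 / (disp M κ : ℂ) * c κ) * wave M t κ)
      (Ioi 0) := fun t => by
    refine integrableOn_mul_wave (C := 4 * C) ?_ (fun κ hκ => ?_) t
    · have hn : ContinuousOn (fun κ : ℝ => (κ : ℂ) ^ 2) (Ioi 0) := by fun_prop
      have hd : ContinuousOn (fun κ : ℝ => (disp M κ : ℂ)) (Ioi 0) :=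
        (Complex.continuous_ofReal.comp (continuous_disp M)).continuousOn
      exact (hn.div hd fun κ hκ => by exact_mod_cast (hdisp κ hκ).ne').mul
        (hc.cont₀.mono Ioi_subset_Ici_self)
    · have h1 := (G'.mono (show (-4 : ℝ) ≤ -3 by norm_num)).le_div_sq hκ.le
        ((G'.mono (show (-4 : ℝ) ≤ -3 by norm_num)).bound₀ κ hκ.le)
      refine le_trans ?_ h1
      rw [norm_mul, norm_mul, norm_div, norm_pow, Complex.norm_real, Complex.norm_real,
        Real.norm_of_nonneg hκ.le, Real.norm_of_nonneg (hdisp κ hκ).le]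
      refine mul_le_mul_of_nonneg_right ?_ (norm_nonneg _)
      rw [div_le_iff₀ (hdisp κ hκ), sq]
      exact mul_le_mul_of_nonneg_left (self_le_disp M κ) hκ.le
  have e : ∀ κ : ℝ, (κ : ℂ) ^ 2 * (b κ * (Real.cos (s * disp M κ) : ℂ) +
      c κ * ((Real.sin (s * disp M κ) / disp M κ : ℝ) : ℂ)) =
      (1 / 2 : ℂ) * (((κ : ℂ) ^ 2 * b κ) * wave M s κ) +
      (1 / 2 : ℂ) * (((κ : ℂ) ^ 2 * b κ) * wave M (-s) κ) +
      ((2 * Complex.I)⁻¹ * (((κ : ℂ) ^ 2 / (disp M κ : ℂ) * c κ) * wave M s κ) +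
      (-(2 * Complex.I)⁻¹) * (((κ : ℂ) ^ 2 / (disp M κ : ℂ) * c κ) * wave M (-s) κ)) := by
    intro κ
    rw [Complex.ofReal_div, cos_eq_wave, sin_eq_wave]
    ring
  simp only [e]
  have four : ∀ (x y z w : ℂ) (f₁ f₂ f₃ f₄ : ℝ → ℂ), IntegrableOn f₁ (Ioi 0) →
      IntegrableOn f₂ (Ioi 0) → IntegrableOn f₃ (Ioi 0) → IntegrableOn f₄ (Ioi 0) →
      ∫ κ in Ioi (0 : ℝ), (x * f₁ κ + y * f₂ κ + (z * f₃ κ + w * f₄ κ)) =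
        x * (∫ κ in Ioi (0 : ℝ), f₁ κ) + y * (∫ κ in Ioi (0 : ℝ), f₂ κ) +
        (z * (∫ κ in Ioi (0 : ℝ), f₃ κ) + w * ∫ κ in Ioi (0 : ℝ), f₄ κ) := by
    intro x y z w f₁ f₂ f₃ f₄ h₁ h₂ h₃ h₄
    rw [integral_add (f := fun κ => x * f₁ κ + y * f₂ κ) (g := fun κ => z * f₃ κ + w * f₄ κ)
      ((h₁.const_mul x).add (h₂.const_mul y)) ((h₃.const_mul z).add (h₄.const_mul w)),
      integral_add (h₁.const_mul x) (h₂.const_mul y),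
      integral_add (h₃.const_mul z) (h₄.const_mul w), integral_const_mul, integral_const_mul,
      integral_const_mul, integral_const_mul]
  rw [four _ _ _ _ _ _ _ _ (hi1 s) (hi1 (-s)) (hi2 s) (hi2 (-s))]
  have n1 := (hle C b b₁ b₂ hb s hs).1
  have n2 := (hle C b b₁ b₂ hb (-s) hs').1
  have n3 := (hle C c c₁ c₂ hc s hs).2
  have n4 := (hle C c c₁ c₂ hc (-s) hs').2
  rw [abs_neg] at n2 n4
  have hhalf : ‖(1 / 2 : ℂ)‖ = 1 / 2 := by simp
  have hhalf' : ‖(2 * Complex.I)⁻¹‖ = 1 / 2 := by simp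
  refine (norm_add_le _ _).trans ?_
  refine (add_le_add (norm_add_le _ _) (norm_add_le _ _)).trans ?_
  rw [norm_mul, norm_mul, norm_mul, norm_mul, norm_neg, hhalf, hhalf']
  linarith

end Radial

/-- Polar coordinates reduce the estimate of an integral over space to one along every ray. -/
lemma norm_integral_le_of_ray {F : Space → ℂ} (hF : Integrable F) {B : ℝ}
    (h : ∀ θ : Space, ‖θ‖ = 1 → ‖∫ r in Ioi (0 : ℝ), (r : ℂ) ^ 2 * F (r • θ)‖ ≤ B) :
    ‖∫ x, F x‖ ≤ (volume : Measure Space).toSphere.real univ * B := by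
  set ν := (volume : Measure Space).toSphere
  have hmp := (volume : Measure Space).measurePreserving_homeomorphUnitSphereProd
  have hdim : Module.finrank ℝ Space - 1 = 2 := by simp
  rw [hdim] at hmp
  set G : Metric.sphere (0 : Space) 1 × Ioi (0 : ℝ) → ℂ := fun q => F ((q.2 : ℝ) • (q.1 : Space))
    with hG
  have hcomp : ∀ x : ({0}ᶜ : Set Space), G (homeomorphUnitSphereProd Space x) = F x := by
    intro x
    have hx : ‖(x : Space)‖ ≠ 0 := norm_ne_zero_iff.2 x.2
    simp only [hG, homeomorphUnitSphereProd_apply_fst_coe, homeomorphUnitSphereProd_apply_snd_coe,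
      smul_smul, mul_inv_cancel₀ hx, one_smul]
  have h1 : ∫ x, F x = ∫ x : ({0}ᶜ : Set Space), F x ∂((volume : Measure Space).comap (↑)) := by
    rw [integral_subtype_comap (measurableSet_singleton _).compl fun x => F x,
      restrict_compl_singleton]
  have h2 : ∫ x : ({0}ᶜ : Set Space), F x ∂((volume : Measure Space).comap (↑)) =
      ∫ q, G q ∂ν.prod (Measure.volumeIoiPow 2) := by
    rw [← hmp.integral_comp (Homeomorph.measurableEmbedding _) G]
    simp only [hcomp]
  have hGi : Integrable G (ν.prod (Measure.volumeIoiPow 2)) := by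
    rw [← hmp.integrable_comp_emb (Homeomorph.measurableEmbedding _)]
    have h3 : Integrable (fun x : ({0}ᶜ : Set Space) => F x)
        ((volume : Measure Space).comap (↑)) := by
      have := (integrableOn_iff_comap_subtypeVal (μ := (volume : Measure Space)) (f := F)
        (measurableSet_singleton (0 : Space)).compl).1 hF.integrableOn
      exact this
    refine h3.congr (Eventually.of_forall fun x => (hcomp x).symm)
  rw [h1, h2, integral_prod G hGi]
  have hray : ∀ θ : Metric.sphere (0 : Space) 1,
      ‖∫ r, G (θ, r) ∂(Measure.volumeIoiPow 2)‖ ≤ B := by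
    intro θ
    have e : ∫ r, G (θ, r) ∂(Measure.volumeIoiPow 2) =
        ∫ r in Ioi (0 : ℝ), (r : ℂ) ^ 2 * F (r • (θ : Space)) := by
      simp only [Measure.volumeIoiPow, ENNReal.ofReal]
      rw [integral_withDensity_eq_integral_smul
        (measurable_subtype_coe.pow_const _).real_toNNReal,
        integral_subtype_comap measurableSet_Ioi
          fun r : ℝ => Real.toNNReal (r ^ 2) • F (r • (θ : Space))]
      refine setIntegral_congr_fun measurableSet_Ioi fun r hr => ?_
      simp only [NNReal.smul_def, Real.coe_toNNReal _ (sq_nonneg r), Complex.real_smul]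
      push_cast
      ring
    rw [e]
    exact h θ (by simp)
  refine (norm_integral_le_of_norm_le_const (Eventually.of_forall hray)).trans_eq (mul_comm _ _)

/-! ### Decay of Klein-Gordon fields with compactly supported data -/

lemma hasDerivAt_ray {E F : Type*} [NormedAddCommGroup E] [NormedSpace ℝ E]
    [NormedAddCommGroup F] [NormedSpace ℝ F] {u : E → F} {r : ℝ} {θ : E}
    (hu : DifferentiableAt ℝ u (r • θ)) :
    HasDerivAt (fun r : ℝ => u (r • θ)) (fderiv ℝ u (r • θ) θ) r := by
  have h2 : HasDerivAt (fun r : ℝ => r • θ) θ r := by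
    simpa using (hasDerivAt_id r).smul_const θ
  exact hu.hasFDerivAt.comp_hasDerivAt r h2

/-- The restrictions of a Schwartz function to the rays satisfy a uniform `C²` bound. -/
lemma exists_c2Bound_ray (u : SchwartzMap Space ℂ) : ∃ C : ℝ, ∀ θ : Space, ‖θ‖ = 1 →
    ∃ b₁ b₂, C2Bound (-5) C (fun r => u (r • θ)) b₁ b₂ := by
  set u₁ := SchwartzMap.fderivCLM ℝ Space ℂ u with hu₁
  set u₂ := SchwartzMap.fderivCLM ℝ Space (Space →L[ℝ] ℂ) u₁ with hu₂
  have e₁ : ∀ x, u₁ x = fderiv ℝ u x := fun x => rfl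
  have e₂ : ∀ x, u₂ x = fderiv ℝ u₁ x := fun x => rfl
  have bd : ∀ {F : Type} [NormedAddCommGroup F] [NormedSpace ℝ F] (w : SchwartzMap Space F),
      ∃ C : ℝ, ∀ x, ‖w x‖ ≤ C * (1 + ‖x‖) ^ (-5 : ℝ) := by
    intro F _ _ w
    refine ⟨2 ^ 5 * (Finset.Iic (5, 0)).sup (fun m => SchwartzMap.seminorm ℝ m.1 m.2) w,
      fun x => ?_⟩
    have := SchwartzMap.one_add_le_sup_seminorm_apply (𝕜 := ℝ) (m := (5, 0)) (k := 5) (n := 0)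
      le_rfl le_rfl w x
    rw [norm_iteratedFDeriv_zero] at this
    rw [Real.rpow_neg (by positivity), ← div_eq_mul_inv, le_div_iff₀ (by positivity), mul_comm]
    exact_mod_cast this
  obtain ⟨C₀, h₀⟩ := bd u
  obtain ⟨C₁, h₁⟩ := bd u₁
  obtain ⟨C₂, h₂⟩ := bd u₂
  refine ⟨max C₀ (max C₁ C₂), fun θ hθ => ⟨fun r => u₁ (r • θ) θ, fun r => u₂ (r • θ) θ θ, ?_⟩⟩
  have hn : ∀ r : ℝ, 0 ≤ r → ‖r • θ‖ = r := fun r hr => by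
    rw [norm_smul, hθ, mul_one, Real.norm_of_nonneg hr]
  have hmax : ∀ {C r : ℝ}, 0 ≤ r → C ≤ max C₀ (max C₁ C₂) →
      C * (1 + r) ^ (-5 : ℝ) ≤ max C₀ (max C₁ C₂) * (1 + r) ^ (-5 : ℝ) := fun hr hC =>
    mul_le_mul_of_nonneg_right hC (by positivity)
  refine ⟨fun r _ => ?_, fun r _ => ?_, ?_, fun r hr => ?_, fun r hr => ?_, fun r hr => ?_⟩
  · rw [e₁]; exact hasDerivAt_ray u.differentiableAt
  · rw [e₂]; exact ((hasDerivAt_ray u₁.differentiableAt).clm_apply (hasDerivAt_const r θ)).congr_deriv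
      (by simp)
  · have : Continuous fun r : ℝ => u₂ (r • θ) := u₂.continuous.comp (by fun_prop)
    exact Continuous.continuousOn (by fun_prop)
  · have := h₀ (r • θ)
    rw [hn r hr] at this
    exact this.trans (hmax hr (le_max_left _ _))
  · have := h₁ (r • θ)
    rw [hn r hr] at this
    refine (((u₁ (r • θ)).le_opNorm θ).trans ?_)
    rw [hθ, mul_one]
    exact this.trans (hmax hr ((le_max_left _ _).trans (le_max_right _ _)))
  · have := h₂ (r • θ)
    rw [hn r hr] at this
    refine ((u₂ (r • θ)).le_opNorm₂ θ θ).trans ?_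
    rw [hθ, mul_one, mul_one]
    exact this.trans (hmax hr ((le_max_right _ _).trans (le_max_right _ _)))

/-- The solution of the oscillator equation with given initial data. -/
lemma eq_cos_add_sin {f : ℝ → ℂ} (hf : ContDiff ℝ ∞ f) {ν : ℝ} (hν : 0 < ν)
    (h : ∀ t, deriv (deriv f) t = -((ν : ℂ) ^ 2 * f t)) (t : ℝ) :
    f t = f 0 * (Real.cos (ν * t) : ℂ) + deriv f 0 * ((Real.sin (ν * t) / ν : ℝ) : ℂ) := by
  have hνC : (ν : ℂ) ≠ 0 := by exact_mod_cast hν.ne'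
  have hf1 : ∀ t, HasDerivAt f (deriv f t) t := fun t => (hf.differentiable (by simp) t).hasDerivAt
  have hf2 : ∀ t, HasDerivAt (deriv f) (-((ν : ℂ) ^ 2 * f t)) t := fun t => by
    rw [← h]
    exact ((contDiff_infty_iff_deriv.1 hf).2.differentiable (by simp) t).hasDerivAt
  have hl : ∀ t : ℝ, HasDerivAt (fun t : ℝ => ν * t) ν t := fun t => by
    simpa using (hasDerivAt_id t).const_mul ν
  have hc : ∀ t : ℝ, HasDerivAt (fun t : ℝ => ((Real.cos (ν * t) : ℝ) : ℂ))
      ((-Real.sin (ν * t) * ν : ℝ) : ℂ) t := fun t => (hl t).cos.ofReal_comp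
  have hs : ∀ t : ℝ, HasDerivAt (fun t : ℝ => ((Real.sin (ν * t) : ℝ) : ℂ))
      ((Real.cos (ν * t) * ν : ℝ) : ℂ) t := fun t => (hl t).sin.ofReal_comp
  have hsq : ((Real.sin (ν * t) : ℝ) : ℂ) ^ 2 + ((Real.cos (ν * t) : ℝ) : ℂ) ^ 2 = 1 := by
    exact_mod_cast Real.sin_sq_add_cos_sq (ν * t)
  -- The two conserved quantities.
  have e1 := is_const_of_deriv_eq_zero (𝕜 := ℝ) (f := fun t : ℝ =>
    ν * f t * ((Real.cos (ν * t) : ℝ) : ℂ) - deriv f t * ((Real.sin (ν * t) : ℝ) : ℂ))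
    (fun t => ((((hf1 t).const_mul _).fun_mul (hc t)).fun_sub ((hf2 t).fun_mul (hs
      t))).differentiableAt) (fun t => by
      rw [((((hf1 t).const_mul _).fun_mul (hc t)).fun_sub ((hf2 t).fun_mul (hs t))).deriv]
      push_cast; ring) t 0
  have e2 := is_const_of_deriv_eq_zero (𝕜 := ℝ) (f := fun t : ℝ =>
    ν * f t * ((Real.sin (ν * t) : ℝ) : ℂ) + deriv f t * ((Real.cos (ν * t) : ℝ) : ℂ))
    (fun t => ((((hf1 t).const_mul _).fun_mul (hs t)).fun_add ((hf2 t).fun_mul (hc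
      t))).differentiableAt) (fun t => by
      rw [((((hf1 t).const_mul _).fun_mul (hs t)).fun_add ((hf2 t).fun_mul (hc t))).deriv]
      push_cast; ring) t 0
  simp only [mul_zero, Real.cos_zero, Real.sin_zero, Complex.ofReal_one, Complex.ofReal_zero,
    mul_one, sub_zero, zero_add] at e1 e2
  rw [Complex.ofReal_div]
  field_simp
  linear_combination ((Real.cos (ν * t) : ℝ) : ℂ) * e1 + ((Real.sin (ν * t) : ℝ) : ℂ) * e2 -
    ν * f t * hsq

lemma ae_smul {c : ℝ} (hc : c ≠ 0) {P : Space → Prop} (h : ∀ᵐ p : Space, P p) :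
    ∀ᵐ w : Space, P (c • w) := by
  rw [ae_iff] at h ⊢
  have := Measure.addHaar_preimage_smul (volume : Measure Space) hc {p | ¬P p}
  rw [h, mul_zero] at this
  exact this

namespace SpatiallyCompact

variable {ψ : ℝ → Space → ℝ}

lemma spatialFourier_translate (ψ : ℝ → Space → ℝ) (y : Space) (t : ℝ) (p : Space) :
    spatialFourier (fun x => ψ t (y + x)) p =
      Complex.exp (-(Complex.I * ((inner ℝ p y : ℝ) : ℂ))) * spatialFourier (ψ t) p := by
  unfold spatialFourier
  rw [← integral_const_mul, ← integral_add_left_eq_self (fun x =>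
    Complex.exp (-(Complex.I * ((inner ℝ p y : ℝ) : ℂ))) * ((ψ t x : ℂ) *
      Complex.exp (Complex.I * ((inner ℝ p x : ℝ) : ℂ)))) y]
  congr 1; ext x
  rw [mul_left_comm, ← Complex.exp_add, inner_add_right]
  push_cast
  ring_nf

/-- The complex-valued Schwartz function given by a time slice. -/
def toSchwartz (h : SpatiallyCompact ψ) (t : ℝ) : SchwartzMap Space ℂ :=
  ((h.hasCompactSupport t).comp_left Complex.ofReal_zero :
    HasCompactSupport fun x => (ψ t x : ℂ)).toSchwartzMap
      (Complex.ofRealCLM.contDiff.comp (h.slice t))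

lemma toSchwartz_apply (h : SpatiallyCompact ψ) (t : ℝ) (x : Space) :
    h.toSchwartz t x = (ψ t x : ℂ) := rfl

lemma fourier_toSchwartz (h : SpatiallyCompact ψ) (t : ℝ) (w : Space) :
    (FourierTransform.fourier (h.toSchwartz t) : SchwartzMap Space ℂ) w =
      spatialFourier (ψ t) ((-(2 * Real.pi)) • w) := by
  rw [SchwartzMap.fourier_coe, Real.fourier_eq', spatialFourier]
  congr 1; ext x
  rw [h.toSchwartz_apply, smul_eq_mul, mul_comm, inner_smul_left, real_inner_comm]
  congr 2
  simp only [conj_trivial]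
  push_cast
  ring

lemma integral_fourier_toSchwartz (h : SpatiallyCompact ψ) (t : ℝ) :
    ∫ w, (FourierTransform.fourier (h.toSchwartz t) : SchwartzMap Space ℂ) w = (ψ t 0 : ℂ) := by
  have h1 := congrFun ((h.toSchwartz t).continuous.fourierInv_fourier_eq (h.toSchwartz t).integrable
    (by rw [← SchwartzMap.fourier_coe]; exact SchwartzMap.integrable _)) 0
  rw [Real.fourierInv_eq', ← SchwartzMap.fourier_coe] at h1
  simpa [h.toSchwartz_apply] using h1

/-- Decay of Klein-Gordon fields of squared mass `-ζ ≥ 0` at the origin of space. -/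
lemma isBigO_zero (h : SpatiallyCompact ψ) {ζ : ℝ} (hζ : ζ ≤ 0)
    (hmode : ∀ᵐ p : Space, ∀ t,
      linOp (-ζ) 1 (‖p‖ ^ 2) (fun t => spatialFourier (ψ t) p) t = 0) :
    (fun t : ℝ => ψ t 0) =O[atTop] fun t : ℝ => t ^ (-(3 / 2) : ℝ) := by
  have hpi := Real.pi_pos
  set M : ℝ := Real.sqrt (-ζ) / (2 * Real.pi) with hM
  have hM0 : 0 ≤ M := by positivity
  have hMsq : (2 * Real.pi) ^ 2 * M ^ 2 = -ζ := by
    rw [hM, div_pow, Real.sq_sqrt (by linarith)]; field_simp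
  set u : SchwartzMap Space ℂ := FourierTransform.fourier (h.toSchwartz 0) with hu
  set v : SchwartzMap Space ℂ := ((2 * Real.pi)⁻¹ : ℝ) •
    FourierTransform.fourier (h.timeDeriv.toSchwartz 0) with hv
  obtain ⟨C, hC⟩ := exists_c2Bound_ray u
  obtain ⟨C', hC'⟩ := exists_c2Bound_ray v
  obtain ⟨K, hK, hle⟩ := exists_norm_integral_mode_le hM0
  set F : ℝ → Space → ℂ := fun s w => u w * (Real.cos (s * disp M ‖w‖) : ℂ) +
    v w * ((Real.sin (s * disp M ‖w‖) / disp M ‖w‖ : ℝ) : ℂ) with hF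
  have hae : ∀ t, (fun w => (FourierTransform.fourier (h.toSchwartz t) : SchwartzMap Space ℂ) w)
      =ᵐ[volume] F (2 * Real.pi * t) := by
    intro t
    filter_upwards [ae_smul (neg_ne_zero.2 (by positivity : (2 * Real.pi) ≠ 0)) hmode,
      (measure_eq_zero_iff_ae_notMem.1 (measure_singleton (0 : Space)))] with w hw hw0
    have hwp : 0 < ‖w‖ := norm_pos_iff.2 (by simpa using hw0)
    set p : Space := (-(2 * Real.pi)) • w with hp
    have hd : 0 < disp M ‖w‖ := hwp.trans_le (self_le_disp M _)
    have hν : 0 < 2 * Real.pi * disp M ‖w‖ := by positivity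
    have hνsq : ‖p‖ ^ 2 - ζ = (2 * Real.pi * disp M ‖w‖) ^ 2 := by
      rw [hp, norm_smul, mul_pow, mul_pow, disp_sq, norm_neg, Real.norm_of_nonneg (by positivity),
        mul_add, hMsq]
      ring
    have hmd := eq_cos_add_sin (h.contDiff_spatialFourier p) hν (fun t => by
      have h1 := hw t
      rw [linOp, boxOp] at h1
      have h2 : ((2 * Real.pi * disp M ‖w‖ : ℝ) : ℂ) ^ 2 = ((‖p‖ ^ 2 - ζ : ℝ) : ℂ) := by
        rw [hνsq]; push_cast; ring
      rw [h2]
      push_cast at h1 ⊢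
      linear_combination h1) t
    rw [h.fourier_toSchwartz, hmd, (h.hasDerivAt_spatialFourier 0 p).deriv]
    simp only [hF, hu, hv, smul_apply, h.fourier_toSchwartz,
      h.timeDeriv.fourier_toSchwartz, ← hp]
    rw [show 2 * Real.pi * disp M ‖w‖ * t = 2 * Real.pi * t * disp M ‖w‖ by ring,
      Complex.real_smul, Complex.ofReal_div, Complex.ofReal_div, Complex.ofReal_inv,
      Complex.ofReal_mul (2 * Real.pi) (disp M ‖w‖)]
    field_simp
  have hray : ∀ t : ℝ, 1 ≤ t → ∀ θ : Space, ‖θ‖ = 1 →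
      ‖∫ r in Ioi (0 : ℝ), (r : ℂ) ^ 2 * F (2 * Real.pi * t) (r • θ)‖ ≤
        K * max C C' * t ^ (-(3 / 2) : ℝ) := by
    intro t ht θ hθ
    obtain ⟨b₁, b₂, hb⟩ := hC θ hθ
    obtain ⟨c₁, c₂, hc⟩ := hC' θ hθ
    have hs : 1 ≤ 2 * Real.pi * t := by nlinarith [Real.pi_gt_three]
    have hCn := hb.nonneg
    have key := hle (max C C') _ b₁ b₂ _ c₁ c₂ (hb.mono_const (le_max_left _ _))
      (hc.mono_const (le_max_right _ _)) (2 * Real.pi * t) (hs.trans (le_abs_self _))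
    rw [abs_of_pos (by linarith)] at key
    have e : ∫ r in Ioi (0 : ℝ), (r : ℂ) ^ 2 * F (2 * Real.pi * t) (r • θ) =
        ∫ κ in Ioi (0 : ℝ), (κ : ℂ) ^ 2 *
          (u (κ • θ) * (Real.cos (2 * Real.pi * t * disp M κ) : ℂ) +
        v (κ • θ) * ((Real.sin (2 * Real.pi * t * disp M κ) / disp M κ : ℝ) : ℂ)) := by
      refine setIntegral_congr_fun measurableSet_Ioi fun r hr => ?_
      have hr : 0 < r := hr
      simp only [hF, norm_smul, hθ, mul_one, Real.norm_of_nonneg hr.le]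
    rw [e]
    refine key.trans ?_
    have h2 : (2 * Real.pi * t) ^ (-(3 / 2) : ℝ) ≤ t ^ (-(3 / 2) : ℝ) :=
      Real.rpow_le_rpow_of_nonpos (by linarith) (by nlinarith [Real.pi_gt_three]) (by norm_num)
    have : 0 ≤ max C C' := hCn.trans (le_max_left _ _)
    gcongr
  refine Asymptotics.IsBigO.of_bound
    ((volume : Measure Space).toSphere.real univ * (K * max C C')) ?_
  filter_upwards [eventually_ge_atTop 1] with t ht
  have hint : Integrable (F (2 * Real.pi * t)) :=
    (SchwartzMap.integrable (FourierTransform.fourier (h.toSchwartz t) :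
      SchwartzMap Space ℂ)).congr (hae t)
  have h1 := norm_integral_le_of_ray hint (hray t ht)
  rw [← integral_congr_ae (hae t), h.integral_fourier_toSchwartz, Complex.norm_real] at h1
  rw [Real.norm_of_nonneg (by positivity : 0 ≤ t ^ (-(3 / 2) : ℝ)), mul_assoc, mul_assoc]
  rwa [mul_assoc] at h1

/-- Smooth Klein-Gordon fields of squared mass `-ζ ≥ 0` with spatially compact support decay at
every point of space like `t^{-3/2}`. -/
theorem isBigO (h : SpatiallyCompact ψ) {ζ : ℝ} (hζ : ζ ≤ 0)
    (hmode : ∀ᵐ p : Space, ∀ t,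
      linOp (-ζ) 1 (‖p‖ ^ 2) (fun t => spatialFourier (ψ t) p) t = 0) (x : Space) :
    (fun t : ℝ => ψ t x) =O[atTop] fun t : ℝ => t ^ (-(3 / 2) : ℝ) := by
  have key := (h.translate x).isBigO_zero hζ ?_
  · simpa using key
  · filter_upwards [hmode] with p hp t
    simp only [spatialFourier_translate]
    rw [linOp_const_mul (h.contDiff_spatialFourier p)]
    simp only [hp, mul_zero]

end SpatiallyCompact

/-! ### Decay of solutions -/

lemma linOp_neg_eq {a c : ℝ} {f : ℝ → ℂ} :
    linOp a (-1) c f = fun t => -1 * linOp (-a) 1 c f t := by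
  ext t
  simp only [linOp]
  push_cast
  ring

namespace SpatiallyCompact

variable {ψ : ℝ → Space → ℝ}

/-- The partial fraction component of `ψ` that belongs to the root `ζ₁`: the operator
`(D - ζ₂) (D - ζ₃) / ((ζ₁ - ζ₂) (ζ₁ - ζ₃))` with `D = -□`, applied to `ψ`. -/
def component (ψ : ℝ → Space → ℝ) (ζ₁ ζ₂ ζ₃ : ℝ) (t : ℝ) (x : Space) : ℝ :=
  ((ζ₁ - ζ₂) * (ζ₁ - ζ₃))⁻¹ * (SemiclassicalToy.dAlembert (SemiclassicalToy.dAlembert ψ) t x +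
    ((ζ₂ + ζ₃) * SemiclassicalToy.dAlembert ψ t x + ζ₂ * ζ₃ * ψ t x))

lemma component_add (ψ : ℝ → Space → ℝ) {ζ₁ ζ₂ ζ₃ : ℝ} (h12 : ζ₁ ≠ ζ₂) (h13 : ζ₁ ≠ ζ₃)
    (h23 : ζ₂ ≠ ζ₃) (t : ℝ) (x : Space) :
    ψ t x = component ψ ζ₁ ζ₂ ζ₃ t x + component ψ ζ₂ ζ₁ ζ₃ t x + component ψ ζ₃ ζ₁ ζ₂ t x := by
  have e12 := sub_ne_zero.2 h12
  have e13 := sub_ne_zero.2 h13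
  have e23 := sub_ne_zero.2 h23
  have e21 := sub_ne_zero.2 h12.symm
  have e31 := sub_ne_zero.2 h13.symm
  have e32 := sub_ne_zero.2 h23.symm
  simp only [component]
  rw [← sub_eq_zero]
  field_simp
  ring

lemma component_spatiallyCompact (h : SpatiallyCompact ψ) (ζ₁ ζ₂ ζ₃ : ℝ) :
    SpatiallyCompact (component ψ ζ₁ ζ₂ ζ₃) :=
  (h.dAlembert.dAlembert.add ((h.dAlembert.const_mul _).add (h.const_mul _))).const_mul _

lemma spatialFourier_component (h : SpatiallyCompact ψ) (ζ₁ ζ₂ ζ₃ : ℝ) (p : Space) :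
    (fun t => spatialFourier (component ψ ζ₁ ζ₂ ζ₃ t) p) = fun t =>
      (((ζ₁ - ζ₂) * (ζ₁ - ζ₃))⁻¹ : ℝ) * linOp (-ζ₂) 1 (‖p‖ ^ 2) (linOp (-ζ₃) 1 (‖p‖ ^ 2)
        fun t => spatialFourier (ψ t) p) t := by
  ext t
  have hf := h.contDiff_spatialFourier p
  have e : component ψ ζ₁ ζ₂ ζ₃ t = fun x => ((ζ₁ - ζ₂) * (ζ₁ - ζ₃))⁻¹ *
      (SemiclassicalToy.dAlembert (SemiclassicalToy.dAlembert ψ) t x +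
    ((ζ₂ + ζ₃) * SemiclassicalToy.dAlembert ψ t x + ζ₂ * ζ₃ * ψ t x)) := rfl
  have hD : (fun t => spatialFourier (SemiclassicalToy.dAlembert ψ t) p) = fun t =>
      -1 * boxOp (‖p‖ ^ 2) (fun t => spatialFourier (ψ t) p) t := by
    ext t; rw [h.spatialFourier_dAlembert, neg_one_mul]
  have hDD : boxOp (‖p‖ ^ 2) (fun t => spatialFourier (SemiclassicalToy.dAlembert ψ t) p) t =
      -boxOp (‖p‖ ^ 2) (boxOp (‖p‖ ^ 2) fun t => spatialFourier (ψ t) p) t := by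
    have h1 := congrFun (linOp_const_mul (α := 0) (β := 1) (c := ‖p‖ ^ 2)
      (contDiff_boxOp (c := ‖p‖ ^ 2) hf) (-1)) t
    rw [hD]
    simpa [linOp] using h1
  rw [e, spatialFourier_const_mul, h.dAlembert.dAlembert.spatialFourier_add
    ((h.dAlembert.const_mul _).add (h.const_mul _)),
    (h.dAlembert.const_mul (ζ₂ + ζ₃)).spatialFourier_add (h.const_mul (ζ₂ * ζ₃)),
    spatialFourier_const_mul, spatialFourier_const_mul, h.dAlembert.spatialFourier_dAlembert, hDD,
    h.spatialFourier_dAlembert, linOp_linOp hf]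
  simp only [linOp]
  push_cast
  ring

/-- If every Fourier mode is annihilated by `(D - ζ₁) (D - ζ₂) (D - ζ₃)`, `D = ∂ₜ² + |p|²`, with
distinct roots `ζ_j ≤ 0`, then the function is a sum of three Klein-Gordon fields and decays. -/
theorem isBigO_of_linOp (h : SpatiallyCompact ψ) {ζ₁ ζ₂ ζ₃ : ℝ} (h1 : ζ₁ ≤ 0) (h2 : ζ₂ ≤ 0)
    (h3 : ζ₃ ≤ 0) (h12 : ζ₁ ≠ ζ₂) (h13 : ζ₁ ≠ ζ₃) (h23 : ζ₂ ≠ ζ₃)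
    (hmode : ∀ᵐ p : Space, ∀ t, linOp (-ζ₁) 1 (‖p‖ ^ 2) (linOp (-ζ₂) 1 (‖p‖ ^ 2)
      (linOp (-ζ₃) 1 (‖p‖ ^ 2) fun t => spatialFourier (ψ t) p)) t = 0) (x : Space) :
    (fun t : ℝ => ψ t x) =O[atTop] fun t : ℝ => t ^ (-(3 / 2) : ℝ) := by
  have hfun : (fun t : ℝ => ψ t x) = fun t => component ψ ζ₁ ζ₂ ζ₃ t x +
      component ψ ζ₂ ζ₁ ζ₃ t x + component ψ ζ₃ ζ₁ ζ₂ t x :=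
    funext fun t => component_add ψ h12 h13 h23 t x
  rw [hfun]
  refine ((isBigO (h.component_spatiallyCompact ζ₁ ζ₂ ζ₃) h1 ?_ x).add
    (isBigO (h.component_spatiallyCompact ζ₂ ζ₁ ζ₃) h2 ?_ x)).add
    (isBigO (h.component_spatiallyCompact ζ₃ ζ₁ ζ₂) h3 ?_ x) <;>
    filter_upwards [hmode] with p hp t <;>
    have hf := h.contDiff_spatialFourier p <;>
    rw [h.spatialFourier_component, linOp_const_mul (contDiff_linOp (contDiff_linOp hf))]
  · simp only [hp, mul_zero]
  · rw [linOp_comm (contDiff_linOp hf)]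
    simp only [hp, mul_zero]
  · rw [linOp_comm (α := -ζ₁) hf, linOp_comm (contDiff_linOp hf),
      linOp_comm (α := -ζ₃) (α' := -ζ₁) hf,
      linOp_comm (α := -ζ₂) (α' := -ζ₁) (contDiff_linOp hf)]
    simp only [hp, mul_zero]

end SpatiallyCompact

section Solution

variable {m a hbar lam lam₁ lam₂ g₁ g₂ ζ₁ ζ₂ : ℝ} {ψ : ℝ → Space → ℝ}

lemma IsSolution.spatiallyCompact (h : IsSolution m a hbar lam lam₁ lam₂ g₁ g₂ ψ) :
    SpatiallyCompact ψ := ⟨h.smooth, h.spatially_compact⟩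

lemma SpatiallyCompact.spatialFourier_source (h : SpatiallyCompact ψ) (t : ℝ) (p : Space) :
    spatialFourier (fun x => SemiclassicalToy.dAlembert ψ t x + a * ψ t x) p =
      linOp a (-1) (‖p‖ ^ 2) (fun t => spatialFourier (ψ t) p) t := by
  rw [h.dAlembert.spatialFourier_add (h.const_mul a), spatialFourier_const_mul,
    h.spatialFourier_dAlembert, linOp]
  push_cast
  ring

lemma SpatiallyCompact.wickFourier_eq (h : SpatiallyCompact ψ) (t : ℝ) (p : Space) :
    wickFourier m a hbar lam ψ t p = ((hbar * lam : ℝ) : ℂ) * conv (retardedLoop m a p)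
      (linOp a (-1) (‖p‖ ^ 2) fun t => spatialFourier (ψ t) p) t := by
  rw [wickFourier, conv_retardedLoop]
  simp only [KaIntegrand, h.spatialFourier_source]

/-- The equation of a single Fourier mode of a solution. -/
lemma IsSolution.mode (h : IsSolution m a hbar lam lam₁ lam₂ g₁ g₂ ψ) (hm : 0 < m)
    (ha : -(4 * m ^ 2) < a) : ∀ᵐ p : Space,
      IsPast (linOp a (-1) (‖p‖ ^ 2) fun t => spatialFourier (ψ t) p) ∧
      ContDiff ℝ 2 (fun t => wickFourier m a hbar lam ψ t p) ∧
      ∀ t, linOp g₁ g₂ (‖p‖ ^ 2) (fun t => spatialFourier (ψ t) p) t +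
        linOp lam₁ lam₂ (‖p‖ ^ 2) (fun t => wickFourier m a hbar lam ψ t p) t = 0 := by
  have hs := h.spatiallyCompact
  filter_upwards [h.converges, h.regular, h.equation] with p hc hr he
  refine ⟨isPast_of_integrableOn hm ha p
    (contDiff_linOp (hs.contDiff_spatialFourier p)).continuous fun t => ?_, hr, fun t => ?_⟩
  · have := hc t
    unfold KaIntegrand at this
    simpa only [hs.spatialFourier_source] using this
  · have h1 := he t
    have e : (fun x => g₂ * dAlembert ψ t x - g₁ * ψ t x) =
        fun x => g₂ * dAlembert ψ t x + (-g₁) * ψ t x := by ext x; ring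
    rw [e, (hs.dAlembert.const_mul g₂).spatialFourier_add (hs.const_mul (-g₁)),
      SpatiallyCompact.spatialFourier_const_mul, SpatiallyCompact.spatialFourier_const_mul,
      hs.spatialFourier_dAlembert, iteratedDeriv_succ, iteratedDeriv_one] at h1
    simp only [linOp, boxOp] at h1 ⊢
    push_cast at h1 ⊢
    linear_combination -h1

/-- Solutions decay if the zeros of the symbol are simple, nonpositive, and different from `a`. -/
theorem RegularSymbol.solutionsDecay
    (H : RegularSymbol m a hbar lam lam₁ lam₂ g₁ g₂ (ζ₁ * ζ₂) (-(ζ₁ + ζ₂)) 1)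
    (hpos : ∀ x : ℝ, 0 < x → S m a hbar lam lam₁ lam₂ g₁ g₂ x ≠ 0) (ha : a ≤ 0) (h1 : ζ₁ ≤ 0)
    (h2 : ζ₂ ≤ 0) (h12 : ζ₁ ≠ ζ₂) (h1a : ζ₁ ≠ a) (h2a : ζ₂ ≠ a) :
    SolutionsDecay m a hbar lam lam₁ lam₂ g₁ g₂ := by
  intro ψ hψ x
  have hs := hψ.spatiallyCompact
  refine hs.isBigO_of_linOp h1 h2 ha h12 h1a h2a ?_ x
  filter_upwards [hψ.mode H.m_pos H.a_gt] with p hp t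
  have hf := hs.contDiff_spatialFourier p
  have key := H.linOp_eq_zero hpos p hf hp.1 (fun t => hs.wickFourier_eq t p) hp.2.1 hp.2.2 t
  rw [linOp_neg_eq, linOp_const_mul (contDiff_linOp hf),
    linOp_const_mul (contDiff_linOp (contDiff_linOp hf))] at key
  simpa using key

/-- The case of a symbol with a zero at `a`. -/
theorem RegularSymbol.solutionsDecay_of_eq
    (H : RegularSymbol m a hbar lam lam₁ 0 (-(g₂ * a)) g₂ (a * ζ₂) (-(a + ζ₂)) 1)
    (hpos : ∀ x : ℝ, 0 < x → S m a hbar lam lam₁ 0 (-(g₂ * a)) g₂ x ≠ 0) (ha : a ≤ 0)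
    (h2 : ζ₂ ≤ 0) (h2a : ζ₂ ≠ a) : SolutionsDecay m a hbar lam lam₁ 0 (-(g₂ * a)) g₂ := by
  intro ψ hψ x
  have hs := hψ.spatiallyCompact
  -- The third root is arbitrary.
  refine hs.isBigO_of_linOp (ζ₁ := a + ζ₂ - 1) (ζ₂ := ζ₂) (ζ₃ := a) (by linarith) h2 ha
    (fun h => by linarith) (fun h => by linarith) h2a ?_ x
  filter_upwards [hψ.mode H.m_pos H.a_gt] with p hp t
  have hf := hs.contDiff_spatialFourier p
  have key : linOp (-ζ₂) 1 (‖p‖ ^ 2) (linOp a (-1) (‖p‖ ^ 2)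
      fun t => spatialFourier (ψ t) p) = fun _ => 0 := by
    ext t
    refine H.linOp_eq_zero_of_eq hpos p hf hp.1 (fun t => hs.wickFourier_eq t p) (fun t => ?_) t
    rw [← hp.2.2 t]
    simp [linOp]
  rw [linOp_neg_eq, linOp_const_mul (contDiff_linOp hf)] at key
  have key' : linOp (-ζ₂) 1 (‖p‖ ^ 2) (linOp (-a) 1 (‖p‖ ^ 2)
      fun t => spatialFourier (ψ t) p) = fun _ => 0 := by
    ext t
    simpa using congrFun key t
  rw [key']
  simp [linOp, boxOp]

end Solution

/-! ### The zeros of the symbol -/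

section Zeros

variable {m a hbar lam lam₁ lam₂ g₁ g₂ : ℝ}

/-- The real function `S` on the half-line `[-4m², ∞)`. -/
def gapSymbol (m a hbar lam lam₁ lam₂ g₁ g₂ s : ℝ) : ℝ :=
  -((lam₁ + lam₂ * s) * coupling hbar lam * FaReal m a s) - (g₁ + g₂ * s)

/-- The real zeros of `S` outside the cut. -/
def gapZeros (m a hbar lam lam₁ lam₂ g₁ g₂ : ℝ) : Set ℝ :=
  {s | -(4 * m ^ 2) ≤ s ∧ gapSymbol m a hbar lam lam₁ lam₂ g₁ g₂ s = 0}

lemma FaReal_strictMonoOn (hm : 0 < m) (ha : -(4 * m ^ 2) < a) :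
    StrictMonoOn (FaReal m a) (Ici (-(4 * m ^ 2))) := by
  intro s hs t ht hst
  rw [FaReal_eq hm ha hs, FaReal_eq hm ha ht]
  have := bubbleReal_strictMonoOn (b := 4 * m ^ 2) (by positivity) hs ht hst
  linarith

lemma FaReal_continuousOn (hm : 0 < m) (ha : -(4 * m ^ 2) < a) :
    ContinuousOn (FaReal m a) (Ici (-(4 * m ^ 2))) :=
  ((bubbleReal_continuousOn (b := 4 * m ^ 2) (by positivity)).sub continuousOn_const).congr
    fun _ hs => FaReal_eq hm ha hs

lemma FaReal_self (hm : 0 < m) (ha : -(4 * m ^ 2) < a) : FaReal m a a = 0 := by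
  rw [FaReal_eq hm ha ha.le, sub_self]

lemma gapSymbol_continuousOn (hm : 0 < m) (ha : -(4 * m ^ 2) < a) :
    ContinuousOn (gapSymbol m a hbar lam lam₁ lam₂ g₁ g₂) (Ici (-(4 * m ^ 2))) := by
  have := FaReal_continuousOn hm ha
  unfold gapSymbol
  fun_prop

/-- Since `F_a` is a Herglotz function and `g₂ λ₁ - λ₂ g₁ ≥ 0`, there are no zeros in the upper
half-plane. -/
lemma S_ne_zero_of_upperHalf (hm : 0 < m) (ha : -(4 * m ^ 2) < a) (hc : 0 < coupling hbar lam)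
    (hlams : lam₁ ≠ 0 ∨ lam₂ ≠ 0) (hcond : 0 ≤ g₂ * lam₁ - lam₂ * g₁) {z : ℂ}
    (hz : z ∈ upperHalf) : S m a hbar lam lam₁ lam₂ g₁ g₂ z ≠ 0 := by
  intro h0
  have hz' : 0 < z.im := hz
  rw [S_eq hm ha (notMem_branchCut_of_upperHalf hz)] at h0
  set B := bubble (4 * m ^ 2) z - (bubbleReal (4 * m ^ 2) a : ℂ) with hB
  have hBim : 0 < B.im := by
    rw [hB, Complex.sub_im, Complex.ofReal_im, sub_zero]
    exact bubble_im_pos (by positivity) hz'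
  set c := coupling hbar lam
  have hre := congrArg Complex.re h0
  have him := congrArg Complex.im h0
  simp only [Complex.sub_re, Complex.neg_re, Complex.mul_re, Complex.add_re, Complex.ofReal_re,
    Complex.ofReal_im, Complex.add_im, Complex.mul_im, Complex.sub_im, Complex.neg_im, zero_mul,
    mul_zero, sub_zero, add_zero, zero_add, Complex.zero_re, Complex.zero_im] at hre him
  set x := z.re
  set y := z.im
  have hL : 0 < (lam₁ + lam₂ * x) ^ 2 + (lam₂ * y) ^ 2 := by
    by_cases h2 : lam₂ = 0
    · have h1 : lam₁ ≠ 0 := hlams.resolve_right fun h => h h2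
      rw [h2]; simp; positivity
    · have : lam₂ * y ≠ 0 := mul_ne_zero h2 hz'.ne'
      positivity
  -- The imaginary part of `S(z)` times the conjugate of `λ₁ + λ₂ z`.
  have key : ((lam₁ + lam₂ * x) ^ 2 + (lam₂ * y) ^ 2) * c * B.im +
      (g₂ * lam₁ - lam₂ * g₁) * y = 0 := by
    linear_combination -(lam₁ + lam₂ * x) * him + lam₂ * y * hre
  have h1 : 0 < ((lam₁ + lam₂ * x) ^ 2 + (lam₂ * y) ^ 2) * c * B.im := by positivity
  have h2 : 0 ≤ (g₂ * lam₁ - lam₂ * g₁) * y := mul_nonneg hcond hz'.le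
  linarith

/-- All zeros of `S` are real and lie outside the cut. -/
lemma zeroSet_eq (hm : 0 < m) (ha : -(4 * m ^ 2) < a) (hc : 0 < coupling hbar lam)
    (hlams : lam₁ ≠ 0 ∨ lam₂ ≠ 0) (hcond : 0 ≤ g₂ * lam₁ - lam₂ * g₁)
    (hcut : ∀ s : ℝ, s < -(4 * m ^ 2) → lam₁ + lam₂ * s = 0 → g₁ + g₂ * s ≠ 0) :
    zeroSet m a hbar lam lam₁ lam₂ g₁ g₂ =
      ((↑) : ℝ → ℂ) '' gapZeros m a hbar lam lam₁ lam₂ g₁ g₂ := by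
  ext z
  constructor
  · rintro (⟨hz, h0⟩ | ⟨hz, h0⟩)
    · have him : z.im = 0 := by
        rcases lt_trichotomy z.im 0 with h | h | h
        · refine absurd ?_ (S_ne_zero_of_upperHalf hm ha hc hlams hcond
            (z := (starRingEnd ℂ) z) (by simpa [upperHalf] using h))
          rw [S_conj, h0, map_zero]
        · exact h
        · exact absurd h0 (S_ne_zero_of_upperHalf hm ha hc hlams hcond h)
      have hz' : ((z.re : ℝ) : ℂ) = z := Complex.ext rfl (by simp [him])
      have hre : -(4 * m ^ 2) ≤ z.re := by
        by_contra hlt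
        exact hz ⟨him, not_le.1 hlt⟩
      refine ⟨z.re, ⟨hre, ?_⟩, hz'⟩
      rw [← hz', S_ofReal hm ha hre] at h0
      exact_mod_cast h0
    · exfalso
      obtain ⟨him, hre⟩ := hz
      set κ := Real.sqrt (-z.re - 4 * m ^ 2) with hκ
      have hκ0 : 0 < κ := Real.sqrt_pos.2 (by linarith)
      have hκsq : κ ^ 2 = -z.re - 4 * m ^ 2 := Real.sq_sqrt (by linarith)
      have hz' : z = -((4 * m ^ 2 + κ ^ 2 : ℝ) : ℂ) := by
        rw [hκsq, ← Complex.ofReal_neg]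
        refine Complex.ext ?_ (by simp [him])
        rw [Complex.ofReal_re]; ring
      have hne : SPlus m a hbar lam lam₁ lam₂ g₁ g₂ κ ≠ 0 := by
        refine SPlus_ne_zero hm hc hκ0 fun h1 h2 => hcut z.re hre ?_ ?_
        · rw [hκsq] at h1; linear_combination h1
        · rw [hκsq] at h2; linear_combination h2
      have hlim := tendsto_S_boundary (hbar := hbar) (lam := lam) (lam₁ := lam₁) (lam₂ := lam₂)
        (g₁ := g₁) (g₂ := g₂) hm ha hκ0.le
      rw [← hz'] at hlim
      have hnb : (𝓝[upperHalf] z).NeBot := by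
        rw [← mem_closure_iff_nhdsWithin_neBot, upperHalf, Complex.closure_setOfPred_lt_im]
        simp [him]
      rcases h0 with h0 | h0
      · exact hne (tendsto_nhds_unique hlim h0)
      · -- the boundary value from below is the complex conjugate one
        have hzc : (starRingEnd ℂ) z = z := Complex.conj_eq_iff_im.2 him
        have hconj : Tendsto (starRingEnd ℂ) (𝓝[upperHalf] z) (𝓝[{w : ℂ | w.im < 0}] z) := by
          refine tendsto_nhdsWithin_iff.2 ⟨?_, ?_⟩
          · have := (Complex.continuous_conj.tendsto z).mono_left
              (nhdsWithin_le_nhds (s := upperHalf))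
            rwa [hzc] at this
          · filter_upwards [self_mem_nhdsWithin] with w hw
            simpa [upperHalf] using hw
        have h1 := (Complex.continuous_conj.tendsto 0).comp (h0.comp hconj)
        rw [map_zero] at h1
        refine hne (tendsto_nhds_unique hlim (h1.congr fun w => ?_))
        simp [S_conj]
  · rintro ⟨s, ⟨hs, h0⟩, rfl⟩
    refine Or.inl ⟨ofReal_notMem_branchCut hs, ?_⟩
    rw [S_ofReal hm ha hs]
    exact_mod_cast h0

/-- The quotient `-S / (λ₁ + λ₂ z)` increases between the zeros of the denominator; this gives the
sign of `S` to the right of a zero. -/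
lemma gapSymbol_mul_neg (hm : 0 < m) (ha : -(4 * m ^ 2) < a) (hc : 0 < coupling hbar lam)
    (hcond : 0 ≤ g₂ * lam₁ - lam₂ * g₁) {s t : ℝ}
    (hs : s ∈ gapZeros m a hbar lam lam₁ lam₂ g₁ g₂) (hst : s < t)
    (hL : 0 < (lam₁ + lam₂ * s) * (lam₁ + lam₂ * t)) :
    gapSymbol m a hbar lam lam₁ lam₂ g₁ g₂ t * (lam₁ + lam₂ * s) < 0 := by
  obtain ⟨hs0, hs⟩ := hs
  have hF := FaReal_strictMonoOn hm ha hs0 (hs0.trans hst.le : -(4 * m ^ 2) ≤ t) hst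
  have h1 : 0 < (lam₁ + lam₂ * s) * (lam₁ + lam₂ * t) * coupling hbar lam *
      (FaReal m a t - FaReal m a s) := mul_pos (mul_pos hL hc) (by linarith)
  have h2 : 0 ≤ (g₂ * lam₁ - lam₂ * g₁) * (t - s) := mul_nonneg hcond (by linarith)
  unfold gapSymbol at hs ⊢
  have e : (-((lam₁ + lam₂ * t) * coupling hbar lam * FaReal m a t) - (g₁ + g₂ * t)) *
      (lam₁ + lam₂ * s) = -((lam₁ + lam₂ * s) * (lam₁ + lam₂ * t) * coupling hbar lam *
      (FaReal m a t - FaReal m a s)) - (g₂ * lam₁ - lam₂ * g₁) * (t - s) := by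
    linear_combination (lam₁ + lam₂ * t) * hs
  rw [e]
  linarith

lemma gapSymbol_mul_pos (hm : 0 < m) (ha : -(4 * m ^ 2) < a) (hc : 0 < coupling hbar lam)
    (hcond : 0 ≤ g₂ * lam₁ - lam₂ * g₁) {s t : ℝ}
    (ht : t ∈ gapZeros m a hbar lam lam₁ lam₂ g₁ g₂) (hs : -(4 * m ^ 2) ≤ s) (hst : s < t)
    (hL : 0 < (lam₁ + lam₂ * s) * (lam₁ + lam₂ * t)) :
    0 < gapSymbol m a hbar lam lam₁ lam₂ g₁ g₂ s * (lam₁ + lam₂ * t) := by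
  obtain ⟨ht0, ht⟩ := ht
  have hF := FaReal_strictMonoOn hm ha hs ht0 hst
  have h1 : 0 < (lam₁ + lam₂ * s) * (lam₁ + lam₂ * t) * coupling hbar lam *
      (FaReal m a t - FaReal m a s) := mul_pos (mul_pos hL hc) (by linarith)
  have h2 : 0 ≤ (g₂ * lam₁ - lam₂ * g₁) * (t - s) := mul_nonneg hcond (by linarith)
  unfold gapSymbol at ht ⊢
  have e : (-((lam₁ + lam₂ * s) * coupling hbar lam * FaReal m a s) - (g₁ + g₂ * s)) *
      (lam₁ + lam₂ * t) = ((lam₁ + lam₂ * s) * (lam₁ + lam₂ * t) * coupling hbar lam *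
      (FaReal m a t - FaReal m a s)) + (g₂ * lam₁ - lam₂ * g₁) * (t - s) := by
    linear_combination (lam₁ + lam₂ * s) * ht
  rw [e]
  linarith

lemma eq_of_mem_gapZeros (hm : 0 < m) (ha : -(4 * m ^ 2) < a) (hc : 0 < coupling hbar lam)
    (hcond : 0 ≤ g₂ * lam₁ - lam₂ * g₁) {s t : ℝ}
    (hs : s ∈ gapZeros m a hbar lam lam₁ lam₂ g₁ g₂)
    (ht : t ∈ gapZeros m a hbar lam lam₁ lam₂ g₁ g₂)
    (hL : 0 < (lam₁ + lam₂ * s) * (lam₁ + lam₂ * t)) : s = t := by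
  rcases lt_trichotomy s t with h | h | h
  · have := gapSymbol_mul_neg hm ha hc hcond hs h hL
    rw [ht.2, zero_mul] at this
    exact absurd this (lt_irrefl _)
  · exact h
  · have := gapSymbol_mul_neg hm ha hc hcond ht h (by rwa [mul_comm])
    rw [hs.2, zero_mul] at this
    exact absurd this (lt_irrefl _)

/-- The zeros of `S` in the gap are simple. -/
lemma deriv_S_ne_zero (hm : 0 < m) (ha : -(4 * m ^ 2) < a) (hc : 0 < coupling hbar lam)
    (hcond : 0 ≤ g₂ * lam₁ - lam₂ * g₁) {s : ℝ} (hs : -(4 * m ^ 2) < s)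
    (h0 : gapSymbol m a hbar lam lam₁ lam₂ g₁ g₂ s = 0)
    (hcommon : lam₁ + lam₂ * s = 0 → lam₂ * coupling hbar lam * FaReal m a s + g₂ ≠ 0) :
    deriv (S m a hbar lam lam₁ lam₂ g₁ g₂) s ≠ 0 := by
  obtain ⟨d, hd, hd'⟩ := bubbleDeriv_ofReal (b := 4 * m ^ 2) (s := s) (by positivity) hs
  rw [(hasDerivAt_S hm ha (ofReal_add_mem_slitPlane hs)).deriv, hd', ← ofReal_bubbleReal]
  have hF := FaReal_eq hm ha hs.le
  have e : -((lam₂ : ℂ) * coupling hbar lam * ((bubbleReal (4 * m ^ 2) s : ℂ) -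
      (bubbleReal (4 * m ^ 2) a : ℂ)) + (lam₁ + lam₂ * s) * coupling hbar lam * d) - g₂ =
      ((-(lam₂ * coupling hbar lam * FaReal m a s + (lam₁ + lam₂ * s) * coupling hbar lam * d)
        - g₂ : ℝ) : ℂ) := by
    rw [hF]; push_cast; ring
  rw [e, Complex.ofReal_ne_zero]
  unfold gapSymbol at h0
  by_cases hL : lam₁ + lam₂ * s = 0
  · intro h
    refine hcommon hL ?_
    rw [hL] at h
    linear_combination -h
  · intro h
    have h1 : (lam₁ + lam₂ * s) ^ 2 * coupling hbar lam * d + (g₂ * lam₁ - lam₂ * g₁) = 0 := by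
      linear_combination -(lam₁ + lam₂ * s) * h + lam₂ * h0
    have h2 : 0 < (lam₁ + lam₂ * s) ^ 2 * coupling hbar lam * d := by positivity
    linarith

/-- The symbol is regular if the two coefficient functions have no common zero, except possibly
for a simple one in the gap. -/
lemma regularSymbol_of_gapZeros (hm : 0 < m) (ha : -(4 * m ^ 2) < a) (hc : 0 < coupling hbar lam)
    (hlams : lam₁ ≠ 0 ∨ lam₂ ≠ 0) (hcond : 0 ≤ g₂ * lam₁ - lam₂ * g₁)
    (hcut : ∀ s : ℝ, s ≤ -(4 * m ^ 2) → lam₁ + lam₂ * s = 0 → g₁ + g₂ * s ≠ 0)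
    (hcommon : ∀ s : ℝ, -(4 * m ^ 2) < s → g₁ + g₂ * s = 0 → lam₁ + lam₂ * s = 0 →
      lam₂ * coupling hbar lam * FaReal m a s + g₂ ≠ 0) {ζ₁ ζ₂ : ℝ}
    (hζ : gapZeros m a hbar lam lam₁ lam₂ g₁ g₂ ⊆ {ζ₁, ζ₂}) :
    RegularSymbol m a hbar lam lam₁ lam₂ g₁ g₂ (ζ₁ * ζ₂) (-(ζ₁ + ζ₂)) 1 := by
  have hquad : ∀ s ∈ gapZeros m a hbar lam lam₁ lam₂ g₁ g₂,
      quadratic (ζ₁ * ζ₂) (-(ζ₁ + ζ₂)) 1 (s : ℂ) = 0 := by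
    intro s hs
    rcases hζ hs with rfl | h
    · rw [quadratic]; push_cast; ring
    · rw [mem_singleton_iff.1 h, quadratic]; push_cast; ring
  refine ⟨hm, ha, hc, hlams, fun z hz => S_ne_zero_of_upperHalf hm ha hc hlams hcond hz,
    fun s hs h0 => ?_, fun κ hκ => ?_, fun h0 => ?_⟩
  · rw [S_ofReal hm ha hs.le, Complex.ofReal_eq_zero] at h0
    refine ⟨hquad s ⟨hs.le, h0⟩, deriv_S_ne_zero hm ha hc hcond hs h0 fun hL => ?_⟩
    refine hcommon s hs ?_ hL
    rw [hL] at h0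
    linear_combination -h0
  · refine SPlus_ne_zero hm hc hκ fun h1 h2 => hcut (-(4 * m ^ 2 + κ ^ 2)) (by nlinarith) ?_ ?_
    · linear_combination h1
    · linear_combination h2
  · rw [S_ofReal hm ha le_rfl, Complex.ofReal_eq_zero] at h0
    refine ⟨hquad _ ⟨le_rfl, h0⟩, fun hL => ?_⟩
    have hL' : lam₁ + lam₂ * -(4 * m ^ 2) = 0 := by linear_combination hL
    refine hcut _ le_rfl hL' ?_
    rw [hL'] at h0
    linear_combination -h0

/-- Decay, if there are at most two zeros, all nonpositive and none at `a`. -/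
lemma solutionsDecay_of_gapZeros (hm : 0 < m) (ha : -(4 * m ^ 2) < a) (ha' : a < 0)
    (hc : 0 < coupling hbar lam)
    (hlams : lam₁ ≠ 0 ∨ lam₂ ≠ 0) (hcond : 0 ≤ g₂ * lam₁ - lam₂ * g₁)
    (hcut : ∀ s : ℝ, s ≤ -(4 * m ^ 2) → lam₁ + lam₂ * s = 0 → g₁ + g₂ * s ≠ 0)
    (hcommon : ∀ s : ℝ, -(4 * m ^ 2) < s → g₁ + g₂ * s = 0 → lam₁ + lam₂ * s = 0 →
      lam₂ * coupling hbar lam * FaReal m a s + g₂ ≠ 0)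
    (hcard : (gapZeros m a hbar lam lam₁ lam₂ g₁ g₂).encard ≤ 2)
    (hneg : ∀ s ∈ gapZeros m a hbar lam lam₁ lam₂ g₁ g₂, s ≤ 0)
    (hga : g₁ + g₂ * a ≠ 0) : SolutionsDecay m a hbar lam lam₁ lam₂ g₁ g₂ := by
  have hsub : gapZeros m a hbar lam lam₁ lam₂ g₁ g₂ ⊆ Iio a ∪ Ioc a 0 := by
    intro s hs
    rcases lt_trichotomy s a with h | rfl | h
    · exact Or.inl h
    · have := hs.2
      rw [gapSymbol, FaReal_self hm ha] at this
      exact absurd (by linear_combination -this) hga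
    · exact Or.inr ⟨h, hneg s hs⟩
  have hinf : (Iio a ∪ Ioc a 0).encard = ⊤ :=
    ((Iio_infinite a).mono subset_union_left).encard_eq
  obtain ⟨r, hr1, hr2, hr⟩ := exists_superset_subset_encard_eq hsub hcard (by rw [hinf]; exact le_top)
  obtain ⟨ζ₁, ζ₂, hne, rfl⟩ := encard_eq_two.1 hr
  have hle : ∀ ζ ∈ Iio a ∪ Ioc a 0, ζ ≤ 0 ∧ ζ ≠ a := by
    rintro ζ (h | h)
    · exact ⟨(le_of_lt h).trans ha'.le, ne_of_lt h⟩
    · exact ⟨h.2, ne_of_gt h.1⟩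
  obtain ⟨h1, h1a⟩ := hle ζ₁ (hr2 (by simp))
  obtain ⟨h2, h2a⟩ := hle ζ₂ (hr2 (by simp))
  refine (regularSymbol_of_gapZeros hm ha hc hlams hcond hcut hcommon hr1).solutionsDecay
    (fun x hx h0 => ?_) ha'.le h1 h2 hne h1a h2a
  have hx' : -(4 * m ^ 2) ≤ x := by nlinarith [sq_nonneg m]
  rw [S_ofReal hm ha hx', Complex.ofReal_eq_zero] at h0
  exact absurd (hneg x ⟨hx', h0⟩) (not_le.2 hx)

end Zeros

/-! ### Zeros and decay for the three orders of the coefficients -/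

section Cases

variable {m a hbar lam lam₁ lam₂ g₁ g₂ : ℝ}

lemma add_mul_eq_mul_sub (h2 : lam₂ ≠ 0) (s : ℝ) :
    lam₁ + lam₂ * s = lam₂ * (s - -(lam₁ / lam₂)) := by
  field_simp; ring

/-- On each side of the zero of `λ₁ + λ₂ z` there is at most one zero of `S`. -/
lemma encard_gapZeros_le_two (hm : 0 < m) (ha : -(4 * m ^ 2) < a) (hc : 0 < coupling hbar lam)
    (hcond : 0 ≤ g₂ * lam₁ - lam₂ * g₁) (h2 : lam₂ ≠ 0)
    (hleft : -(lam₁ / lam₂) ∈ gapZeros m a hbar lam lam₁ lam₂ g₁ g₂ →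
      ∀ s ∈ gapZeros m a hbar lam lam₁ lam₂ g₁ g₂, -(lam₁ / lam₂) ≤ s) :
    (gapZeros m a hbar lam lam₁ lam₂ g₁ g₂).encard ≤ 2 := by
  set Z := gapZeros m a hbar lam lam₁ lam₂ g₁ g₂
  set z := -(lam₁ / lam₂) with hz
  have hLL : ∀ s t : ℝ, 0 < (s - z) * (t - z) → 0 < (lam₁ + lam₂ * s) * (lam₁ + lam₂ * t) := by
    intro s t hst
    rw [add_mul_eq_mul_sub h2 s, add_mul_eq_mul_sub h2 t, ← hz]
    have : 0 < lam₂ ^ 2 := by positivity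
    nlinarith [mul_pos this hst]
  have h1 : (Z ∩ Ioi z).encard ≤ 1 := by
    rw [encard_le_one_iff]
    rintro s t ⟨hs, hs'⟩ ⟨ht, ht'⟩
    exact eq_of_mem_gapZeros hm ha hc hcond hs ht
      (hLL s t (mul_pos (sub_pos.2 hs') (sub_pos.2 ht')))
  have h1' : (Z ∩ Iic z).encard ≤ 1 := by
    rw [encard_le_one_iff]
    rintro s t ⟨hs, hs'⟩ ⟨ht, ht'⟩
    rcases (show s ≤ z from hs').lt_or_eq with hlt | rfl
    · rcases (show t ≤ z from ht').lt_or_eq with hlt' | rfl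
      · exact eq_of_mem_gapZeros hm ha hc hcond hs ht
          (hLL s t (mul_pos_of_neg_of_neg (sub_neg.2 hlt) (sub_neg.2 hlt')))
      · exact le_antisymm hs' (hleft ht s hs)
    · exact le_antisymm (hleft hs t ht) ht'
  calc Z.encard ≤ ((Z ∩ Iic z) ∪ (Z ∩ Ioi z)).encard := by
        refine encard_le_encard fun s hs => ?_
        rcases le_or_gt s z with h | h
        · exact Or.inl ⟨hs, h⟩
        · exact Or.inr ⟨hs, h⟩
    _ ≤ (Z ∩ Iic z).encard + (Z ∩ Ioi z).encard := encard_union_le _ _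
    _ ≤ 1 + 1 := add_le_add h1' h1
    _ = 2 := by norm_num

lemma encard_eq_one_or_two {α : Type*} {s : Set α} (h : s.encard ≤ 2) (hne : s.Nonempty) :
    s.encard = 1 ∨ s.encard = 2 := by
  have h1 : 1 ≤ s.encard := one_le_encard_iff_nonempty.2 hne
  rcases h1.eq_or_lt with h1 | h1
  · exact Or.inl h1.symm
  · refine Or.inr (le_antisymm h ?_)
    have := Order.add_one_le_of_lt h1
    rwa [one_add_one_eq_two] at this

lemma encard_zeroSet (hm : 0 < m) (ha : -(4 * m ^ 2) < a) (hc : 0 < coupling hbar lam)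
    (hlams : lam₁ ≠ 0 ∨ lam₂ ≠ 0) (hcond : 0 ≤ g₂ * lam₁ - lam₂ * g₁)
    (hcut : ∀ s : ℝ, s < -(4 * m ^ 2) → lam₁ + lam₂ * s = 0 → g₁ + g₂ * s ≠ 0) :
    (zeroSet m a hbar lam lam₁ lam₂ g₁ g₂).encard =
      (gapZeros m a hbar lam lam₁ lam₂ g₁ g₂).encard := by
  rw [zeroSet_eq hm ha hc hlams hcond hcut, Complex.ofReal_injective.encard_image]

/-- A zero of `S` at which `F_a` can be compared with the ratio of the coefficients at `0` is
nonpositive. -/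
lemma nonpos_of_mem_gapZeros (hm : 0 < m) (ha : -(4 * m ^ 2) < a) (hc : 0 < coupling hbar lam)
    (hcond : 0 ≤ g₂ * lam₁ - lam₂ * g₁) (h1 : lam₁ ≠ 0)
    (hL : ∀ s : ℝ, 0 < s → 0 < lam₁ * (lam₁ + lam₂ * s))
    (h0 : -(g₁ / lam₁) ≤ coupling hbar lam * FaReal m a 0) {s : ℝ}
    (hs : s ∈ gapZeros m a hbar lam lam₁ lam₂ g₁ g₂) : s ≤ 0 ∧
      (-(g₁ / lam₁) < coupling hbar lam * FaReal m a 0 → s < 0) := by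
  have hval : gapSymbol m a hbar lam lam₁ lam₂ g₁ g₂ 0 =
      -(lam₁ * (coupling hbar lam * FaReal m a 0 - -(g₁ / lam₁))) := by
    rw [gapSymbol]; field_simp; ring
  have hle : s ≤ 0 := by
    by_contra hpos
    rw [not_le] at hpos
    have hLs := hL s hpos
    have key := gapSymbol_mul_pos hm ha hc hcond hs (by nlinarith [sq_nonneg m]) hpos
      (by simpa using hLs)
    rw [hval] at key
    nlinarith [mul_nonneg hLs.le (sub_nonneg.2 h0)]
  refine ⟨hle, fun hlt => lt_of_le_of_ne hle fun he => ?_⟩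
  have h2 := hs.2
  rw [he, hval, neg_eq_zero] at h2
  rcases mul_eq_zero.1 h2 with h | h
  · exact h1 h
  · linarith

/-- For `λ₂ = 0`, the function `-S / λ₁ = c F_a + g₁ / λ₁ + (g₂ / λ₁) z` is strictly increasing on
`[-4m², ∞)`, nonpositive at `-4m²` and nonnegative at `0`, so that it has exactly one zero there. -/
theorem zeros_and_decay_of_const (hm : 0 < m) (hc : 0 < coupling hbar lam)
    (ha : -(4 * m ^ 2) < a) (ha' : a < 0) (hlam₁ : lam₁ ≠ 0) (hcond : 0 ≤ g₂ * lam₁)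
    (h0 : -(g₁ / lam₁) ≤ coupling hbar lam * FaReal m a 0)
    (hb : coupling hbar lam * FaReal m a (-(4 * m ^ 2)) ≤
      -(g₁ / lam₁) + 4 * m ^ 2 * (g₂ / lam₁)) :
    (zeroSet m a hbar lam lam₁ 0 g₁ g₂).encard = 1 ∧
      (∀ z ∈ zeroSet m a hbar lam lam₁ 0 g₁ g₂, z.im = 0 ∧ z.re ≤ 0 ∧
        (-(g₁ / lam₁) < coupling hbar lam * FaReal m a 0 → z.re < 0)) ∧
      SolutionsDecay m a hbar lam lam₁ 0 g₁ g₂ := by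
  have hcond' : 0 ≤ g₂ * lam₁ - 0 * g₁ := by simpa using hcond
  have hlams : lam₁ ≠ 0 ∨ (0 : ℝ) ≠ 0 := Or.inl hlam₁
  have hcut : ∀ s : ℝ, lam₁ + 0 * s = 0 → g₁ + g₂ * s ≠ 0 := fun s hs =>
    absurd (by simpa using hs) hlam₁
  have hsq : 0 < lam₁ * lam₁ := mul_self_pos.2 hlam₁
  set Z := gapZeros m a hbar lam lam₁ 0 g₁ g₂ with hZ
  have huniq : ∀ s ∈ Z, ∀ t ∈ Z, s = t := fun s hs t ht =>
    eq_of_mem_gapZeros hm ha hc hcond' hs ht (by simpa using hsq)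
  have hnonpos : ∀ s ∈ Z, s ≤ 0 ∧
      (-(g₁ / lam₁) < coupling hbar lam * FaReal m a 0 → s < 0) := fun s hs =>
    nonpos_of_mem_gapZeros hm ha hc hcond' hlam₁ (fun s _ => by simpa using hsq) h0 hs
  obtain ⟨s₀, hs₀⟩ : Z.Nonempty := by
    have hcont : ContinuousOn (fun s => -gapSymbol m a hbar lam lam₁ 0 g₁ g₂ s / lam₁)
        (Icc (-(4 * m ^ 2)) 0) :=
      (((gapSymbol_continuousOn hm ha).mono Icc_subset_Ici_self).neg).div_const _
    have hval : ∀ s, -gapSymbol m a hbar lam lam₁ 0 g₁ g₂ s / lam₁ =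
        coupling hbar lam * FaReal m a s + g₁ / lam₁ + g₂ / lam₁ * s := fun s => by
      rw [gapSymbol]; field_simp; ring
    obtain ⟨s, hs, h⟩ := intermediate_value_Icc (by nlinarith [sq_nonneg m]) hcont
      (show (0 : ℝ) ∈ Icc _ _ from ⟨by rw [hval]; linarith, by rw [hval]; linarith⟩)
    refine ⟨s, hs.1, ?_⟩
    simpa [hlam₁] using h
  have hZs : Z = {s₀} := eq_singleton_iff_unique_mem.2 ⟨hs₀, fun s hs => huniq s hs s₀ hs₀⟩
  refine ⟨?_, ?_, ?_⟩
  · rw [encard_zeroSet hm ha hc hlams hcond' fun s _ => hcut s, ← hZ, hZs, encard_singleton]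
  · rw [zeroSet_eq hm ha hc hlams hcond' fun s _ => hcut s]
    rintro z ⟨s, hs, rfl⟩
    exact ⟨Complex.ofReal_im s, hnonpos s hs⟩
  · by_cases hga : g₁ + g₂ * a = 0
    · -- the only zero of `S` is `a`
      obtain rfl : g₁ = -(g₂ * a) := by linear_combination hga
      have haZ : a ∈ Z := ⟨ha.le, by rw [gapSymbol, FaReal_self hm ha]; ring⟩
      have hsub : Z ⊆ {a, a - 1} := fun s hs => by simp [huniq s hs a haZ]
      refine (regularSymbol_of_gapZeros hm ha hc hlams hcond' (fun s _ => hcut s)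
        (fun s _ h1 h2 => absurd h1 (hcut s h2)) hsub).solutionsDecay_of_eq (fun x hx h => ?_)
        ha'.le (by linarith) (by linarith)
      have hx' : -(4 * m ^ 2) ≤ x := by nlinarith [sq_nonneg m]
      rw [S_ofReal hm ha hx', Complex.ofReal_eq_zero] at h
      exact absurd (hnonpos x ⟨hx', h⟩).1 (not_le.2 hx)
    · refine solutionsDecay_of_gapZeros hm ha ha' hc hlams hcond' (fun s _ => hcut s)
        (fun s _ h1 h2 => absurd h1 (hcut s h2)) ?_ (fun s hs => (hnonpos s hs).1) hga
      rw [← hZ, hZs, encard_singleton]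
      exact one_le_two

/-- If `-λ₁/λ₂ < -g₁/g₂ < a`, then `-S λ₂` is positive on `[a, ∞)`, as the sum of a nonnegative and a
positive term. At `-g₁/g₂`, if `S` is real there, it is nonpositive, which gives a zero below `a`. -/
theorem zeros_and_decay_of_lt (hm : 0 < m) (hc : 0 < coupling hbar lam)
    (ha : -(4 * m ^ 2) < a) (ha' : a < 0) (hcond : 0 ≤ g₂ * lam₁ - lam₂ * g₁)
    (hlt : -(lam₁ / lam₂) < -(g₁ / g₂)) (hga : -(g₁ / g₂) < a) :
    (∀ z ∈ zeroSet m a hbar lam lam₁ lam₂ g₁ g₂, z.im = 0 ∧ z.re < 0) ∧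
      (zeroSet m a hbar lam lam₁ lam₂ g₁ g₂).encard ≤ 2 ∧
      (-(4 * m ^ 2) ≤ -(g₁ / g₂) →
        (zeroSet m a hbar lam lam₁ lam₂ g₁ g₂).encard = 1 ∨
        (zeroSet m a hbar lam lam₁ lam₂ g₁ g₂).encard = 2) ∧
      SolutionsDecay m a hbar lam lam₁ lam₂ g₁ g₂ := by
  -- By the convention `x / 0 = 0`, the order of the zeros excludes vanishing denominators.
  have h2 : lam₂ ≠ 0 := by rintro rfl; simp at hlt; linarith
  have hg : g₂ ≠ 0 := by rintro rfl; simp at hga; linarith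
  set z := -(lam₁ / lam₂) with hz
  set y := -(g₁ / g₂) with hy
  have hL : ∀ s, lam₁ + lam₂ * s = lam₂ * (s - z) := fun s => add_mul_eq_mul_sub h2 s
  have hG : ∀ s, g₁ + g₂ * s = g₂ * (s - y) := fun s => add_mul_eq_mul_sub hg s
  have hk : 0 < g₂ * lam₂ := by
    have e : g₂ * lam₁ - lam₂ * g₁ = g₂ * lam₂ * (y - z) := by
      rw [hy, hz]; field_simp; ring
    rw [e] at hcond
    have hne : g₂ * lam₂ ≠ 0 := mul_ne_zero hg h2
    exact lt_of_le_of_ne (nonneg_of_mul_nonneg_left hcond (by linarith)) hne.symm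
  have hsq : 0 < lam₂ ^ 2 := by positivity
  have hcut : ∀ s : ℝ, lam₁ + lam₂ * s = 0 → g₁ + g₂ * s ≠ 0 := by
    intro s hs hs'
    rw [hL] at hs
    rw [hG] at hs'
    have h3 := (mul_eq_zero.1 hs).resolve_left h2
    have h4 := (mul_eq_zero.1 hs').resolve_left hg
    linarith
  have hlams : lam₁ ≠ 0 ∨ lam₂ ≠ 0 := Or.inr h2
  have hval : ∀ s, -gapSymbol m a hbar lam lam₁ lam₂ g₁ g₂ s * lam₂ =
      lam₂ ^ 2 * ((s - z) * (coupling hbar lam * FaReal m a s)) + g₂ * lam₂ * (s - y) := by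
    intro s
    rw [gapSymbol, hL, hG]; ring
  have hpos : ∀ s, a ≤ s → 0 < -gapSymbol m a hbar lam lam₁ lam₂ g₁ g₂ s * lam₂ := by
    intro s hs
    rw [hval]
    have hF : 0 ≤ FaReal m a s := by
      rw [← FaReal_self hm ha]
      exact (FaReal_strictMonoOn hm ha).monotoneOn (mem_Ici.2 ha.le)
        (mem_Ici.2 (ha.le.trans hs)) hs
    have h3 : 0 ≤ (s - z) * (coupling hbar lam * FaReal m a s) :=
      mul_nonneg (by linarith) (by positivity)
    have h4 : 0 < g₂ * lam₂ * (s - y) := mul_pos hk (by linarith)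
    nlinarith [mul_nonneg hsq.le h3]
  set Z := gapZeros m a hbar lam lam₁ lam₂ g₁ g₂ with hZ
  have hlta : ∀ s ∈ Z, s < a := by
    intro s hs
    by_contra h
    have := hpos s (not_lt.1 h)
    rw [hs.2] at this
    simp at this
  have hcard : Z.encard ≤ 2 := by
    refine encard_gapZeros_le_two hm ha hc hcond h2 fun hzZ => ?_
    have h3 := hzZ.2
    rw [gapSymbol, hL, sub_self, mul_zero, zero_mul, zero_mul, neg_zero, zero_sub,
      neg_eq_zero] at h3
    exact absurd h3 (hcut _ (by rw [hL, sub_self, mul_zero]))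
  have henc := encard_zeroSet hm ha hc hlams hcond fun s _ => hcut s
  refine ⟨?_, by rw [henc]; exact hcard, fun hyb => ?_, ?_⟩
  · rw [zeroSet_eq hm ha hc hlams hcond fun s _ => hcut s]
    rintro w ⟨s, hs, rfl⟩
    exact ⟨Complex.ofReal_im s, (hlta s hs).trans ha'⟩
  · rw [henc]
    refine encard_eq_one_or_two hcard ?_
    have hcont : ContinuousOn (fun s => -gapSymbol m a hbar lam lam₁ lam₂ g₁ g₂ s * lam₂)
        (Icc y a) :=
      (((gapSymbol_continuousOn hm ha).mono ((Icc_subset_Ici_self).trans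
        (Ici_subset_Ici.2 hyb))).neg).mul continuousOn_const
    have hy0 : -gapSymbol m a hbar lam lam₁ lam₂ g₁ g₂ y * lam₂ ≤ 0 := by
      rw [hval, sub_self, mul_zero, add_zero]
      have hF : FaReal m a y ≤ 0 := by
        rw [← FaReal_self hm ha]
        exact (FaReal_strictMonoOn hm ha).monotoneOn (mem_Ici.2 hyb) (mem_Ici.2 ha.le) hga.le
      have h3 : (y - z) * (coupling hbar lam * FaReal m a y) ≤ 0 :=
        mul_nonpos_of_nonneg_of_nonpos (by linarith) (mul_nonpos_of_nonneg_of_nonpos hc.le hF)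
      exact mul_nonpos_of_nonneg_of_nonpos hsq.le h3
    obtain ⟨s, hs, h⟩ := intermediate_value_Icc hga.le hcont
      (show (0 : ℝ) ∈ Icc _ _ from ⟨hy0, (hpos a le_rfl).le⟩)
    refine ⟨s, hyb.trans hs.1, ?_⟩
    simpa [h2] using h
  · refine solutionsDecay_of_gapZeros hm ha ha' hc hlams hcond (fun s _ => hcut s)
      (fun s _ h1 h3 => absurd h1 (hcut s h3)) hcard (fun s hs => ((hlta s hs).trans ha').le) ?_
    rw [hG]
    exact mul_ne_zero hg (by linarith)

/-- If the zero `-λ₁/λ₂` of the coefficient of `F_a` lies between the threshold and `a`, then `-S λ₂` is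
nonpositive at this point and nonnegative at `0`, which gives a zero in between. The coefficients may
have a common zero at this point; there `F_a < 0` and the zero of `S` is still simple. -/
theorem zeros_and_decay_of_gap (hm : 0 < m) (hc : 0 < coupling hbar lam)
    (ha : -(4 * m ^ 2) < a) (ha' : a < 0) (hcond : 0 ≤ g₂ * lam₁ - lam₂ * g₁)
    (hzb : -(4 * m ^ 2) < -(lam₁ / lam₂)) (hza : -(lam₁ / lam₂) < a) (hg : 0 < g₂)
    (hg₁ : 0 ≤ -(g₁ / lam₁)) (h0 : -(g₁ / lam₁) ≤ coupling hbar lam * FaReal m a 0) :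
    (∀ z ∈ zeroSet m a hbar lam lam₁ lam₂ g₁ g₂, z.im = 0 ∧ z.re ≤ 0 ∧
        (-(g₁ / lam₁) < coupling hbar lam * FaReal m a 0 → z.re < 0)) ∧
      ((zeroSet m a hbar lam lam₁ lam₂ g₁ g₂).encard = 1 ∨
        (zeroSet m a hbar lam lam₁ lam₂ g₁ g₂).encard = 2) ∧
      SolutionsDecay m a hbar lam lam₁ lam₂ g₁ g₂ := by
  have h2 : lam₂ ≠ 0 := by rintro rfl; simp at hza; linarith
  have h1 : lam₁ ≠ 0 := by rintro rfl; simp at hza; linarith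
  set z := -(lam₁ / lam₂) with hz
  have hL : ∀ s, lam₁ + lam₂ * s = lam₂ * (s - z) := fun s => add_mul_eq_mul_sub h2 s
  have hzv : lam₁ = -(lam₂ * z) := by rw [hz]; field_simp
  have hsq : 0 < lam₂ ^ 2 := by positivity
  have hz0 : z < 0 := hza.trans ha'
  have hlams : lam₁ ≠ 0 ∨ lam₂ ≠ 0 := Or.inr h2
  have hcut : ∀ s : ℝ, s ≤ -(4 * m ^ 2) → lam₁ + lam₂ * s = 0 → g₁ + g₂ * s ≠ 0 := by
    intro s hs hs'
    rw [hL] at hs'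
    have h3 := (mul_eq_zero.1 hs').resolve_left h2
    linarith
  have hFneg : ∀ s, -(4 * m ^ 2) ≤ s → s < a → FaReal m a s < 0 := fun s hs hsa => by
    rw [← FaReal_self hm ha]
    exact FaReal_strictMonoOn hm ha (mem_Ici.2 hs) (mem_Ici.2 ha.le) hsa
  -- A common zero of the coefficients forces `g₁ / λ₁ = g₂ / λ₂ ≤ 0`.
  have hratio : g₁ + g₂ * z = 0 → g₂ / lam₂ ≤ 0 := by
    intro h
    have e : g₂ / lam₂ = g₁ / lam₁ := by
      rw [div_eq_div_iff h2 h1, hzv]; linear_combination -lam₂ * h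
    rw [e]; linarith
  have hcommon : ∀ s : ℝ, -(4 * m ^ 2) < s → g₁ + g₂ * s = 0 → lam₁ + lam₂ * s = 0 →
      lam₂ * coupling hbar lam * FaReal m a s + g₂ ≠ 0 := by
    intro s hs h3 h4 h5
    rw [hL] at h4
    have hsz : s = z := by linarith [(mul_eq_zero.1 h4).resolve_left h2]
    rw [hsz] at h3 h5
    have h6 := hratio h3
    have h7 : coupling hbar lam * FaReal m a z = -(g₂ / lam₂) := by
      field_simp; linear_combination h5
    have h8 := mul_neg_of_pos_of_neg hc (hFneg z hzb.le hza)
    linarith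
  set Z := gapZeros m a hbar lam lam₁ lam₂ g₁ g₂ with hZ
  have hnonpos : ∀ s ∈ Z, s ≤ 0 ∧
      (-(g₁ / lam₁) < coupling hbar lam * FaReal m a 0 → s < 0) := by
    refine fun s hs => nonpos_of_mem_gapZeros hm ha hc hcond h1 (fun t ht => ?_) h0 hs
    rw [hL, hzv]
    nlinarith [mul_pos hsq (mul_pos (neg_pos.2 hz0) (show 0 < t - z by linarith))]
  have hcard : Z.encard ≤ 2 := by
    refine encard_gapZeros_le_two hm ha hc hcond h2 fun hzZ s hs => ?_
    have h3 := hzZ.2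
    rw [gapSymbol, hL, sub_self, mul_zero, zero_mul, zero_mul, neg_zero, zero_sub,
      neg_eq_zero] at h3
    by_contra hlt
    rw [not_le] at hlt
    have h4 := hs.2
    have e : gapSymbol m a hbar lam lam₁ lam₂ g₁ g₂ s =
        -(lam₂ * (s - z) * (coupling hbar lam * FaReal m a s + g₂ / lam₂)) := by
      rw [gapSymbol, hL, show g₁ = -(g₂ * z) by linear_combination h3]; field_simp; ring
    rw [e, neg_eq_zero] at h4
    rcases mul_eq_zero.1 h4 with h5 | h5
    · have := (mul_eq_zero.1 h5).resolve_left h2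
      linarith
    · have h6 := hratio h3
      have h8 := mul_neg_of_pos_of_neg hc (hFneg s hs.1 (hlt.trans hza))
      linarith
  have hcut' : ∀ s : ℝ, s < -(4 * m ^ 2) → lam₁ + lam₂ * s = 0 → g₁ + g₂ * s ≠ 0 :=
    fun s hs => hcut s hs.le
  refine ⟨?_, ?_, ?_⟩
  · rw [zeroSet_eq hm ha hc hlams hcond hcut']
    rintro w ⟨s, hs, rfl⟩
    exact ⟨Complex.ofReal_im s, hnonpos s hs⟩
  · rw [encard_zeroSet hm ha hc hlams hcond hcut']
    refine encard_eq_one_or_two hcard ?_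
    have hcont : ContinuousOn (fun s => -gapSymbol m a hbar lam lam₁ lam₂ g₁ g₂ s * lam₂)
        (Icc z 0) :=
      (((gapSymbol_continuousOn hm ha).mono ((Icc_subset_Ici_self).trans
        (Ici_subset_Ici.2 hzb.le))).neg).mul continuousOn_const
    have hz' : -gapSymbol m a hbar lam lam₁ lam₂ g₁ g₂ z * lam₂ ≤ 0 := by
      rw [gapSymbol, hL, sub_self]
      have e : (g₁ + g₂ * z) * lam₂ = -(g₂ * lam₁ - lam₂ * g₁) := by rw [hzv]; ring
      linarith
    have h0' : 0 ≤ -gapSymbol m a hbar lam lam₁ lam₂ g₁ g₂ 0 * lam₂ := by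
      have e : -gapSymbol m a hbar lam lam₁ lam₂ g₁ g₂ 0 * lam₂ =
          lam₂ ^ 2 * -z * (coupling hbar lam * FaReal m a 0 - -(g₁ / lam₁)) := by
        have e1 : lam₂ ^ 2 * -z = lam₁ * lam₂ := by rw [hzv]; ring
        rw [e1, gapSymbol]; field_simp; ring
      rw [e]
      exact mul_nonneg (mul_nonneg hsq.le (by linarith)) (by linarith)
    obtain ⟨s, hs, h⟩ := intermediate_value_Icc hz0.le hcont
      (show (0 : ℝ) ∈ Icc _ _ from ⟨hz', h0'⟩)
    refine ⟨s, hzb.le.trans hs.1, ?_⟩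
    simpa [h2] using h
  · refine solutionsDecay_of_gapZeros hm ha ha' hc hlams hcond hcut hcommon hcard
      (fun s hs => (hnonpos s hs).1) fun h => ?_
    -- `g₁ = -g₂ a > 0` makes `λ₁` and `λ₂` negative, which contradicts `g₂ λ₁ - λ₂ g₁ ≥ 0`.
    have hg₁v : g₁ = -(g₂ * a) := by linear_combination h
    have hg₁p : 0 < g₁ := by rw [hg₁v]; nlinarith
    have h1n : lam₁ < 0 := by
      rcases lt_or_gt_of_ne h1 with h3 | h3
      · exact h3
      · have := div_pos hg₁p h3
        linarith
    have h2n : lam₂ < 0 := by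
      rw [hzv] at h1n
      nlinarith
    have e : g₂ * lam₁ - lam₂ * g₁ = g₂ * lam₂ * (a - z) := by rw [hzv, hg₁v]; ring
    rw [e] at hcond
    have : g₂ * lam₂ * (a - z) < 0 :=
      mul_neg_of_neg_of_pos (mul_neg_of_pos_of_neg hg h2n) (by linarith)
    linarith

end Cases

end SemiclassicalToy

end

theorem mainTheorem3 (m a hbar lam lam₁ lam₂ g₁ g₂ : ℝ)
    (hm : 0 < m) (hhbar : 0 < hbar) (hlam : 0 < lam)
    (ha : -(4 * m ^ 2) < a) (ha' : a < 0)
    (hlams : lam₁ ≠ 0 ∨ lam₂ ≠ 0) (hgs : g₁ ≠ 0 ∨ g₂ ≠ 0)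
    (hcond : 0 ≤ g₂ * lam₁ - lam₂ * g₁) :
    -- case a)
    ((lam₂ = 0 ∧ 0 ≤ g₂ / lam₁ ∧
        -(g₁ / lam₁) ≤ SemiclassicalToy.coupling hbar lam * SemiclassicalToy.FaReal m a 0 ∧
        SemiclassicalToy.coupling hbar lam * SemiclassicalToy.FaReal m a (-(4 * m ^ 2)) ≤
          -(g₁ / lam₁) + 4 * m ^ 2 * (g₂ / lam₁)) →
      (SemiclassicalToy.zeroSet m a hbar lam lam₁ lam₂ g₁ g₂).encard = 1 ∧
      (∀ z ∈ SemiclassicalToy.zeroSet m a hbar lam lam₁ lam₂ g₁ g₂, z.im = 0 ∧ z.re ≤ 0 ∧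
        (-(g₁ / lam₁) < SemiclassicalToy.coupling hbar lam * SemiclassicalToy.FaReal m a 0 →
          z.re < 0)) ∧
      SemiclassicalToy.SolutionsDecay m a hbar lam lam₁ lam₂ g₁ g₂) ∧
    -- case b)
    ((-(lam₁ / lam₂) < -(g₁ / g₂) ∧ -(g₁ / g₂) < a) →
      (∀ z ∈ SemiclassicalToy.zeroSet m a hbar lam lam₁ lam₂ g₁ g₂, z.im = 0 ∧ z.re < 0) ∧
      (SemiclassicalToy.zeroSet m a hbar lam lam₁ lam₂ g₁ g₂).encard ≤ 2 ∧
      (-(4 * m ^ 2) ≤ -(g₁ / g₂) →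
        (SemiclassicalToy.zeroSet m a hbar lam lam₁ lam₂ g₁ g₂).encard = 1 ∨
        (SemiclassicalToy.zeroSet m a hbar lam lam₁ lam₂ g₁ g₂).encard = 2) ∧
      SemiclassicalToy.SolutionsDecay m a hbar lam lam₁ lam₂ g₁ g₂) ∧
    -- case c)
    ((-(4 * m ^ 2) < -(lam₁ / lam₂) ∧ -(lam₁ / lam₂) < a ∧ 0 < g₂ ∧ 0 ≤ -(g₁ / lam₁) ∧
        -(g₁ / lam₁) ≤ SemiclassicalToy.coupling hbar lam * SemiclassicalToy.FaReal m a 0) →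
      (∀ z ∈ SemiclassicalToy.zeroSet m a hbar lam lam₁ lam₂ g₁ g₂, z.im = 0 ∧ z.re ≤ 0 ∧
        (-(g₁ / lam₁) < SemiclassicalToy.coupling hbar lam * SemiclassicalToy.FaReal m a 0 →
          z.re < 0)) ∧
      ((SemiclassicalToy.zeroSet m a hbar lam lam₁ lam₂ g₁ g₂).encard = 1 ∨
        (SemiclassicalToy.zeroSet m a hbar lam lam₁ lam₂ g₁ g₂).encard = 2) ∧
      SemiclassicalToy.SolutionsDecay m a hbar lam lam₁ lam₂ g₁ g₂) := by
  have hc := SemiclassicalToy.coupling_pos hhbar hlam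
  refine ⟨?_, ?_, ?_⟩
  · rintro ⟨rfl, -, h0, hb⟩
    exact SemiclassicalToy.zeros_and_decay_of_const hm hc ha ha'
      (hlams.resolve_right fun h => h rfl) (by simpa using hcond) h0 hb
  · rintro ⟨hlt, hga⟩
    exact SemiclassicalToy.zeros_and_decay_of_lt hm hc ha ha' hcond hlt hga
  · rintro ⟨hzb, hza, hg, hg₁, h0⟩
    exact SemiclassicalToy.zeros_and_decay_of_gap hm hc ha ha' hcond hzb hza hg hg₁ h0
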